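/- **Setting.** Let $X$ be the line $\mathbb R$ or the circle $\mathbb T=\mathbb R/\mathbb Z$, and fix $s\in(-\tfrac12,0)$. Use the Fourier transform that is unitary on $L^2$, with frequencies $\xi\in\mathbb R$ on the line and $\xi\in2\pi\mathbb Z$ on the circle. For $\sigma\in\mathbb R$, $H^\sigma=H^\sigma(X)$ has norm $\|f\|_{H^\sigma}^2=\int(|\xi|+1)^{2\sigma}|\hat f(\xi)|^2\,d\xi$ (a sum over $2\pi\mathbb Z$ on the circle), and $H^\infty=\bigcap_\sigma H^\sigma$. $C_+$ is the Fourier multiplier with symbol $1_{[0,\infty)}(\xi)$, $\mathsf H$ is the Fourier multiplier with symbol $-i\,\mathrm{sgn}(\xi)$ ($\mathrm{sgn}(0)=0$), and $H^{\sigma}_+$ is the set of $f\in H^\sigma$ with $\hat f(\xi)=0$ for $\xi<0$. For $A>0$ let $B_A=\{q\in H^s \text{ real-valued}:\|q\|_{H^s}\le A\}$. For real-valued $q\in H^s$ and $\kappa>0$ let $m=m(\kappa;q)\in H^{s+1}_+$ denote the solution, when it exists and is unique, of $$-im'-C_+[q(m+1)]+\kappa m=0,$$ and put $\beta(\kappa;q)=\int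 q\,m(\kappa;q)\,dx$. The $H_\kappa$ flow is the evolution $$\tfrac{d}{dt}q=-\kappa^2\bigl(m+\bar m+|m|^2\bigr)'+\kappa q'\ \text{ on }\mathbb R,\qquad \tfrac{d}{dt}q=-\kappa^2\bigl(m+\bar m+|m|^2\bigr)'+\bigl[\kappa+\textstyle\int q\bigr]q'\ \text{ on }\mathbb T,$$ with $m=m(\kappa;q(t))$. A solution on an interval $I$ is a real-valued $q\in C(I;H^s)$ such that, for each $t\in I$, the equation for $m(\kappa;q(t))$ has a unique solution and the evolution equation holds with the time derivative taken in $H^{s-1}$. The Benjamin–Ono flow is $\tfrac{d}{dt}q=\mathsf Hq''-2qq'$; an $H^\infty$ solution of it is a real-valued $q:\mathbb R\to H^\infty$ for which this holds with the time derivative taken in every $H^\sigma$. Let $(B_A)_{**}\supseteq B_A$ be the set of all $q(b)$, where $q:[a,b]\to H^s$ is continuous and real-valued, $q(a)\in B_A$, and for every $t\in[a,b]$ one has $\beta(\varkappa;q(t))=\beta(\varkappa;q(a))$ for all sufficiently large $\varkappa$ (equivalently, as meromorphic functions on the right half-plane). **Theorem.** There is a constant $C\ge1$, depending only on $s$ and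 on the choice of $X$, such that $m(\kappa;q)$ exists and is unique for every real-valued $q\in H^s$ and every $\kappa\ge C(1+\|q\|_{H^s})^{1/(\frac12-|s|)}$, and such that the following holds for every $A>0$. There exist numbers $\kappa_0$ with $$\kappa_0\ge C(1+\|q\|_{H^s})^{1/(\frac12-|s|)}\quad\text{for all }q\in(B_A)_{**},\tag{$*$}$$ and for every $\kappa_0$ satisfying $(*)$ and every $\kappa\ge\kappa_0$ there is a map $(t,q_0)\mapsto\Phi_t(q_0)$ defined for $t\in\mathbb R$ and $q_0\in(B_A)_{**}$ (in particular for $q_0\in B_A$), with values in $H^s$, such that: 1. (Global well-posedness.) For each $q_0\in(B_A)_{**}$, $t\mapsto\Phi_t(q_0)$ is a solution of the $H_\kappa$ flow on $\mathbb R$ with $\Phi_0(q_0)=q_0$; every solution on an interval $I\ni0$ with initial value $q_0$ coincides with it on $I$; and $(t,q_0)\mapsto\Phi_t(q_0)$ is jointly continuous from $\mathbb R\times(B_A)_{**}$ to $H^s$. 2. (Conservation.) For all $q_0\in(B_A)_{**}$, $\varkappa\ge\kappa_0$ and $t\in\mathbb R$, $m(\varkappa;\Phi_t(q_0))$ exists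 and is unique, and $\tfrac{d}{dt}\beta(\varkappa;\Phi_t(q_0))=0$. 3. (Regularity.) If $q_0\in(B_A)_{**}\cap H^\infty$, then $\Phi_t(q_0)\in H^\infty$ for all $t\in\mathbb R$. 4. (Commutation with Benjamin–Ono.) If $u$ is an $H^\infty$ solution of the Benjamin–Ono equation with $u(0)\in(B_A)_{**}$, then $u(t)\in(B_A)_{**}$ for all $t\in\mathbb R$, and for each $\tau\in\mathbb R$ the function $t\mapsto\Phi_\tau(u(t))$ is an $H^\infty$ solution of the Benjamin–Ono equation, and is the only one with initial value $\Phi_\tau(u(0))$. -/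

import Mathlib

open MeasureTheory Set Filter

noncomputable section

namespace BenjaminOno

/-- The two settings: the real line `ℝ` and the circle `𝕋 = ℝ / ℤ`. -/
inductive Geometry where
  | line
  | circle

/-- The measure on the frequency side for which the Fourier transform is unitary on `L²`:
Lebesgue measure `dξ` on the line (transform `(2π)^(-1/2) ∫ e^{-iξx} f(x) dx`), counting measure on
`2πℤ` on the circle (transform `∫₀¹ e^{-iξx} f(x) dx`). -/
def freq : Geometry → Measure ℝ
  | .line => volume
  | .circle => Measure.sum fun k : ℤ => Measure.dirac (2 * Real.pi * (k : ℝ))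

/-- The measure `(|ξ| + 1)^(2σ)` times the frequency measure. -/
def sobolevMeasure (G : Geometry) (σ : ℝ) : Measure ℝ :=
  (freq G).withDensity fun ξ => ENNReal.ofReal ((|ξ| + 1) ^ (2 * σ))

/-- The Sobolev space `H^σ` (complex-valued), the completion of the Schwartz functions, respectively
of the smooth functions on the circle, under `‖f‖² = ∫ (|ξ| + 1)^(2σ) |f̂(ξ)|² dξ`, respectively
`∑_{ξ ∈ 2πℤ} (|ξ| + 1)^(2σ) |f̂(ξ)|²`. It is realised through the Fourier transform as a weighted
`L²` space: an element of `H^σ` is recorded by its Fourier transform, and `‖·‖` is the norm above.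
All the operations below are accordingly written for Fourier transforms. -/
abbrev Hs (G : Geometry) (σ : ℝ) : Type := Lp ℂ 2 (sobolevMeasure G σ)

/-- `f ↦ f'`. -/
def dx (f : ℝ → ℂ) : ℝ → ℂ := fun ξ => Complex.I * (ξ : ℂ) * f ξ

/-- The Hilbert transform, with symbol `-i sgn ξ` and `sgn 0 = 0`. -/
def hilbert (f : ℝ → ℂ) : ℝ → ℂ := fun ξ => -Complex.I * ((SignType.sign ξ : ℝ) : ℂ) * f ξ

/-- The Cauchy–Szegő projection `C₊`, with symbol `1_{[0,∞)}`. -/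
def szego (f : ℝ → ℂ) : ℝ → ℂ := fun ξ => (Ici (0 : ℝ)).indicator f ξ

/-- Pointwise complex conjugation of the function (not of its transform). -/
def conjF (f : ℝ → ℂ) : ℝ → ℂ := fun ξ => starRingEnd ℂ (f (-ξ))

/-- The constant in `(f g)^ = c · f̂ * ĝ`. -/
def convConst : Geometry → ℂ
  | .line => (1 / Real.sqrt (2 * Real.pi) : ℝ)
  | .circle => 1

/-- The product of two functions: on the Fourier side, a multiple of the convolution. -/
def mul (G : Geometry) (f g : ℝ → ℂ) : ℝ → ℂ :=
  fun ξ => convConst G * ∫ η, f (ξ - η) * g η ∂(freq G)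

/-- The pairing `⟨f, g⟩ = ∫ f̄ g dx` (by Plancherel). -/
def pairing (G : Geometry) (f g : ℝ → ℂ) : ℂ :=
  ∫ ξ, starRingEnd ℂ (f ξ) * g ξ ∂(freq G)

/-- `∫ q dx` on the circle. This term is absent on the line, where we put `0`. -/
def mean : Geometry → (ℝ → ℂ) → ℂ
  | .line, _ => 0
  | .circle, f => f 0

variable {G : Geometry} {s : ℝ}

/-- `q` is real-valued. -/
def IsReal (q : Hs G s) : Prop := ∀ᵐ ξ ∂(freq G), q (-ξ) = starRingEnd ℂ (q ξ)

/-- `q` belongs to `H^∞ = ⋂_σ H^σ`. -/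
def MemHInfty (q : Hs G s) : Prop := ∀ σ : ℝ, ∃ u : Hs G σ, u =ᵐ[freq G] q

/-- `B_A`: the real-valued `q ∈ H^s` with `‖q‖_{H^s} ≤ A`. -/
def closedBallReal (G : Geometry) (s A : ℝ) : Set (Hs G s) := {q | IsReal q ∧ ‖q‖ ≤ A}

/-- `m ∈ H^{s+1}₊` solves `-i m' - C₊[q (m + 1)] + κ m = 0`. -/
def IsGauge (κ : ℝ) (q : Hs G s) (m : Hs G (s + 1)) : Prop :=
  (∀ᵐ ξ ∂(freq G), ξ < 0 → m ξ = 0) ∧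
  ∀ᵐ ξ ∂(freq G),
    -Complex.I * dx m ξ - szego (fun η => mul G q m η + q η) ξ + (κ : ℂ) * m ξ = 0

/-- The equation for `m(κ; q)` has exactly one solution. -/
def HasGauge (κ : ℝ) (q : Hs G s) : Prop := ∃! m : Hs G (s + 1), IsGauge κ q m

open Classical in
/-- `m(κ; q)`, the unique solution (and `0` where there is no unique solution). -/
def gauge (κ : ℝ) (q : Hs G s) : Hs G (s + 1) :=
  if h : HasGauge κ q then h.choose else 0

/-- `β(κ; q) = ∫ q m dx = ⟨q, m⟩` for real-valued `q`. -/
def beta (κ : ℝ) (q : Hs G s) : ℂ := pairing G q (gauge κ q)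

/-- `Q_**`: the endpoints of continuous paths in (real-valued) `H^s` that start in `Q` and along
which `β` is constant. Since `z ↦ β(z; q)` is determined as a meromorphic function on the right
half-plane by its values at all large real `ϰ`, constancy is expressed for large `ϰ`. -/
def starStar (Q : Set (Hs G s)) : Set (Hs G s) :=
  {p | ∃ (a b : ℝ) (q : ℝ → Hs G s), a ≤ b ∧ ContinuousOn q (Icc a b) ∧
    (∀ t ∈ Icc a b, IsReal (q t)) ∧ q a ∈ Q ∧
    (∀ t ∈ Icc a b, ∀ᶠ ϰ : ℝ in atTop, beta ϰ (q t) = beta ϰ (q a)) ∧ q b = p}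

/-- `B_A ⊆ (B_A)_**`, by constant paths. -/
theorem closedBallReal_subset_starStar (A : ℝ) :
    closedBallReal G s A ⊆ starStar (closedBallReal G s A) := fun p hp =>
  ⟨0, 0, fun _ => p, le_rfl, continuousOn_const, fun _ _ => hp.1, hp,
    fun _ _ => Eventually.of_forall fun _ => rfl, rfl⟩

/-- `κ₀` is admissible for `A`, relative to the constant `C`:
`κ₀ ≥ C (1 + ‖q‖_{H^s})^(1/(2ε))`, `2ε = 1/2 - |s|`, for all `q ∈ (B_A)_**`. -/
def Admissible (G : Geometry) (s C A κ₀ : ℝ) : Prop :=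
  ∀ q ∈ starStar (closedBallReal G s A), C * (1 + ‖q‖) ^ (1 / (1 / 2 - |s|)) ≤ κ₀

/-- On `I`, the path `q` (given through Fourier transforms) takes values in `H^σ`, the
path `F` does too, and `dq/dt = F` in the norm of `H^σ` (one-sided at endpoints of `I`). -/
def HasTimeDeriv (G : Geometry) (σ : ℝ) (I : Set ℝ) (q F : ℝ → ℝ → ℂ) : Prop :=
  ∃ U V : ℝ → Hs G σ, ∀ t ∈ I,
    U t =ᵐ[freq G] q t ∧ V t =ᵐ[freq G] F t ∧ HasDerivWithinAt U (V t) I t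

/-- The `H_κ` vector field `-κ² (m + m̄ + |m|²)' + κ q'`, with `κ` replaced by
`κ + ∫ q` in the last term on the circle. -/
def hkField (κ : ℝ) (q : Hs G s) : ℝ → ℂ := fun ξ =>
  -(κ : ℂ) ^ 2 *
      dx (fun η => gauge κ q η + conjF (gauge κ q) η +
        mul G (gauge κ q) (conjF (gauge κ q)) η) ξ
    + ((κ : ℂ) + mean G q) * dx q ξ

/-- `q` is a (real-valued) solution in `C(I; H^s)` of the `H_κ` flow on the time interval `I`; as
`q' ∈ H^{s-1}`, the equation is one in `H^{s-1}`. -/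
def IsHkSolution (κ : ℝ) (I : Set ℝ) (q : ℝ → Hs G s) : Prop :=
  ContinuousOn q I ∧ (∀ t ∈ I, IsReal (q t) ∧ HasGauge κ (q t)) ∧
  HasTimeDeriv G (s - 1) I (fun t => q t) (fun t => hkField κ (q t))

/-- The Benjamin–Ono vector field `H q'' - 2 q q'`. -/
def boField (G : Geometry) (f : ℝ → ℂ) : ℝ → ℂ := fun ξ =>
  hilbert (dx (dx f)) ξ - 2 * mul G f (dx f) ξ

/-- `q` is a global real-valued `H^∞` solution of the Benjamin–Ono equation: `q(t) ∈ H^∞` and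
the equation holds in every `H^σ`. -/
def IsBOSolution (q : ℝ → Hs G s) : Prop :=
  (∀ t, IsReal (q t)) ∧
  ∀ σ : ℝ, HasTimeDeriv G σ univ (fun t => q t) (fun t => boField G (q t))

end BenjaminOno

end

open BenjaminOno

noncomputable section

namespace BenjaminOno

open scoped ENNReal NNReal Topology

section

/-! ### The frequency measure -/

/-! In a frame moving at speed `κ + ∫ q` (`κ` on the line), constant because the mean is conserved,
the `H_κ` flow is `dq/dt = Y(q)` with `Y(q) = -κ² Z'` and `Z = m + m̄ + |m|²`. The gauge equation is
the fixed-point equation `m = (-i∂ + κ)⁻¹ C₊ (q + q m)`. In norms with the weight `|ξ| + κ` in place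
of `|ξ| + 1`, the operator `m ↦ (-i∂ + κ)⁻¹ C₊ (q m)` has norm at most a constant times
`κ^(-(1/2+s)) ‖q‖` (`exists_isKer_gKer`), so a Neumann series solves the equation above the
threshold. Since `m` has one derivative more than `q` and `H^{s+1}` is an algebra, `Y` is bounded,
Lipschitz and differentiable on balls of `H^s` (`exists_Yf_bounds`): the flow is an ordinary
differential equation.

Global existence rests on `β`. Its gradient is `Z(ϰ)` (`hasDerivAt_beta`), and `∫ Z(ϰ) Z(κ)' = 0`
(`du_Zf_dx_Zf`), which comes down to the reality of a few integrals; hence `β(ϰ)` is conserved.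
Conversely `β` controls the norm: its leading term is `∫_{ξ ≥ 0} |q̂|² / (ξ + κ)`, and summing this
over `κ = 2ⁿ K` with the factor `κ^(1+2s)` gives back the weighted `H^s` norm, up to a cubic error
that is small for large `K` (`exists_apriori`). A continuity argument then bounds `(B_A)_**`
(`exists_starStar_bound`), and concatenation of paths keeps trajectories inside that set. So `Y` may
be truncated outside a ball: the truncated field has a global flow (`exists_global_flow`), and
orbits starting in `(B_A)_**` never see the truncation.

A solution of the `H_κ` flow has a time derivative only in `H^{s-1}`. In the moving frame it
satisfies a Lipschitz ODE in a weak sense, and frequency cutoffs recover estimates in `H^s`, whence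
uniqueness (`IsRegEmb.ode_unique`). For regularity, `Y` is Lipschitz in each `H^{s+k}` on bounded
sets and commutes with translations; Gronwall for the difference of an orbit and its translate gains
one derivative at a time (`exists_eN_curve_le`).

For smooth `q` the time derivative of `m` along Benjamin–Ono is explicit (`Sm.gaugeDot`,
`Sm.Dmm_bo`). It gives conservation of `β` along that flow and the vanishing of the Lie bracket of
`Y` with the Benjamin–Ono field (`Sm.exists_DYf_bo`). For `P(τ, t)`, the flow of `Y` for time `τ`
applied to `u(t)`, the bracket identity says that the Benjamin–Ono field at `P` solves the
linearised equation in `τ`, as `∂ₜP` should, with the same value at `τ = 0`; `hasDerivAt_flow` then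
gives that `P` solves Benjamin–Ono in `t` (`Sm.HasDeriv.comp_flow`). Uniqueness there is an `L²`
energy estimate (`Sm.HasDeriv.unique`). -/

instance instSFiniteFreq (G : Geometry) : SFinite (freq G) := by
  cases G <;> (unfold freq; infer_instance)

theorem measurePreserving_neg_freq (G : Geometry) :
    MeasurePreserving (fun ξ : ℝ => -ξ) (freq G) (freq G) := by
  cases G with
  | line => exact Measure.measurePreserving_neg volume
  | circle =>
    refine ⟨measurable_neg, ?_⟩
    ext A hA
    rw [Measure.map_apply measurable_neg hA]
    simp only [freq, Measure.sum_apply _ hA, Measure.sum_apply _ (measurable_neg hA),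
      Measure.dirac_apply' _ hA, Measure.dirac_apply' _ (measurable_neg hA)]
    rw [← (Equiv.neg ℤ).tsum_eq]
    refine tsum_congr fun k => ?_
    have : 2 * Real.pi * (((Equiv.neg ℤ) k : ℤ) : ℝ) = -(2 * Real.pi * k) := by simp
    rw [this]
    by_cases h : 2 * Real.pi * (k : ℝ) ∈ A <;> simp [h]

theorem ae_freq_circle {p : ℝ → Prop} :
    (∀ᵐ ξ ∂(freq .circle), p ξ) ↔ ∀ k : ℤ, p (2 * Real.pi * k) := by
  simp only [freq, Measure.ae_sum_iff, ae_dirac_eq, eventually_pure]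

/-- Only almost every shift is allowed: on the circle the measure is invariant under shifts by `2πℤ`
alone, but it is also carried by `2πℤ`. -/
theorem ae_measurePreserving_sub_right (G : Geometry) :
    ∀ᵐ η ∂(freq G), MeasurePreserving (fun ξ : ℝ => ξ - η) (freq G) (freq G) := by
  cases G with
  | line => exact Eventually.of_forall fun η => measurePreserving_sub_right volume η
  | circle =>
    rw [ae_freq_circle]
    intro k
    have hm : Measurable fun ξ : ℝ => ξ - 2 * Real.pi * k := measurable_id.sub_const _
    refine ⟨hm, ?_⟩
    ext A hA
    rw [Measure.map_apply hm hA]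
    simp only [freq, Measure.sum_apply _ hA, Measure.sum_apply _ (hm hA),
      Measure.dirac_apply' _ hA, Measure.dirac_apply' _ (hm hA)]
    rw [← (Equiv.addRight k).tsum_eq]
    refine tsum_congr fun j => ?_
    have : 2 * Real.pi * ((j : ℝ) + k) - 2 * Real.pi * k = 2 * Real.pi * j := by ring
    have h2 : 2 * Real.pi * (((Equiv.addRight k) j : ℤ) : ℝ) = 2 * Real.pi * ((j : ℝ) + k) := by
      simp
    rw [h2]
    by_cases h : 2 * Real.pi * (j : ℝ) ∈ A <;> simp [Set.indicator, this, h]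

theorem ae_measurePreserving_sub_left (G : Geometry) :
    ∀ᵐ ξ ∂(freq G), MeasurePreserving (fun η : ℝ => ξ - η) (freq G) (freq G) := by
  filter_upwards [ae_measurePreserving_sub_right G] with ξ hξ
  convert (measurePreserving_neg_freq G).comp hξ using 1
  ext η; simp

/-- This makes convolutions independent of the representatives of their factors. -/
theorem ae_ae_sub {G : Geometry} {p : ℝ → Prop} (h : ∀ᵐ ξ ∂(freq G), p ξ) :
    ∀ᵐ ξ ∂(freq G), ∀ᵐ η ∂(freq G), p (ξ - η) := by
  filter_upwards [ae_measurePreserving_sub_left G] with ξ hξ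
  exact hξ.quasiMeasurePreserving.ae h

theorem ae_neg {G : Geometry} {p : ℝ → Prop} (h : ∀ᵐ ξ ∂(freq G), p ξ) :
    ∀ᵐ ξ ∂(freq G), p (-ξ) :=
  (measurePreserving_neg_freq G).quasiMeasurePreserving.ae h

/-- Scaling `ξ = κ ξ'`. -/
theorem lintegral_rpow_line {p κ : ℝ} (hκ : 0 < κ) :
    ∫⁻ ξ : ℝ, ENNReal.ofReal ((|ξ| + κ) ^ (-p)) =
      ENNReal.ofReal (κ ^ (1 - p)) * ∫⁻ ξ : ℝ, ENNReal.ofReal ((|ξ| + 1) ^ (-p)) := by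
  have hm : Measurable fun ξ : ℝ => ENNReal.ofReal ((|ξ| + κ) ^ (-p)) := by fun_prop
  have h1 := Real.map_volume_mul_left hκ.ne'
  have h2 : ENNReal.ofReal κ⁻¹ * ∫⁻ ξ : ℝ, ENNReal.ofReal ((|ξ| + κ) ^ (-p)) =
      ∫⁻ ξ : ℝ, ENNReal.ofReal ((|κ * ξ| + κ) ^ (-p)) := by
    rw [← lintegral_map hm (measurable_const_mul κ), h1, lintegral_smul_measure,
      abs_of_pos (inv_pos.2 hκ), smul_eq_mul]
  have h3 : ∀ ξ : ℝ, ENNReal.ofReal ((|κ * ξ| + κ) ^ (-p)) =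
      ENNReal.ofReal (κ ^ (-p)) * ENNReal.ofReal ((|ξ| + 1) ^ (-p)) := fun ξ => by
    rw [← ENNReal.ofReal_mul (by positivity), ← Real.mul_rpow hκ.le (by positivity), abs_mul,
      abs_of_pos hκ]
    ring_nf
  simp only [h3] at h2
  rw [lintegral_const_mul _ (by fun_prop)] at h2
  have h4 : ENNReal.ofReal κ * ENNReal.ofReal κ⁻¹ = 1 := by
    rw [← ENNReal.ofReal_mul hκ.le, mul_inv_cancel₀ hκ.ne', ENNReal.ofReal_one]
  calc _ = ENNReal.ofReal κ * ENNReal.ofReal κ⁻¹ *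
        ∫⁻ ξ : ℝ, ENNReal.ofReal ((|ξ| + κ) ^ (-p)) := by rw [h4, one_mul]
    _ = _ := by
      rw [mul_assoc, h2, ← mul_assoc, ← ENNReal.ofReal_mul hκ.le]
      congr 2
      rw [sub_eq_add_neg, Real.rpow_add hκ, Real.rpow_one]

theorem lintegral_rpow_one_lt_top {p : ℝ} (hp : 1 < p) :
    ∫⁻ ξ : ℝ, ENNReal.ofReal ((|ξ| + 1) ^ (-p)) < ∞ := by
  have h := integrable_one_add_norm (E := ℝ) (μ := volume) (r := p) (by simpa using hp)
  have h2 := h.lintegral_lt_top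
  simpa [add_comm] using h2

/-- Comparison of sum and integral: the unit intervals starting at the points of `2πℤ` are disjoint,
and on each of them `|ξ| + κ` at most doubles because `κ ≥ 1`. -/
theorem lintegral_circle_le {p κ : ℝ} (hp : 0 ≤ p) (hκ : 1 ≤ κ) :
    ∫⁻ ξ, ENNReal.ofReal ((|ξ| + κ) ^ (-p)) ∂(freq .circle) ≤
      ENNReal.ofReal (2 ^ p) * ∫⁻ ξ : ℝ, ENNReal.ofReal ((|ξ| + κ) ^ (-p)) := by
  have hm : Measurable fun ξ : ℝ => ENNReal.ofReal ((|ξ| + κ) ^ (-p)) := by fun_prop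
  let I : ℤ → Set ℝ := fun k => Ico (2 * Real.pi * k) (2 * Real.pi * k + 1)
  have hpi : (3 : ℝ) < Real.pi := Real.pi_gt_three
  have hI : Pairwise (Function.onFun Disjoint I) := by
    intro j k hjk
    refine Set.disjoint_left.2 fun x hx hy => ?_
    simp only [I, mem_Ico] at hx hy
    rcases lt_or_gt_of_ne hjk with h | h
    · have : (j : ℝ) + 1 ≤ k := by exact_mod_cast h
      nlinarith
    · have : (k : ℝ) + 1 ≤ j := by exact_mod_cast h
      nlinarith
  have key : ∀ k : ℤ, ENNReal.ofReal ((|2 * Real.pi * k| + κ) ^ (-p)) ≤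
      ENNReal.ofReal (2 ^ p) * ∫⁻ ξ in I k, ENNReal.ofReal ((|ξ| + κ) ^ (-p)) := by
    intro k
    rw [← lintegral_const_mul _ hm]
    calc ENNReal.ofReal ((|2 * Real.pi * k| + κ) ^ (-p))
        = ∫⁻ ξ in I k, ENNReal.ofReal ((|2 * Real.pi * k| + κ) ^ (-p)) := by
          simp [I]
      _ ≤ _ := by
          refine setLIntegral_mono (by fun_prop) fun ξ hξ => ?_
          rw [← ENNReal.ofReal_mul (by positivity)]
          refine ENNReal.ofReal_le_ofReal ?_
          have h1 : |ξ| + κ ≤ 2 * (|2 * Real.pi * k| + κ) := by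
            have : |ξ - 2 * Real.pi * k| ≤ 1 := by
              rw [abs_le]; simp only [I, mem_Ico] at hξ; constructor <;> linarith
            have h2 : |ξ| ≤ |ξ - 2 * Real.pi * k| + |2 * Real.pi * k| := by
              simpa using abs_add_le (ξ - 2 * Real.pi * k) (2 * Real.pi * k)
            have := abs_nonneg (2 * Real.pi * k)
            linarith
          have hpos : 0 < |ξ| + κ := by positivity
          have h3 := Real.rpow_le_rpow_of_nonpos hpos h1 (neg_nonpos.2 hp)
          rw [Real.mul_rpow (by norm_num) (by positivity)] at h3
          calc _ = (2:ℝ) ^ p * (2 ^ (-p) * (|2 * Real.pi * k| + κ) ^ (-p)) := by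
                rw [← mul_assoc, ← Real.rpow_add (by norm_num)]; simp
            _ ≤ _ := by gcongr
  calc _ = ∑' k : ℤ, ENNReal.ofReal ((|2 * Real.pi * k| + κ) ^ (-p)) := by
        simp only [freq, lintegral_sum_measure, lintegral_dirac' _ hm]
    _ ≤ ∑' k : ℤ, ENNReal.ofReal (2 ^ p) * ∫⁻ ξ in I k, ENNReal.ofReal ((|ξ| + κ) ^ (-p)) :=
        ENNReal.tsum_le_tsum key
    _ = ENNReal.ofReal (2 ^ p) * ∫⁻ ξ in ⋃ k, I k, ENNReal.ofReal ((|ξ| + κ) ^ (-p)) := by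
        rw [ENNReal.tsum_mul_left, lintegral_iUnion (fun k => measurableSet_Ico) hI]
    _ ≤ _ := by gcongr; exact Measure.restrict_le_self

/-- `∫ (|ξ| + κ)^(-p) dξ ≲ κ^(1 - p)`. -/
theorem exists_lintegral_rpow_le (G : Geometry) {p : ℝ} (hp : 1 < p) :
    ∃ c : ℝ, 0 < c ∧ ∀ κ : ℝ, 1 ≤ κ →
      ∫⁻ ξ, ENNReal.ofReal ((|ξ| + κ) ^ (-p)) ∂(freq G) ≤ ENNReal.ofReal (c * κ ^ (1 - p)) := by
  set I := ∫⁻ ξ : ℝ, ENNReal.ofReal ((|ξ| + 1) ^ (-p)) with hI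
  have hfin : I ≠ ∞ := (lintegral_rpow_one_lt_top hp).ne
  have hI2 : I ≤ ENNReal.ofReal (I.toReal + 1) := by
    rw [← ENNReal.ofReal_toReal hfin]
    refine ENNReal.ofReal_le_ofReal ?_
    simp
  have hpos : 0 ≤ I.toReal := ENNReal.toReal_nonneg
  have h1 : ∀ κ : ℝ, 1 ≤ κ → ∫⁻ ξ : ℝ, ENNReal.ofReal ((|ξ| + κ) ^ (-p)) ≤
      ENNReal.ofReal ((I.toReal + 1) * κ ^ (1 - p)) := fun κ hκ => by
    rw [lintegral_rpow_line (by linarith), mul_comm, ENNReal.ofReal_mul (by positivity)]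
    gcongr
  cases G with
  | line => exact ⟨I.toReal + 1, by positivity, h1⟩
  | circle =>
    refine ⟨2 ^ p * (I.toReal + 1), by positivity, fun κ hκ => ?_⟩
    refine (lintegral_circle_le (by linarith) hκ).trans ?_
    rw [mul_assoc, ENNReal.ofReal_mul (by positivity)]
    gcongr
    exact h1 κ hκ

/-! ### A trilinear estimate -/

theorem sq_lintegral_mul_le {μ : Measure ℝ} {f g : ℝ → ℝ≥0∞} (hf : AEMeasurable f μ)
    (hg : AEMeasurable g μ) :
    (∫⁻ ξ, f ξ * g ξ ∂μ) ^ 2 ≤ (∫⁻ ξ, f ξ ^ 2 ∂μ) * ∫⁻ ξ, g ξ ^ 2 ∂μ := by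
  have h := ENNReal.lintegral_mul_le_Lp_mul_Lq μ (p := 2) (q := 2) Real.HolderConjugate.two_two hf hg
  have h2 := pow_le_pow_left₀ zero_le h 2
  refine h2.trans (le_of_eq ?_)
  rw [mul_pow, ← ENNReal.rpow_natCast, ← ENNReal.rpow_natCast, ← ENNReal.rpow_mul,
    ← ENNReal.rpow_mul]
  norm_num

theorem lintegral_sub_left {G : Geometry} {f : ℝ → ℝ≥0∞} (hf : Measurable f) :
    ∀ᵐ ξ ∂(freq G), ∫⁻ η, f (ξ - η) ∂(freq G) = ∫⁻ η, f η ∂(freq G) := by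
  filter_upwards [ae_measurePreserving_sub_left G] with ξ hξ using hξ.lintegral_comp hf

theorem lintegral_lintegral_sub {G : Geometry} {a b : ℝ → ℝ≥0∞} (ha : Measurable a)
    (hb : Measurable b) :
    ∫⁻ ξ, ∫⁻ η, a (ξ - η) * b η ∂(freq G) ∂(freq G) =
      (∫⁻ ξ, a ξ ∂(freq G)) * ∫⁻ ξ, b ξ ∂(freq G) := by
  rw [lintegral_lintegral_swap (by fun_prop)]
  rw [← lintegral_const_mul _ hb]
  refine lintegral_congr_ae ?_
  filter_upwards [ae_measurePreserving_sub_right G] with η hη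
  rw [lintegral_mul_const _ (by fun_prop), hη.lintegral_comp ha]

/-- Cauchy–Schwarz in `η`, with the square-integrable factor `g` sitting at any one of the three
frequencies. When `g` depends on `η` or `ξ - η`, it is separated from `a b`, and what is left is the
convolution of `a²` and `b²`, of total mass `Sa * Sb`. The `9` is three terms times the `3` from
squaring a sum of three. -/
theorem lintegral_sq_conv_le {G : Geometry} {g a b : ℝ → ℝ≥0∞} (hg : Measurable g)
    (ha : Measurable a) (hb : Measurable b) :
    ∫⁻ ξ, (∫⁻ η, (g ξ + g η + g (ξ - η)) * (a (ξ - η) * b η) ∂(freq G)) ^ 2 ∂(freq G) ≤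
      9 * ((∫⁻ ξ, g ξ ^ 2 ∂(freq G)) * (∫⁻ ξ, a ξ ^ 2 ∂(freq G)) *
        ∫⁻ ξ, b ξ ^ 2 ∂(freq G)) := by
  set Sg := ∫⁻ ξ, g ξ ^ 2 ∂(freq G)
  set Sa := ∫⁻ ξ, a ξ ^ 2 ∂(freq G)
  set Sb := ∫⁻ ξ, b ξ ^ 2 ∂(freq G)
  have hsub : ∀ {f : ℝ → ℝ≥0∞} (_ : Measurable f) (ξ : ℝ), Measurable fun η => f (ξ - η) :=
    fun hf ξ => hf.comp (measurable_const.sub measurable_id)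
  have h3 : ∀ x y z : ℝ≥0∞, (x + y + z) ^ 2 ≤ 3 * (x ^ 2 + y ^ 2 + z ^ 2) := by
    intro x y z
    induction x using ENNReal.recTopCoe with
    | top => simp
    | coe x =>
      induction y using ENNReal.recTopCoe with
      | top => simp
      | coe y =>
        induction z using ENNReal.recTopCoe with
        | top => simp
        | coe z =>
          norm_cast
          rw [← NNReal.coe_le_coe]
          push_cast
          nlinarith [sq_nonneg ((x : ℝ) - y), sq_nonneg ((y : ℝ) - z), sq_nonneg ((x : ℝ) - z)]
  let J : ℝ → ℝ≥0∞ := fun ξ => ∫⁻ η, a (ξ - η) ^ 2 * b η ^ 2 ∂(freq G)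
  have hJm : Measurable J := by
    refine Measurable.lintegral_prod_right' (f := fun p : ℝ × ℝ => a (p.1 - p.2) ^ 2 * b p.2 ^ 2) ?_
    fun_prop
  have hJ : ∫⁻ ξ, J ξ ∂(freq G) = Sa * Sb :=
    lintegral_lintegral_sub (ha.pow_const 2) (hb.pow_const 2)
  have key : ∀ᵐ ξ ∂(freq G),
      (∫⁻ η, (g ξ + g η + g (ξ - η)) * (a (ξ - η) * b η) ∂(freq G)) ^ 2 ≤
        3 * (g ξ ^ 2 * (Sa * Sb) + Sg * J ξ + Sg * J ξ) := by
    filter_upwards [lintegral_sub_left (G := G) (ha.pow_const 2),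
      lintegral_sub_left (G := G) (hg.pow_const 2)] with ξ h1 h2
    have ma := hsub ha ξ
    have mg := hsub hg ξ
    have e : ∫⁻ η, (g ξ + g η + g (ξ - η)) * (a (ξ - η) * b η) ∂(freq G) =
        g ξ * (∫⁻ η, a (ξ - η) * b η ∂(freq G)) + (∫⁻ η, g η * (a (ξ - η) * b η) ∂(freq G)) +
          ∫⁻ η, g (ξ - η) * (a (ξ - η) * b η) ∂(freq G) := by
      simp only [add_mul]
      rw [lintegral_add_left (by fun_prop), lintegral_add_left (by fun_prop),
        lintegral_const_mul _ (by fun_prop)]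
    rw [e]
    refine (h3 _ _ _).trans ?_
    gcongr
    · rw [mul_pow]
      gcongr
      refine (sq_lintegral_mul_le ma.aemeasurable hb.aemeasurable).trans (le_of_eq ?_)
      rw [h1]
    · refine (sq_lintegral_mul_le hg.aemeasurable (ma.mul hb).aemeasurable).trans (le_of_eq ?_)
      simp only [mul_pow, Pi.mul_apply, J, Sg]
    · refine (sq_lintegral_mul_le mg.aemeasurable (ma.mul hb).aemeasurable).trans (le_of_eq ?_)
      simp only [mul_pow, Pi.mul_apply, J, Sg]
      rw [h2]
  refine (lintegral_mono_ae key).trans (le_of_eq ?_)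
  rw [lintegral_const_mul _ (by fun_prop), lintegral_add_left (by fun_prop),
    lintegral_add_left (by fun_prop), lintegral_mul_const _ (by fun_prop),
    lintegral_const_mul _ hJm, hJ]
  change 3 * (Sg * (Sa * Sb) + Sg * (Sa * Sb) + Sg * (Sa * Sb)) = _
  ring

end

section

variable {G : Geometry}

/-! ### Sobolev norms and spaces -/

/-- The square of the `H^σ` norm of a function given by its Fourier transform. -/
def sobSq (G : Geometry) (σ : ℝ) (f : ℝ → ℂ) : ℝ≥0∞ :=
  ∫⁻ ξ, (ENNReal.ofReal ((|ξ| + 1) ^ σ) * ‖f ξ‖ₑ) ^ 2 ∂(freq G)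

theorem bracket_pos (ξ : ℝ) : 0 < |ξ| + 1 := by positivity

theorem one_le_bracket (ξ : ℝ) : 1 ≤ |ξ| + 1 := by linarith [abs_nonneg ξ]

theorem bracket_rpow_pos (ξ σ : ℝ) : 0 < (|ξ| + 1) ^ σ := Real.rpow_pos_of_pos (bracket_pos ξ) σ

theorem measurable_weight (σ : ℝ) : Measurable fun ξ : ℝ => ENNReal.ofReal ((|ξ| + 1) ^ σ) := by
  fun_prop

/-- The weight is positive and finite, so all the spaces share the null sets of `freq G`, and
elements of different `H^σ` can be compared almost everywhere. -/
theorem ae_sobolevMeasure (G : Geometry) (σ : ℝ) : ae (sobolevMeasure G σ) = ae (freq G) := by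
  refine le_antisymm (withDensity_absolutelyContinuous _ _).ae_le ?_
  refine (withDensity_absolutelyContinuous' (measurable_weight _).aemeasurable ?_).ae_le
  exact Eventually.of_forall fun ξ => by simpa using bracket_rpow_pos ξ _

theorem eLpNorm_sobolevMeasure_sq (σ : ℝ) (f : ℝ → ℂ) :
    eLpNorm f 2 (sobolevMeasure G σ) ^ 2 = sobSq G σ f := by
  rw [eLpNorm_eq_lintegral_rpow_enorm_toReal (by norm_num) (by norm_num), ← ENNReal.rpow_natCast,
    ← ENNReal.rpow_mul]
  simp only [ENNReal.toReal_ofNat, Nat.cast_ofNat, one_div, ENNReal.rpow_ofNat]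
  norm_num
  rw [sobolevMeasure, lintegral_withDensity_eq_lintegral_mul_non_measurable _ (measurable_weight _)
    (Eventually.of_forall fun ξ => ENNReal.ofReal_lt_top), sobSq]
  refine lintegral_congr fun ξ => ?_
  simp only [Pi.mul_apply]
  rw [mul_pow, ← ENNReal.ofReal_pow (by positivity), ← Real.rpow_natCast,
    ← Real.rpow_mul (by positivity)]
  norm_num [mul_comm]

theorem sobSq_congr {σ : ℝ} {f g : ℝ → ℂ} (h : f =ᵐ[freq G] g) : sobSq G σ f = sobSq G σ g := by
  refine lintegral_congr_ae ?_
  filter_upwards [h] with ξ hξ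
  rw [hξ]

theorem memLp_sobolevMeasure {σ : ℝ} {f : ℝ → ℂ} (hf : Measurable f) (h : sobSq G σ f < ∞) :
    MemLp f 2 (sobolevMeasure G σ) := by
  refine ⟨hf.aestronglyMeasurable, ?_⟩
  rw [← eLpNorm_sobolevMeasure_sq] at h
  by_contra h2
  simp only [not_lt, top_le_iff] at h2
  simp [h2] at h

/-- The element of `H^σ` with a given Fourier transform. -/
def ofFun {σ : ℝ} (f : ℝ → ℂ) (hf : Measurable f) (h : sobSq G σ f < ∞) : Hs G σ :=
  (memLp_sobolevMeasure hf h).toLp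

theorem ofFun_coe {σ : ℝ} {f : ℝ → ℂ} (hf : Measurable f) (h : sobSq G σ f < ∞) :
    (ofFun f hf h : ℝ → ℂ) =ᵐ[freq G] f := by
  have := (memLp_sobolevMeasure hf h).coeFn_toLp
  rwa [EventuallyEq, ae_sobolevMeasure] at this

theorem enorm_sq_Hs {σ : ℝ} (f : Hs G σ) : ‖f‖ₑ ^ 2 = sobSq G σ f := by
  rw [Lp.enorm_def, eLpNorm_sobolevMeasure_sq]

theorem sobSq_lt_top {σ : ℝ} (f : Hs G σ) : sobSq G σ f < ∞ := by
  rw [← enorm_sq_Hs]; exact ENNReal.pow_lt_top enorm_lt_top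

theorem measurable_coe {σ : ℝ} (f : Hs G σ) : Measurable (f : ℝ → ℂ) :=
  (Lp.stronglyMeasurable f).measurable

theorem Hs_ext {σ : ℝ} {f g : Hs G σ} (h : (f : ℝ → ℂ) =ᵐ[freq G] g) : f = g := by
  refine Lp.ext ?_
  rwa [EventuallyEq, ae_sobolevMeasure]

theorem coe_add_ae {σ : ℝ} (f g : Hs G σ) :
    ((f + g : Hs G σ) : ℝ → ℂ) =ᵐ[freq G] fun ξ => f ξ + g ξ := by
  have := Lp.coeFn_add f g
  rwa [EventuallyEq, ae_sobolevMeasure] at this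

theorem coe_sub_ae {σ : ℝ} (f g : Hs G σ) :
    ((f - g : Hs G σ) : ℝ → ℂ) =ᵐ[freq G] fun ξ => f ξ - g ξ := by
  have := Lp.coeFn_sub f g
  rwa [EventuallyEq, ae_sobolevMeasure] at this

theorem coe_neg_ae {σ : ℝ} (f : Hs G σ) :
    ((-f : Hs G σ) : ℝ → ℂ) =ᵐ[freq G] fun ξ => -f ξ := by
  have := Lp.coeFn_neg f
  rwa [EventuallyEq, ae_sobolevMeasure] at this

theorem coe_zero_ae {σ : ℝ} : ((0 : Hs G σ) : ℝ → ℂ) =ᵐ[freq G] fun _ => 0 := by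
  have := Lp.coeFn_zero ℂ 2 (sobolevMeasure G σ)
  rwa [EventuallyEq, ae_sobolevMeasure] at this

theorem coe_smul_ae {σ : ℝ} (c : ℂ) (f : Hs G σ) :
    ((c • f : Hs G σ) : ℝ → ℂ) =ᵐ[freq G] fun ξ => c * f ξ := by
  have := Lp.coeFn_smul c f
  rwa [EventuallyEq, ae_sobolevMeasure] at this

theorem coe_real_smul_ae {σ : ℝ} (c : ℝ) (f : Hs G σ) :
    ((c • f : Hs G σ) : ℝ → ℂ) =ᵐ[freq G] fun ξ => (c : ℂ) * f ξ := by
  have := Lp.coeFn_smul c f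
  rw [EventuallyEq, ae_sobolevMeasure] at this
  filter_upwards [this] with ξ h
  rw [h]; simp

theorem norm_le_of_sobSq_le {σ σ' c : ℝ} (hc : 0 ≤ c) {f : Hs G σ} {g : Hs G σ'}
    (h : sobSq G σ' g ≤ ENNReal.ofReal (c ^ 2) * sobSq G σ f) : ‖g‖ ≤ c * ‖f‖ := by
  rw [← enorm_sq_Hs, ← enorm_sq_Hs, ← ofReal_norm, ← ofReal_norm, ← ENNReal.ofReal_pow (norm_nonneg _),
    ← ENNReal.ofReal_pow (norm_nonneg _), ← ENNReal.ofReal_mul (by positivity),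
    ENNReal.ofReal_le_ofReal_iff (by positivity)] at h
  rw [← mul_pow] at h
  exact le_of_sq_le_sq h (by positivity)

theorem norm_eq_of_ae_norm_eq {σ : ℝ} {f g : Hs G σ}
    (h : ∀ᵐ ξ ∂(freq G), ‖(g : ℝ → ℂ) ξ‖ = ‖(f : ℝ → ℂ) ξ‖) : ‖g‖ = ‖f‖ := by
  have e : sobSq G σ g = sobSq G σ f := by
    refine lintegral_congr_ae ?_
    filter_upwards [h] with ξ hξ
    rw [← ofReal_norm, hξ, ofReal_norm]
  rw [← toReal_enorm, ← toReal_enorm]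
  congr 1
  rw [← enorm_sq_Hs, ← enorm_sq_Hs] at e
  exact (ENNReal.pow_right_strictMono two_ne_zero).injective e

/-! ### Fourier multipliers -/

/-- `φ` is the symbol of an operator `H^σ → H^σ'` of norm at most `c`. -/
structure IsMult (σ σ' c : ℝ) (φ : ℝ → ℂ) : Prop where
  meas : Measurable φ
  nonneg : 0 ≤ c
  bound : ∀ ξ, (|ξ| + 1) ^ σ' * ‖φ ξ‖ ≤ c * (|ξ| + 1) ^ σ

theorem sobSq_mult_le {σ σ' c : ℝ} {φ : ℝ → ℂ} (h : IsMult σ σ' c φ) (f : ℝ → ℂ) :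
    sobSq G σ' (fun ξ => φ ξ * f ξ) ≤ ENNReal.ofReal (c ^ 2) * sobSq G σ f := by
  unfold sobSq
  rw [← lintegral_const_mul' _ _ ENNReal.ofReal_ne_top]
  refine lintegral_mono fun ξ => ?_
  rw [ENNReal.ofReal_pow h.nonneg, ← mul_pow, enorm_mul, ← mul_assoc, ← mul_assoc]
  refine pow_le_pow_left₀ zero_le (mul_le_mul_left ?_ _) 2
  rw [← ofReal_norm (φ ξ), ← ENNReal.ofReal_mul (by positivity), ← ENNReal.ofReal_mul h.nonneg]
  exact ENNReal.ofReal_le_ofReal (h.bound ξ)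

variable {σ σ' σ'' c : ℝ} {φ : ℝ → ℂ}

theorem IsMult.sobSq_lt_top (h : IsMult σ σ' c φ) (f : Hs G σ) :
    sobSq G σ' (fun ξ => φ ξ * f ξ) < ∞ :=
  (sobSq_mult_le h f).trans_lt (ENNReal.mul_lt_top ENNReal.ofReal_lt_top (BenjaminOno.sobSq_lt_top f))

/-- The Fourier multiplier with symbol `φ`. -/
def mlt (G : Geometry) (h : IsMult σ σ' c φ) : Hs G σ →L[ℂ] Hs G σ' :=
  LinearMap.mkContinuous
    { toFun := fun f => ofFun (fun ξ => φ ξ * f ξ) (h.meas.mul (measurable_coe f)) (h.sobSq_lt_top f)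
      map_add' := fun f g => Hs_ext <| by
        filter_upwards [ofFun_coe (h.meas.mul (measurable_coe (f + g))) (h.sobSq_lt_top (f + g)),
          coe_add_ae f g, ofFun_coe (h.meas.mul (measurable_coe f)) (h.sobSq_lt_top f),
          ofFun_coe (h.meas.mul (measurable_coe g)) (h.sobSq_lt_top g),
          coe_add_ae (ofFun _ (h.meas.mul (measurable_coe f)) (h.sobSq_lt_top f))
            (ofFun _ (h.meas.mul (measurable_coe g)) (h.sobSq_lt_top g))] with ξ h1 h2 h3 h4 h5
        erw [h1, h5, h3, h4]
        simp only [Pi.mul_apply, h2, mul_add]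
      map_smul' := fun c f => Hs_ext <| by
        filter_upwards [ofFun_coe (h.meas.mul (measurable_coe (c • f))) (h.sobSq_lt_top (c • f)),
          coe_smul_ae c f, ofFun_coe (h.meas.mul (measurable_coe f)) (h.sobSq_lt_top f),
          coe_smul_ae c (ofFun _ (h.meas.mul (measurable_coe f)) (h.sobSq_lt_top f))]
          with ξ h1 h2 h3 h4
        erw [h1, h4, h3]
        simp only [Pi.mul_apply, h2]
        ring }
    c fun f => norm_le_of_sobSq_le h.nonneg <| by
      rw [LinearMap.coe_mk, AddHom.coe_mk, sobSq_congr (ofFun_coe _ _)]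
      exact sobSq_mult_le h f

theorem mlt_coe (h : IsMult σ σ' c φ) (f : Hs G σ) :
    (mlt G h f : ℝ → ℂ) =ᵐ[freq G] fun ξ => φ ξ * f ξ :=
  ofFun_coe (h.meas.mul (measurable_coe f)) (h.sobSq_lt_top f)

theorem mlt_norm_le (h : IsMult σ σ' c φ) (f : Hs G σ) : ‖mlt G h f‖ ≤ c * ‖f‖ :=
  norm_le_of_sobSq_le h.nonneg <| by
    rw [sobSq_congr (mlt_coe h f)]
    exact sobSq_mult_le h f

theorem isMult_one (h : σ' ≤ σ) : IsMult σ σ' 1 fun _ => 1 :=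
  ⟨measurable_const, zero_le_one, fun ξ => by
    simpa using Real.rpow_le_rpow_of_exponent_le (one_le_bracket ξ) h⟩

/-- The inclusion `H^σ ⊆ H^σ'`, `σ' ≤ σ`. -/
def emb (G : Geometry) (h : σ' ≤ σ) : Hs G σ →L[ℂ] Hs G σ' := mlt G (isMult_one h)

theorem emb_coe (h : σ' ≤ σ) (f : Hs G σ) : (emb G h f : ℝ → ℂ) =ᵐ[freq G] f := by
  filter_upwards [mlt_coe (isMult_one h) f] with ξ hξ
  rw [emb, hξ, one_mul]

theorem isMult_dx (σ : ℝ) : IsMult (σ + 1) σ 1 fun ξ => Complex.I * (ξ : ℂ) :=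
  ⟨by fun_prop, zero_le_one, fun ξ => by
    rw [Real.rpow_add (bracket_pos ξ), Real.rpow_one]
    simp only [norm_mul, Complex.norm_I, Complex.norm_real, one_mul, Real.norm_eq_abs]
    gcongr
    linarith [abs_nonneg ξ]⟩

/-- `f ↦ f'` as an operator `H^{σ+1} → H^σ`. -/
def dxL (G : Geometry) (σ : ℝ) : Hs G (σ + 1) →L[ℂ] Hs G σ := mlt G (isMult_dx σ)

theorem dxL_coe (f : Hs G (σ + 1)) : (dxL G σ f : ℝ → ℂ) =ᵐ[freq G] dx f := mlt_coe _ f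

theorem isMult_tr (σ h : ℝ) : IsMult σ σ 1 fun ξ => Complex.exp (Complex.I * (ξ : ℂ) * (h : ℂ)) :=
  ⟨by fun_prop, zero_le_one, fun ξ => by
    have : Complex.I * (ξ : ℂ) * (h : ℂ) = ((ξ * h : ℝ) : ℂ) * Complex.I := by push_cast; ring
    rw [this, Complex.norm_exp_ofReal_mul_I, mul_one, one_mul]⟩

/-- The translation `f ↦ f(· + h)`. -/
def tr (G : Geometry) (σ h : ℝ) : Hs G σ →L[ℂ] Hs G σ := mlt G (isMult_tr σ h)

theorem tr_coe (h : ℝ) (f : Hs G σ) :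
    (tr G σ h f : ℝ → ℂ) =ᵐ[freq G] fun ξ => Complex.exp (Complex.I * (ξ : ℂ) * (h : ℂ)) * f ξ :=
  mlt_coe _ f

theorem norm_exp_I_mul (ξ h : ℝ) : ‖Complex.exp (Complex.I * (ξ : ℂ) * (h : ℂ))‖ = 1 := by
  have : Complex.I * (ξ : ℂ) * (h : ℂ) = ((ξ * h : ℝ) : ℂ) * Complex.I := by push_cast; ring
  rw [this, Complex.norm_exp_ofReal_mul_I]

theorem tr_norm (h : ℝ) (f : Hs G σ) : ‖tr G σ h f‖ = ‖f‖ := by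
  refine norm_eq_of_ae_norm_eq ?_
  filter_upwards [tr_coe h f] with ξ hξ
  rw [hξ, norm_mul, norm_exp_I_mul, one_mul]

theorem tr_tr (h k : ℝ) (f : Hs G σ) : tr G σ h (tr G σ k f) = tr G σ (h + k) f := by
  refine Hs_ext ?_
  filter_upwards [tr_coe h (tr G σ k f), tr_coe k f, tr_coe (h + k) f] with ξ h1 h2 h3
  rw [h1, h2, h3, ← mul_assoc, ← Complex.exp_add]
  push_cast; ring_nf

theorem tr_zero (f : Hs G σ) : tr G σ 0 f = f := by
  refine Hs_ext ?_
  filter_upwards [tr_coe 0 f] with ξ h1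
  rw [h1]; simp

theorem isMult_cut (σ σ' : ℝ) {R : ℝ} (hR : 0 ≤ R) :
    IsMult σ σ' ((R + 1) ^ |σ' - σ|) (indicator {ξ : ℝ | |ξ| ≤ R} fun _ => (1 : ℂ)) :=
  ⟨measurable_const.indicator (measurableSet_le measurable_norm measurable_const), by positivity,
    fun ξ => by
      by_cases h : |ξ| ≤ R
      · rw [indicator_of_mem (by exact h), norm_one, mul_one]
        have : (|ξ| + 1) ^ σ' = (|ξ| + 1) ^ (σ' - σ) * (|ξ| + 1) ^ σ := by
          rw [← Real.rpow_add (bracket_pos ξ)]; ring_nf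
        rw [this]
        gcongr
        exact (Real.rpow_le_rpow_of_exponent_le (one_le_bracket ξ) (le_abs_self _)).trans
          (Real.rpow_le_rpow (by positivity) (by linarith) (abs_nonneg _))
      · rw [indicator_of_notMem (by exact h), norm_zero, mul_zero]
        positivity⟩

/-- The frequency cutoff to `|ξ| ≤ R`. -/
def cut (G : Geometry) (σ σ' : ℝ) {R : ℝ} (hR : 0 ≤ R) : Hs G σ →L[ℂ] Hs G σ' :=
  mlt G (isMult_cut σ σ' hR)

theorem cut_coe {R : ℝ} (hR : 0 ≤ R) (f : Hs G σ) :
    (cut G σ σ' hR f : ℝ → ℂ) =ᵐ[freq G] indicator {ξ : ℝ | |ξ| ≤ R} f := by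
  filter_upwards [mlt_coe (isMult_cut σ σ' hR) f] with ξ hξ
  rw [cut, hξ]
  by_cases h : |ξ| ≤ R <;> simp [h]

theorem cut_emb_norm_le {R : ℝ} (hR : 0 ≤ R) (h : σ' ≤ σ) (f : Hs G σ) :
    ‖cut G σ' σ hR (emb G h f)‖ ≤ ‖f‖ := by
  rw [← one_mul ‖f‖]
  refine norm_le_of_sobSq_le zero_le_one ?_
  simp only [one_pow, ENNReal.ofReal_one, one_mul, sobSq]
  refine lintegral_mono_ae ?_
  filter_upwards [cut_coe (σ' := σ) hR (emb G h f), emb_coe h f] with ξ h1 h2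
  rw [h1]
  gcongr
  by_cases hξ : |ξ| ≤ R <;> simp [hξ, h2]

/-- Dominated convergence: the error is the part of the norm integral over `|ξ| > n`. -/
theorem tendsto_cut_self (f : Hs G σ) :
    Tendsto (fun n : ℕ => cut G σ σ (Nat.cast_nonneg n) f) atTop (𝓝 f) := by
  rw [tendsto_iff_norm_sub_tendsto_zero]
  have h1 : Tendsto (fun n : ℕ => sobSq G σ (cut G σ σ (Nat.cast_nonneg n) f - f : Hs G σ)) atTop
      (𝓝 0) := by
    have e : ∀ n : ℕ, sobSq G σ (cut G σ σ (Nat.cast_nonneg n) f - f : Hs G σ) =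
        ∫⁻ ξ, indicator {ξ : ℝ | (n : ℝ) < |ξ|}
          (fun ξ => (ENNReal.ofReal ((|ξ| + 1) ^ σ) * ‖f ξ‖ₑ) ^ 2) ξ ∂(freq G) := fun n => by
      refine lintegral_congr_ae ?_
      filter_upwards [coe_sub_ae (cut G σ σ (Nat.cast_nonneg n) f) f,
        cut_coe (σ' := σ) (Nat.cast_nonneg n) f] with ξ h1 h2
      rw [h1, h2]
      by_cases hξ : |ξ| ≤ n
      · simp [hξ]
      · simp [hξ, not_le.1 hξ]
    simp only [e]
    have hm : Measurable fun ξ : ℝ => (ENNReal.ofReal ((|ξ| + 1) ^ σ) * ‖f ξ‖ₑ) ^ 2 := by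
      have := measurable_coe f
      fun_prop
    rw [show (0 : ℝ≥0∞) = ∫⁻ ξ, (0 : ℝ≥0∞) ∂(freq G) by simp]
    refine tendsto_lintegral_of_dominated_convergence _
      (fun n => hm.indicator (measurableSet_lt measurable_const measurable_norm))
      (fun n => Eventually.of_forall fun ξ => indicator_le_self _ _ ξ) (sobSq_lt_top f).ne
      (Eventually.of_forall fun ξ => ?_)
    refine tendsto_const_nhds.congr' ?_
    obtain ⟨N, hN⟩ := exists_nat_ge |ξ|
    filter_upwards [eventually_ge_atTop N] with n hn
    have : |ξ| ≤ n := hN.trans (by exact_mod_cast hn)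
    simp [this]
  have h2 : ∀ n : ℕ, ‖cut G σ σ (Nat.cast_nonneg n) f - f‖ =
      Real.sqrt (sobSq G σ (cut G σ σ (Nat.cast_nonneg n) f - f : Hs G σ)).toReal := fun n => by
    rw [← enorm_sq_Hs, ENNReal.toReal_pow, toReal_enorm, Real.sqrt_sq (norm_nonneg _)]
  simp only [h2]
  have h3 := (Real.continuous_sqrt.tendsto 0).comp ((ENNReal.tendsto_toReal ENNReal.zero_ne_top).comp h1)
  rwa [Real.sqrt_zero] at h3

theorem cut_emb (h : σ' ≤ σ) {R : ℝ} (hR : 0 ≤ R) (f : Hs G σ) :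
    cut G σ' σ hR (emb G h f) = cut G σ σ hR f := by
  refine Hs_ext ?_
  filter_upwards [cut_coe (σ' := σ) hR (emb G h f), cut_coe (σ' := σ) hR f, emb_coe h f]
    with ξ h1 h2 h3
  rw [h1, h2]
  by_cases hξ : |ξ| ≤ R <;> simp [hξ, h3]

/-! ### Complex conjugation -/

theorem measurable_conjF {f : ℝ → ℂ} (hf : Measurable f) : Measurable (conjF f) :=
  Complex.continuous_conj.measurable.comp (hf.comp measurable_neg)

theorem conjF_congr {f g : ℝ → ℂ} (h : f =ᵐ[freq G] g) : conjF f =ᵐ[freq G] conjF g := by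
  filter_upwards [ae_neg h] with ξ hξ
  rw [conjF, conjF, hξ]

theorem sobSq_conjF {f : ℝ → ℂ} (hf : Measurable f) : sobSq G σ (conjF f) = sobSq G σ f := by
  have := (measurePreserving_neg_freq G).lintegral_comp
    (f := fun ξ => (ENNReal.ofReal ((|ξ| + 1) ^ σ) * ‖f ξ‖ₑ) ^ 2) (by fun_prop)
  rw [sobSq, sobSq, ← this]
  refine lintegral_congr fun ξ => ?_
  simp [conjF]

theorem sobSq_conjF_lt_top (f : Hs G σ) : sobSq G σ (conjF f) < ∞ := by
  rw [sobSq_conjF (measurable_coe f)]; exact sobSq_lt_top f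

/-- Complex conjugation on `H^σ`. -/
def conjL (G : Geometry) (σ : ℝ) : Hs G σ →L[ℝ] Hs G σ :=
  LinearMap.mkContinuous
    { toFun := fun f => ofFun (conjF f) (measurable_conjF (measurable_coe f)) (sobSq_conjF_lt_top f)
      map_add' := fun f g => Hs_ext <| by
        filter_upwards [ofFun_coe (measurable_conjF (measurable_coe (f + g)))
            (sobSq_conjF_lt_top (f + g)), ae_neg (coe_add_ae f g),
          ofFun_coe (measurable_conjF (measurable_coe f)) (sobSq_conjF_lt_top f),
          ofFun_coe (measurable_conjF (measurable_coe g)) (sobSq_conjF_lt_top g),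
          coe_add_ae (ofFun _ (measurable_conjF (measurable_coe f)) (sobSq_conjF_lt_top f))
            (ofFun _ (measurable_conjF (measurable_coe g)) (sobSq_conjF_lt_top g))]
          with ξ h1 h2 h3 h4 h5
        rw [h1, h5, h3, h4]
        simp only [conjF, h2, map_add]
      map_smul' := fun c f => Hs_ext <| by
        filter_upwards [ofFun_coe (measurable_conjF (measurable_coe (c • f)))
            (sobSq_conjF_lt_top (c • f)), ae_neg (coe_real_smul_ae c f),
          ofFun_coe (measurable_conjF (measurable_coe f)) (sobSq_conjF_lt_top f),
          coe_real_smul_ae c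
            (ofFun _ (measurable_conjF (measurable_coe f)) (sobSq_conjF_lt_top f))]
          with ξ h1 h2 h3 h4
        rw [h1, RingHom.id_apply, h4, h3]
        simp only [conjF, h2, map_mul, Complex.conj_ofReal] }
    1 fun f => norm_le_of_sobSq_le zero_le_one <| by
      rw [LinearMap.coe_mk, AddHom.coe_mk, sobSq_congr (ofFun_coe _ _),
        sobSq_conjF (measurable_coe f)]
      simp

theorem conjL_coe (f : Hs G σ) : (conjL G σ f : ℝ → ℂ) =ᵐ[freq G] conjF f :=
  ofFun_coe (measurable_conjF (measurable_coe f)) (sobSq_conjF_lt_top f)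

theorem conjL_norm_le (f : Hs G σ) : ‖conjL G σ f‖ ≤ ‖f‖ := by
  rw [← one_mul ‖f‖]
  refine norm_le_of_sobSq_le zero_le_one ?_
  rw [sobSq_congr (conjL_coe f), sobSq_conjF (measurable_coe f)]
  simp

theorem isReal_iff {s : ℝ} {q : Hs G s} : IsReal q ↔ conjL G s q = q := by
  constructor
  · intro h
    refine Hs_ext ?_
    filter_upwards [h, conjL_coe q] with ξ h1 h2
    rw [h2, conjF, h1, Complex.conj_conj]
  · intro h
    have h2 := conjL_coe q
    rw [h] at h2
    filter_upwards [h2] with ξ h1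
    rw [h1, conjF, Complex.conj_conj]

end

section

variable {G : Geometry} {σ σ' σ₁ σ₂ σ₃ A : ℝ}

/-! ### Bilinear operators given by kernels -/

/-- `k` is the kernel of a bilinear operator `H^σ₁ × H^σ₂ → H^σ₃` of norm at most `3 A`. -/
structure IsKer (G : Geometry) (σ₁ σ₂ σ₃ A : ℝ) (k : ℝ → ℝ → ℂ) : Prop where
  meas : Measurable (Function.uncurry k)
  nonneg : 0 ≤ A
  bound : ∃ g : ℝ → ℝ, Measurable g ∧ (∀ ξ, 0 ≤ g ξ) ∧
    ∫⁻ ξ, ENNReal.ofReal (g ξ) ^ 2 ∂(freq G) ≤ ENNReal.ofReal (A ^ 2) ∧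
    ∀ ξ η, (|ξ| + 1) ^ σ₃ * ‖k ξ η‖ ≤
      (g ξ + g η + g (ξ - η)) * ((|ξ - η| + 1) ^ σ₁ * (|η| + 1) ^ σ₂)

/-- The bilinear operator with kernel `k`. -/
def kconv (G : Geometry) (k : ℝ → ℝ → ℂ) (f g : ℝ → ℂ) : ℝ → ℂ :=
  fun ξ => ∫ η, k ξ η * (f (ξ - η) * g η) ∂(freq G)

/-- The bound is on the integral of absolute values, so it yields convergence of the defining
integral as well as the norm estimate. After the weights are moved onto `f` and `g` it is
`lintegral_sq_conv_le`; `9 A² = (3 A)²`. -/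
theorem kconv_lintegral_le {k : ℝ → ℝ → ℂ} (hk : IsKer G σ₁ σ₂ σ₃ A k) {f g : ℝ → ℂ}
    (hf : Measurable f) (hg : Measurable g) :
    ∫⁻ ξ, (ENNReal.ofReal ((|ξ| + 1) ^ σ₃) *
      ∫⁻ η, ‖k ξ η * (f (ξ - η) * g η)‖ₑ ∂(freq G)) ^ 2 ∂(freq G) ≤
      ENNReal.ofReal ((3 * A) ^ 2) * (sobSq G σ₁ f * sobSq G σ₂ g) := by
  obtain ⟨w, hwm, hw0, hwA, hw⟩ := hk.bound
  let w' : ℝ → ℝ≥0∞ := fun ξ => ENNReal.ofReal (w ξ)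
  let a : ℝ → ℝ≥0∞ := fun ξ => ENNReal.ofReal ((|ξ| + 1) ^ σ₁) * ‖f ξ‖ₑ
  let b : ℝ → ℝ≥0∞ := fun ξ => ENNReal.ofReal ((|ξ| + 1) ^ σ₂) * ‖g ξ‖ₑ
  have hw'm : Measurable w' := by fun_prop
  have ham : Measurable a := by fun_prop
  have hbm : Measurable b := by fun_prop
  have key := lintegral_sq_conv_le (G := G) hw'm ham hbm
  have hle : ∀ ξ, ENNReal.ofReal ((|ξ| + 1) ^ σ₃) * ∫⁻ η, ‖k ξ η * (f (ξ - η) * g η)‖ₑ ∂(freq G) ≤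
      ∫⁻ η, (w' ξ + w' η + w' (ξ - η)) * (a (ξ - η) * b η) ∂(freq G) := fun ξ => by
    rw [← lintegral_const_mul' _ _ ENNReal.ofReal_ne_top]
    refine lintegral_mono fun η => ?_
    have h1 : ENNReal.ofReal ((|ξ| + 1) ^ σ₃) * ‖k ξ η‖ₑ ≤ (w' ξ + w' η + w' (ξ - η)) *
        (ENNReal.ofReal ((|ξ - η| + 1) ^ σ₁) * ENNReal.ofReal ((|η| + 1) ^ σ₂)) := by
      simp only [w']
      rw [← ofReal_norm, ← ENNReal.ofReal_add (hw0 _) (hw0 _),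
        ← ENNReal.ofReal_add (add_nonneg (hw0 _) (hw0 _)) (hw0 _),
        ← ENNReal.ofReal_mul (by positivity), ← ENNReal.ofReal_mul (by positivity),
        ← ENNReal.ofReal_mul (add_nonneg (add_nonneg (hw0 _) (hw0 _)) (hw0 _))]
      exact ENNReal.ofReal_le_ofReal (hw ξ η)
    calc ENNReal.ofReal ((|ξ| + 1) ^ σ₃) * ‖k ξ η * (f (ξ - η) * g η)‖ₑ
        = ENNReal.ofReal ((|ξ| + 1) ^ σ₃) * ‖k ξ η‖ₑ * (‖f (ξ - η)‖ₑ * ‖g η‖ₑ) := by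
          rw [enorm_mul, enorm_mul]; ring
      _ ≤ (w' ξ + w' η + w' (ξ - η)) * (ENNReal.ofReal ((|ξ - η| + 1) ^ σ₁) *
            ENNReal.ofReal ((|η| + 1) ^ σ₂)) * (‖f (ξ - η)‖ₑ * ‖g η‖ₑ) := by gcongr
      _ = _ := by simp only [a, b]; ring
  calc _ ≤ _ := lintegral_mono fun ξ => pow_le_pow_left₀ zero_le (hle ξ) 2
    _ ≤ _ := key
    _ ≤ 9 * (ENNReal.ofReal (A ^ 2) * sobSq G σ₁ f * sobSq G σ₂ g) := by
      gcongr <;> exact le_of_eq rfl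
    _ = _ := by
      rw [mul_pow, ENNReal.ofReal_mul (by norm_num), mul_assoc (ENNReal.ofReal _),
        mul_assoc (ENNReal.ofReal _)]
      norm_num

theorem kconv_measurable {k : ℝ → ℝ → ℂ} (hk : Measurable (Function.uncurry k)) {f g : ℝ → ℂ}
    (hf : Measurable f) (hg : Measurable g) : Measurable (kconv G k f g) := by
  refine (StronglyMeasurable.integral_prod_right'
    (f := fun p : ℝ × ℝ => k p.1 p.2 * (f (p.1 - p.2) * g p.2)) ?_).measurable
  have hk' : Measurable fun p : ℝ × ℝ => k p.1 p.2 := hk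
  exact Measurable.stronglyMeasurable (by fun_prop)

theorem kconv_congr {k : ℝ → ℝ → ℂ} {f f' g g' : ℝ → ℂ} (hf : f =ᵐ[freq G] f')
    (hg : g =ᵐ[freq G] g') : kconv G k f g =ᵐ[freq G] kconv G k f' g' := by
  filter_upwards [ae_ae_sub hf] with ξ hξ
  refine integral_congr_ae ?_
  filter_upwards [hξ, hg] with η h1 h2
  rw [h1, h2]

theorem sobSq_kconv_le {k : ℝ → ℝ → ℂ} (hk : IsKer G σ₁ σ₂ σ₃ A k) {f g : ℝ → ℂ}
    (hf : Measurable f) (hg : Measurable g) :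
    sobSq G σ₃ (kconv G k f g) ≤
      ENNReal.ofReal ((3 * A) ^ 2) * (sobSq G σ₁ f * sobSq G σ₂ g) := by
  refine le_trans (lintegral_mono fun ξ => ?_) (kconv_lintegral_le hk hf hg)
  refine pow_le_pow_left₀ zero_le ?_ 2
  gcongr
  exact enorm_integral_le_lintegral_enorm _

theorem kconv_integrable {k : ℝ → ℝ → ℂ} (hk : IsKer G σ₁ σ₂ σ₃ A k) {f g : ℝ → ℂ}
    (hf : Measurable f) (hg : Measurable g) (hf2 : sobSq G σ₁ f < ∞) (hg2 : sobSq G σ₂ g < ∞) :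
    ∀ᵐ ξ ∂(freq G), Integrable (fun η => k ξ η * (f (ξ - η) * g η)) (freq G) := by
  have h := (kconv_lintegral_le hk hf hg).trans_lt
    (ENNReal.mul_lt_top ENNReal.ofReal_lt_top (ENNReal.mul_lt_top hf2 hg2))
  have hk' : Measurable fun p : ℝ × ℝ => k p.1 p.2 := hk.meas
  have hm : Measurable fun ξ => ∫⁻ η, ‖k ξ η * (f (ξ - η) * g η)‖ₑ ∂(freq G) :=
    Measurable.lintegral_prod_right' (f := fun p : ℝ × ℝ => ‖k p.1 p.2 * (f (p.1 - p.2) * g p.2)‖ₑ)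
      (by fun_prop)
  filter_upwards [ae_lt_top (((measurable_weight σ₃).mul hm).pow_const 2) h.ne] with ξ hξ
  have hk2 : Measurable fun η => k ξ η := hk.meas.of_uncurry_left
  have hf3 : Measurable fun η => f (ξ - η) := hf.comp (measurable_const.sub measurable_id)
  refine ⟨(by fun_prop : Measurable _).aestronglyMeasurable, ?_⟩
  rw [hasFiniteIntegral_iff_enorm]
  simp only [Pi.mul_apply] at hξ
  by_contra hcon
  rw [not_lt, top_le_iff] at hcon
  rw [hcon, ENNReal.mul_top (by simpa using bracket_rpow_pos ξ σ₃)] at hξ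
  simp at hξ

theorem IsKer.sobSq_lt_top {k : ℝ → ℝ → ℂ} (hk : IsKer G σ₁ σ₂ σ₃ A k) (f : Hs G σ₁)
    (g : Hs G σ₂) : sobSq G σ₃ (kconv G k f g) < ∞ :=
  (sobSq_kconv_le hk (measurable_coe f) (measurable_coe g)).trans_lt
    (ENNReal.mul_lt_top ENNReal.ofReal_lt_top
      (ENNReal.mul_lt_top (BenjaminOno.sobSq_lt_top f) (BenjaminOno.sobSq_lt_top g)))

/-- The value of the bilinear operator with kernel `k`. -/
def bilFun {k : ℝ → ℝ → ℂ} (hk : IsKer G σ₁ σ₂ σ₃ A k) (f : Hs G σ₁) (g : Hs G σ₂) : Hs G σ₃ :=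
  ofFun (kconv G k f g) (kconv_measurable hk.meas (measurable_coe f) (measurable_coe g))
    (hk.sobSq_lt_top f g)

theorem bilFun_coe {k : ℝ → ℝ → ℂ} (hk : IsKer G σ₁ σ₂ σ₃ A k) (f : Hs G σ₁) (g : Hs G σ₂) :
    (bilFun hk f g : ℝ → ℂ) =ᵐ[freq G] kconv G k f g :=
  ofFun_coe (kconv_measurable hk.meas (measurable_coe f) (measurable_coe g)) (hk.sobSq_lt_top f g)

theorem bilFun_norm_le {k : ℝ → ℝ → ℂ} (hk : IsKer G σ₁ σ₂ σ₃ A k) (f : Hs G σ₁) (g : Hs G σ₂) :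
    ‖bilFun hk f g‖ ≤ 3 * A * ‖f‖ * ‖g‖ := by
  have h := sobSq_kconv_le hk (measurable_coe f) (measurable_coe g)
  have hA := hk.nonneg
  rw [← sobSq_congr (bilFun_coe hk f g), ← enorm_sq_Hs, ← enorm_sq_Hs, ← enorm_sq_Hs, ← ofReal_norm,
    ← ofReal_norm, ← ofReal_norm, ← ENNReal.ofReal_pow (norm_nonneg _),
    ← ENNReal.ofReal_pow (norm_nonneg _), ← ENNReal.ofReal_pow (norm_nonneg _),
    ← ENNReal.ofReal_mul (by positivity), ← ENNReal.ofReal_mul (by positivity),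
    ENNReal.ofReal_le_ofReal_iff (by positivity), ← mul_pow, ← mul_pow] at h
  have := le_of_sq_le_sq h (by positivity)
  linarith

/-- The bounded bilinear operator with kernel `k`. -/
def bil {k : ℝ → ℝ → ℂ} (hk : IsKer G σ₁ σ₂ σ₃ A k) : Hs G σ₁ →L[ℂ] Hs G σ₂ →L[ℂ] Hs G σ₃ :=
  LinearMap.mkContinuous₂
    (LinearMap.mk₂ ℂ (bilFun hk)
      (fun f f' g => Hs_ext <| by
        filter_upwards [bilFun_coe hk (f + f') g, bilFun_coe hk f g, bilFun_coe hk f' g,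
          coe_add_ae (bilFun hk f g) (bilFun hk f' g),
          kconv_congr (k := k) (coe_add_ae f f') (ae_eq_refl (μ := freq G) (g : ℝ → ℂ)),
          kconv_integrable hk (measurable_coe f) (measurable_coe g) (sobSq_lt_top f)
            (sobSq_lt_top g),
          kconv_integrable hk (measurable_coe f') (measurable_coe g) (sobSq_lt_top f')
            (sobSq_lt_top g)] with ξ h1 h2 h3 h4 h5 h6 h7
        rw [h1, h4, h2, h3, h5]
        simp only [kconv]
        rw [← integral_add h6 h7]
        congr 1; ext η; ring)
      (fun c f g => Hs_ext <| by
        filter_upwards [bilFun_coe hk (c • f) g, bilFun_coe hk f g, coe_smul_ae c (bilFun hk f g),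
          kconv_congr (k := k) (coe_smul_ae c f) (ae_eq_refl (μ := freq G) (g : ℝ → ℂ))]
          with ξ h1 h2 h3 h4
        rw [h1, h3, h2, h4]
        simp only [kconv]
        rw [← integral_const_mul]
        congr 1; ext η; ring)
      (fun f g g' => Hs_ext <| by
        filter_upwards [bilFun_coe hk f (g + g'), bilFun_coe hk f g, bilFun_coe hk f g',
          coe_add_ae (bilFun hk f g) (bilFun hk f g'),
          kconv_congr (k := k) (ae_eq_refl (μ := freq G) (f : ℝ → ℂ)) (coe_add_ae g g'),
          kconv_integrable hk (measurable_coe f) (measurable_coe g) (sobSq_lt_top f)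
            (sobSq_lt_top g),
          kconv_integrable hk (measurable_coe f) (measurable_coe g') (sobSq_lt_top f)
            (sobSq_lt_top g')] with ξ h1 h2 h3 h4 h5 h6 h7
        rw [h1, h4, h2, h3, h5]
        simp only [kconv]
        rw [← integral_add h6 h7]
        congr 1; ext η; ring)
      (fun c f g => Hs_ext <| by
        filter_upwards [bilFun_coe hk f (c • g), bilFun_coe hk f g, coe_smul_ae c (bilFun hk f g),
          kconv_congr (k := k) (ae_eq_refl (μ := freq G) (f : ℝ → ℂ)) (coe_smul_ae c g)]
          with ξ h1 h2 h3 h4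
        rw [h1, h3, h2, h4]
        simp only [kconv]
        rw [← integral_const_mul]
        congr 1; ext η; ring))
    (3 * A) (bilFun_norm_le hk)

theorem bil_coe {k : ℝ → ℝ → ℂ} (hk : IsKer G σ₁ σ₂ σ₃ A k) (f : Hs G σ₁) (g : Hs G σ₂) :
    (bil hk f g : ℝ → ℂ) =ᵐ[freq G] kconv G k f g := bilFun_coe hk f g

theorem bil_norm_le {k : ℝ → ℝ → ℂ} (hk : IsKer G σ₁ σ₂ σ₃ A k) (f : Hs G σ₁) (g : Hs G σ₂) :
    ‖bil hk f g‖ ≤ 3 * A * ‖f‖ * ‖g‖ := bilFun_norm_le hk f g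

/-! ### Products -/

theorem mul_eq_kconv (f g : ℝ → ℂ) : mul G f g = kconv G (fun _ _ => convConst G) f g := by
  ext ξ
  simp only [mul, kconv, integral_const_mul]

theorem mul_congr {f f' g g' : ℝ → ℂ} (hf : f =ᵐ[freq G] f') (hg : g =ᵐ[freq G] g') :
    mul G f g =ᵐ[freq G] mul G f' g' := by
  rw [mul_eq_kconv, mul_eq_kconv]; exact kconv_congr hf hg

theorem lintegral_weight_sq_le {κ p c : ℝ} (hκ : 1 ≤ κ)
    (h : ∫⁻ ξ, ENNReal.ofReal ((|ξ| + κ) ^ (-(2 * p))) ∂(freq G) ≤ ENNReal.ofReal c) :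
    ∫⁻ ξ, ENNReal.ofReal ((|ξ| + κ) ^ (-p)) ^ 2 ∂(freq G) ≤ ENNReal.ofReal c := by
  refine le_trans (le_of_eq (lintegral_congr fun ξ => ?_)) h
  have : 0 < |ξ| + κ := by positivity
  rw [← ENNReal.ofReal_pow (by positivity), ← Real.rpow_natCast, ← Real.rpow_mul this.le]
  congr 2; push_cast; ring

theorem weight_sub_le {κ : ℝ} (hκ : 0 ≤ κ) (ξ η : ℝ) : |ξ| + κ ≤ (|ξ - η| + κ) + (|η| + κ) := by
  have : |ξ| ≤ |ξ - η| + |η| := by simpa using abs_add_le (ξ - η) η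
  linarith

theorem weight_sub_le' {κ : ℝ} (hκ : 0 ≤ κ) (ξ η : ℝ) : |ξ - η| + κ ≤ (|ξ| + κ) + (|η| + κ) := by
  have := abs_sub ξ η
  linarith

/-- The weight inequality behind `H^{-a} × H^{1-a} → H^{-a}`. -/
theorem weight_low {κ a : ℝ} (hκ : 0 < κ) (ha : 0 < a) (ha2 : a < 1 / 2) (ξ η : ℝ) :
    (|ξ| + κ) ^ (-a) ≤ 2 * ((|ξ| + κ) ^ (-(1 - a)) + (|η| + κ) ^ (-(1 - a))) *
      ((|ξ - η| + κ) ^ (-a) * (|η| + κ) ^ (1 - a)) := by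
  set x := |ξ| + κ
  set y := |η| + κ
  set z := |ξ - η| + κ
  have hx : 0 < x := by positivity
  have hy : 0 < y := by positivity
  have hz : 0 < z := by positivity
  -- Triangle inequality for the weights and subadditivity of the concave power `a < 1`.
  have h1 : z ^ a ≤ x ^ a + y ^ a :=
    (Real.rpow_le_rpow hz.le (weight_sub_le' hκ.le ξ η) ha.le).trans
      (Real.rpow_add_le_add_rpow hx.le hy.le ha.le (by linarith))
  -- The two negative exponents add up to `-(1 - a)`; the whole power may be put on the smaller of
  -- the two variables.
  have h2 : x ^ (-a) * y ^ (-(1 - 2 * a)) ≤ x ^ (-(1 - a)) + y ^ (-(1 - a)) := by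
    rcases le_total x y with h | h
    · have : y ^ (-(1 - 2 * a)) ≤ x ^ (-(1 - 2 * a)) :=
        Real.rpow_le_rpow_of_nonpos hx h (by linarith)
      calc x ^ (-a) * y ^ (-(1 - 2 * a)) ≤ x ^ (-a) * x ^ (-(1 - 2 * a)) := by gcongr
        _ = x ^ (-(1 - a)) := by rw [← Real.rpow_add hx]; ring_nf
        _ ≤ _ := by have := Real.rpow_pos_of_pos hy (-(1 - a)); linarith
    · have : x ^ (-a) ≤ y ^ (-a) := Real.rpow_le_rpow_of_nonpos hy h (by linarith)
      calc x ^ (-a) * y ^ (-(1 - 2 * a)) ≤ y ^ (-a) * y ^ (-(1 - 2 * a)) := by gcongr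
        _ = y ^ (-(1 - a)) := by rw [← Real.rpow_add hy]; ring_nf
        _ ≤ _ := by have := Real.rpow_pos_of_pos hx (-(1 - a)); linarith
  have h3 : x ^ (-a) * z ^ a * y ^ (-(1 - a)) ≤
      2 * (x ^ (-(1 - a)) + y ^ (-(1 - a))) := by
    calc x ^ (-a) * z ^ a * y ^ (-(1 - a)) ≤ x ^ (-a) * (x ^ a + y ^ a) * y ^ (-(1 - a)) := by
          gcongr
      _ = y ^ (-(1 - a)) + x ^ (-a) * y ^ (-(1 - 2 * a)) := by
          have e1 : x ^ (-a) * x ^ a = 1 := by rw [← Real.rpow_add hx]; simp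
          have e2 : y ^ a * y ^ (-(1 - a)) = y ^ (-(1 - 2 * a)) := by
            rw [← Real.rpow_add hy]; ring_nf
          rw [mul_add, e1, add_mul, one_mul, mul_assoc, e2]
      _ ≤ _ := by have := Real.rpow_pos_of_pos hx (-(1 - a)); linarith
  have e3 : z ^ a * z ^ (-a) = 1 := by rw [← Real.rpow_add hz]; simp
  have e4 : y ^ (-(1 - a)) * y ^ (1 - a) = 1 := by rw [← Real.rpow_add hy]; simp
  calc x ^ (-a) = x ^ (-a) * (z ^ a * z ^ (-a)) * (y ^ (-(1 - a)) * y ^ (1 - a)) := by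
        rw [e3, e4]; ring
    _ = (x ^ (-a) * z ^ a * y ^ (-(1 - a))) * (z ^ (-a) * y ^ (1 - a)) := by ring
    _ ≤ _ := by gcongr

/-- `weight_low` with `a = -s` leaves the weight `(|ξ| + 1)^(-(s+1))`, which is square-integrable
exactly because `s > -1/2`. -/
theorem exists_isKer_mul_low (G : Geometry) {s : ℝ} (hs : s ∈ Ioo (-(1 / 2) : ℝ) 0) :
    ∃ A, IsKer G s (s + 1) s A fun _ _ => convConst G := by
  obtain ⟨c, hc, h⟩ := exists_lintegral_rpow_le G (p := 2 * (s + 1)) (by linarith [hs.1])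
  have h1 := lintegral_weight_sq_le le_rfl (h 1 le_rfl)
  rw [Real.one_rpow, mul_one] at h1
  set C := ‖convConst G‖
  have hC : 0 ≤ C := norm_nonneg _
  refine ⟨2 * C * Real.sqrt c, measurable_const, by positivity,
    fun ξ => 2 * C * (|ξ| + 1) ^ (-(s + 1)), by fun_prop, fun ξ => by positivity, ?_, ?_⟩
  · rw [mul_pow, Real.sq_sqrt hc.le, ENNReal.ofReal_mul (by positivity)]
    calc _ = ∫⁻ ξ, ENNReal.ofReal ((2 * C) ^ 2) * ENNReal.ofReal ((|ξ| + 1) ^ (-(s + 1))) ^ 2 ∂(freq G) := by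
          refine lintegral_congr fun ξ => ?_
          rw [ENNReal.ofReal_mul (by positivity), mul_pow, ENNReal.ofReal_pow (by positivity)]
      _ = ENNReal.ofReal ((2 * C) ^ 2) * ∫⁻ ξ, ENNReal.ofReal ((|ξ| + 1) ^ (-(s + 1))) ^ 2 ∂(freq G) :=
          lintegral_const_mul _ (by fun_prop)
      _ ≤ _ := by gcongr
  · intro ξ η
    have h2 := weight_low (κ := 1) one_pos (a := -s) (by linarith [hs.2]) (by linarith [hs.1]) ξ η
    rw [neg_neg, sub_neg_eq_add, add_comm 1 s] at h2
    have h3 := bracket_rpow_pos (ξ - η) (-(s + 1))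
    calc _ ≤ 2 * ((|ξ| + 1) ^ (-(s + 1)) + (|η| + 1) ^ (-(s + 1))) *
          ((|ξ - η| + 1) ^ s * (|η| + 1) ^ (s + 1)) * C := by gcongr
      _ ≤ 2 * ((|ξ| + 1) ^ (-(s + 1)) + (|η| + 1) ^ (-(s + 1)) + (|ξ - η| + 1) ^ (-(s + 1))) *
          ((|ξ - η| + 1) ^ s * (|η| + 1) ^ (s + 1)) * C := by
          gcongr ?_ * _ * _
          linarith
      _ = _ := by ring

/-- The larger of the two input frequencies carries all of `(|ξ| + 1)^σ`; the weight left over at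
the other one is square-integrable for `σ > 1/2`. -/
theorem exists_isKer_mul_alg (G : Geometry) {σ : ℝ} (hσ : 1 / 2 < σ) :
    ∃ A, IsKer G σ σ σ A fun _ _ => convConst G := by
  obtain ⟨c, hc, h⟩ := exists_lintegral_rpow_le G (p := 2 * σ) (by linarith)
  have h1 := lintegral_weight_sq_le le_rfl (h 1 le_rfl)
  rw [Real.one_rpow, mul_one] at h1
  set C := 2 ^ σ * ‖convConst G‖ with hCdef
  have hC : 0 ≤ C := by positivity
  refine ⟨C * Real.sqrt c, measurable_const, by positivity,
    fun ξ => C * (|ξ| + 1) ^ (-σ), by fun_prop, fun ξ => by positivity, ?_, ?_⟩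
  · rw [mul_pow, Real.sq_sqrt hc.le, ENNReal.ofReal_mul (by positivity)]
    calc _ = ∫⁻ ξ, ENNReal.ofReal (C ^ 2) * ENNReal.ofReal ((|ξ| + 1) ^ (-σ)) ^ 2 ∂(freq G) := by
          refine lintegral_congr fun ξ => ?_
          rw [ENNReal.ofReal_mul (by positivity), mul_pow, ENNReal.ofReal_pow (by positivity)]
      _ = ENNReal.ofReal (C ^ 2) * ∫⁻ ξ, ENNReal.ofReal ((|ξ| + 1) ^ (-σ)) ^ 2 ∂(freq G) :=
          lintegral_const_mul _ (by fun_prop)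
      _ ≤ _ := by gcongr
  · intro ξ η
    have hx := bracket_pos ξ
    set y := |η| + 1
    set z := |ξ - η| + 1
    have hy : 0 < y := by positivity
    have hz : 0 < z := by positivity
    have hσ0 : 0 < σ := by linarith
    have h2 : (|ξ| + 1) ^ σ ≤ 2 ^ σ * (z ^ σ + y ^ σ) := by
      have hm : |ξ| + 1 ≤ 2 * max z y := by
        have := weight_sub_le zero_le_one ξ η
        have h3 := le_max_left z y
        have h4 := le_max_right z y
        simp only [z, y] at *
        linarith
      calc (|ξ| + 1) ^ σ ≤ (2 * max z y) ^ σ := Real.rpow_le_rpow hx.le hm hσ0.le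
        _ = 2 ^ σ * (max z y) ^ σ := Real.mul_rpow (by norm_num) (by positivity)
        _ ≤ _ := by
          gcongr
          rcases max_choice z y with h | h <;> rw [h]
          · linarith [Real.rpow_pos_of_pos hy σ]
          · linarith [Real.rpow_pos_of_pos hz σ]
    have e1 : y ^ (-σ) * y ^ σ = 1 := by rw [← Real.rpow_add hy]; simp
    have e2 : z ^ (-σ) * z ^ σ = 1 := by rw [← Real.rpow_add hz]; simp
    have h5 := bracket_rpow_pos ξ (-σ)
    calc (|ξ| + 1) ^ σ * ‖convConst G‖ ≤ 2 ^ σ * (z ^ σ + y ^ σ) * ‖convConst G‖ := by gcongr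
      _ = C * (z ^ σ * (y ^ (-σ) * y ^ σ) + (z ^ (-σ) * z ^ σ) * y ^ σ) := by
          rw [e1, e2, hCdef]; ring
      _ = (C * y ^ (-σ) + C * z ^ (-σ)) * (z ^ σ * y ^ σ) := by ring
      _ ≤ _ := by
          gcongr
          have : 0 ≤ C * (|ξ| + 1) ^ (-σ) := by positivity
          linarith

/-- The product `H^s × H^{s+1} → H^s` for `-1/2 < s < 0`. -/
def mulLow {s : ℝ} (G : Geometry) (hs : s ∈ Ioo (-(1 / 2) : ℝ) 0) :
    Hs G s →L[ℂ] Hs G (s + 1) →L[ℂ] Hs G s :=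
  bil (exists_isKer_mul_low G hs).choose_spec

/-- The product on the algebra `H^σ`, `σ > 1/2`. -/
def mulAlg {σ : ℝ} (G : Geometry) (hσ : 1 / 2 < σ) : Hs G σ →L[ℂ] Hs G σ →L[ℂ] Hs G σ :=
  bil (exists_isKer_mul_alg G hσ).choose_spec

theorem mulLow_coe {s : ℝ} (hs : s ∈ Ioo (-(1 / 2) : ℝ) 0) (f : Hs G s) (g : Hs G (s + 1)) :
    (mulLow G hs f g : ℝ → ℂ) =ᵐ[freq G] mul G f g := by
  rw [mul_eq_kconv]; exact bil_coe _ f g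

theorem mulAlg_coe (hσ : 1 / 2 < σ) (f g : Hs G σ) :
    (mulAlg G hσ f g : ℝ → ℂ) =ᵐ[freq G] mul G f g := by
  rw [mul_eq_kconv]; exact bil_coe _ f g

/-! ### The bilinear pairing `∫ f g` -/

/-- The bilinear pairing `∫ f g dx`, in terms of Fourier transforms. -/
def dp (G : Geometry) (f g : ℝ → ℂ) : ℂ := ∫ ξ, f (-ξ) * g ξ ∂(freq G)

theorem dp_congr {f f' g g' : ℝ → ℂ} (hf : f =ᵐ[freq G] f') (hg : g =ᵐ[freq G] g') :
    dp G f g = dp G f' g' := by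
  refine integral_congr_ae ?_
  filter_upwards [ae_neg hf, hg] with ξ h1 h2
  rw [h1, h2]

theorem dp_lintegral_sq_le (h : 0 ≤ σ + σ') {f g : ℝ → ℂ} (hf : Measurable f) (hg : Measurable g) :
    (∫⁻ ξ, ‖f (-ξ) * g ξ‖ₑ ∂(freq G)) ^ 2 ≤ sobSq G σ f * sobSq G σ' g := by
  let a : ℝ → ℝ≥0∞ := fun ξ => ENNReal.ofReal ((|ξ| + 1) ^ σ) * ‖f (-ξ)‖ₑ
  let b : ℝ → ℝ≥0∞ := fun ξ => ENNReal.ofReal ((|ξ| + 1) ^ σ') * ‖g ξ‖ₑ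
  have ham : Measurable a := by fun_prop
  have hbm : Measurable b := by fun_prop
  have h1 : ∫⁻ ξ, ‖f (-ξ) * g ξ‖ₑ ∂(freq G) ≤ ∫⁻ ξ, a ξ * b ξ ∂(freq G) := by
    refine lintegral_mono fun ξ => ?_
    have h2 : (1 : ℝ≥0∞) ≤ ENNReal.ofReal ((|ξ| + 1) ^ σ) * ENNReal.ofReal ((|ξ| + 1) ^ σ') := by
      rw [← ENNReal.ofReal_mul (by positivity), ← Real.rpow_add (bracket_pos ξ),
        ENNReal.one_le_ofReal]
      exact Real.one_le_rpow (one_le_bracket ξ) h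
    calc ‖f (-ξ) * g ξ‖ₑ = 1 * (‖f (-ξ)‖ₑ * ‖g ξ‖ₑ) := by rw [enorm_mul, one_mul]
      _ ≤ _ := mul_le_mul_left h2 _
      _ = _ := by simp only [a, b]; ring
  refine (pow_le_pow_left₀ zero_le h1 2).trans ((sq_lintegral_mul_le ham.aemeasurable
    hbm.aemeasurable).trans (le_of_eq ?_))
  congr 1
  rw [← sobSq_conjF hf]
  refine lintegral_congr fun ξ => ?_
  simp [a, conjF]

theorem dp_integrable (h : 0 ≤ σ + σ') (f : Hs G σ) (g : Hs G σ') :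
    Integrable (fun ξ => (f : ℝ → ℂ) (-ξ) * g ξ) (freq G) := by
  have hf := measurable_coe f
  have hg := measurable_coe g
  refine ⟨(by fun_prop : Measurable _).aestronglyMeasurable, ?_⟩
  rw [hasFiniteIntegral_iff_enorm]
  have h1 := (dp_lintegral_sq_le h hf hg).trans_lt (ENNReal.mul_lt_top (sobSq_lt_top f)
    (sobSq_lt_top g))
  by_contra hcon
  rw [not_lt, top_le_iff] at hcon
  rw [hcon] at h1
  simp at h1

theorem dp_norm_le (h : 0 ≤ σ + σ') (f : Hs G σ) (g : Hs G σ') : ‖dp G f g‖ ≤ ‖f‖ * ‖g‖ := by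
  have h1 := dp_lintegral_sq_le (G := G) h (measurable_coe f) (measurable_coe g)
  have h2 : ‖dp G f g‖ₑ ^ 2 ≤ sobSq G σ f * sobSq G σ' g :=
    (pow_le_pow_left₀ zero_le (enorm_integral_le_lintegral_enorm _) 2).trans h1
  rw [← enorm_sq_Hs, ← enorm_sq_Hs, ← ofReal_norm, ← ofReal_norm, ← ofReal_norm,
    ← ENNReal.ofReal_pow (norm_nonneg _), ← ENNReal.ofReal_pow (norm_nonneg _),
    ← ENNReal.ofReal_pow (norm_nonneg _), ← ENNReal.ofReal_mul (by positivity),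
    ENNReal.ofReal_le_ofReal_iff (by positivity), ← mul_pow] at h2
  exact le_of_sq_le_sq h2 (by positivity)

/-- The bilinear pairing `∫ f g dx` on `H^σ × H^σ'`, `σ + σ' ≥ 0`. -/
def dpL (G : Geometry) (h : 0 ≤ σ + σ') : Hs G σ →L[ℂ] Hs G σ' →L[ℂ] ℂ :=
  LinearMap.mkContinuous₂
    (LinearMap.mk₂ ℂ (fun (f : Hs G σ) (g : Hs G σ') => dp G f g)
      (fun f f' g => by
        rw [dp_congr (coe_add_ae f f') (ae_eq_refl (μ := freq G) (g : ℝ → ℂ)), dp, dp, dp,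
          ← integral_add (dp_integrable h f g) (dp_integrable h f' g)]
        congr 1; ext η; ring)
      (fun c f g => by
        rw [dp_congr (coe_smul_ae c f) (ae_eq_refl (μ := freq G) (g : ℝ → ℂ)), dp, dp, smul_eq_mul,
          ← integral_const_mul]
        congr 1; ext η; ring)
      (fun f g g' => by
        rw [dp_congr (ae_eq_refl (μ := freq G) (f : ℝ → ℂ)) (coe_add_ae g g'), dp, dp, dp,
          ← integral_add (dp_integrable h f g) (dp_integrable h f g')]
        congr 1; ext η; ring)
      (fun c f g => by
        rw [dp_congr (ae_eq_refl (μ := freq G) (f : ℝ → ℂ)) (coe_smul_ae c g), dp, dp, smul_eq_mul,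
          ← integral_const_mul]
        congr 1; ext η; ring))
    1 fun f g => (dp_norm_le h f g).trans_eq (by rw [one_mul])

theorem dpL_apply (h : 0 ≤ σ + σ') (f : Hs G σ) (g : Hs G σ') : dpL G h f g = dp G f g := rfl

end

section

variable {G : Geometry} {σ κ : ℝ}

/-! ### The gauge equation as a fixed-point equation -/

/-- The symbol `1_{[0,∞)}(ξ) / (ξ + κ)` for `κ ≥ 1`. -/
def resSym (κ : ℝ) : ℝ → ℂ := indicator (Ici 0) fun ξ => (((|ξ| + max κ 1)⁻¹ : ℝ) : ℂ)

theorem isMult_resSym (σ κ : ℝ) : IsMult σ (σ + 1) 1 (resSym κ) := by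
  refine ⟨Measurable.indicator (by fun_prop) measurableSet_Ici, zero_le_one, fun ξ => ?_⟩
  have h0 : 0 < |ξ| + max κ 1 := by positivity
  have h1 : ‖resSym κ ξ‖ ≤ (|ξ| + max κ 1)⁻¹ := by
    rw [resSym]
    refine (norm_indicator_le_norm_self _ _).trans (le_of_eq ?_)
    rw [Complex.norm_real, Real.norm_of_nonneg (by positivity)]
  have h2 : (|ξ| + max κ 1)⁻¹ ≤ (|ξ| + 1)⁻¹ := by
    gcongr; exact le_max_right _ _
  have hb := bracket_pos ξ
  rw [Real.rpow_add hb, Real.rpow_one, one_mul]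
  calc _ ≤ (|ξ| + 1) ^ σ * (|ξ| + 1) * (|ξ| + 1)⁻¹ := by gcongr; exact h1.trans h2
    _ = _ := by rw [mul_assoc, mul_inv_cancel₀ hb.ne', mul_one]

/-- The resolvent `(-i∂ + κ)⁻¹ C₊ : H^σ → H^{σ+1}`, `κ ≥ 1`. -/
def res (G : Geometry) (σ κ : ℝ) : Hs G σ →L[ℂ] Hs G (σ + 1) := mlt G (isMult_resSym σ κ)

theorem res_coe (f : Hs G σ) : (res G σ κ f : ℝ → ℂ) =ᵐ[freq G] fun ξ => resSym κ ξ * f ξ :=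
  mlt_coe _ f

theorem res_norm_le (f : Hs G σ) : ‖res G σ κ f‖ ≤ ‖f‖ :=
  (mlt_norm_le (isMult_resSym σ κ) f).trans_eq (one_mul _)

theorem resSym_of_neg {ξ : ℝ} (h : ξ < 0) : resSym κ ξ = 0 := by
  rw [resSym, indicator_of_notMem]; simpa using h

theorem resSym_of_nonneg (hκ : 1 ≤ κ) {ξ : ℝ} (h : 0 ≤ ξ) :
    ((ξ : ℂ) + κ) * resSym κ ξ = 1 := by
  rw [resSym, indicator_of_mem (by exact h), max_eq_left hκ, abs_of_nonneg h]
  have : (ξ : ℂ) + κ ≠ 0 := by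
    rw [← Complex.ofReal_add]; exact_mod_cast (by linarith : ξ + κ ≠ 0)
  push_cast
  exact mul_inv_cancel₀ this

variable {s : ℝ}

theorem gauge_eq_of_isGauge {q : Hs G s} (h : HasGauge κ q) {m : Hs G (s + 1)}
    (hm : IsGauge κ q m) : gauge κ q = m := by
  rw [gauge, dif_pos h]
  exact h.unique h.choose_spec.1 hm

variable [hs : Fact (s ∈ Ioo (-(1 / 2) : ℝ) 0)]

theorem half_lt_add_one : 1 / 2 < s + 1 := by linarith [hs.out.1]

/-- The operator `m ↦ (-i∂ + κ)⁻¹ C₊ (q m)` on `H^{s+1}`, as a function of `q`. -/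
def gT (G : Geometry) (s κ : ℝ) [hs : Fact (s ∈ Ioo (-(1 / 2) : ℝ) 0)] :
    Hs G s →L[ℂ] Hs G (s + 1) →L[ℂ] Hs G (s + 1) :=
  (ContinuousLinearMap.compL ℂ (Hs G (s + 1)) (Hs G s) (Hs G (s + 1)) (res G s κ)).comp
    (mulLow G hs.out)

theorem gT_apply (q : Hs G s) (m : Hs G (s + 1)) :
    gT G s κ q m = res G s κ (mulLow G hs.out q m) := rfl

/-- On `ξ ≥ 0` the equation is divided by `ξ + κ > 0`; on `ξ < 0` both formulations say that `m`
vanishes. -/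
theorem isGauge_iff (hκ : 1 ≤ κ) {q : Hs G s} {m : Hs G (s + 1)} :
    IsGauge κ q m ↔ m = res G s κ q + gT G s κ q m := by
  have e : (res G s κ q + gT G s κ q m : Hs G (s + 1)) =ᵐ[freq G]
      fun ξ => resSym κ ξ * (mul G q m ξ + q ξ) := by
    filter_upwards [coe_add_ae (res G s κ q) (gT G s κ q m), res_coe (κ := κ) q,
      res_coe (κ := κ) (mulLow G hs.out q m), mulLow_coe hs.out q m] with ξ h1 h2 h3 h4
    rw [h1, h2, gT_apply, h3, h4]; ring
  constructor
  · rintro ⟨h1, h2⟩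
    refine Hs_ext ?_
    filter_upwards [h1, h2, e] with ξ h1 h2 h3
    rw [h3]
    rcases lt_or_ge ξ 0 with h | h
    · rw [h1 h, resSym_of_neg h, zero_mul]
    · have h4 := resSym_of_nonneg hκ h
      rw [szego, indicator_of_mem (by exact h), dx] at h2
      have h5 : mul G q m ξ + q ξ = ((ξ : ℂ) + κ) * m ξ := by
        linear_combination -h2 - (ξ : ℂ) * m ξ * Complex.I_sq
      rw [h5, ← mul_assoc, mul_comm (resSym κ ξ), h4, one_mul]
  · intro h
    rw [← h] at e
    constructor
    · filter_upwards [e] with ξ h1 h2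
      rw [h1, resSym_of_neg h2, zero_mul]
    · filter_upwards [e] with ξ h1
      rcases lt_or_ge ξ 0 with h | h
      · rw [szego, indicator_of_notMem (by simpa using h), dx, h1, resSym_of_neg h]; ring
      · have h4 := resSym_of_nonneg hκ h
        rw [szego, indicator_of_mem (by exact h), dx, h1]
        linear_combination (mul G q m ξ + q ξ) * h4 -
          (ξ : ℂ) * (resSym κ ξ * (mul G q m ξ + q ξ)) * Complex.I_sq

/-- The operator of the gauge equation is invertible. -/
def Good (κ : ℝ) (q : Hs G s) : Prop := IsUnit (1 - gT G s κ q)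

/-- The inverse of the operator of the gauge equation. -/
def gInv (κ : ℝ) (q : Hs G s) : Hs G (s + 1) →L[ℂ] Hs G (s + 1) :=
  Ring.inverse (1 - gT G s κ q)

/-- The solution of the gauge equation, if the equation is invertible. -/
def mm (κ : ℝ) (q : Hs G s) : Hs G (s + 1) :=
  gInv κ q (res G s κ q)

theorem gInv_eq {q : Hs G s} (h : Good κ q) (x : Hs G (s + 1)) :
    gInv κ q x = x + gT G s κ q (gInv κ q x) := by
  have h1 := Ring.mul_inverse_cancel _ h
  have h2 := congrArg (fun L : Hs G (s + 1) →L[ℂ] Hs G (s + 1) => L x) h1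
  simp only [mul_apply_eq_comp, sub_apply,
    one_apply_eq_self] at h2
  rw [sub_eq_iff_eq_add] at h2
  exact h2

theorem eq_gInv {q : Hs G s} (h : Good κ q) {x y : Hs G (s + 1)} (hy : y = x + gT G s κ q y) :
    y = gInv κ q x := by
  have h1 := Ring.inverse_mul_cancel _ h
  have h2 := congrArg (fun L : Hs G (s + 1) →L[ℂ] Hs G (s + 1) => L y) h1
  simp only [mul_apply_eq_comp, sub_apply,
    one_apply_eq_self] at h2
  have h3 : y - gT G s κ q y = x := by rw [sub_eq_iff_eq_add]; exact hy
  rw [h3] at h2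
  exact h2.symm

theorem mm_eq {q : Hs G s} (h : Good κ q) :
    mm κ q = res G s κ q + gT G s κ q (mm κ q) := gInv_eq h _

theorem Good.hasGauge {q : Hs G s} (h : Good κ q) (hκ : 1 ≤ κ) : HasGauge κ q :=
  ⟨mm κ q, (isGauge_iff hκ).2 (mm_eq h), fun _ hm => eq_gInv h ((isGauge_iff hκ).1 hm)⟩

theorem Good.gauge_eq {q : Hs G s} (h : Good κ q) (hκ : 1 ≤ κ) : gauge κ q = mm κ q :=
  gauge_eq_of_isGauge (h.hasGauge hκ) ((isGauge_iff hκ).2 (mm_eq h))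

/-! ### The contraction estimate, in `κ`-dependent norms -/

theorem isMult_weight_neg {p : ℝ} (hp : p ≤ 0) (hκ : 1 ≤ κ) :
    IsMult p 0 1 fun ξ => (((|ξ| + κ) ^ p : ℝ) : ℂ) :=
  ⟨by fun_prop, zero_le_one, fun ξ => by
    rw [Real.rpow_zero, one_mul, one_mul, Complex.norm_real, Real.norm_of_nonneg (by positivity)]
    exact Real.rpow_le_rpow_of_nonpos (bracket_pos ξ) (by linarith) hp⟩

theorem isMult_weight_pos {p : ℝ} (hp : 0 ≤ p) (hκ : 1 ≤ κ) :
    IsMult p 0 (κ ^ p) fun ξ => (((|ξ| + κ) ^ p : ℝ) : ℂ) :=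
  ⟨by fun_prop, by positivity, fun ξ => by
    rw [Real.rpow_zero, one_mul, Complex.norm_real, Real.norm_of_nonneg (by positivity),
      ← Real.mul_rpow (by positivity) (by positivity)]
    exact Real.rpow_le_rpow (by positivity) (by nlinarith [abs_nonneg ξ]) hp⟩

theorem isMult_weight_inv {p : ℝ} (hp : 0 ≤ p) (hκ : 1 ≤ κ) :
    IsMult 0 p 1 fun ξ => (((|ξ| + κ) ^ (-p) : ℝ) : ℂ) :=
  ⟨by fun_prop, zero_le_one, fun ξ => by
    rw [Real.rpow_zero, one_mul, Complex.norm_real, Real.norm_of_nonneg (by positivity)]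
    have h1 : (|ξ| + 1) ^ p ≤ (|ξ| + κ) ^ p := Real.rpow_le_rpow (by positivity) (by linarith) hp
    have h2 : 0 < |ξ| + κ := by positivity
    calc _ ≤ (|ξ| + κ) ^ p * (|ξ| + κ) ^ (-p) := by gcongr
      _ = 1 := by rw [← Real.rpow_add h2]; simp⟩

/-- The kernel of the gauge operator in `κ`-weighted coordinates. -/
def gKer (G : Geometry) (s κ : ℝ) : ℝ → ℝ → ℂ := fun ξ η =>
  indicator (Ici (0 : ℝ)) (fun _ => convConst G) ξ *
    (((|ξ| + κ) ^ s * (|ξ - η| + κ) ^ (-s) * (|η| + κ) ^ (-(s + 1)) : ℝ) : ℂ)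

/-- The source of the exponent in the threshold. The weight inequality is homogeneous in `|ξ| + κ`,
and `∫ (|ξ| + κ)^(-2(s+1)) dξ` is of size `κ^(-(1+2s))`, whose square root is the gain
`κ^(-(1/2+s))`. -/
theorem exists_isKer_gKer (G : Geometry) {s : ℝ} (hs : s ∈ Ioo (-(1 / 2) : ℝ) 0) :
    ∃ A : ℝ, 0 < A ∧ ∀ κ : ℝ, 1 ≤ κ → IsKer G 0 0 0 (A * κ ^ (-(1 / 2 + s))) (gKer G s κ) := by
  obtain ⟨c, hc, h⟩ := exists_lintegral_rpow_le G (p := 2 * (s + 1)) (by linarith [hs.1])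
  set C := ‖convConst G‖ + 1
  have hC : 0 < C := by positivity
  refine ⟨2 * C * Real.sqrt c, by positivity, fun κ hκ => ⟨?_, by positivity,
    fun ξ => 2 * C * (|ξ| + κ) ^ (-(s + 1)), by fun_prop, fun ξ => by positivity, ?_, ?_⟩⟩
  · have h1 : Measurable fun p : ℝ × ℝ => indicator (Ici (0 : ℝ)) (fun _ => convConst G) p.1 :=
      (measurable_const.indicator measurableSet_Ici).comp measurable_fst
    exact h1.mul (by fun_prop)
  · have h1 := lintegral_weight_sq_le hκ (h κ hκ)
    have e : (2 * C * Real.sqrt c * κ ^ (-(1 / 2 + s))) ^ 2 =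
        (2 * C) ^ 2 * (c * κ ^ (1 - 2 * (s + 1))) := by
      rw [mul_pow, mul_pow _ (Real.sqrt c), Real.sq_sqrt hc.le, ← Real.rpow_natCast (κ ^ _),
        ← Real.rpow_mul (by linarith)]
      rw [mul_assoc]; congr 3; push_cast; ring
    rw [e, ENNReal.ofReal_mul (by positivity)]
    calc _ = ∫⁻ ξ, ENNReal.ofReal ((2 * C) ^ 2) * ENNReal.ofReal ((|ξ| + κ) ^ (-(s + 1))) ^ 2 ∂(freq G) := by
          refine lintegral_congr fun ξ => ?_
          rw [ENNReal.ofReal_mul (by positivity), mul_pow, ENNReal.ofReal_pow (by positivity)]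
      _ = ENNReal.ofReal ((2 * C) ^ 2) * ∫⁻ ξ, ENNReal.ofReal ((|ξ| + κ) ^ (-(s + 1))) ^ 2 ∂(freq G) :=
          lintegral_const_mul _ (by fun_prop)
      _ ≤ _ := by gcongr
  · intro ξ η
    have hκ0 : 0 < κ := by linarith
    have h2 := weight_low hκ0 (a := -s) (by linarith [hs.2]) (by linarith [hs.1]) ξ η
    rw [neg_neg, sub_neg_eq_add, add_comm 1 s] at h2
    have hx : 0 < |ξ| + κ := by positivity
    have hy : 0 < |η| + κ := by positivity
    have hz : 0 < |ξ - η| + κ := by positivity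
    have e1 : (|ξ - η| + κ) ^ s * (|ξ - η| + κ) ^ (-s) = 1 := by rw [← Real.rpow_add hz]; simp
    have e2 : (|η| + κ) ^ (s + 1) * (|η| + κ) ^ (-(s + 1)) = 1 := by rw [← Real.rpow_add hy]; simp
    have h3 : ‖gKer G s κ ξ η‖ ≤
        C * ((|ξ| + κ) ^ s * (|ξ - η| + κ) ^ (-s) * (|η| + κ) ^ (-(s + 1))) := by
      rw [gKer, norm_mul, Complex.norm_real, Real.norm_of_nonneg (by positivity)]
      gcongr
      refine (norm_indicator_le_norm_self _ _).trans ?_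
      simp [C]
    simp only [Real.rpow_zero, one_mul, mul_one]
    refine h3.trans ?_
    calc _ ≤ C * ((2 * ((|ξ| + κ) ^ (-(s + 1)) + (|η| + κ) ^ (-(s + 1))) *
          ((|ξ - η| + κ) ^ s * (|η| + κ) ^ (s + 1))) *
            (|ξ - η| + κ) ^ (-s) * (|η| + κ) ^ (-(s + 1))) := by gcongr
      _ = C * (2 * ((|ξ| + κ) ^ (-(s + 1)) + (|η| + κ) ^ (-(s + 1)))) *
          (((|ξ - η| + κ) ^ s * (|ξ - η| + κ) ^ (-s)) *
            ((|η| + κ) ^ (s + 1) * (|η| + κ) ^ (-(s + 1)))) := by ring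
      _ ≤ _ := by
        rw [e1, e2]
        have : 0 ≤ 2 * C * (|ξ - η| + κ) ^ (-(s + 1)) := by positivity
        linarith

/-- The constant in the contraction estimate. -/
def gConst (G : Geometry) (s : ℝ) [hs : Fact (s ∈ Ioo (-(1 / 2) : ℝ) 0)] : ℝ :=
  (exists_isKer_gKer G hs.out).choose

theorem gConst_pos (G : Geometry) (s : ℝ) [Fact (s ∈ Ioo (-(1 / 2) : ℝ) 0)] : 0 < gConst G s :=
  (exists_isKer_gKer G Fact.out).choose_spec.1

theorem isKer_gKer (hκ : 1 ≤ κ) :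
    IsKer G 0 0 0 (gConst G s * κ ^ (-(1 / 2 + s))) (gKer G s κ) :=
  (exists_isKer_gKer G hs.out).choose_spec.2 κ hκ

/-- The function `(|ξ| + κ)^s q̂`. -/
def wq (hκ : 1 ≤ κ) : Hs G s →L[ℂ] Hs G 0 := mlt G (isMult_weight_neg hs.out.2.le hκ)

theorem s_add_one_nonneg : 0 ≤ s + 1 := by linarith [hs.out.1]

/-- The function `(|ξ| + κ)^{s+1} m̂`. -/
def wm (hκ : 1 ≤ κ) : Hs G (s + 1) →L[ℂ] Hs G 0 := mlt G (isMult_weight_pos s_add_one_nonneg hκ)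

/-- The inverse of `wm`. -/
def wmInv (hκ : 1 ≤ κ) : Hs G 0 →L[ℂ] Hs G (s + 1) :=
  mlt G (isMult_weight_inv s_add_one_nonneg hκ)

theorem wq_coe (hκ : 1 ≤ κ) (q : Hs G s) :
    (wq hκ q : ℝ → ℂ) =ᵐ[freq G] fun ξ => (((|ξ| + κ) ^ s : ℝ) : ℂ) * q ξ := mlt_coe _ q

theorem wm_coe (hκ : 1 ≤ κ) (m : Hs G (s + 1)) :
    (wm hκ m : ℝ → ℂ) =ᵐ[freq G] fun ξ => (((|ξ| + κ) ^ (s + 1) : ℝ) : ℂ) * m ξ := mlt_coe _ m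

theorem wq_norm_le (hκ : 1 ≤ κ) (q : Hs G s) : ‖wq hκ q‖ ≤ ‖q‖ :=
  (mlt_norm_le (isMult_weight_neg hs.out.2.le hκ) q).trans_eq (one_mul _)

theorem wm_norm_le (hκ : 1 ≤ κ) (m : Hs G (s + 1)) : ‖wm hκ m‖ ≤ κ ^ (s + 1) * ‖m‖ :=
  mlt_norm_le (isMult_weight_pos s_add_one_nonneg hκ) m

theorem wmInv_norm_le (hκ : 1 ≤ κ) (m : Hs G 0) : ‖(wmInv hκ m : Hs G (s + 1))‖ ≤ ‖m‖ :=
  (mlt_norm_le (isMult_weight_inv s_add_one_nonneg hκ) m).trans_eq (one_mul _)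

theorem wmInv_wm (hκ : 1 ≤ κ) (m : Hs G (s + 1)) : wmInv hκ (wm hκ m) = m := by
  refine Hs_ext ?_
  filter_upwards [mlt_coe (isMult_weight_inv (s_add_one_nonneg (s := s)) hκ) (wm hκ m), wm_coe hκ m]
    with ξ h1 h2
  have hx : 0 < |ξ| + κ := by positivity
  rw [wmInv, h1, h2, ← mul_assoc, ← Complex.ofReal_mul, ← Real.rpow_add hx]
  simp

theorem wm_wmInv (hκ : 1 ≤ κ) (m : Hs G 0) : wm hκ (wmInv hκ m : Hs G (s + 1)) = m := by
  refine Hs_ext ?_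
  filter_upwards [mlt_coe (isMult_weight_inv (s_add_one_nonneg (s := s)) hκ) m,
    wm_coe hκ (wmInv hκ m : Hs G (s + 1))] with ξ h1 h2
  have hx : 0 < |ξ| + κ := by positivity
  rw [h2, wmInv, h1, ← mul_assoc, ← Complex.ofReal_mul, ← Real.rpow_add hx]
  simp

theorem norm_le_wm (hκ : 1 ≤ κ) (m : Hs G (s + 1)) : ‖m‖ ≤ ‖wm hκ m‖ := by
  conv_lhs => rw [← wmInv_wm hκ m]
  exact wmInv_norm_le hκ _

/-- Conjugation by the `κ`-weights turns the gauge operator into a bilinear operator on unweighted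
`L²`, where its small norm is visible. -/
theorem wm_gT (hκ : 1 ≤ κ) (q : Hs G s) (m : Hs G (s + 1)) :
    wm hκ (gT G s κ q m) = bil (isKer_gKer (s := s) hκ) (wq hκ q) (wm hκ m) := by
  refine Hs_ext ?_
  filter_upwards [wm_coe hκ (gT G s κ q m), res_coe (κ := κ) (mulLow G hs.out q m),
    mulLow_coe hs.out q m, bil_coe (isKer_gKer (s := s) hκ) (wq hκ q) (wm hκ m),
    kconv_congr (k := gKer G s κ) (wq_coe hκ q) (wm_coe hκ m)] with ξ h1 h2 h3 h4 h5
  rw [h1, gT_apply, h2, h3, h4, h5, kconv, mul, ← integral_const_mul, ← integral_const_mul,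
    ← integral_const_mul]
  congr 1; ext η
  have hx : 0 < |ξ| + κ := by positivity
  have hy : 0 < |η| + κ := by positivity
  have hz : 0 < |ξ - η| + κ := by positivity
  rw [gKer]
  rcases lt_or_ge ξ 0 with h | h
  · rw [resSym_of_neg h, indicator_of_notMem (by simpa using h)]; ring
  · rw [resSym, indicator_of_mem (by exact h), indicator_of_mem (by exact h), max_eq_left hκ,
      Real.rpow_add hx, Real.rpow_one, Real.rpow_neg hy.le, Real.rpow_neg hz.le]
    have e1 : (((|ξ| + κ : ℝ)) : ℂ) ≠ 0 := by exact_mod_cast hx.ne'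
    have e2 : (((|η| + κ) ^ (s + 1) : ℝ) : ℂ) ≠ 0 := by
      exact_mod_cast (Real.rpow_pos_of_pos hy _).ne'
    have e3 : (((|ξ - η| + κ) ^ s : ℝ) : ℂ) ≠ 0 := by
      exact_mod_cast (Real.rpow_pos_of_pos hz _).ne'
    push_cast at e1 ⊢
    field_simp

/-- The gauge operator is a contraction in `κ`-weighted norms. -/
def Small (κ : ℝ) (hκ : 1 ≤ κ) (q : Hs G s) : Prop :=
  3 * (gConst G s * κ ^ (-(1 / 2 + s))) * ‖wq hκ q‖ ≤ 1 / 2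

theorem wm_gT_norm_le (hκ : 1 ≤ κ) (q : Hs G s) (m : Hs G (s + 1)) :
    ‖wm hκ (gT G s κ q m)‖ ≤ 3 * (gConst G s * κ ^ (-(1 / 2 + s))) * ‖wq hκ q‖ * ‖wm hκ m‖ := by
  rw [wm_gT]; exact bil_norm_le _ _ _

/-- Neumann series for the conjugated operator `V`, of norm at most `1/2`; conjugating back gives
the inverse on `H^{s+1}`. -/
theorem Small.good {hκ : 1 ≤ κ} {q : Hs G s} (h : Small κ hκ q) : Good κ q := by
  set V : Hs G 0 →L[ℂ] Hs G 0 := bil (isKer_gKer (s := s) hκ) (wq hκ q)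
  have hV : ‖V‖ < 1 := by
    refine lt_of_le_of_lt (ContinuousLinearMap.opNorm_le_bound _ (by norm_num) fun x => ?_)
      (by norm_num : (1 / 2 : ℝ) < 1)
    refine (bil_norm_le (isKer_gKer (s := s) hκ) (wq hκ q) x).trans ?_
    gcongr
    exact h
  have hu : IsUnit (1 - V) := isUnit_one_sub_of_norm_lt_one hV
  have hT : ∀ m, gT G s κ q m = wmInv hκ (V (wm hκ m)) := fun m => by
    rw [← wm_gT, wmInv_wm]
  obtain ⟨U, hU⟩ := hu
  have h1 : ∀ x, (U⁻¹ : (Hs G 0 →L[ℂ] Hs G 0)ˣ).1 x - V ((U⁻¹ : (Hs G 0 →L[ℂ] Hs G 0)ˣ).1 x) = x :=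
    fun x => by
      have := congrArg (fun L : Hs G 0 →L[ℂ] Hs G 0 => L x) U.mul_inv
      rw [hU] at this
      simpa using this
  have h2 : ∀ x, (U⁻¹ : (Hs G 0 →L[ℂ] Hs G 0)ˣ).1 (x - V x) = x := fun x => by
    have := congrArg (fun L : Hs G 0 →L[ℂ] Hs G 0 => L x) U.inv_mul
    rw [hU] at this
    simpa using this
  refine isUnit_iff_exists.2 ⟨(wmInv hκ).comp ((U⁻¹ : (Hs G 0 →L[ℂ] Hs G 0)ˣ).1.comp (wm hκ)), ?_, ?_⟩
  · ext1 x
    simp only [mul_apply_eq_comp, sub_apply,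
      one_apply_eq_self, ContinuousLinearMap.comp_apply, hT, wm_wmInv]
    rw [← map_sub, h1, wmInv_wm]
  · ext1 x
    simp only [mul_apply_eq_comp, sub_apply,
      one_apply_eq_self, ContinuousLinearMap.comp_apply, hT, map_sub, wm_wmInv]
    rw [← map_sub, ← map_sub, h2, wmInv_wm]

/-- In `y = x + T y` the term `T y` has at most half the weighted norm of `y` and is absorbed. -/
theorem Small.wm_gInv_le {hκ : 1 ≤ κ} {q : Hs G s} (h : Small κ hκ q) (x : Hs G (s + 1)) :
    ‖wm hκ (gInv κ q x)‖ ≤ 2 * ‖wm hκ x‖ := by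
  have h1 := gInv_eq h.good x
  have h2 : ‖wm hκ (gInv κ q x)‖ ≤ ‖wm hκ x‖ + 1 / 2 * ‖wm hκ (gInv κ q x)‖ := by
    conv_lhs => rw [h1, map_add]
    refine (norm_add_le _ _).trans ?_
    gcongr
    refine (wm_gT_norm_le hκ q _).trans ?_
    gcongr
    exact h
  linarith

theorem Small.gInv_le {hκ : 1 ≤ κ} {q : Hs G s} (h : Small κ hκ q) (x : Hs G (s + 1)) :
    ‖gInv κ q x‖ ≤ 2 * κ ^ (s + 1) * ‖x‖ := by
  refine (norm_le_wm hκ _).trans ((h.wm_gInv_le x).trans ?_)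
  rw [mul_assoc]
  gcongr
  exact wm_norm_le hκ x

theorem small_of_norm_le (hκ : 1 ≤ κ) {r : ℝ}
    (hr : 3 * (gConst G s * κ ^ (-(1 / 2 + s))) * r ≤ 1 / 2) {q : Hs G s} (hq : ‖q‖ ≤ r) :
    Small κ hκ q := by
  refine le_trans ?_ hr
  have := (gConst_pos G s).le
  have h2 : 0 ≤ κ ^ (-(1 / 2 + s)) := by positivity
  gcongr
  exact (wq_norm_le hκ q).trans hq

theorem good_of_norm_le (hκ : 1 ≤ κ) {r : ℝ}
    (hr : 3 * (gConst G s * κ ^ (-(1 / 2 + s))) * r ≤ 1 / 2) {q : Hs G s} (hq : ‖q‖ ≤ r) :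
    Good κ q := (small_of_norm_le hκ hr hq).good

/-! ### Translations -/

theorem mul_tr (h : ℝ) (f g : ℝ → ℂ) (ξ : ℝ) :
    mul G (fun ξ => Complex.exp (Complex.I * (ξ : ℂ) * (h : ℂ)) * f ξ)
      (fun ξ => Complex.exp (Complex.I * (ξ : ℂ) * (h : ℂ)) * g ξ) ξ =
      Complex.exp (Complex.I * (ξ : ℂ) * (h : ℂ)) * mul G f g ξ := by
  simp only [mul]
  rw [mul_left_comm, ← integral_const_mul (Complex.exp _)]
  congr 2
  refine funext fun η => ?_
  have : Complex.exp (Complex.I * (ξ : ℂ) * (h : ℂ)) =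
      Complex.exp (Complex.I * ((ξ - η : ℝ) : ℂ) * (h : ℂ)) *
        Complex.exp (Complex.I * (η : ℂ) * (h : ℂ)) := by
    rw [← Complex.exp_add]; push_cast; ring_nf
  rw [this]; ring

theorem mulLow_tr (h : ℝ) (f : Hs G s) (g : Hs G (s + 1)) :
    mulLow G hs.out (tr G s h f) (tr G (s + 1) h g) = tr G s h (mulLow G hs.out f g) := by
  refine Hs_ext ?_
  filter_upwards [mulLow_coe hs.out (tr G s h f) (tr G (s + 1) h g),
    tr_coe h (mulLow G hs.out f g), mulLow_coe hs.out f g, mul_congr (tr_coe h f) (tr_coe h g)]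
    with ξ h1 h2 h3 h4
  rw [h1, h2, h3, h4, mul_tr]

theorem mulAlg_tr (hσ : 1 / 2 < σ) (h : ℝ) (f g : Hs G σ) :
    mulAlg G hσ (tr G σ h f) (tr G σ h g) = tr G σ h (mulAlg G hσ f g) := by
  refine Hs_ext ?_
  filter_upwards [mulAlg_coe hσ (tr G σ h f) (tr G σ h g),
    tr_coe h (mulAlg G hσ f g), mulAlg_coe hσ f g, mul_congr (tr_coe h f) (tr_coe h g)]
    with ξ h1 h2 h3 h4
  rw [h1, h2, h3, h4, mul_tr]

theorem mlt_tr {σ σ' c : ℝ} {φ : ℝ → ℂ} (hφ : IsMult σ σ' c φ) (h : ℝ) (f : Hs G σ) :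
    mlt G hφ (tr G σ h f) = tr G σ' h (mlt G hφ f) := by
  refine Hs_ext ?_
  filter_upwards [mlt_coe hφ (tr G σ h f), tr_coe h f, tr_coe h (mlt G hφ f), mlt_coe hφ f]
    with ξ h1 h2 h3 h4
  rw [h1, h2, h3, h4]; ring

theorem conjL_tr (h : ℝ) (f : Hs G σ) : conjL G σ (tr G σ h f) = tr G σ h (conjL G σ f) := by
  refine Hs_ext ?_
  filter_upwards [conjL_coe (tr G σ h f), ae_neg (tr_coe h f), tr_coe h (conjL G σ f),
    conjL_coe f] with ξ h1 h2 h3 h4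
  rw [h1, h3, h4, conjF, h2, conjF, map_mul, ← Complex.exp_conj]
  simp

/-- The translate of the solution solves the translated equation, and the solution is unique. -/
theorem mm_tr (h : ℝ) {q : Hs G s} (hq : Good κ q) (hq2 : Good κ (tr G s h q)) :
    mm κ (tr G s h q) = tr G (s + 1) h (mm κ q) := by
  symm
  refine eq_gInv hq2 ?_
  conv_lhs => rw [mm_eq hq]
  rw [map_add, gT_apply, gT_apply, mulLow_tr, res, mlt_tr, mlt_tr]

/-! ### Dependence of the gauge on `q` -/

/-- Subtraction of the two fixed-point equations gives an equation for the difference with the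
operator of `x`. -/
theorem mm_sub {x y : Hs G s} (hx : Good κ x) (hy : Good κ y) :
    mm κ x - mm κ y = gInv κ x (res G s κ (x - y) + gT G s κ (x - y) (mm κ y)) := by
  refine eq_gInv hx ?_
  conv_lhs => rw [mm_eq hx, mm_eq hy]
  simp only [map_sub, sub_apply]
  abel

/-- The derivative of `q ↦ m(κ; q)`. -/
def Dmm (κ : ℝ) (y : Hs G s) : Hs G s →L[ℂ] Hs G (s + 1) :=
  (gInv κ y).comp (res G s κ + (gT G s κ).flip (mm κ y))

theorem Dmm_apply (y f : Hs G s) :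
    Dmm κ y f = gInv κ y (res G s κ f + gT G s κ f (mm κ y)) := rfl

/-- An exact formula for the Taylor remainder, visibly of second order in `x - y`. All
differentiability used later comes from such explicit remainders. -/
theorem mm_taylor {x y : Hs G s} (hx : Good κ x) (hy : Good κ y) :
    mm κ x - mm κ y - Dmm κ y (x - y) = gInv κ x (gT G s κ (x - y) (Dmm κ y (x - y))) := by
  refine eq_gInv hx ?_
  have h1 := gInv_eq hx (res G s κ (x - y) + gT G s κ (x - y) (mm κ y))
  have h2 := gInv_eq hy (res G s κ (x - y) + gT G s κ (x - y) (mm κ y))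
  rw [← mm_sub hx hy] at h1
  rw [← Dmm_apply] at h2
  set d := Dmm κ y (x - y)
  conv_lhs => rw [h1, h2]
  simp only [map_sub, sub_apply]
  abel

/-- The constant `κ` and radius `r` are such that the gauge exists on the ball of radius `r`. -/
structure Adm (G : Geometry) (s κ r : ℝ) [Fact (s ∈ Ioo (-(1 / 2) : ℝ) 0)] : Prop where
  one_le : 1 ≤ κ
  nonneg : 0 ≤ r
  small : 3 * (gConst G s * κ ^ (-(1 / 2 + s))) * r ≤ 1 / 2

theorem Adm.good {r : ℝ} (h : Adm G s κ r) {q : Hs G s} (hq : ‖q‖ ≤ r) : Good κ q :=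
  good_of_norm_le h.one_le h.small hq

theorem Adm.gInv_le {r : ℝ} (h : Adm G s κ r) {q : Hs G s} (hq : ‖q‖ ≤ r) (x : Hs G (s + 1)) :
    ‖gInv κ q x‖ ≤ 2 * κ ^ (s + 1) * ‖x‖ :=
  (small_of_norm_le h.one_le h.small hq).gInv_le x

theorem Adm.mono {r κ' : ℝ} (h : Adm G s κ r) (hκ : κ ≤ κ') : Adm G s κ' r := by
  refine ⟨h.one_le.trans hκ, h.nonneg, le_trans ?_ h.small⟩
  have := (gConst_pos G s).le
  have h0 := h.nonneg
  gcongr 3 * (_ * ?_) * _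
  exact Real.rpow_le_rpow_of_nonpos (by linarith [h.one_le]) hκ (by linarith [hs.out.1])

theorem exists_mm_bounds {r : ℝ} (h : Adm G s κ r) : ∃ K : ℝ, 0 ≤ K ∧
    (∀ x : Hs G s, ‖x‖ ≤ r → ‖mm κ x‖ ≤ K) ∧
    (∀ x y : Hs G s, ‖x‖ ≤ r → ‖y‖ ≤ r → ‖mm κ x - mm κ y‖ ≤ K * ‖x - y‖) ∧
    (∀ y f : Hs G s, ‖y‖ ≤ r → ‖Dmm κ y f‖ ≤ K * ‖f‖) ∧
    (∀ x y : Hs G s, ‖x‖ ≤ r → ‖y‖ ≤ r →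
      ‖mm κ x - mm κ y - Dmm κ y (x - y)‖ ≤ K * ‖x - y‖ ^ 2) := by
  set N := 2 * κ ^ (s + 1)
  have hκ0 : 0 < κ := by linarith [h.one_le]
  have hN : 0 ≤ N := by positivity
  set t := ‖gT G s κ‖
  have ht : 0 ≤ t := norm_nonneg (gT G s κ)
  have hr := h.nonneg
  have hT : ∀ (f : Hs G s) (m : Hs G (s + 1)), ‖gT G s κ f m‖ ≤ t * ‖f‖ * ‖m‖ :=
    fun f m => (gT G s κ).le_opNorm₂ f m
  have b1 : ∀ x : Hs G s, ‖x‖ ≤ r → ‖mm κ x‖ ≤ N * r := fun x hx => by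
    refine (h.gInv_le hx _).trans ?_
    gcongr
    exact (res_norm_le x).trans hx
  have b0 : ∀ y f : Hs G s, ‖y‖ ≤ r →
      ‖res G s κ f + gT G s κ f (mm κ y)‖ ≤ (1 + t * (N * r)) * ‖f‖ := fun y f hy => by
    refine (norm_add_le _ _).trans ?_
    have h1 := res_norm_le (κ := κ) f
    have h2 := hT f (mm κ y)
    have h3 : t * ‖f‖ * ‖mm κ y‖ ≤ t * ‖f‖ * (N * r) := by gcongr; exact b1 y hy
    linarith
  set M := N * (1 + t * (N * r)) with hM
  have hM0 : 0 ≤ M := by positivity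
  have b2 : ∀ x y f : Hs G s, ‖x‖ ≤ r → ‖y‖ ≤ r →
      ‖gInv κ x (res G s κ f + gT G s κ f (mm κ y))‖ ≤ M * ‖f‖ := fun x y f hx hy => by
    exact (h.gInv_le hx _).trans
      ((mul_le_mul_of_nonneg_left (b0 y f hy) hN).trans_eq (by rw [hM]; ring))
  refine ⟨N * r + M + N * t * M, by positivity, fun x hx => ?_, fun x y hx hy => ?_,
    fun y f hy => ?_, fun x y hx hy => ?_⟩
  · refine (b1 x hx).trans ?_
    have : 0 ≤ M + N * t * M := by positivity
    linarith
  · rw [mm_sub (h.good hx) (h.good hy)]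
    refine (b2 x y _ hx hy).trans ?_
    gcongr
    have : 0 ≤ N * r + N * t * M := by positivity
    linarith
  · refine (b2 y y _ hy hy).trans ?_
    gcongr
    have : 0 ≤ N * r + N * t * M := by positivity
    linarith
  · rw [mm_taylor (h.good hx) (h.good hy)]
    refine (h.gInv_le hx _).trans ?_
    calc N * ‖gT G s κ (x - y) (Dmm κ y (x - y))‖ ≤ N * (t * ‖x - y‖ * (M * ‖x - y‖)) := by
          gcongr
          refine (hT _ _).trans ?_
          gcongr
          exact b2 y y _ hy hy
      _ = N * t * M * ‖x - y‖ ^ 2 := by ring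
      _ ≤ _ := by
        gcongr
        have : 0 ≤ N * r + M := by positivity
        linarith

end

section

variable {G : Geometry} {σ κ s : ℝ}

theorem pairing_eq_dp {q : Hs G s} (hq : IsReal q) (f : ℝ → ℂ) : pairing G q f = dp G q f := by
  refine integral_congr_ae ?_
  filter_upwards [hq] with ξ h
  rw [h]

variable [hs : Fact (s ∈ Ioo (-(1 / 2) : ℝ) 0)]

theorem zero_le_dual : 0 ≤ s + (s + 1) := by linarith [hs.out.1]

theorem beta_eq {q : Hs G s} (hr : IsReal q) (h : Good κ q) (hκ : 1 ≤ κ) :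
    beta κ q = dp G q (mm κ q) := by
  rw [beta, h.gauge_eq hκ, pairing_eq_dp hr]

/-! ### Analyticity of `β` in the spectral parameter -/

/-- The resolvent is kept at the fixed `κ` and the difference `(ϰ - κ) m` is treated as a source.
The number `ϰ` is arbitrary, so the dependence on the spectral parameter becomes affine. -/
theorem isGauge_iff_shift (hκ : 1 ≤ κ) (ϰ : ℝ) {q : Hs G s} {m : Hs G (s + 1)} :
    IsGauge ϰ q m ↔ m = res G s κ q + gT G s κ q m -
      ((ϰ - κ : ℝ) : ℂ) • res G s κ (emb G (by linarith) m) := by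
  have hle : s ≤ s + 1 := by linarith
  have e : (res G s κ q + gT G s κ q m - ((ϰ - κ : ℝ) : ℂ) • res G s κ (emb G hle m) :
      Hs G (s + 1)) =ᵐ[freq G]
      fun ξ => resSym κ ξ * (mul G q m ξ + q ξ - (ϰ - κ) * m ξ) := by
    filter_upwards [coe_sub_ae (res G s κ q + gT G s κ q m)
        (((ϰ - κ : ℝ) : ℂ) • res G s κ (emb G hle m)),
      coe_add_ae (res G s κ q) (gT G s κ q m), res_coe (κ := κ) q,
      coe_smul_ae ((ϰ - κ : ℝ) : ℂ) (res G s κ (emb G hle m)), res_coe (κ := κ) (emb G hle m),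
      emb_coe hle m,
      res_coe (κ := κ) (mulLow G hs.out q m), mulLow_coe hs.out q m]
      with ξ h0 h1 h2 h5 h6 h7 h3 h4
    rw [h0, h1, h2, gT_apply, h3, h4, h5, h6, h7]; push_cast; ring
  constructor
  · rintro ⟨h1, h2⟩
    refine Hs_ext ?_
    filter_upwards [h1, h2, e] with ξ h1 h2 h3
    rw [h3]
    rcases lt_or_ge ξ 0 with h | h
    · rw [h1 h, resSym_of_neg h, zero_mul]
    · have h4 := resSym_of_nonneg hκ h
      rw [szego, indicator_of_mem (by exact h), dx] at h2
      have h5 : mul G q m ξ + q ξ - (ϰ - κ) * m ξ = ((ξ : ℂ) + κ) * m ξ := by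
        linear_combination -h2 - (ξ : ℂ) * m ξ * Complex.I_sq
      rw [h5, ← mul_assoc, mul_comm (resSym κ ξ), h4, one_mul]
  · intro h
    rw [← h] at e
    constructor
    · filter_upwards [e] with ξ h1 h2
      rw [h1, resSym_of_neg h2, zero_mul]
    · filter_upwards [e] with ξ h1
      rcases lt_or_ge ξ 0 with h | h
      · rw [szego, indicator_of_notMem (by simpa using h), dx, h1, resSym_of_neg h]; ring
      · have h4 := resSym_of_nonneg hκ h
        rw [szego, indicator_of_mem (by exact h), dx]
        have h5 : ((ξ : ℂ) + κ) * m ξ = mul G q m ξ + q ξ - (ϰ - κ) * m ξ := by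
          conv_lhs => rw [h1]
          rw [← mul_assoc, h4, one_mul]
        linear_combination h5 - (ξ : ℂ) * m ξ * Complex.I_sq

/-- With `S` the inverse gauge operator composed with the resolvent, `m(ϰ) = (1 + (ϰ - κ) S)⁻¹
m(κ)`, and inversion is analytic near the identity. Analyticity lets equality of `β` for large
parameters spread to smaller ones. -/
theorem analyticAt_beta {q : Hs G s} (hr : IsReal q) (h : Good κ q) (hκ : 1 ≤ κ) :
    AnalyticAt ℝ (fun ϰ => beta ϰ q) κ := by
  have hle : s ≤ s + 1 := by linarith
  set S : Hs G (s + 1) →L[ℂ] Hs G (s + 1) := (gInv κ q).comp ((res G s κ).comp (emb G hle)) with hS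
  let L : ℂ → (Hs G (s + 1) →L[ℂ] Hs G (s + 1)) := fun z => 1 + (z - κ) • S
  have hL : AnalyticAt ℂ L κ := by
    refine analyticAt_const.add ?_
    exact (analyticAt_id.sub analyticAt_const).smul analyticAt_const
  have hL0 : L κ = 1 := by simp [L]
  have hinv : AnalyticAt ℂ (fun z => Ring.inverse (L z)) κ := by
    refine AnalyticAt.comp (g := Ring.inverse) ?_ hL
    rw [hL0]
    exact analyticAt_inverse (1 : (Hs G (s + 1) →L[ℂ] Hs G (s + 1))ˣ)
  let ev : (Hs G (s + 1) →L[ℂ] Hs G (s + 1)) →L[ℂ] ℂ :=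
    (dpL G zero_le_dual q).comp (ContinuousLinearMap.apply ℂ (Hs G (s + 1)) (mm κ q))
  have hg : AnalyticAt ℂ (fun z => ev (Ring.inverse (L z))) ((κ : ℝ) : ℂ) :=
    (ev.analyticAt _).comp hinv
  have hg2 : AnalyticAt ℝ (fun ϰ : ℝ => ev (Ring.inverse (L (ϰ : ℂ)))) κ :=
    (hg.restrictScalars (𝕜 := ℝ)).comp (f := fun ϰ : ℝ => (ϰ : ℂ)) (Complex.ofRealCLM.analyticAt κ)
  refine hg2.congr ?_
  have hcont : Tendsto (fun ϰ : ℝ => L (ϰ : ℂ)) (𝓝 κ) (𝓝 1) := by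
    rw [← hL0]
    exact hL.continuousAt.tendsto.comp (Complex.continuous_ofReal.tendsto κ)
  have hu : ∀ᶠ ϰ : ℝ in 𝓝 κ, IsUnit (L (ϰ : ℂ)) :=
    hcont.eventually (Units.isOpen.mem_nhds isUnit_one)
  filter_upwards [hu] with ϰ hϰ
  have key : ∀ m : Hs G (s + 1), IsGauge ϰ q m ↔ L (ϰ : ℂ) m = mm κ q := fun m => by
    rw [isGauge_iff_shift hκ ϰ]
    have hLm : L (ϰ : ℂ) m = m + ((ϰ - κ : ℝ) : ℂ) • gInv κ q (res G s κ (emb G hle m)) := by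
      simp [L, hS]
    rw [hLm]
    constructor
    · intro hm
      have : m = gInv κ q (res G s κ q - ((ϰ - κ : ℝ) : ℂ) • res G s κ (emb G hle m)) := by
        refine eq_gInv h ?_
        conv_lhs => rw [hm]
        abel
      rw [map_sub, map_smul] at this
      exact eq_sub_iff_add_eq.1 this
    · intro hm
      have h1 : m = gInv κ q (res G s κ q - ((ϰ - κ : ℝ) : ℂ) • res G s κ (emb G hle m)) := by
        rw [map_sub, map_smul, ← mm, ← hm]
        exact (add_sub_cancel_right _ _).symm
      have h2 := gInv_eq h (res G s κ q - ((ϰ - κ : ℝ) : ℂ) • res G s κ (emb G hle m))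
      rw [← h1] at h2
      conv_lhs => rw [h2]
      abel
  obtain ⟨U, hU⟩ := hϰ
  have hex : IsGauge ϰ q (Ring.inverse (L (ϰ : ℂ)) (mm κ q)) := by
    rw [key, ← hU, Ring.inverse_unit]
    exact congrArg (fun L : Hs G (s + 1) →L[ℂ] Hs G (s + 1) => L (mm κ q)) U.mul_inv
  have huniq : HasGauge ϰ q := by
    refine ⟨_, hex, fun m hm => ?_⟩
    have hm := (key m).1 hm
    rw [← hm, ← hU, Ring.inverse_unit]
    exact (congrArg (fun L : Hs G (s + 1) →L[ℂ] Hs G (s + 1) => L m) U.inv_mul).symm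
  rw [beta, gauge_eq_of_isGauge huniq hex, pairing_eq_dp hr]
  rfl

/-! ### Control of the Sobolev norm by `β` -/

/-- Since `s < 0`, the weighted norm decreases in `κ`; smallness therefore persists for larger `κ`.
-/
theorem wq_anti {κ' : ℝ} (hκ : 1 ≤ κ) (h : κ ≤ κ') (q : Hs G s) :
    ‖wq (hκ.trans h) q‖ ≤ ‖wq hκ q‖ := by
  rw [← one_mul ‖wq hκ q‖]
  refine norm_le_of_sobSq_le zero_le_one ?_
  rw [one_pow, ENNReal.ofReal_one, one_mul, sobSq_congr (wq_coe _ q), sobSq_congr (wq_coe _ q)]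
  refine lintegral_mono fun ξ => ?_
  rw [enorm_mul, enorm_mul]
  refine pow_le_pow_left₀ zero_le ?_ 2
  gcongr
  rw [← ofReal_norm, ← ofReal_norm]
  refine ENNReal.ofReal_le_ofReal ?_
  have h0 : 0 < |ξ| + κ := by positivity
  have h1 : 0 < |ξ| + κ' := by linarith
  rw [Complex.norm_real, Complex.norm_real, Real.norm_of_nonneg (by positivity),
    Real.norm_of_nonneg (by positivity)]
  exact Real.rpow_le_rpow_of_nonpos h0 (by linarith) hs.out.2.le

theorem Small.mono {κ' : ℝ} {hκ : 1 ≤ κ} {q : Hs G s} (hq : Small κ hκ q) (h : κ ≤ κ') :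
    Small κ' (hκ.trans h) q := by
  refine le_trans ?_ hq
  have := (gConst_pos G s).le
  gcongr 3 * (_ * ?_) * ?_
  · exact Real.rpow_le_rpow_of_nonpos (by linarith) h (by linarith [hs.out.1])
  · exact wq_anti hκ h q

/-- The two weights multiply to `(|ξ| + κ)^(1+2s) ≥ κ^(1+2s)`, the exponent being positive. -/
theorem dp_weighted_le (hκ : 1 ≤ κ) (q : Hs G s) (x : Hs G (s + 1)) :
    ‖dp G q x‖ ≤ κ ^ (-(1 + 2 * s)) * ‖wq hκ q‖ * ‖wm hκ x‖ := by
  have hκ0 : 0 < κ := by linarith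
  have hM : IsMult 0 0 (κ ^ (-(1 + 2 * s))) fun ξ => (((|ξ| + κ) ^ (-(1 + 2 * s)) : ℝ) : ℂ) :=
    ⟨by fun_prop, by positivity, fun ξ => by
      rw [Real.rpow_zero, one_mul, mul_one, Complex.norm_real, Real.norm_of_nonneg (by positivity)]
      exact Real.rpow_le_rpow_of_nonpos hκ0 (by linarith [abs_nonneg ξ]) (by linarith [hs.out.1])⟩
  have e : dp G q x = dp G (wq hκ q) (mlt G hM (wm hκ x)) := by
    refine integral_congr_ae ?_
    filter_upwards [ae_neg (wq_coe hκ q), mlt_coe hM (wm hκ x), wm_coe hκ x] with ξ h1 h2 h3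
    rw [h1, h2, h3, abs_neg]
    have h0 : 0 < |ξ| + κ := by positivity
    have : (((|ξ| + κ) ^ s : ℝ) : ℂ) * (((|ξ| + κ) ^ (-(1 + 2 * s)) : ℝ) : ℂ) *
        (((|ξ| + κ) ^ (s + 1) : ℝ) : ℂ) = 1 := by
      rw [← Complex.ofReal_mul, ← Complex.ofReal_mul, ← Real.rpow_add h0, ← Real.rpow_add h0]
      rw [show s + -(1 + 2 * s) + (s + 1) = 0 by ring]; simp
    linear_combination -(q (-ξ) * x ξ) * this
  rw [e]
  refine (dp_norm_le (by norm_num) _ _).trans ?_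
  calc _ ≤ ‖wq hκ q‖ * (κ ^ (-(1 + 2 * s)) * ‖wm hκ x‖) := by gcongr; exact mlt_norm_le hM _
    _ = _ := by ring

theorem wm_res_le (hκ : 1 ≤ κ) (q : Hs G s) : ‖wm hκ (res G s κ q)‖ ≤ ‖wq hκ q‖ := by
  rw [← one_mul ‖wq hκ q‖]
  refine norm_le_of_sobSq_le zero_le_one ?_
  rw [one_pow, ENNReal.ofReal_one, one_mul, sobSq_congr (wq_coe _ q)]
  refine lintegral_mono_ae ?_
  filter_upwards [wm_coe hκ (res G s κ q), res_coe (κ := κ) q] with ξ h1 h2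
  rw [h1, h2, ← mul_assoc, enorm_mul, enorm_mul _ (q ξ)]
  refine pow_le_pow_left₀ zero_le ?_ 2
  gcongr
  have h0 : 0 < |ξ| + κ := by positivity
  rcases lt_or_ge ξ 0 with h | h
  · rw [resSym_of_neg h]; simp
  · rw [resSym, indicator_of_mem (by exact h), max_eq_left hκ, ← Complex.ofReal_mul,
      Real.rpow_add h0, Real.rpow_one, mul_assoc, mul_inv_cancel₀ h0.ne', mul_one]

/-- One iteration of `m = R q + T m`: the error is `∫ q (T m)`, and the weighted norm of `m` is at
most twice that of `q`, so the error is cubic with the extra factor `κ^(-(1/2+s))` of the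
contraction estimate. -/
theorem beta_sub_lead_le {hκ : 1 ≤ κ} {q : Hs G s} (hr : IsReal q) (h : Small κ hκ q) :
    ‖beta κ q - dp G q (res G s κ q)‖ ≤
      6 * gConst G s * κ ^ (-(1 + 2 * s) - (1 / 2 + s)) * ‖wq hκ q‖ ^ 3 := by
  have hκ0 : 0 < κ := by linarith
  have hc := gConst_pos G s
  have e : beta κ q - dp G q (res G s κ q) = dp G q (gT G s κ q (mm κ q)) := by
    rw [beta_eq hr h.good hκ, ← dpL_apply zero_le_dual, ← dpL_apply zero_le_dual,
      ← dpL_apply zero_le_dual]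
    conv_lhs => rw [mm_eq h.good]
    rw [map_add, add_sub_cancel_left]
  rw [e]
  refine (dp_weighted_le hκ _ _).trans ?_
  have h1 : ‖wm hκ (mm κ q)‖ ≤ 2 * ‖wq hκ q‖ := (h.wm_gInv_le _).trans (by
    gcongr; exact wm_res_le hκ q)
  calc _ ≤ κ ^ (-(1 + 2 * s)) * ‖wq hκ q‖ *
        (3 * (gConst G s * κ ^ (-(1 / 2 + s))) * ‖wq hκ q‖ * (2 * ‖wq hκ q‖)) := by
        gcongr
        exact (wm_gT_norm_le hκ _ _).trans (by gcongr)
    _ = 6 * gConst G s * (κ ^ (-(1 + 2 * s)) * κ ^ (-(1 / 2 + s))) * ‖wq hκ q‖ ^ 3 := by ring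
    _ = _ := by rw [← Real.rpow_add hκ0]; ring_nf

/-- The leading term of `β`. -/
def lead (G : Geometry) (κ : ℝ) (q : ℝ → ℂ) : ℝ≥0∞ :=
  ∫⁻ ξ in Ici 0, ENNReal.ofReal (|ξ| + κ)⁻¹ * ‖q ξ‖ₑ ^ 2 ∂(freq G)

/-- For real `q` the integrand is `|q̂|² / (ξ + κ)` on `ξ ≥ 0`, hence nonnegative; passing to `ℝ≥0∞`
makes the dyadic sums below unconditional. -/
theorem lead_eq (hκ : 1 ≤ κ) {q : Hs G s} (hr : IsReal q) :
    lead G κ q = ENNReal.ofReal (dp G q (res G s κ q)).re := by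
  have hint := dp_integrable zero_le_dual q (res G s κ q)
  have e : ∀ᵐ ξ ∂(freq G), ((q : ℝ → ℂ) (-ξ) * (res G s κ q : ℝ → ℂ) ξ).re =
      indicator (Ici 0) (fun ξ => (|ξ| + κ)⁻¹ * ‖(q : ℝ → ℂ) ξ‖ ^ 2) ξ := by
    filter_upwards [hr, res_coe (κ := κ) q] with ξ h1 h2
    rw [h1, h2]
    rcases lt_or_ge ξ 0 with h | h
    · rw [resSym_of_neg h, indicator_of_notMem (by simpa using h)]; simp
    · rw [resSym, indicator_of_mem (by exact h), indicator_of_mem (by exact h), max_eq_left hκ,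
        mul_left_comm, ← Complex.normSq_eq_conj_mul_self, ← Complex.ofReal_mul, Complex.ofReal_re,
        Complex.normSq_eq_norm_sq]
  have h2 : (dp G q (res G s κ q)).re = ∫ ξ, indicator (Ici 0)
      (fun ξ => (|ξ| + κ)⁻¹ * ‖(q : ℝ → ℂ) ξ‖ ^ 2) ξ ∂(freq G) := by
    rw [← integral_congr_ae e]
    exact (integral_re hint).symm
  have hint2 : Integrable (indicator (Ici 0) (fun ξ => (|ξ| + κ)⁻¹ * ‖(q : ℝ → ℂ) ξ‖ ^ 2))
      (freq G) := by
    have : Integrable (fun ξ => ((q : ℝ → ℂ) (-ξ) * (res G s κ q : ℝ → ℂ) ξ).re) (freq G) := hint.re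
    exact this.congr e
  have hnn : ∀ ξ : ℝ, 0 ≤ (|ξ| + κ)⁻¹ * ‖(q : ℝ → ℂ) ξ‖ ^ 2 := fun ξ => by positivity
  rw [h2, ofReal_integral_eq_lintegral_ofReal hint2
    (Eventually.of_forall fun ξ => indicator_nonneg (fun ξ _ => hnn ξ) ξ), lead,
    ← lintegral_indicator measurableSet_Ici]
  refine lintegral_congr fun ξ => ?_
  by_cases h : ξ ∈ Ici (0 : ℝ)
  · rw [indicator_of_mem h, indicator_of_mem h, ENNReal.ofReal_mul (by positivity),
      ENNReal.ofReal_pow (norm_nonneg _), ofReal_norm]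
  · rw [indicator_of_notMem h, indicator_of_notMem h, ENNReal.ofReal_zero]

/-- The nonnegative frequencies of the `κ`-weighted norm. -/
def halfSq (G : Geometry) (s κ : ℝ) (q : ℝ → ℂ) : ℝ≥0∞ :=
  ∫⁻ ξ in Ici 0, ENNReal.ofReal ((|ξ| + κ) ^ (2 * s)) * ‖q ξ‖ₑ ^ 2 ∂(freq G)

theorem enorm_wq_sq (hκ : 1 ≤ κ) (q : Hs G s) :
    ‖wq hκ q‖ₑ ^ 2 = ∫⁻ ξ, ENNReal.ofReal ((|ξ| + κ) ^ (2 * s)) * ‖q ξ‖ₑ ^ 2 ∂(freq G) := by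
  rw [enorm_sq_Hs, sobSq_congr (wq_coe hκ q)]
  refine lintegral_congr fun ξ => ?_
  have h0 : 0 < |ξ| + κ := by positivity
  rw [Real.rpow_zero, ENNReal.ofReal_one, one_mul, enorm_mul, mul_pow, ← ofReal_norm
    (((|ξ| + κ) ^ s : ℝ) : ℂ), Complex.norm_real, Real.norm_of_nonneg (by positivity),
    ← ENNReal.ofReal_pow (by positivity), ← Real.rpow_natCast, ← Real.rpow_mul h0.le]
  congr 3; push_cast; ring

theorem halfSq_le (hκ : 1 ≤ κ) (q : Hs G s) : halfSq G s κ q ≤ ‖wq hκ q‖ₑ ^ 2 := by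
  rw [enorm_wq_sq]; exact setLIntegral_le_lintegral _ _

/-- The reflection symmetry of a real function: its negative frequencies weigh no more than its
nonnegative ones. -/
theorem enorm_wq_sq_le (hκ : 1 ≤ κ) {q : Hs G s} (hr : IsReal q) :
    ‖wq hκ q‖ₑ ^ 2 ≤ 2 * halfSq G s κ q := by
  have hm := measurable_coe q
  let F : ℝ → ℝ≥0∞ := fun ξ => ENNReal.ofReal ((|ξ| + κ) ^ (2 * s)) * ‖q ξ‖ₑ ^ 2
  have hF : Measurable F := by fun_prop
  have h1 : ∫⁻ ξ in Iio 0, F ξ ∂(freq G) ≤ ∫⁻ ξ in Ici 0, F ξ ∂(freq G) := by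
    rw [← lintegral_indicator measurableSet_Iio, ← lintegral_indicator measurableSet_Ici,
      ← (measurePreserving_neg_freq G).lintegral_comp (hF.indicator measurableSet_Iio)]
    refine lintegral_mono_ae ?_
    filter_upwards [hr] with ξ h
    by_cases h2 : 0 < ξ
    · rw [indicator_of_mem (by simpa using h2), indicator_of_mem (by simpa using h2.le)]
      simp only [F, abs_neg, h]
      rw [← ofReal_norm, Complex.norm_conj, ofReal_norm]
    · rw [indicator_of_notMem (by simpa using h2)]; exact zero_le
  rw [enorm_wq_sq, ← lintegral_add_compl _ (measurableSet_Ici (a := (0 : ℝ))), compl_Ici, two_mul (halfSq _ _ _ _)]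
  exact add_le_add_right h1 _

end

section

variable {G : Geometry} {σ κ s : ℝ}

/-! ### Dyadic sums -/

/-- The dyadic sum `∑ κₙ^(1+2s) / (|ξ| + κₙ)`, `κₙ = 2ⁿ K`. -/
def dyad (s K ξ : ℝ) : ℝ≥0∞ :=
  ∑' n : ℕ, ENNReal.ofReal ((K * 2 ^ n) ^ (1 + 2 * s)) * ENNReal.ofReal (|ξ| + K * 2 ^ n)⁻¹

theorem exists_dyadic {K : ℝ} (hK : 1 ≤ K) (ξ : ℝ) :
    ∃ N : ℕ, K * 2 ^ N ≤ |ξ| + K ∧ |ξ| + K < K * 2 ^ (N + 1) := by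
  have hK0 : 0 < K := by linarith
  obtain ⟨N, h1, h2⟩ := exists_nat_pow_near (x := (|ξ| + K) / K) (y := 2)
    (by rw [le_div_iff₀ hK0]; linarith [abs_nonneg ξ]) (by norm_num)
  rw [le_div_iff₀ hK0] at h1
  rw [div_lt_iff₀ hK0] at h2
  exact ⟨N, by linarith, by linarith⟩

/-- A single term suffices, the one with `K * 2 ^ N` comparable to `X = |ξ| + K`. The losses are a
factor `2` in `y ≥ X / 2` (the exponent `1 + 2s` being less than `1`) and a factor `2` in `|ξ| + y ≤
2 X`. -/
theorem weight_le_dyad (hs : s ∈ Ioo (-(1 / 2) : ℝ) 0) {K : ℝ} (hK : 1 ≤ K) (ξ : ℝ) :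
    ENNReal.ofReal ((|ξ| + K) ^ (2 * s)) ≤ 4 * dyad s K ξ := by
  have hK0 : 0 < K := by linarith
  obtain ⟨N, h1, h2⟩ := exists_dyadic hK ξ
  refine le_trans ?_ (mul_le_mul_right (ENNReal.le_tsum N) 4)
  rw [← ENNReal.ofReal_mul (by positivity), show (4 : ℝ≥0∞) = ENNReal.ofReal 4 by norm_num,
    ← ENNReal.ofReal_mul (by norm_num)]
  refine ENNReal.ofReal_le_ofReal ?_
  set X := |ξ| + K
  have hX : 0 < X := by positivity
  set y := K * 2 ^ N
  have hy : 0 < y := by positivity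
  have h3 : X / 2 ≤ y := by
    have : K * 2 ^ (N + 1) = 2 * y := by simp only [y]; ring
    linarith
  have h4 : (X / 2) ^ (1 + 2 * s) ≤ y ^ (1 + 2 * s) :=
    Real.rpow_le_rpow (by positivity) h3 (by linarith [hs.1])
  have h5 : (2 * X)⁻¹ ≤ (|ξ| + y)⁻¹ := by
    gcongr
    have : |ξ| ≤ X := by simp only [X]; linarith
    linarith
  have h6 : X * (1 / 2) ≤ X := by linarith
  have h7 : (1 / 2 : ℝ) ≤ (1 / 2 : ℝ) ^ (1 + 2 * s) := by
    conv_lhs => rw [← Real.rpow_one (1 / 2 : ℝ)]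
    exact Real.rpow_le_rpow_of_exponent_ge (by norm_num) (by norm_num) (by linarith [hs.2])
  calc X ^ (2 * s) = 4 * (X ^ (1 + 2 * s) * (1 / 2) * (2 * X)⁻¹) := by
        rw [Real.rpow_add hX, Real.rpow_one]; field_simp; norm_num
    _ ≤ 4 * (X ^ (1 + 2 * s) * (1 / 2 : ℝ) ^ (1 + 2 * s) * (2 * X)⁻¹) := by gcongr
    _ = 4 * ((X / 2) ^ (1 + 2 * s) * (2 * X)⁻¹) := by
        rw [← Real.mul_rpow hX.le (by norm_num)]; ring_nf
    _ ≤ _ := by gcongr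

/-- Below the scale `|ξ| + K` the terms grow like the power `1 + 2s > 0`, above it they decay like
the power `2s < 0`: two geometric series, one for each end of the range of `s`. -/
theorem exists_dyad_le (hs : s ∈ Ioo (-(1 / 2) : ℝ) 0) : ∃ D : ℝ≥0∞, D ≠ ∞ ∧
    ∀ K : ℝ, 1 ≤ K → ∀ ξ : ℝ, dyad s K ξ ≤ D * ENNReal.ofReal ((|ξ| + K) ^ (2 * s)) := by
  set r₁ : ℝ := (1 / 2) ^ (1 + 2 * s)
  set r₂ : ℝ := 2 ^ (2 * s)
  have hr₁ : r₁ < 1 := Real.rpow_lt_one (by norm_num) (by norm_num) (by linarith [hs.1])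
  have hr₂ : r₂ < 1 := Real.rpow_lt_one_of_one_lt_of_neg (by norm_num) (by linarith [hs.2])
  have hr₁0 : 0 ≤ r₁ := by positivity
  have hr₂0 : 0 ≤ r₂ := by positivity
  have hfin : ∀ r : ℝ, r < 1 → (1 - ENNReal.ofReal r)⁻¹ ≠ ∞ := fun r hr => by
    rw [Ne, ENNReal.inv_eq_top, tsub_eq_zero_iff_le, not_le]
    exact ENNReal.ofReal_lt_one.2 hr
  refine ⟨(1 - ENNReal.ofReal r₁)⁻¹ + (1 - ENNReal.ofReal r₂)⁻¹,
    ENNReal.add_ne_top.2 ⟨hfin _ hr₁, hfin _ hr₂⟩, fun K hK ξ => ?_⟩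
  have hK0 : 0 < K := by linarith
  obtain ⟨N, h1, h2⟩ := exists_dyadic hK ξ
  set X := |ξ| + K
  have hX : 0 < X := by positivity
  have hlow : ∀ n ∈ Finset.range (N + 1), ENNReal.ofReal ((K * 2 ^ n) ^ (1 + 2 * s)) *
      ENNReal.ofReal (|ξ| + K * 2 ^ n)⁻¹ ≤
      ENNReal.ofReal (X ^ (2 * s)) * ENNReal.ofReal r₁ ^ (N - n) := fun n hn => by
    have hn : n ≤ N := by simpa [Nat.lt_succ_iff] using hn
    rw [← ENNReal.ofReal_pow hr₁0, ← ENNReal.ofReal_mul (by positivity),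
      ← ENNReal.ofReal_mul (by positivity)]
    refine ENNReal.ofReal_le_ofReal ?_
    have e1 : K * 2 ^ n = K * 2 ^ N * (1 / 2) ^ (N - n) := by
      obtain ⟨j, rfl⟩ := Nat.exists_eq_add_of_le hn
      rw [Nat.add_sub_cancel_left, pow_add, one_div, inv_pow]
      field_simp
    have e2 : (K * 2 ^ n) ^ (1 + 2 * s) ≤ X ^ (1 + 2 * s) * r₁ ^ (N - n) := by
      calc _ ≤ (X * (1 / 2) ^ (N - n)) ^ (1 + 2 * s) := by
            refine Real.rpow_le_rpow (by positivity) ?_ (by linarith [hs.1])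
            rw [e1]; gcongr
        _ = _ := by
            rw [Real.mul_rpow hX.le (by positivity), ← Real.rpow_natCast, ← Real.rpow_mul (by norm_num),
              mul_comm ((N - n : ℕ) : ℝ), Real.rpow_mul (by norm_num), Real.rpow_natCast]
    have e3 : (|ξ| + K * 2 ^ n)⁻¹ ≤ X⁻¹ := by
      gcongr
      exact add_le_add_right (le_mul_of_one_le_right hK0.le (one_le_pow₀ (by norm_num))) _
    calc _ ≤ X ^ (1 + 2 * s) * r₁ ^ (N - n) * X⁻¹ := by gcongr
      _ = _ := by rw [Real.rpow_add hX, Real.rpow_one]; field_simp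
  have hhigh : ∀ j : ℕ, ENNReal.ofReal ((K * 2 ^ (j + (N + 1))) ^ (1 + 2 * s)) *
      ENNReal.ofReal (|ξ| + K * 2 ^ (j + (N + 1)))⁻¹ ≤
      ENNReal.ofReal (X ^ (2 * s)) * ENNReal.ofReal r₂ ^ j := fun j => by
    rw [← ENNReal.ofReal_pow hr₂0, ← ENNReal.ofReal_mul (by positivity),
      ← ENNReal.ofReal_mul (by positivity)]
    refine ENNReal.ofReal_le_ofReal ?_
    set y := K * 2 ^ (j + (N + 1))
    have hy : 0 < y := by positivity
    have e1 : X * 2 ^ j ≤ y := by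
      have : y = K * 2 ^ (N + 1) * 2 ^ j := by simp only [y]; ring
      rw [this]; gcongr
    calc y ^ (1 + 2 * s) * (|ξ| + y)⁻¹ ≤ y ^ (1 + 2 * s) * y⁻¹ := by
          gcongr; linarith [abs_nonneg ξ]
      _ = y ^ (2 * s) := by rw [Real.rpow_add hy, Real.rpow_one]; field_simp
      _ ≤ (X * 2 ^ j) ^ (2 * s) :=
          Real.rpow_le_rpow_of_nonpos (by positivity) e1 (by linarith [hs.2])
      _ = _ := by
          rw [Real.mul_rpow hX.le (by positivity), ← Real.rpow_natCast 2 j,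
            ← Real.rpow_mul (by norm_num : (0 : ℝ) ≤ 2), mul_comm (j : ℝ),
            Real.rpow_mul (by norm_num : (0 : ℝ) ≤ 2), Real.rpow_natCast]
  rw [dyad, ← ENNReal.summable.sum_add_tsum_nat_add' (k := N + 1), add_mul]
  refine add_le_add ?_ ?_
  · refine (Finset.sum_le_sum hlow).trans ?_
    rw [← Finset.mul_sum, mul_comm]
    gcongr
    have h3 := Finset.sum_range_reflect (fun n => ENNReal.ofReal r₁ ^ n) (N + 1)
    simp only [Nat.add_sub_cancel] at h3
    rw [h3, ← ENNReal.tsum_geometric]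
    exact ENNReal.sum_le_tsum _
  · refine (ENNReal.tsum_le_tsum hhigh).trans ?_
    rw [ENNReal.tsum_mul_left, ENNReal.tsum_geometric, mul_comm]

theorem tsum_lead_eq {K : ℝ} {q : ℝ → ℂ} (hq : Measurable q) :
    ∑' n : ℕ, ENNReal.ofReal ((K * 2 ^ n) ^ (1 + 2 * s)) * lead G (K * 2 ^ n) q =
      ∫⁻ ξ in Ici 0, dyad s K ξ * ‖q ξ‖ₑ ^ 2 ∂(freq G) := by
  simp only [lead, dyad, ← ENNReal.tsum_mul_right]
  rw [lintegral_tsum fun n => by fun_prop]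
  refine tsum_congr fun n => ?_
  rw [← lintegral_const_mul' _ _ ENNReal.ofReal_ne_top]
  simp only [mul_assoc]

/-! ### A priori bounds from the conservation of `β` -/

variable [hs : Fact (s ∈ Ioo (-(1 / 2) : ℝ) 0)]

/-- If `β(·; q₁) = β(·; q₀)`, then the norm of `q₁` is controlled by that of `q₀`. -/
theorem exists_apriori (G : Geometry) (s : ℝ) [hs : Fact (s ∈ Ioo (-(1 / 2) : ℝ) 0)] :
    ∃ D : ℝ, 0 < D ∧ ∀ (K : ℝ) (hK : 1 ≤ K) (q₀ q₁ : Hs G s), IsReal q₀ → IsReal q₁ →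
      Small K hK q₀ → Small K hK q₁ → (∀ κ, K ≤ κ → beta κ q₁ = beta κ q₀) →
      ‖wq hK q₁‖ ^ 2 ≤ D * (‖wq hK q₀‖ ^ 2 +
        K ^ (-(1 / 2 + s)) * (‖wq hK q₁‖ ^ 3 + ‖wq hK q₀‖ ^ 3)) := by
  obtain ⟨D₁, hD₁, hD⟩ := exists_dyad_le hs.out
  have hc := gConst_pos G s
  set r : ℝ := 2 ^ (-(1 / 2 + s)) with hr
  have hr1 : r < 1 := Real.rpow_lt_one_of_one_lt_of_neg (by norm_num) (by linarith [hs.out.1])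
  have hr0 : 0 ≤ r := by positivity
  set D₂ : ℝ≥0∞ := (1 - ENNReal.ofReal r)⁻¹
  have hD₂ : D₂ ≠ ∞ := by
    rw [Ne, ENNReal.inv_eq_top, tsub_eq_zero_iff_le, not_le]
    exact ENNReal.ofReal_lt_one.2 hr1
  -- `8 = 2 · 4`: the `2` from the symmetry of a real function, the `4` from `weight_le_dyad`.
  refine ⟨8 * (D₁.toReal + D₂.toReal * (6 * gConst G s)) + 1, by positivity, ?_⟩
  intro K hK q₀ q₁ hr₀ hr₁ hs₀ hs₁ hβ
  have hK0 : 0 < K := by linarith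
  set x₀ := ‖wq hK q₀‖
  set x₁ := ‖wq hK q₁‖
  have hx₀ : 0 ≤ x₀ := norm_nonneg _
  have hx₁ : 0 ≤ x₁ := norm_nonneg _
  set E := 6 * gConst G s * K ^ (-(1 / 2 + s)) * (x₁ ^ 3 + x₀ ^ 3) with hE
  have hE0 : 0 ≤ E := by positivity
  -- Since `β` agrees at `K * 2 ^ n`, the leading terms differ by at most the two cubic errors;
  -- multiplied by `(K * 2 ^ n)^(1+2s)` these are still geometric in `n`, with ratio `r =
  -- 2^(-(1/2+s)) < 1`.
  have hterm : ∀ n : ℕ, ENNReal.ofReal ((K * 2 ^ n) ^ (1 + 2 * s)) * lead G (K * 2 ^ n) q₁ ≤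
      ENNReal.ofReal ((K * 2 ^ n) ^ (1 + 2 * s)) * lead G (K * 2 ^ n) q₀ +
        ENNReal.ofReal E * ENNReal.ofReal r ^ n := fun n => by
    have hle : K ≤ K * 2 ^ n := le_mul_of_one_le_right hK0.le (one_le_pow₀ (by norm_num))
    set y := K * 2 ^ n with hy
    have hy0 : 0 < y := by positivity
    have hy1 : 1 ≤ y := hK.trans hle
    rw [lead_eq hy1 hr₁, lead_eq hy1 hr₀]
    have b₀ := beta_sub_lead_le hr₀ (hs₀.mono hle)
    have b₁ := beta_sub_lead_le hr₁ (hs₁.mono hle)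
    have hb : (dp G q₁ (res G s y q₁)).re ≤ (dp G q₀ (res G s y q₀)).re +
        6 * gConst G s * y ^ (-(1 + 2 * s) - (1 / 2 + s)) * (x₁ ^ 3 + x₀ ^ 3) := by
      have e : (dp G q₁ (res G s y q₁)).re - (dp G q₀ (res G s y q₀)).re =
          (beta y q₀ - dp G q₀ (res G s y q₀)).re - (beta y q₁ - dp G q₁ (res G s y q₁)).re := by
        rw [hβ y hle]; simp
      have h1 := (Complex.abs_re_le_norm _).trans b₀
      have h2 := (Complex.abs_re_le_norm _).trans b₁
      have h3 : ‖wq (hK.trans hle) q₀‖ ^ 3 ≤ x₀ ^ 3 := by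
        gcongr; exact wq_anti hK hle q₀
      have h4 : ‖wq (hK.trans hle) q₁‖ ^ 3 ≤ x₁ ^ 3 := by
        gcongr; exact wq_anti hK hle q₁
      set c := 6 * gConst G s * y ^ (-(1 + 2 * s) - (1 / 2 + s))
      have hc0 : 0 ≤ c := by positivity
      have h5 := h1.trans (mul_le_mul_of_nonneg_left h3 hc0)
      have h6 := h2.trans (mul_le_mul_of_nonneg_left h4 hc0)
      have := (abs_le.1 h5).2
      have := (abs_le.1 h6).1
      linarith
    calc _ ≤ ENNReal.ofReal (y ^ (1 + 2 * s)) * (ENNReal.ofReal (dp G q₀ (res G s y q₀)).re +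
          ENNReal.ofReal (6 * gConst G s * y ^ (-(1 + 2 * s) - (1 / 2 + s)) * (x₁ ^ 3 + x₀ ^ 3))) := by
          gcongr
          exact (ENNReal.ofReal_le_ofReal hb).trans ENNReal.ofReal_add_le
      _ = _ := by
          rw [mul_add, ← ENNReal.ofReal_mul (by positivity : (0 : ℝ) ≤ y ^ (1 + 2 * s)),
            ← ENNReal.ofReal_mul (by positivity : (0 : ℝ) ≤ y ^ (1 + 2 * s)),
            ← ENNReal.ofReal_pow hr0, ← ENNReal.ofReal_mul hE0]
          congr 2
          have e1 : y ^ (1 + 2 * s) * y ^ (-(1 + 2 * s) - (1 / 2 + s)) = y ^ (-(1 / 2 + s)) := by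
            rw [← Real.rpow_add hy0]; ring_nf
          have e2 : y ^ (-(1 / 2 + s)) = K ^ (-(1 / 2 + s)) * r ^ n := by
            rw [hy, Real.mul_rpow hK0.le (by positivity), ← Real.rpow_natCast 2 n,
              ← Real.rpow_mul (by norm_num), mul_comm (n : ℝ), Real.rpow_mul (by norm_num),
              Real.rpow_natCast]
          rw [hE]
          calc _ = 6 * gConst G s * (y ^ (1 + 2 * s) * y ^ (-(1 + 2 * s) - (1 / 2 + s))) *
                (x₁ ^ 3 + x₀ ^ 3) := by ring
            _ = _ := by rw [e1, e2]; ring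
  have hsum := ENNReal.tsum_le_tsum hterm
  rw [ENNReal.tsum_add, ENNReal.tsum_mul_left, ENNReal.tsum_geometric,
    tsum_lead_eq (measurable_coe q₁), tsum_lead_eq (measurable_coe q₀)] at hsum
  have hlow : halfSq G s K q₁ ≤ 4 * ∫⁻ ξ in Ici 0, dyad s K ξ * ‖(q₁ : ℝ → ℂ) ξ‖ₑ ^ 2 ∂(freq G) := by
    rw [← lintegral_const_mul' _ _ (by norm_num)]
    refine lintegral_mono fun ξ => ?_
    rw [← mul_assoc]
    gcongr
    exact weight_le_dyad hs.out hK ξ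
  have hupp : ∫⁻ ξ in Ici 0, dyad s K ξ * ‖(q₀ : ℝ → ℂ) ξ‖ₑ ^ 2 ∂(freq G) ≤
      D₁ * halfSq G s K q₀ := by
    rw [halfSq, ← lintegral_const_mul' _ _ hD₁]
    refine lintegral_mono fun ξ => ?_
    rw [← mul_assoc]
    gcongr
    exact hD K hK ξ
  have hfinal : ‖wq hK q₁‖ₑ ^ 2 ≤ 8 * (D₁ * ‖wq hK q₀‖ₑ ^ 2 + ENNReal.ofReal E * D₂) := by
    calc _ ≤ 2 * halfSq G s K q₁ := enorm_wq_sq_le hK hr₁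
      _ ≤ 2 * (4 * (D₁ * halfSq G s K q₀ + ENNReal.ofReal E * D₂)) := by
          gcongr
          exact hlow.trans (by gcongr; exact hsum.trans (by gcongr))
      _ ≤ 2 * (4 * (D₁ * ‖wq hK q₀‖ₑ ^ 2 + ENNReal.ofReal E * D₂)) := by
          gcongr; exact halfSq_le hK q₀
      _ = _ := by rw [← mul_assoc]; norm_num
  rw [← ENNReal.ofReal_toReal hD₁, ← ENNReal.ofReal_toReal hD₂, ← ofReal_norm, ← ofReal_norm,
    ← ENNReal.ofReal_pow hx₀, ← ENNReal.ofReal_pow hx₁, ← ENNReal.ofReal_mul (by positivity),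
    ← ENNReal.ofReal_mul hE0, ← ENNReal.ofReal_add (by positivity) (by positivity),
    show (8 : ℝ≥0∞) = ENNReal.ofReal 8 by norm_num, ← ENNReal.ofReal_mul (by norm_num),
    ENNReal.ofReal_le_ofReal_iff (by positivity)] at hfinal
  refine hfinal.trans ?_
  set P := K ^ (-(1 / 2 + s)) * (x₁ ^ 3 + x₀ ^ 3)
  have hP : 0 ≤ P := by positivity
  have hEP : E = 6 * gConst G s * P := by rw [hE]; ring
  rw [hEP]
  have h1 : 0 ≤ D₁.toReal := ENNReal.toReal_nonneg
  have h2 : 0 ≤ D₂.toReal := ENNReal.toReal_nonneg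
  have h3 : 0 ≤ D₁.toReal * P := by positivity
  have h4 : 0 ≤ D₂.toReal * (6 * gConst G s) * x₀ ^ 2 := by positivity
  have h5 : 0 ≤ x₀ ^ 2 := by positivity
  change 8 * (D₁.toReal * x₀ ^ 2 + _) ≤ _
  nlinarith

theorem norm_le_wq {K : ℝ} (hK : 1 ≤ K) (q : Hs G s) : ‖q‖ ≤ K ^ (-s) * ‖wq hK q‖ := by
  refine norm_le_of_sobSq_le (by positivity) ?_
  rw [sobSq_congr (wq_coe hK q), sobSq, sobSq, ← lintegral_const_mul' _ _ ENNReal.ofReal_ne_top]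
  refine lintegral_mono fun ξ => ?_
  have h0 : 0 < |ξ| + K := by positivity
  have hK0 : 0 < K := by linarith
  rw [ENNReal.ofReal_pow (by positivity), ← mul_pow, Real.rpow_zero, ENNReal.ofReal_one, one_mul,
    enorm_mul, ← mul_assoc, ← ofReal_norm (((|ξ| + K) ^ s : ℝ) : ℂ), Complex.norm_real,
    Real.norm_of_nonneg (by positivity), ← ENNReal.ofReal_mul (by positivity)]
  refine pow_le_pow_left₀ zero_le ?_ 2
  gcongr
  have h1 : (|ξ| + 1) ^ s ≤ ((|ξ| + K) / K) ^ s := by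
    refine Real.rpow_le_rpow_of_nonpos (by positivity) ?_ hs.out.2.le
    rw [div_le_iff₀ hK0]; nlinarith [abs_nonneg ξ]
  rw [Real.div_rpow h0.le hK0.le] at h1
  rw [Real.rpow_neg hK0.le, mul_comm]
  exact h1

/-- The identity theorem for real-analytic functions on `[K, ∞)`. -/
theorem beta_eq_of_eventually {K : ℝ} {hK : 1 ≤ K} {q₀ q₁ : Hs G s} (hr₀ : IsReal q₀)
    (hr₁ : IsReal q₁) (h₀ : Small K hK q₀) (h₁ : Small K hK q₁)
    (h : ∀ᶠ ϰ : ℝ in atTop, beta ϰ q₁ = beta ϰ q₀) : ∀ κ, K ≤ κ → beta κ q₁ = beta κ q₀ := by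
  obtain ⟨M, hM⟩ := (h.and (eventually_gt_atTop K)).exists_forall_of_atTop
  have ha : ∀ (q : Hs G s), IsReal q → Small K hK q →
      AnalyticOnNhd ℝ (fun ϰ => beta ϰ q) (Ici K) := fun q hr hq κ hκ =>
    analyticAt_beta hr (hq.mono hκ).good (hK.trans hκ)
  have hMK : K < M := (hM M le_rfl).2
  have := (ha q₁ hr₁ h₁).eqOn_of_preconnected_of_eventuallyEq (ha q₀ hr₀ h₀) isPreconnected_Ici
    (z₀ := M + 1) (by simp only [mem_Ici]; linarith) (by
      filter_upwards [Ioi_mem_nhds (lt_add_one M)] with κ hκ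
      exact (hM κ (le_of_lt hκ)).1)
  exact fun κ hκ => this hκ

/-- A continuity argument in the `K`-weighted norm. That norm starts at most `A`, and while it is at
most `M` the a priori estimate makes it strictly less than `M`; being continuous along the path, it
cannot pass `M`. -/
theorem exists_starStar_bound (G : Geometry) (s : ℝ) [hs : Fact (s ∈ Ioo (-(1 / 2) : ℝ) 0)]
    {A : ℝ} (hA : 0 < A) : ∃ B : ℝ, ∀ q ∈ starStar (closedBallReal G s A), ‖q‖ ≤ B := by
  obtain ⟨D, hD0, hD⟩ := exists_apriori G s
  have hc := gConst_pos G s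
  -- `M` beats the a priori bound once the cubic error is at most `1`. Only afterwards is `K` taken
  -- large, so that the gauge is contractive on the ball of radius `M` and the cubic error at that
  -- size is below `1`.
  set M := Real.sqrt (D * (A ^ 2 + 1)) + 1 + A
  have hM0 : 0 < M := by positivity
  have hMsq : D * (A ^ 2 + 1) < M ^ 2 := by
    have h1 := Real.sq_sqrt (show 0 ≤ D * (A ^ 2 + 1) by positivity)
    have h2 := Real.sqrt_nonneg (D * (A ^ 2 + 1))
    nlinarith
  have hlim := tendsto_rpow_neg_atTop (y := 1 / 2 + s) (by linarith [hs.out.1])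
  have e1 : ∀ᶠ K : ℝ in atTop, K ^ (-(1 / 2 + s)) < 1 / (6 * gConst G s * M) :=
    hlim.eventually_lt_const (by positivity)
  have e2 : ∀ᶠ K : ℝ in atTop, K ^ (-(1 / 2 + s)) < 1 / (M ^ 3 + A ^ 3) :=
    hlim.eventually_lt_const (by positivity)
  obtain ⟨K, ⟨h1, h2⟩, hK⟩ := ((e1.and e2).and (eventually_ge_atTop 1)).exists
  have hKp : 0 < K := by linarith
  rw [lt_div_iff₀ (by positivity)] at h1 h2
  have hsmall : ∀ q : Hs G s, ‖wq hK q‖ ≤ M → Small K hK q := fun q hq => by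
    have h3 : 0 ≤ K ^ (-(1 / 2 + s)) := by positivity
    rw [Small]
    calc _ ≤ 3 * (gConst G s * K ^ (-(1 / 2 + s))) * M := by gcongr
      _ = 1 / 2 * (K ^ (-(1 / 2 + s)) * (6 * gConst G s * M)) := by ring
      _ ≤ _ := by linarith
  refine ⟨K ^ (-s) * M, ?_⟩
  rintro p ⟨a, b, q, hab, hcont, hreal, hqa, hβ, rfl⟩
  have hqa2 : ‖wq hK (q a)‖ ≤ A := (wq_norm_le hK _).trans hqa.2
  have hqaM : ‖wq hK (q a)‖ ≤ M := hqa2.trans (by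
    have := Real.sqrt_nonneg (D * (A ^ 2 + 1)); simp only [M]; linarith)
  have hstep : ∀ t ∈ Icc a b, ‖wq hK (q t)‖ ≤ M → ‖wq hK (q t)‖ < M := fun t ht hle => by
    have ha := left_mem_Icc.2 hab
    have h3 := hD K hK (q a) (q t) (hreal a ha) (hreal t ht) (hsmall _ hqaM) (hsmall _ hle)
      (beta_eq_of_eventually (hreal a ha) (hreal t ht) (hsmall _ hqaM) (hsmall _ hle) (hβ t ht))
    have h4 : K ^ (-(1 / 2 + s)) * (‖wq hK (q t)‖ ^ 3 + ‖wq hK (q a)‖ ^ 3) ≤ 1 :=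
      le_trans (by gcongr) h2.le
    have h5 : ‖wq hK (q a)‖ ^ 2 ≤ A ^ 2 := by gcongr
    have h6 : ‖wq hK (q t)‖ ^ 2 < M ^ 2 := lt_of_le_of_lt (h3.trans (by gcongr)) hMsq
    exact lt_of_pow_lt_pow_left₀ 2 hM0.le h6
  have hwc : ContinuousOn (fun t => ‖wq hK (q t)‖) (Icc a b) :=
    ((wq hK).continuous.comp_continuousOn hcont).norm
  have hall : ‖wq hK (q b)‖ ≤ M := by
    by_contra hcon
    rw [not_le] at hcon
    obtain ⟨t, ht, hte⟩ := intermediate_value_Icc hab hwc ⟨hqaM, hcon.le⟩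
    exact (hstep t ht hte.le).ne hte
  refine (norm_le_wq hK _).trans ?_
  gcongr

/-! ### The threshold constant -/

/-- The exponent `1 / (1/2 - |s|)`. -/
theorem abs_s : 1 / 2 - |s| = 1 / 2 + s := by rw [abs_of_neg hs.out.2]; ring

/-- The constant `C` of the main theorem. -/
def thr (G : Geometry) (s : ℝ) [Fact (s ∈ Ioo (-(1 / 2) : ℝ) 0)] : ℝ :=
  (6 * gConst G s + 1) ^ (1 / (1 / 2 - |s|))

theorem one_le_thr : 1 ≤ thr G s := by
  have h1 := hs.out.1
  have h2 := (gConst_pos G s).le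
  refine Real.one_le_rpow (by linarith) ?_
  rw [abs_s]
  exact one_div_nonneg.2 (by linarith)

/-- Raising the threshold to the power `1/2 + s` gives `κ^(1/2+s) ≥ (6 c + 1)(1 + ρ)`, with `c` the
contraction constant. The radius obtained is `ρ + 1`, because the threshold contains `1 + ρ`; the
spare unit is the room in which orbits are followed. -/
theorem adm_of_thr_le {ρ : ℝ} (hρ : 0 ≤ ρ) (h : thr G s * (1 + ρ) ^ (1 / (1 / 2 - |s|)) ≤ κ) :
    Adm G s κ (ρ + 1) := by
  have h1 := hs.out.1
  have hc := gConst_pos G s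
  set θ := 1 / 2 + s
  have hθ : 0 < θ := by simp only [θ]; linarith
  have hκ : 1 ≤ κ := by
    refine le_trans ?_ h
    have : 1 ≤ (1 + ρ) ^ (1 / (1 / 2 - |s|)) := by
      refine Real.one_le_rpow (by linarith) ?_
      rw [abs_s]; exact one_div_nonneg.2 (by linarith)
    nlinarith [one_le_thr (G := G) (s := s)]
  have hκ0 : 0 < κ := by linarith
  refine ⟨hκ, by linarith, ?_⟩
  rw [thr, abs_s, ← Real.mul_rpow (by positivity) (by positivity)] at h
  have h2 := Real.rpow_le_rpow (by positivity) h hθ.le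
  rw [← Real.rpow_mul (by positivity), one_div_mul_cancel hθ.ne', Real.rpow_one] at h2
  rw [Real.rpow_neg hκ0.le]
  have h3 : 0 < κ ^ θ := by positivity
  rw [show 3 * (gConst G s * (κ ^ θ)⁻¹) * (ρ + 1) = (3 * gConst G s * (ρ + 1)) / κ ^ θ by
    field_simp, div_le_iff₀ h3]
  nlinarith

theorem exists_admissible {A : ℝ} (hA : 0 < A) : ∃ κ₀ : ℝ, Admissible G s (thr G s) A κ₀ := by
  obtain ⟨B, hB⟩ := exists_starStar_bound G s hA
  refine ⟨thr G s * (1 + B) ^ (1 / (1 / 2 - |s|)), fun q hq => ?_⟩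
  have h1 := hs.out.1
  have h2 := one_le_thr (G := G) (s := s)
  gcongr
  · rw [abs_s]; exact one_div_nonneg.2 (by linarith)
  · exact hB q hq

/-- For admissible `κ₀`, all of `(B_A)_**` lies in a ball on which the gauge exists with room
to spare. -/
theorem Admissible.exists_radius {A κ₀ : ℝ} (hA : 0 < A) (h : Admissible G s (thr G s) A κ₀) :
    ∃ R : ℝ, 0 ≤ R ∧ (∀ q ∈ starStar (closedBallReal G s A), ‖q‖ ≤ R) ∧ Adm G s κ₀ (R + 1) := by
  have h1 := hs.out.1
  have hthr := one_le_thr (G := G) (s := s)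
  -- The zero function shows `κ₀ ≥ C`, so that the radius below is nonnegative.
  have hmem : (0 : Hs G s) ∈ starStar (closedBallReal G s A) := by
    refine closedBallReal_subset_starStar A ⟨?_, by simpa using hA.le⟩
    rw [isReal_iff, map_zero]
  have hκ₀ : thr G s ≤ κ₀ := by simpa using h 0 hmem
  set θ := 1 / 2 + s
  have hθ : 0 < θ := by simp only [θ]; linarith
  have hb : 1 ≤ κ₀ / thr G s := by rw [one_le_div (by linarith)]; exact hκ₀
  -- `R` solves `C (1 + R)^(1/θ) = κ₀`: the largest radius to which `κ₀` applies.
  refine ⟨(κ₀ / thr G s) ^ θ - 1, ?_, fun q hq => ?_, adm_of_thr_le ?_ ?_⟩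
  · linarith [Real.one_le_rpow hb hθ.le]
  · have h2 := h q hq
    rw [mul_comm, ← le_div_iff₀ (by linarith), abs_s] at h2
    have h3 := Real.rpow_le_rpow (by positivity) h2 hθ.le
    rw [← Real.rpow_mul (by positivity), one_div_mul_cancel hθ.ne', Real.rpow_one] at h3
    linarith
  · linarith [Real.one_le_rpow hb hθ.le]
  · rw [add_sub_cancel, abs_s, ← Real.rpow_mul (by positivity), mul_one_div_cancel hθ.ne',
      Real.rpow_one, mul_div_cancel₀ _ (by linarith)]

end

section

/-! ### Ordinary differential equations, with derivatives possibly known only in a weaker norm -/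

section Ode

variable {E F : Type*} [NormedAddCommGroup E] [NormedSpace ℝ E]
  [NormedAddCommGroup F] [NormedSpace ℝ F]

/-- The continuous embedding `ι : E → F` is compatible with regularising maps `F → E`, so that
bounds in `E` can be recovered from information in `F`. -/
structure IsRegEmb (ι : E →L[ℝ] F) (P : ℕ → F →L[ℝ] E) : Prop where
  norm_le : ∀ n x, ‖P n (ι x)‖ ≤ ‖x‖
  tendsto : ∀ x, Tendsto (fun n => P n (ι x)) atTop (𝓝 x)

theorem isRegEmb_id : IsRegEmb (ContinuousLinearMap.id ℝ E)
    (fun _ => ContinuousLinearMap.id ℝ E) :=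
  ⟨fun _ _ => le_rfl, fun _ => tendsto_const_nhds⟩

/-- The curve need only be differentiable in `F`. Applying `P n` produces a curve differentiable in
`E`, to which the mean value inequality applies with a bound independent of `n`. -/
theorem IsRegEmb.norm_image_sub_le {ι : E →L[ℝ] F} {P : ℕ → F →L[ℝ] E} (h : IsRegEmb ι P)
    {I : Set ℝ} (hI : Convex ℝ I) {f f' : ℝ → E} {c : E} {K : ℝ}
    (hf : ∀ t ∈ I, HasDerivWithinAt (fun t => ι (f t)) (ι (f' t)) I t)
    (hK : ∀ t ∈ I, ‖f' t - c‖ ≤ K) {x y : ℝ} (hx : x ∈ I) (hy : y ∈ I) :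
    ‖f y - f x - (y - x) • c‖ ≤ K * ‖y - x‖ := by
  have key : ∀ n, ‖P n (ι (f y - f x - (y - x) • c))‖ ≤ K * ‖y - x‖ := by
    intro n
    have h1 : ∀ t ∈ I, HasDerivWithinAt (fun t => P n (ι (f t)) - t • P n (ι c))
        (P n (ι (f' t - c))) I t := by
      intro t ht
      have a := (P n).hasFDerivAt.comp_hasDerivWithinAt t (hf t ht)
      have b := (hasDerivWithinAt_id t I).smul_const (P n (ι c))
      refine (a.sub b).congr_deriv ?_
      simp
    have h2 := hI.norm_image_sub_le_of_norm_hasDerivWithin_le h1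
      (fun t ht => (h.norm_le n _).trans (hK t ht)) hx hy
    have : P n (ι (f y - f x - (y - x) • c)) =
        P n (ι (f y)) - y • P n (ι c) - (P n (ι (f x)) - x • P n (ι c)) := by
      simp only [map_sub, map_smul, sub_smul]; abel
    rw [this]; exact h2
  exact le_of_tendsto (h.tendsto _).norm (Eventually.of_forall key)

/-- The mean value bound with `c = f' t` on a short interval: continuity of `f'` in the stronger
norm upgrades the derivative to that norm. -/
theorem IsRegEmb.hasDerivWithinAt {ι : E →L[ℝ] F} {P : ℕ → F →L[ℝ] E} (h : IsRegEmb ι P)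
    {I : Set ℝ} (hI : Convex ℝ I) {f f' : ℝ → E}
    (hf : ∀ t ∈ I, HasDerivWithinAt (fun t => ι (f t)) (ι (f' t)) I t)
    {t : ℝ} (ht : t ∈ I) (hc : ContinuousWithinAt f' I t) :
    HasDerivWithinAt f (f' t) I t := by
  rw [hasDerivWithinAt_iff_isLittleO, Asymptotics.isLittleO_iff]
  intro ε hε
  have h1 : ∀ᶠ y in 𝓝[I] t, ‖f' y - f' t‖ < ε := by
    have := hc.eventually (Metric.ball_mem_nhds (f' t) hε)
    filter_upwards [this] with y hy
    simpa [dist_eq_norm] using hy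
  obtain ⟨δ, hδ, hδ'⟩ := Metric.mem_nhdsWithin_iff.1 h1
  have hJ : Convex ℝ (Metric.ball t δ ∩ I) := (convex_ball t δ).inter hI
  filter_upwards [inter_mem (mem_nhdsWithin_of_mem_nhds (Metric.ball_mem_nhds t hδ))
    self_mem_nhdsWithin] with y hy
  exact h.norm_image_sub_le hJ (fun u hu => (hf u hu.2).mono inter_subset_right)
    (fun u hu => (hδ' hu).le) ⟨Metric.mem_ball_self hδ, ht⟩ hy

/-- Uniqueness for solutions in a weak sense of an ODE that is locally Lipschitz in `E`. -/
theorem IsRegEmb.ode_unique {ι : E →L[ℝ] F} {P : ℕ → F →L[ℝ] E} (h : IsRegEmb ι P)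
    {I : Set ℝ} (hI : I.OrdConnected) (h0 : (0 : ℝ) ∈ I) {Y : E → E} {R K : ℝ} (hK : 0 ≤ K)
    (hY : ∀ x y, ‖x‖ ≤ R + 1 → ‖y‖ ≤ R + 1 → ‖Y x - Y y‖ ≤ K * ‖x - y‖)
    {p u : ℝ → E} (hp : ContinuousOn p I) (hu : ∀ t ∈ I, HasDerivWithinAt u (Y (u t)) I t)
    (huR : ∀ t ∈ I, ‖u t‖ ≤ R) (h00 : p 0 = u 0)
    (hp' : ∀ t ∈ I, ‖p t‖ ≤ R + 1 → HasDerivWithinAt (fun t => ι (p t)) (ι (Y (p t))) I t) :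
    ∀ t ∈ I, p t = u t := by
  have hIc : Convex ℝ I := hI.convex
  have huc : ContinuousOn u I := fun t ht => (hu t ht).continuousWithinAt
  have : PreconnectedSpace I := Subtype.preconnectedSpace hIc.isPreconnected
  -- Nothing bounds `p` in advance. Near a time of agreement continuity keeps it in the ball of
  -- radius `R + 1`, where `Y` is Lipschitz, so agreement spreads to a neighbourhood.
  have hclo : IsClopen {t : I | p t = u t} := by
    refine ⟨isClosed_eq hp.domRestrict huc.domRestrict, ?_⟩
    rw [isOpen_iff_mem_nhds]
    rintro ⟨x, hx⟩ hxe
    have hxe : p x = u x := hxe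
    have hpx : ‖p x‖ < R + 1 := by rw [hxe]; linarith [huR x hx]
    have h1 : ∀ᶠ y in 𝓝[I] x, ‖p y‖ < R + 1 :=
      (hp x hx).norm.eventually (Iio_mem_nhds hpx)
    obtain ⟨δ, hδ, hδ'⟩ := Metric.mem_nhdsWithin_iff.1 h1
    set δ₁ := min δ (1 / (2 * K + 1)) with hδ₁
    have hδ₁p : 0 < δ₁ := by positivity
    have hKδ : K * δ₁ ≤ 1 / 2 := by
      have : δ₁ ≤ 1 / (2 * K + 1) := min_le_right _ _
      calc K * δ₁ ≤ K * (1 / (2 * K + 1)) := by gcongr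
        _ ≤ 1 / 2 := by rw [mul_one_div, div_le_div_iff₀ (by positivity) two_pos]; linarith
    set J := Metric.ball x δ₁ ∩ I with hJdef
    have hJ : Convex ℝ J := (convex_ball x δ₁).inter hIc
    have hsm : ∀ t ∈ J, ‖p t‖ ≤ R + 1 := fun t ht =>
      (hδ' ⟨Metric.ball_subset_ball (min_le_left _ _) ht.1, ht.2⟩).le
    have hxJ : x ∈ J := ⟨Metric.mem_ball_self hδ₁p, hx⟩
    -- On an interval of length scale `δ₁` with `K * δ₁ ≤ 1 / 2`, any bound on the difference may be
    -- halved; iteration forces it to vanish.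
    have step : ∀ M : ℝ, 0 ≤ M → (∀ t ∈ J, ‖p t - u t‖ ≤ M) → ∀ t ∈ J, ‖p t - u t‖ ≤ M / 2 := by
      intro M hM hb t ht
      have := h.norm_image_sub_le hJ (f := fun t => p t - u t)
        (f' := fun t => Y (p t) - Y (u t)) (c := 0) (K := K * M)
        (fun t ht => by
          have a := (hp' t ht.2 (hsm t ht)).mono (inter_subset_right : J ⊆ I)
          have b := (ι.hasFDerivAt.comp_hasDerivWithinAt t
            ((hu t ht.2).mono (inter_subset_right : J ⊆ I)))
          refine ((a.sub b).congr_deriv (map_sub ι _ _).symm).congr_of_mem (fun u _ => ?_) ht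
          simp)
        (fun t ht => by
          rw [sub_zero]
          refine (hY _ _ (hsm t ht) (by linarith [huR t ht.2])).trans ?_
          gcongr; exact hb t ht) hxJ ht
      simp only [hxe, sub_self, sub_zero, smul_zero] at this
      refine this.trans ?_
      have hd : ‖t - x‖ ≤ δ₁ := by simpa [dist_eq_norm] using (Metric.mem_ball.1 ht.1).le
      calc K * M * ‖t - x‖ ≤ K * M * δ₁ := by gcongr
        _ = M * (K * δ₁) := by ring
        _ ≤ M * (1 / 2) := by gcongr
        _ = M / 2 := by ring
    have hR : 0 ≤ R := (norm_nonneg _).trans (huR x hx)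
    have all : ∀ n : ℕ, ∀ t ∈ J, ‖p t - u t‖ ≤ (2 * R + 1) * (1 / 2) ^ n := by
      intro n
      induction n with
      | zero =>
        intro t ht
        refine (norm_sub_le _ _).trans ?_
        have := hsm t ht; have := huR t ht.2
        simp; linarith
      | succ k ih =>
        intro t ht
        refine (step _ (by positivity) ih t ht).trans (le_of_eq ?_)
        ring
    have hz : ∀ t ∈ J, p t = u t := by
      intro t ht
      have hl : Tendsto (fun n : ℕ => (2 * R + 1) * (1 / 2 : ℝ) ^ n) atTop (𝓝 0) := by
        simpa using (tendsto_pow_atTop_nhds_zero_of_lt_one (by norm_num : (0 : ℝ) ≤ 1 / 2)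
          (by norm_num)).const_mul (2 * R + 1)
      have := ge_of_tendsto' hl (fun n => all n t ht)
      exact sub_eq_zero.1 (norm_le_zero_iff.1 this)
    have hopen : (Subtype.val ⁻¹' Metric.ball x δ₁ : Set I) ∈ 𝓝 (⟨x, hx⟩ : I) :=
      continuous_subtype_val.continuousAt.preimage_mem_nhds (Metric.ball_mem_nhds x hδ₁p)
    filter_upwards [hopen] with y hy
    exact hz y ⟨hy, y.2⟩
  have huniv := hclo.eq_univ ⟨⟨0, h0⟩, h00⟩
  intro t ht
  have : (⟨t, ht⟩ : I) ∈ {t : I | p t = u t} := by rw [huniv]; trivial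
  exact this

theorem hasDerivAt_comp_neg {f : ℝ → E} {f' : E} {t : ℝ} (hf : HasDerivAt f f' (-t)) :
    HasDerivAt (fun t => f (-t)) (-f') t := by
  refine (hf.scomp t (hasDerivAt_neg t)).congr_deriv ?_
  simp

/-- A bounded Lipschitz vector field has a global flow. -/
theorem exists_global_flow [CompleteSpace E] {F : E → E} {K L : ℝ≥0} (hF : LipschitzWith K F)
    (hL : ∀ x, ‖F x‖ ≤ L) :
    ∃ Φ : ℝ → E → E, (∀ x, Φ 0 x = x) ∧ (∀ x t, HasDerivAt (fun t => Φ t x) (F (Φ t x)) t) ∧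
      ∀ t x y, ‖Φ t x - Φ t y‖ ≤ ‖x - y‖ * Real.exp (K * |t|) := by
  have ex : ∀ (x : E) (n : ℕ), ∃ α : ℝ → E, α 0 = x ∧ ∀ t ∈ Icc (-(n : ℝ)) n,
      HasDerivWithinAt α (F (α t)) (Icc (-(n : ℝ)) n) t := by
    intro x n
    have h0 : (0 : ℝ) ∈ Icc (-(n : ℝ)) n := by constructor <;> simp
    have hpl : IsPicardLindelof (fun _ => F) (⟨0, h0⟩ : Icc (-(n : ℝ)) n) x (L * n) 0 L K := by
      -- The field is bounded by `L`, so on `[-n, n]` a ball of radius `L * n` contains the orbit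
      -- whatever `n` is.
      apply IsPicardLindelof.of_time_independent (fun y _ => hL y) hF.lipschitzOnWith
      simp
    obtain ⟨α, h1, h2⟩ := hpl.exists_eq_forall_mem_Icc_hasDerivWithinAt₀
    exact ⟨α, h1, h2⟩
  choose α hα0 hα using ex
  have hLip : ∀ x y : E, ‖F x - F y‖ ≤ K * ‖x - y‖ := fun x y => by
    simpa [dist_eq_norm] using hF.dist_le_mul x y
  have uniq : ∀ x (n m : ℕ), n ≤ m → ∀ t ∈ Icc (-(n : ℝ)) n, α x m t = α x n t := by
    intro x n m hnm
    have hnm' : (n : ℝ) ≤ m := by exact_mod_cast hnm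
    have h0 : (0 : ℝ) ∈ Icc (-(n : ℝ)) n := by constructor <;> simp
    have hsub : Icc (-(n : ℝ)) n ⊆ Icc (-(m : ℝ)) m := Icc_subset_Icc (by linarith) hnm'
    have hbd : ∃ R, ∀ t ∈ Icc (-(n : ℝ)) n, ‖α x n t‖ ≤ R :=
      isCompact_Icc.exists_bound_of_continuousOn fun t ht => (hα x n t ht).continuousWithinAt
    obtain ⟨R, hR⟩ := hbd
    refine isRegEmb_id.ode_unique (R := R) ordConnected_Icc h0 K.2 (fun a b _ _ => hLip a b)
      (fun t ht => (hα x m t (hsub ht)).continuousWithinAt.mono hsub) (hα x n) hR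
      (by rw [hα0, hα0]) (fun t ht _ => (hα x m t (hsub ht)).mono hsub)
  -- The extra `1` puts `t` in the interior of the interval of definition, as a two-sided derivative
  -- requires.
  set Φ : ℝ → E → E := fun t x => α x (⌈|t|⌉₊ + 1) t with hΦ
  have hΦeq : ∀ x (n : ℕ) (t : ℝ), |t| ≤ n → Φ t x = α x (n + 1) t := by
    intro x n t ht
    have h1 : ⌈|t|⌉₊ ≤ n := Nat.ceil_le.2 ht
    refine (uniq x _ _ (Nat.succ_le_succ h1) t ?_).symm
    refine abs_le.1 ?_
    exact (Nat.le_ceil _).trans (by push_cast; linarith)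
  have hd : ∀ x t, HasDerivAt (fun t => Φ t x) (F (Φ t x)) t := by
    intro x t
    obtain ⟨n, hn⟩ := exists_nat_gt |t|
    have hev : (fun t => Φ t x) =ᶠ[𝓝 t] α x (n + 1) := by
      filter_upwards [continuous_abs.continuousAt.eventually (Iio_mem_nhds hn)] with y hy
      exact hΦeq x n y (le_of_lt hy)
    have hI : Icc (-((n + 1 : ℕ) : ℝ)) ((n + 1 : ℕ) : ℝ) ∈ 𝓝 t := by
      have := abs_lt.1 hn
      apply Icc_mem_nhds <;> push_cast <;> linarith
    have h2 := (hα x (n + 1) t (mem_of_mem_nhds hI)).hasDerivAt hI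
    rw [hΦeq x n t hn.le]
    exact h2.congr_of_eventuallyEq hev
  have h0 : ∀ x, Φ 0 x = x := fun x => hα0 x _
  refine ⟨Φ, h0, hd, fun t x y => ?_⟩
  rcases le_total 0 t with ht | ht
  · have := dist_le_of_trajectories_ODE (v := fun _ => F) (K := K) (a := 0) (b := t)
      (f := fun t => Φ t x) (g := fun t => Φ t y) (δ := ‖x - y‖) (fun _ => hF)
      (fun u _ => (hd x u).continuousAt.continuousWithinAt) (fun u _ => (hd x u).hasDerivWithinAt)
      (fun u _ => (hd y u).continuousAt.continuousWithinAt) (fun u _ => (hd y u).hasDerivWithinAt)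
      (by simp [h0, dist_eq_norm]) t ⟨ht, le_rfl⟩
    simpa [dist_eq_norm, abs_of_nonneg ht] using this
  · have hd' : ∀ x t, HasDerivAt (fun t => Φ (-t) x) (-F (Φ (-t) x)) t := fun x t =>
      hasDerivAt_comp_neg (hd x (-t))
    have := dist_le_of_trajectories_ODE (v := fun _ x => -F x) (K := K) (a := 0) (b := -t)
      (f := fun t => Φ (-t) x) (g := fun t => Φ (-t) y) (δ := ‖x - y‖) (fun _ => hF.neg)
      (fun u _ => (hd' x u).continuousAt.continuousWithinAt)
      (fun u _ => (hd' x u).hasDerivWithinAt)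
      (fun u _ => (hd' y u).continuousAt.continuousWithinAt)
      (fun u _ => (hd' y u).hasDerivWithinAt)
      (by simp [h0, dist_eq_norm]) (-t) ⟨by linarith, le_rfl⟩
    simpa [dist_eq_norm, abs_of_nonpos ht] using this

/-- Gronwall for `p h - p 0 - h • z`: it satisfies the linearised equation up to an error quadratic
in `p h - p 0`, which by Lipschitz dependence is of order `h²`. -/
theorem hasDerivAt_flow_of_nonneg {p v : ℝ → ℝ → E} {z : ℝ → E} {D : ℝ → E → E} {K L T : ℝ}
    (hT : 0 ≤ T) (hK : 0 ≤ K)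
    (hp : ∀ h, ∀ t ∈ Icc 0 T, HasDerivAt (p h) (v h t) t)
    (hlip : ∀ h, ∀ t ∈ Icc 0 T, ‖p h t - p 0 t‖ ≤ L * ‖p h 0 - p 0 0‖)
    (hD : ∀ t ∈ Icc 0 T, ∀ x, ‖D t x‖ ≤ K * ‖x‖)
    (hDsub : ∀ t ∈ Icc 0 T, ∀ x y (h : ℝ), D t (x - h • y) = D t x - h • D t y)
    (hq : ∀ h, ∀ t ∈ Icc 0 T, ‖v h t - v 0 t - D t (p h t - p 0 t)‖ ≤ K * ‖p h t - p 0 t‖ ^ 2)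
    (hz : ∀ t ∈ Icc 0 T, HasDerivAt z (D t (z t)) t)
    (h0 : HasDerivAt (fun h => p h 0) (z 0) 0) :
    HasDerivAt (fun h => p h T) (z T) 0 := by
  rw [hasDerivAt_iff_isLittleO]
  simp only [sub_zero]
  have hb : ∀ h, ‖p h T - p 0 T - h • z T‖ ≤
      Real.exp (K * T) * ‖p h 0 - p 0 0 - h • z 0‖ +
        K * L ^ 2 * ‖p h 0 - p 0 0‖ ^ 2 * (T * Real.exp (K * T)) := by
    intro h
    have hd : ∀ t ∈ Icc 0 T, HasDerivAt (fun t => p h t - p 0 t - h • z t)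
        (v h t - v 0 t - h • D t (z t)) t := fun t ht =>
      ((hp h t ht).sub (hp 0 t ht)).sub ((hz t ht).const_smul h)
    set ε := K * L ^ 2 * ‖p h 0 - p 0 0‖ ^ 2 with hε
    have hε0 : 0 ≤ ε := by positivity
    have := norm_le_gronwallBound_of_norm_deriv_right_le
      (f := fun t => p h t - p 0 t - h • z t) (a := 0) (b := T) (K := K)
      (δ := ‖p h 0 - p 0 0 - h • z 0‖) (ε := ε)
      (fun t ht => (hd t ht).continuousAt.continuousWithinAt)
      (fun t ht => (hd t (Ico_subset_Icc_self ht)).hasDerivWithinAt) le_rfl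
      (fun t ht => by
        have ht' := Ico_subset_Icc_self ht
        have e : v h t - v 0 t - h • D t (z t) =
            (v h t - v 0 t - D t (p h t - p 0 t)) + D t (p h t - p 0 t - h • z t) := by
          rw [hDsub t ht']; abel
        rw [e, add_comm (K * _)]
        refine (norm_add_le _ _).trans (add_le_add ((hq h t ht').trans ?_) (hD t ht' _))
        rw [hε, mul_assoc, ← mul_pow]
        exact mul_le_mul_of_nonneg_left (pow_le_pow_left₀ (norm_nonneg _) (hlip h t ht') 2) hK) T ⟨hT, le_rfl⟩
    refine this.trans ?_
    rw [sub_zero]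
    rcases hK.eq_or_lt with hK0 | hK0
    · rw [← hK0, gronwallBound_K0]
      simp only [zero_mul, Real.exp_zero, one_mul, mul_one, le_refl]
    · rw [gronwallBound_of_K_ne_0 hK0.ne', mul_comm (Real.exp _)]
      refine add_le_add le_rfl ?_
      have h1 : Real.exp (K * T) - 1 ≤ K * T * Real.exp (K * T) := by
        have := Real.add_one_le_exp (-(K * T))
        have e : Real.exp (-(K * T)) * Real.exp (K * T) = 1 := by
          rw [← Real.exp_add]; simp
        nlinarith [Real.exp_pos (K * T)]
      calc ε / K * (Real.exp (K * T) - 1) ≤ ε / K * (K * T * Real.exp (K * T)) := by gcongr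
        _ = ε * (T * Real.exp (K * T)) := by field_simp
  have h0' := hasDerivAt_iff_isLittleO.1 h0
  simp only [sub_zero] at h0'
  have hO : (fun h => p h 0 - p 0 0) =O[𝓝 0] fun h : ℝ => h := by
    simpa using h0.isBigO_sub
  have hO2 : (fun h => ‖p h 0 - p 0 0‖ ^ 2) =o[𝓝 0] fun h : ℝ => h := by
    have h1 := hO.norm_left.pow 2
    refine h1.trans_isLittleO ?_
    have := Asymptotics.isLittleO_pow_id (𝕜 := ℝ) (n := 2) (by norm_num)
    simpa using this
  have hsum : (fun h => Real.exp (K * T) * ‖p h 0 - p 0 0 - h • z 0‖ +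
        K * L ^ 2 * ‖p h 0 - p 0 0‖ ^ 2 * (T * Real.exp (K * T))) =o[𝓝 0] fun h : ℝ => h := by
    refine (h0'.norm_left.const_mul_left _).add ?_
    have := (hO2.const_mul_left (K * L ^ 2)).const_mul_left (T * Real.exp (K * T))
    refine this.congr_left fun h => by ring
  refine (Asymptotics.IsBigO.of_bound 1 (Eventually.of_forall fun h => ?_)).trans_isLittleO hsum
  rw [one_mul]
  exact (hb h).trans (le_abs_self _)

/-- Differentiable dependence on the initial data, along a differentiable curve of data. -/
theorem hasDerivAt_flow {p v : ℝ → ℝ → E} {z : ℝ → E} {D : ℝ → E →L[ℝ] E} {K L T : ℝ}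
    (hK : 0 ≤ K)
    (hp : ∀ h t, HasDerivAt (p h) (v h t) t)
    (hlip : ∀ h, ∀ t ∈ Icc (-|T|) |T|, ‖p h t - p 0 t‖ ≤ L * ‖p h 0 - p 0 0‖)
    (hD : ∀ t, ‖D t‖ ≤ K)
    (hq : ∀ h t, ‖v h t - v 0 t - D t (p h t - p 0 t)‖ ≤ K * ‖p h t - p 0 t‖ ^ 2)
    (hz : ∀ t, HasDerivAt z (D t (z t)) t)
    (h0 : HasDerivAt (fun h => p h 0) (z 0) 0) :
    HasDerivAt (fun h => p h T) (z T) 0 := by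
  have hD' : ∀ t x, ‖D t x‖ ≤ K * ‖x‖ := fun t x =>
    ((D t).le_opNorm x).trans (by gcongr; exact hD t)
  rcases le_total 0 T with hT | hT
  · refine hasDerivAt_flow_of_nonneg (L := L) (D := fun t => D t) hT hK (fun h t _ => hp h t)
      (fun h t ht => hlip h t ?_) (fun t _ => hD' t) (fun t _ x y h => by simp)
      (fun h t _ => hq h t) (fun t _ => hz t) h0
    rw [abs_of_nonneg hT]
    exact ⟨by linarith [ht.1], ht.2⟩
  -- Negative times by time reversal, which changes the sign of the linearised field.
  · have := hasDerivAt_flow_of_nonneg (L := L) (T := -T) (p := fun h t => p h (-t))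
      (v := fun h t => -v h (-t)) (z := fun t => z (-t)) (D := fun t x => -D (-t) x)
      (by linarith) hK (fun h t _ => hasDerivAt_comp_neg (hp h (-t)))
      (fun h t ht => by
        have := hlip h (-t) (by
          rw [abs_of_nonpos hT]
          exact ⟨by linarith [ht.2], by linarith [ht.1]⟩)
        simpa using this) (fun t _ x => by simpa using hD' (-t) x)
      (fun t _ x y h => by simp; abel)
      (fun h t _ => by
        have := hq h (-t)
        rw [← norm_neg]
        convert! this using 2
        abel) (fun t _ => hasDerivAt_comp_neg (hz (-t))) (by simpa using h0)
    simpa using this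

/-- The radial retraction onto the ball of radius `r`. -/
def retract (r : ℝ) (x : E) : E := (r / max r ‖x‖) • x

theorem retract_of_norm_le {r : ℝ} (hr : 0 < r) {x : E} (hx : ‖x‖ ≤ r) : retract r x = x := by
  rw [retract, max_eq_left hx, div_self hr.ne', one_smul]

theorem norm_retract_le {r : ℝ} (hr : 0 < r) (x : E) : ‖retract r x‖ ≤ r := by
  have : 0 < max r ‖x‖ := lt_max_of_lt_left hr
  rw [retract, norm_smul, Real.norm_of_nonneg (by positivity), div_mul_eq_mul_div,
    div_le_iff₀ this]
  gcongr
  exact le_max_right _ _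

/-- Change the point with the scaling factor fixed, and then the factor with the point fixed; each
change costs at most `‖x - y‖`. -/
theorem norm_retract_sub_le {r : ℝ} (hr : 0 < r) (x y : E) :
    ‖retract r x - retract r y‖ ≤ 2 * ‖x - y‖ := by
  set a := max r ‖x‖ with ha
  set b := max r ‖y‖ with hb
  have hap : 0 < a := lt_max_of_lt_left hr
  have hbp : 0 < b := lt_max_of_lt_left hr
  have e : retract r x - retract r y = (r / a) • (x - y) + (r / a - r / b) • y := by
    rw [retract, retract, smul_sub, sub_smul]; abel
  have h1 : r / a ≤ 1 := (div_le_one hap).2 (le_max_left _ _)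
  have hab : |b - a| ≤ ‖x - y‖ := by
    refine (abs_max_sub_max_le_max _ _ _ _).trans ?_
    rw [sub_self, abs_zero, max_eq_right (abs_nonneg _), norm_sub_rev]
    exact abs_norm_sub_norm_le _ _
  have h2 : |r / a - r / b| * ‖y‖ ≤ ‖x - y‖ := by
    have e2 : r / a - r / b = (r / a) * ((b - a) / b) := by field_simp
    rw [e2, abs_mul, abs_div (b - a), abs_of_pos hbp, abs_of_nonneg (by positivity : 0 ≤ r / a)]
    have h3 : ‖y‖ / b ≤ 1 := (div_le_one hbp).2 (le_max_right _ _)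
    calc r / a * (|b - a| / b) * ‖y‖ = (r / a) * |b - a| * (‖y‖ / b) := by ring
      _ ≤ 1 * ‖x - y‖ * 1 := by gcongr
      _ = ‖x - y‖ := by ring
  rw [e]
  refine (norm_add_le _ _).trans ?_
  rw [norm_smul, norm_smul, Real.norm_of_nonneg (by positivity : 0 ≤ r / a), Real.norm_eq_abs,
    two_mul]
  refine add_le_add ?_ h2
  calc r / a * ‖x - y‖ ≤ 1 * ‖x - y‖ := by gcongr
    _ = _ := one_mul _

end Ode

end

section

variable {G : Geometry} {σ σ' σ₁ σ₂ A s : ℝ}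

/-! ### Algebra of the product -/

theorem convConst_ne_zero (G : Geometry) : convConst G ≠ 0 := by
  cases G with
  | line =>
    simp only [convConst]
    exact_mod_cast (one_div_pos.2 (Real.sqrt_pos.2 (by positivity : 0 < 2 * Real.pi))).ne'
  | circle => exact one_ne_zero

theorem conj_convConst (G : Geometry) : starRingEnd ℂ (convConst G) = convConst G := by
  cases G with
  | line => simp only [convConst, Complex.conj_ofReal]
  | circle => simp [convConst]

/-- The convolution of the absolute values is itself dominated by a function of the Sobolev space.
In triple integrals it replaces an inner convolution and so justifies Fubini. -/
theorem exists_abs_conv {f g : ℝ → ℂ} (hk : IsKer G σ₁ σ₂ σ₁ A fun _ _ => convConst G)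
    (hf : Measurable f) (hg : Measurable g) (hf2 : sobSq G σ₁ f < ∞) (hg2 : sobSq G σ₂ g < ∞) :
    ∃ F : ℝ → ℂ, Measurable F ∧ sobSq G σ₁ F < ∞ ∧
      ∀ᵐ ξ ∂(freq G), ∫⁻ η, ‖f (ξ - η) * g η‖ₑ ∂(freq G) ≤ ‖F ξ‖ₑ := by
  have h := (kconv_lintegral_le hk hf hg).trans_lt
    (ENNReal.mul_lt_top ENNReal.ofReal_lt_top (ENNReal.mul_lt_top hf2 hg2))
  have hI := kconv_integrable hk hf hg hf2 hg2
  set T : ℝ → ℝ≥0∞ := fun ξ => ∫⁻ η, ‖convConst G * (f (ξ - η) * g η)‖ₑ ∂(freq G) with hT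
  have hTm : Measurable T :=
    Measurable.lintegral_prod_right'
      (f := fun p : ℝ × ℝ => ‖convConst G * (f (p.1 - p.2) * g p.2)‖ₑ) (by fun_prop)
  have hTF : ∀ᵐ ξ ∂(freq G), T ξ < ∞ := by
    filter_upwards [hI] with ξ hξ
    exact hξ.2
  have hTe : ∀ᵐ ξ ∂(freq G), ‖(((T ξ).toReal : ℝ) : ℂ)‖ₑ = T ξ := by
    filter_upwards [hTF] with ξ hξ
    rw [← ofReal_norm, Complex.norm_real, Real.norm_of_nonneg ENNReal.toReal_nonneg,
      ENNReal.ofReal_toReal hξ.ne]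
  refine ⟨fun ξ => (convConst G)⁻¹ * ((T ξ).toReal : ℝ), by fun_prop, ?_, ?_⟩
  · have e : sobSq G σ₁ (fun ξ => (convConst G)⁻¹ * ((T ξ).toReal : ℝ)) =
        ‖(convConst G)⁻¹‖ₑ ^ 2 * ∫⁻ ξ, (ENNReal.ofReal ((|ξ| + 1) ^ σ₁) * T ξ) ^ 2 ∂(freq G) := by
      rw [← lintegral_const_mul _ (by fun_prop)]
      refine lintegral_congr_ae ?_
      filter_upwards [hTe] with ξ hξ
      rw [enorm_mul, hξ]; ring
    rw [e]
    exact ENNReal.mul_lt_top (by simp) h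
  · filter_upwards [hTe] with ξ hξ
    rw [enorm_mul, hξ, hT]
    simp only
    rw [← lintegral_const_mul _ (by fun_prop)]
    refine le_of_eq (lintegral_congr fun η => ?_)
    rw [← enorm_mul, ← mul_assoc, inv_mul_cancel₀ (convConst_ne_zero G), one_mul]

/-- Fubini. Right-commutativity is the form of associativity that makes sense when `f` is only in
the low space: the middle product stays in `H^σ₁`. -/
theorem mul_right_comm_ae {f g h : ℝ → ℂ} (hk : IsKer G σ₁ σ₂ σ₁ A fun _ _ => convConst G)
    (hf : Measurable f) (hg : Measurable g) (hh : Measurable h) (hf2 : sobSq G σ₁ f < ∞)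
    (hg2 : sobSq G σ₂ g < ∞) (hh2 : sobSq G σ₂ h < ∞) :
    mul G (mul G f g) h =ᵐ[freq G] mul G (mul G f h) g := by
  obtain ⟨F, hF, hF2, hFb⟩ := exists_abs_conv hk hf hg hf2 hg2
  filter_upwards [kconv_integrable hk hF hh hF2 hh2, ae_ae_sub hFb] with ξ h1 h2
  have h1' : ∫⁻ η, ‖F (ξ - η) * h η‖ₑ ∂(freq G) < ∞ := by
    have := (h1.const_mul (convConst G)⁻¹).2
    refine lt_of_le_of_lt (le_of_eq (lintegral_congr fun η => ?_)) this
    simp only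
    rw [← mul_assoc, inv_mul_cancel₀ (convConst_ne_zero G), one_mul]
  have hint : Integrable (Function.uncurry fun η ζ => f (ξ - η - ζ) * g ζ * h η)
      ((freq G).prod (freq G)) := by
    have hm : Measurable (Function.uncurry fun η ζ => f (ξ - η - ζ) * g ζ * h η) := by
      unfold Function.uncurry; fun_prop
    refine ⟨hm.aestronglyMeasurable, ?_⟩
    rw [hasFiniteIntegral_iff_enorm, lintegral_prod _ (by fun_prop)]
    refine lt_of_le_of_lt (lintegral_mono_ae ?_) h1'
    filter_upwards [h2] with η hη
    simp only [Function.uncurry, enorm_mul _ (h η)]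
    rw [lintegral_mul_const _ (by fun_prop)]
    gcongr
  simp only [mul]
  have e1 : ∀ η, convConst G * (∫ ζ, f (ξ - η - ζ) * g ζ ∂(freq G)) * h η =
      convConst G * ∫ ζ, f (ξ - η - ζ) * g ζ * h η ∂(freq G) := fun η => by
    rw [integral_mul_const, mul_assoc]
  have e2 : ∀ η, convConst G * (∫ ζ, f (ξ - η - ζ) * h ζ ∂(freq G)) * g η =
      convConst G * ∫ ζ, f (ξ - ζ - η) * g η * h ζ ∂(freq G) := fun η => by
    rw [mul_assoc, ← integral_mul_const]
    congr 2
    ext ζ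
    rw [sub_right_comm]; ring
  simp only [e1, e2, integral_const_mul]
  rw [integral_integral_swap hint]

theorem mul_comm_ae (f g : ℝ → ℂ) : mul G f g =ᵐ[freq G] mul G g f := by
  filter_upwards [ae_measurePreserving_sub_left G] with ξ hξ
  simp only [mul]
  congr 1
  have hm : MeasurableEmbedding fun η : ℝ => ξ - η :=
    (MeasurableEquiv.subLeft ξ).measurableEmbedding
  rw [← hξ.integral_comp hm]
  refine integral_congr_ae (Eventually.of_forall fun η => ?_)
  simp only [sub_sub_cancel]
  ring

theorem conjF_mul (f g : ℝ → ℂ) : conjF (mul G f g) = mul G (conjF f) (conjF g) := by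
  ext ξ
  simp only [mul, conjF, map_mul, conj_convConst]
  congr 1
  rw [← integral_conj, ← (measurePreserving_neg_freq G).integral_comp
    (MeasurableEquiv.neg ℝ).measurableEmbedding]
  refine integral_congr_ae (Eventually.of_forall fun η => ?_)
  simp only [map_mul, neg_sub]
  congr 3
  ring

/-- Leibniz is `ξ = (ξ - η) + η` under the convolution; the two kernels ensure that both pieces
converge separately. -/
theorem dx_mul_ae {f g : ℝ → ℂ} (hk : IsKer G σ₁ σ₂ σ A fun _ _ => convConst G)
    (hk' : IsKer G (σ₁ + 1) (σ₂ - 1) σ' A fun _ _ => convConst G)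
    (hf : Measurable f) (hg : Measurable g) (hf2 : sobSq G (σ₁ + 1) f < ∞)
    (hg2 : sobSq G σ₂ g < ∞) :
    dx (mul G f g) =ᵐ[freq G] fun ξ => mul G (dx f) g ξ + mul G f (dx g) ξ := by
  have hdf : Measurable (dx f) := by unfold dx; fun_prop
  have hdg : Measurable (dx g) := by unfold dx; fun_prop
  have b1 : sobSq G σ₁ (dx f) < ∞ :=
    (sobSq_mult_le (isMult_dx σ₁) f).trans_lt (ENNReal.mul_lt_top ENNReal.ofReal_lt_top hf2)
  have b2 : sobSq G (σ₂ - 1) (dx g) < ∞ := by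
    have := isMult_dx (σ₂ - 1)
    rw [sub_add_cancel] at this
    exact (sobSq_mult_le this g).trans_lt (ENNReal.mul_lt_top ENNReal.ofReal_lt_top hg2)
  filter_upwards [kconv_integrable hk hdf hg b1 hg2, kconv_integrable hk' hf hdg hf2 b2]
    with ξ h1 h2
  have e : dx (mul G f g) ξ = Complex.I * (ξ : ℂ) *
      ∫ η, convConst G * (f (ξ - η) * g η) ∂(freq G) := by
    rw [dx, mul_eq_kconv, kconv]
  rw [e, mul_eq_kconv, mul_eq_kconv, kconv, kconv, ← integral_add h1 h2]
  simp only [dx]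
  rw [← integral_const_mul]
  refine integral_congr_ae (Eventually.of_forall fun η => ?_)
  simp only
  push_cast
  ring

/-- A frequency-support property of products. -/
theorem mul_supp {f g : ℝ → ℂ} {S P Q : ℝ → Prop} (hf : ∀ᵐ ξ ∂(freq G), P ξ → f ξ = 0)
    (hg : ∀ᵐ ξ ∂(freq G), Q ξ → g ξ = 0) (h : ∀ ξ, S ξ → ∀ η, P (ξ - η) ∨ Q η) :
    ∀ᵐ ξ ∂(freq G), S ξ → mul G f g ξ = 0 := by
  filter_upwards [ae_ae_sub hf] with ξ h1 hξ
  rw [mul, integral_eq_zero_of_ae, mul_zero]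
  filter_upwards [h1, hg] with η h2 h3
  rcases h ξ hξ η with h4 | h4
  · rw [h2 h4, zero_mul]; rfl
  · rw [h3 h4, mul_zero]; rfl

theorem dp_comm (f g : ℝ → ℂ) : dp G f g = dp G g f := by
  rw [dp, ← (measurePreserving_neg_freq G).integral_comp
    (MeasurableEquiv.neg ℝ).measurableEmbedding, dp]
  refine integral_congr_ae (Eventually.of_forall fun η => ?_)
  simp only [neg_neg]; ring

theorem dp_conjF (f g : ℝ → ℂ) : dp G (conjF f) (conjF g) = starRingEnd ℂ (dp G f g) := by
  rw [dp_comm, dp, dp, ← integral_conj]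
  refine integral_congr_ae (Eventually.of_forall fun η => ?_)
  simp only [conjF, neg_neg, map_mul]; ring

/-- `∫ a (q b) = ∫ q (a b)`. -/
theorem dp_tri_fun {q a b : ℝ → ℂ} (hk : IsKer G σ₁ σ₂ σ₁ A fun _ _ => convConst G)
    (h0 : 0 ≤ σ + σ₁) (hq : Measurable q) (ha : Measurable a) (hb : Measurable b)
    (hq2 : sobSq G σ₁ q < ∞) (ha2 : sobSq G σ a < ∞) (hb2 : sobSq G σ₂ b < ∞) :
    dp G a (mul G q b) = dp G q (mul G a b) := by
  obtain ⟨F, hF, hF2, hFb⟩ := exists_abs_conv hk hq hb hq2 hb2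
  have h1 : ∫⁻ ξ, ‖a (-ξ) * F ξ‖ₑ ∂(freq G) < ∞ := by
    have := (dp_lintegral_sq_le h0 ha hF).trans_lt (ENNReal.mul_lt_top ha2 hF2)
    by_contra hcon
    rw [not_lt, top_le_iff] at hcon
    rw [hcon] at this
    simp at this
  have hint : Integrable (Function.uncurry fun ξ η => a (-ξ) * (q (ξ - η) * b η))
      ((freq G).prod (freq G)) := by
    have hm : Measurable (Function.uncurry fun ξ η => a (-ξ) * (q (ξ - η) * b η)) := by
      unfold Function.uncurry; fun_prop
    refine ⟨hm.aestronglyMeasurable, ?_⟩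
    rw [hasFiniteIntegral_iff_enorm, lintegral_prod _ (by fun_prop)]
    refine lt_of_le_of_lt (lintegral_mono_ae ?_) h1
    filter_upwards [hFb] with ξ hξ
    simp only [Function.uncurry, enorm_mul (a (-ξ))]
    rw [lintegral_const_mul _ (by fun_prop)]
    gcongr
  have e1 : dp G a (mul G q b) =
      convConst G * ∫ ξ, ∫ η, a (-ξ) * (q (ξ - η) * b η) ∂(freq G) ∂(freq G) := by
    rw [dp, ← integral_const_mul]
    refine integral_congr_ae (Eventually.of_forall fun ξ => ?_)
    simp only [mul]
    rw [integral_const_mul]; ring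
  have hint2 : Integrable (Function.uncurry fun η ξ => a (-ξ) * (q (ξ - η) * b η))
      ((freq G).prod (freq G)) := hint.swap
  -- Substitution `ξ = η - ζ`.
  have hsub : ∀ᵐ η ∂(freq G), ∫ ξ, a (-ξ) * (q (ξ - η) * b η) ∂(freq G) =
      ∫ ζ, a (ζ - η) * (q (-ζ) * b η) ∂(freq G) := by
    filter_upwards [ae_measurePreserving_sub_left G] with η hη
    rw [← hη.integral_comp (MeasurableEquiv.subLeft η).measurableEmbedding]
    refine integral_congr_ae (Eventually.of_forall fun ζ => ?_)
    simp only [neg_sub]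
    congr 3
    ring
  have hint3 : Integrable (Function.uncurry fun η ζ => a (ζ - η) * (q (-ζ) * b η))
      ((freq G).prod (freq G)) := by
    have hm : Measurable (Function.uncurry fun η ζ => a (ζ - η) * (q (-ζ) * b η)) := by
      unfold Function.uncurry; fun_prop
    refine ⟨hm.aestronglyMeasurable, ?_⟩
    have := hint2.2
    rw [hasFiniteIntegral_iff_enorm, lintegral_prod _ (by fun_prop)] at this ⊢
    refine lt_of_le_of_lt (le_of_eq (lintegral_congr_ae ?_)) this
    filter_upwards [ae_measurePreserving_sub_left G] with η hη
    rw [← hη.lintegral_comp_emb (MeasurableEquiv.subLeft η).measurableEmbedding]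
    refine lintegral_congr fun ζ => ?_
    simp only [Function.uncurry, neg_sub]
    congr 4
    ring
  rw [e1, integral_integral_swap hint, integral_congr_ae hsub, integral_integral_swap hint3, dp,
    ← integral_const_mul]
  refine integral_congr_ae (Eventually.of_forall fun ξ => ?_)
  simp only [mul]
  rw [mul_left_comm, ← integral_const_mul (q (-ξ))]
  congr 2
  ext η; ring

/-! ### The same for elements of Sobolev spaces -/

section Calculus

variable [hs : Fact (s ∈ Ioo (-(1 / 2) : ℝ) 0)]

/-- The embedding `H^{s+1} → H^s`. -/
def emb1 (G : Geometry) (s : ℝ) : Hs G (s + 1) →L[ℂ] Hs G s := emb G (by linarith)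

theorem emb1_coe (a : Hs G (s + 1)) : (emb1 G s a : ℝ → ℂ) =ᵐ[freq G] a := emb_coe _ a

/-- The product `H^s × H^{s+1} → H^s`. -/
def low (q : Hs G s) (a : Hs G (s + 1)) : Hs G s := mulLow G hs.out q a

/-- The product of `H^{s+1}`. -/
def alg (a b : Hs G (s + 1)) : Hs G (s + 1) := mulAlg G half_lt_add_one a b

theorem low_coe (q : Hs G s) (a : Hs G (s + 1)) : (low q a : ℝ → ℂ) =ᵐ[freq G] mul G q a :=
  mulLow_coe _ _ _

theorem alg_coe (a b : Hs G (s + 1)) : (alg a b : ℝ → ℂ) =ᵐ[freq G] mul G a b :=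
  mulAlg_coe _ _ _

theorem add_low (q p : Hs G s) (a : Hs G (s + 1)) : low (q + p) a = low q a + low p a := by
  simp [low]
theorem sub_low (q p : Hs G s) (a : Hs G (s + 1)) : low (q - p) a = low q a - low p a := by
  simp [low]
theorem smul_low (c : ℂ) (q : Hs G s) (a : Hs G (s + 1)) : low (c • q) a = c • low q a := by
  simp [low]

theorem alg_comm (a b : Hs G (s + 1)) : alg a b = alg b a :=
  Hs_ext ((alg_coe a b).trans ((mul_comm_ae _ _).trans (alg_coe b a).symm))

theorem emb1_alg (a b : Hs G (s + 1)) : emb1 G s (alg a b) = low (emb1 G s a) b :=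
  Hs_ext ((emb1_coe _).trans ((alg_coe a b).trans (((low_coe _ _).trans
    (mul_congr (emb1_coe a) ae_eq_rfl)).symm)))

theorem low_low (q : Hs G s) (a b : Hs G (s + 1)) : low (low q a) b = low (low q b) a :=
  Hs_ext ((low_coe _ _).trans ((mul_congr (low_coe q a) ae_eq_rfl).trans
    ((mul_right_comm_ae (exists_isKer_mul_low G hs.out).choose_spec (measurable_coe q)
      (measurable_coe a) (measurable_coe b) (sobSq_lt_top q) (sobSq_lt_top a)
      (sobSq_lt_top b)).trans (((low_coe _ _).trans (mul_congr (low_coe q b) ae_eq_rfl)).symm))))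

theorem dx_alg (a b : Hs G (s + 1)) :
    dxL G s (alg a b) = low (dxL G s a) b + low (dxL G s b) a := by
  refine Hs_ext ((dxL_coe _).trans ?_)
  have h1 : dx (alg a b : Hs G (s + 1)) =ᵐ[freq G] dx (mul G a b) := by
    filter_upwards [alg_coe a b] with ξ h
    rw [dx, dx, h]
  have hk : IsKer G s (s + 1) s _ fun _ _ => convConst G :=
    (exists_isKer_mul_low G hs.out).choose_spec
  -- The kernel is constant, so exchanging the factors amounts to replacing `η` by `ξ - η` in the
  -- bound, which is symmetric under it.
  have hk' : IsKer G (s + 1) (s + 1 - 1) s (exists_isKer_mul_low G hs.out).choose fun _ _ => convConst G := by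
    have := hk
    rw [add_sub_cancel_right]
    refine ⟨hk.meas, hk.nonneg, ?_⟩
    obtain ⟨g, h1, h2, h3, h4⟩ := hk.bound
    refine ⟨g, h1, h2, h3, fun ξ η => ?_⟩
    have := h4 ξ (ξ - η)
    simp only [sub_sub_cancel] at this
    refine this.trans (le_of_eq ?_)
    ring
  refine h1.trans ((dx_mul_ae hk hk' (measurable_coe a) (measurable_coe b) (sobSq_lt_top a)
    (sobSq_lt_top b)).trans ?_)
  filter_upwards [coe_add_ae (low (dxL G s a) b) (low (dxL G s b) a), low_coe (dxL G s a) b,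
    low_coe (dxL G s b) a, mul_congr (dxL_coe a) (ae_eq_refl (b : ℝ → ℂ)),
    mul_congr (dxL_coe b) (ae_eq_refl (a : ℝ → ℂ)), mul_comm_ae (G := G) a (dx b)]
    with ξ h2 h3 h4 h5 h6 h7
  rw [h2, h3, h4, h5, h6, h7]

theorem conj_low (q : Hs G s) (a : Hs G (s + 1)) :
    conjL G s (low q a) = low (conjL G s q) (conjL G (s + 1) a) := by
  refine Hs_ext ((conjL_coe _).trans ((conjF_congr (low_coe q a)).trans ?_))
  rw [conjF_mul]
  exact ((low_coe _ _).trans (mul_congr (conjL_coe q) (conjL_coe a))).symm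

theorem conj_alg (a b : Hs G (s + 1)) :
    conjL G (s + 1) (alg a b) = alg (conjL G (s + 1) a) (conjL G (s + 1) b) := by
  refine Hs_ext ((conjL_coe _).trans ((conjF_congr (alg_coe a b)).trans ?_))
  rw [conjF_mul]
  exact ((alg_coe _ _).trans (mul_congr (conjL_coe a) (conjL_coe b))).symm

theorem conj_emb {σ σ' : ℝ} (h : σ' ≤ σ) (a : Hs G σ) :
    conjL G σ' (emb G h a) = emb G h (conjL G σ a) :=
  Hs_ext ((conjL_coe _).trans ((conjF_congr (emb_coe h a)).trans
    ((emb_coe h _).trans (conjL_coe a)).symm))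

theorem conj_dxL (a : Hs G (σ + 1)) : conjL G σ (dxL G σ a) = dxL G σ (conjL G (σ + 1) a) := by
  refine Hs_ext ((conjL_coe _).trans ((conjF_congr (dxL_coe a)).trans ?_))
  filter_upwards [dxL_coe (conjL G (σ + 1) a), conjL_coe a] with ξ h1 h2
  rw [h1, dx, h2]
  simp [conjF, dx]

theorem conjL_conjL (a : Hs G σ) : conjL G σ (conjL G σ a) = a := by
  refine Hs_ext ((conjL_coe _).trans ((conjF_congr (conjL_coe a)).trans ?_))
  exact Eventually.of_forall fun ξ => by simp [conjF]

theorem conj_smul (c : ℂ) (a : Hs G σ) :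
    conjL G σ (c • a) = (starRingEnd ℂ c) • conjL G σ a := by
  refine Hs_ext ((conjL_coe _).trans ((conjF_congr (coe_smul_ae c a)).trans ?_))
  filter_upwards [coe_smul_ae (starRingEnd ℂ c) (conjL G σ a), conjL_coe a] with ξ h1 h2
  rw [h1, h2]
  simp [conjF]

/-- The duality pairing `∫ a q` of `H^{s+1}` and `H^s`. -/
def du (a : Hs G (s + 1)) (q : Hs G s) : ℂ := dp G a q

theorem du_def (a : Hs G (s + 1)) (q : Hs G s) :
    du a q = dpL G (by linarith [zero_le_dual (s := s)]) a q := rfl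

theorem du_add (a : Hs G (s + 1)) (q p : Hs G s) : du a (q + p) = du a q + du a p := by
  simp only [du_def, map_add]
theorem du_sub (a : Hs G (s + 1)) (q p : Hs G s) : du a (q - p) = du a q - du a p := by
  simp only [du_def, map_sub]
theorem du_smul (a : Hs G (s + 1)) (c : ℂ) (q : Hs G s) : du a (c • q) = c * du a q := by
  simp only [du_def, map_smul, smul_eq_mul]
theorem add_du (a b : Hs G (s + 1)) (q : Hs G s) : du (a + b) q = du a q + du b q := by
  simp only [du_def, map_add, _root_.add_apply]
theorem sub_du (a b : Hs G (s + 1)) (q : Hs G s) : du (a - b) q = du a q - du b q := by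
  simp only [du_def, map_sub, _root_.sub_apply]

theorem du_conj (a : Hs G (s + 1)) (q : Hs G s) :
    du (conjL G (s + 1) a) (conjL G s q) = starRingEnd ℂ (du a q) := by
  rw [du, dp_congr (conjL_coe a) (conjL_coe q), dp_conjF, du]

theorem du_low (a b : Hs G (s + 1)) (q : Hs G s) : du a (low q b) = du (alg a b) q := by
  rw [du, dp_congr ae_eq_rfl (low_coe q b), dp_tri_fun
    (exists_isKer_mul_low G hs.out).choose_spec (by linarith [zero_le_dual (s := s)])
    (measurable_coe q) (measurable_coe a) (measurable_coe b) (sobSq_lt_top q) (sobSq_lt_top a)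
    (sobSq_lt_top b), dp_comm, du]
  exact dp_congr (alg_coe a b).symm ae_eq_rfl

theorem du_low_comm (a b : Hs G (s + 1)) (q : Hs G s) : du a (low q b) = du b (low q a) := by
  rw [du_low, du_low, alg_comm]

end Calculus

end

section

variable {G : Geometry} {σ κ ϰ s : ℝ}

/-! ### Identities for `m(κ; q)` -/

theorem isMult_neg (σ : ℝ) : IsMult σ σ 1 (indicator (Iio 0) fun _ => (1 : ℂ)) :=
  ⟨measurable_const.indicator measurableSet_Iio, zero_le_one, fun ξ => by
    rw [one_mul]
    refine mul_le_of_le_one_right (bracket_rpow_pos ξ σ).le ?_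
    by_cases h : ξ ∈ Iio (0 : ℝ)
    · simp [indicator_of_mem h]
    · simp [indicator_of_notMem h]⟩

/-- The projection to negative frequencies. -/
def negP (G : Geometry) (σ : ℝ) : Hs G σ →L[ℂ] Hs G σ := mlt G (isMult_neg σ)

theorem negP_coe (f : Hs G σ) :
    (negP G σ f : ℝ → ℂ) =ᵐ[freq G] fun ξ => (indicator (Iio 0) (fun _ => (1 : ℂ)) ξ) * f ξ :=
  mlt_coe _ f

theorem negP_supp (f : Hs G σ) : ∀ᵐ ξ ∂(freq G), 0 ≤ ξ → (negP G σ f : ℝ → ℂ) ξ = 0 := by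
  filter_upwards [negP_coe f] with ξ h hξ
  rw [h, indicator_of_notMem (by simpa using hξ), zero_mul]

theorem dp_im_eq_zero {f g : ℝ → ℂ} (h : ∀ᵐ ξ ∂(freq G), (f (-ξ) * g ξ).im = 0) :
    (dp G f g).im = 0 := by
  rw [← Complex.conj_eq_iff_im, dp, ← integral_conj]
  refine integral_congr_ae ?_
  filter_upwards [h] with ξ h
  exact Complex.conj_eq_iff_im.2 h

theorem convConst_im (G : Geometry) : (convConst G).im = 0 :=
  Complex.conj_eq_iff_im.1 (conj_convConst G)

theorem mul_im_eq_zero {z w : ℂ} (hz : z.im = 0) (hw : w.im = 0) : (z * w).im = 0 := by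
  simp [Complex.mul_im, hz, hw]

theorem conj_supp_nonneg {f : ℝ → ℂ} (h : ∀ᵐ ξ ∂(freq G), 0 ≤ ξ → f ξ = 0) :
    ∀ᵐ ξ ∂(freq G), ξ ≤ 0 → conjF f ξ = 0 := by
  filter_upwards [ae_neg h] with ξ h hξ
  rw [conjF, h (by linarith), map_zero]

theorem conj_supp_neg {f : ℝ → ℂ} (h : ∀ᵐ ξ ∂(freq G), ξ < 0 → f ξ = 0) :
    ∀ᵐ ξ ∂(freq G), 0 < ξ → conjF f ξ = 0 := by
  filter_upwards [ae_neg h] with ξ h hξ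
  rw [conjF, h (by linarith), map_zero]

theorem conj_resSym (κ ξ : ℝ) : starRingEnd ℂ (resSym κ ξ) = resSym κ ξ := by
  unfold resSym indicator; split_ifs
  · exact Complex.conj_ofReal _
  · exact map_zero _

variable [hs : Fact (s ∈ Ioo (-(1 / 2) : ℝ) 0)]

theorem du_dx (a b : Hs G (s + 1)) : du a (dxL G s b) = -du b (dxL G s a) := by
  rw [du, du, dp_congr ae_eq_rfl (dxL_coe b), dp_comm, dp_congr ae_eq_rfl (dxL_coe a), dp, dp,
    ← integral_neg]
  refine integral_congr_ae (Eventually.of_forall fun ξ => ?_)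
  simp only [dx]
  push_cast; ring

theorem mm_eq_res {q : Hs G s} (h : Good κ q) : mm κ q = res G s κ (q + low q (mm κ q)) := by
  conv_lhs => rw [mm_eq h]
  rw [map_add]; rfl

theorem mm_supp {q : Hs G s} (h : Good κ q) :
    ∀ᵐ ξ ∂(freq G), ξ < 0 → (mm κ q : ℝ → ℂ) ξ = 0 := by
  have := res_coe (κ := κ) (q + low q (mm κ q))
  rw [← mm_eq_res h] at this
  filter_upwards [this] with ξ h1 h2
  rw [h1, resSym_of_neg h2, zero_mul]

/-- The conjugate of `m`. -/
def mc (κ : ℝ) (q : Hs G s) : Hs G (s + 1) := conjL G (s + 1) (mm κ q)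

/-- The negative frequencies of `q (1 + m)`. -/
def rr (κ : ℝ) (q : Hs G s) : Hs G s := negP G s (q + low q (mm κ q))

/-- The conjugate of `rr`. -/
def rc (κ : ℝ) (q : Hs G s) : Hs G s := conjL G s (rr κ q)

theorem mc_supp {q : Hs G s} (h : Good κ q) :
    ∀ᵐ ξ ∂(freq G), 0 < ξ → (mc κ q : ℝ → ℂ) ξ = 0 := by
  filter_upwards [conjL_coe (mm κ q), conj_supp_neg (mm_supp h)] with ξ h1 h2 hξ
  rw [mc, h1, h2 hξ]

theorem rc_supp (κ : ℝ) (q : Hs G s) : ∀ᵐ ξ ∂(freq G), ξ ≤ 0 → (rc κ q : ℝ → ℂ) ξ = 0 := by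
  filter_upwards [conjL_coe (rr κ q), conj_supp_nonneg (negP_supp (q + low q (mm κ q)))]
    with ξ h1 h2 hξ
  rw [rc, h1, rr, h2 hξ]

/-- The gauge equation without the projection: `rr` restores the frequencies that `C₊` removes. -/
theorem dx_mm {q : Hs G s} (h : Good κ q) (hκ : 1 ≤ κ) :
    (-Complex.I) • dxL G s (mm κ q) =
      q + low q (mm κ q) - rr κ q - (κ : ℂ) • emb1 G s (mm κ q) := by
  set w := q + low q (mm κ q) with hw
  have hm := res_coe (κ := κ) w
  rw [← mm_eq_res h] at hm
  refine Hs_ext ?_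
  filter_upwards [coe_smul_ae (-Complex.I) (dxL G s (mm κ q)), dxL_coe (mm κ q), hm,
    coe_sub_ae (w - rr κ q) ((κ : ℂ) • emb1 G s (mm κ q)), coe_sub_ae w (rr κ q),
    coe_smul_ae (κ : ℂ) (emb1 G s (mm κ q)), emb1_coe (mm κ q), negP_coe w]
    with ξ h1 h2 h3 h4 h5 h6 h7 h8
  rw [h1, h2, h4, h5, h6, h7, rr, ← hw, h8, dx, h3]
  rcases lt_or_ge ξ 0 with hξ | hξ
  · rw [resSym_of_neg hξ, indicator_of_mem (by exact hξ)]; ring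
  · rw [indicator_of_notMem (by simpa using hξ)]
    linear_combination (w : ℝ → ℂ) ξ * resSym_of_nonneg hκ hξ -
      (ξ : ℂ) * resSym κ ξ * (w : ℝ → ℂ) ξ * Complex.I_sq

theorem dx_mc {q : Hs G s} (hq : IsReal q) (h : Good κ q) (hκ : 1 ≤ κ) :
    (-Complex.I) • dxL G s (mc κ q) =
      -(q + low q (mc κ q) - rc κ q - (κ : ℂ) • emb1 G s (mc κ q)) := by
  have := congrArg (conjL G s) (dx_mm h hκ)
  simp only [conj_smul, map_sub, map_add, conj_low, isReal_iff.1 hq, map_neg, Complex.conj_I,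
    neg_neg, conj_dxL, emb1, conj_emb, Complex.conj_ofReal] at this
  rw [neg_smul, mc, this]
  rfl

/-- Transposition replaces the symbol `φ(ξ)` by `φ(-ξ)`; for a real symbol this is conjugation of
the operator by complex conjugation. -/
theorem du_res (a b : Hs G s) :
    du (res G s κ a) b = du (conjL G (s + 1) (res G s κ (conjL G s b))) a := by
  rw [du, du, dp_congr (res_coe a) ae_eq_rfl, dp_comm]
  have : (conjL G (s + 1) (res G s κ (conjL G s b)) : ℝ → ℂ) =ᵐ[freq G]
      fun ξ => resSym κ (-ξ) * b ξ := by
    filter_upwards [conjL_coe (res G s κ (conjL G s b)),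
      conjF_congr (res_coe (κ := κ) (conjL G s b)), ae_neg (conjL_coe b)] with ξ h1 h2 h3
    rw [h1, h2, conjF, h3]
    simp [conjF, conj_resSym]
  rw [dp_congr this ae_eq_rfl, dp, dp]
  refine integral_congr_ae (Eventually.of_forall fun ξ => ?_)
  simp only [neg_neg]; ring

/-- The density `m + m̄ + |m|²`. -/
def Zf (κ : ℝ) (q : Hs G s) : Hs G (s + 1) := mm κ q + mc κ q + alg (mm κ q) (mc κ q)

theorem Zf_real (κ : ℝ) (q : Hs G s) : conjL G (s + 1) (Zf κ q) = Zf κ q := by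
  rw [Zf, map_add, map_add, conj_alg, mc, conjL_conjL, alg_comm, add_comm (conjL _ _ _)]

/-- With `R` the resolvent, `n = Dmm κ q f` equals `R F`, where `F = f + f m + q n`. Transposing `R`
and using the conjugate gauge equation gives `∫ n q = ∫ m̄ F - ∫ n q m̄`, and the terms in `q n`
cancel. Adding the direct variation `∫ m f` shows that the gradient of `β` is `m + m̄ + |m|²`. -/
theorem du_Dmm {q : Hs G s} (hq : IsReal q) (h : Good κ q) (f : Hs G s) :
    du (Dmm κ q f) q = du (mc κ q + alg (mm κ q) (mc κ q)) f := by
  have hq := isReal_iff.1 hq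
  set n := Dmm κ q f with hn
  set F := f + low f (mm κ q) + low q n with hF
  have hnF : n = res G s κ F := by
    have := gInv_eq h (res G s κ f + gT G s κ f (mm κ q))
    rw [← Dmm_apply, ← hn] at this
    rw [this, hF, map_add, map_add]; rfl
  have e1 : conjL G (s + 1) (res G s κ (conjL G s q)) =
      mc κ q - conjL G (s + 1) (res G s κ (conjL G s (low q (mc κ q)))) := by
    have := mm_eq_res h
    rw [map_add] at this
    rw [conj_low, hq, mc, conjL_conjL]
    conv_rhs => rw [this]
    rw [← map_sub, ← this, eq_sub_of_add_eq this.symm]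
  have e2 : du n q = du (mc κ q) F - du n (low q (mc κ q)) := by
    conv_lhs => rw [hnF, du_res, e1, sub_du, ← du_res, ← hnF]
  rw [e2, hF, du_add, du_add, du_low_comm (mc κ q) n, du_low, add_du, alg_comm]
  ring

/-- `β` is real: `∫ m̄ (q + q m) = ∫ (ξ + κ) |m̂|²` is real, and so is `∫ q |m|²`. -/
theorem du_mm_im {q : Hs G s} (hq : IsReal q) (h : Good κ q) (hκ : 1 ≤ κ) :
    (du (mm κ q) q).im = 0 := by
  have hq := isReal_iff.1 hq
  set w := q + low q (mm κ q) with hw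
  have hm := res_coe (κ := κ) w
  rw [← mm_eq_res h] at hm
  have h1 : (du (mc κ q) w).im = 0 := by
    refine dp_im_eq_zero ?_
    filter_upwards [ae_neg (conjL_coe (mm κ q)), hm] with ξ h1 h2
    rw [mc, h1, conjF, neg_neg, h2]
    rcases lt_or_ge ξ 0 with hξ | hξ
    · simp [resSym_of_neg hξ]
    · have h3 := resSym_of_nonneg hκ hξ
      have : (w : ℝ → ℂ) ξ = ((ξ : ℂ) + κ) * (resSym κ ξ * (w : ℝ → ℂ) ξ) := by
        rw [← mul_assoc, h3, one_mul]
      rw [← Complex.conj_eq_iff_im]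
      conv_rhs => rw [this]
      conv_lhs => rw [this]
      simp only [map_mul, map_add, Complex.conj_ofReal, Complex.conj_conj, conj_resSym]
      ring
  have h2 : (du (mc κ q) (low q (mm κ q))).im = 0 := by
    rw [← Complex.conj_eq_iff_im, du_low, ← du_conj, hq, conj_alg, mc, conjL_conjL, alg_comm]
  have h3 : du (mc κ q) q = starRingEnd ℂ (du (mm κ q) q) := by
    rw [← du_conj, hq, mc]
  rw [hw, du_add, Complex.add_im, h2, h3, Complex.conj_im] at h1
  linarith

theorem du_eq_zero_of_supp {a : Hs G (s + 1)} {b : Hs G s}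
    (ha : ∀ᵐ ξ ∂(freq G), ξ < 0 → (a : ℝ → ℂ) ξ = 0)
    (hb : ∀ᵐ ξ ∂(freq G), ξ ≤ 0 → (b : ℝ → ℂ) ξ = 0) : du a b = 0 := by
  rw [du, dp, integral_eq_zero_of_ae]
  filter_upwards [ae_neg ha, hb] with ξ h1 h2
  rcases le_or_gt ξ 0 with h | h
  · rw [h2 h, mul_zero]; rfl
  · rw [h1 (by linarith), zero_mul]; rfl

/-- Pair the equation of `m(κ)` with `m̄(ϰ)` and the conjugate equation of `m̄(ϰ)` with `m(κ)`. The
remainders `r` drop out by their supports, and what remains is `(κ - ϰ) ∫ m̄(ϰ) m(κ)` as a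
difference of real numbers. -/
theorem du_mc_mm_im {q : Hs G s} (hq : IsReal q) (h : Good κ q) (hκ : 1 ≤ κ) (h' : Good ϰ q)
    (hϰ : 1 ≤ ϰ) : (du (mc ϰ q) (emb1 G s (mm κ q))).im = 0 := by
  rcases eq_or_ne κ ϰ with rfl | hne
  · refine dp_im_eq_zero ?_
    filter_upwards [ae_neg (conjL_coe (mm κ q)), emb1_coe (mm κ q)] with ξ h1 h2
    rw [mc, h1, h2, conjF, neg_neg, ← Complex.conj_eq_iff_im]
    simp only [map_mul, Complex.conj_conj]; ring
  have hqc := isReal_iff.1 hq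
  have r1 : du (mc ϰ q) (rr κ q) = 0 := by
    have := du_eq_zero_of_supp (mm_supp h') (rc_supp κ q)
    have h2 := congrArg (starRingEnd ℂ) this
    rw [← du_conj, rc, conjL_conjL, map_zero] at h2
    exact h2
  have r2 : du (mm κ q) (rc ϰ q) = 0 := du_eq_zero_of_supp (mm_supp h) (rc_supp ϰ q)
  have e1 := congrArg (du (mc ϰ q)) (dx_mm h hκ)
  have e2 := congrArg (du (mm κ q)) (dx_mc hq h' hϰ)
  rw [← neg_one_smul ℂ (_ - _)] at e2
  simp only [du_smul, du_sub, du_add] at e1 e2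
  rw [r1] at e1
  rw [r2, du_dx, du_low_comm (mm κ q)] at e2
  have e3 : du (mm κ q) (emb1 G s (mc ϰ q)) = du (mc ϰ q) (emb1 G s (mm κ q)) := by
    rw [du, du, dp_congr ae_eq_rfl (emb1_coe _), dp_comm]
    exact dp_congr ae_eq_rfl (emb1_coe _).symm
  have e4 : du (mc ϰ q) q = starRingEnd ℂ (du (mm ϰ q) q) := by
    rw [← du_conj, hqc, mc]
  have e5 : ((κ - ϰ : ℝ) : ℂ) * du (mc ϰ q) (emb1 G s (mm κ q)) =
      starRingEnd ℂ (du (mm ϰ q) q) - du (mm κ q) q := by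
    rw [← e4]; push_cast
    rw [e3] at e2
    linear_combination e1 + e2
  have e6 := congrArg Complex.im e5
  rw [Complex.im_ofReal_mul, Complex.sub_im, Complex.conj_im, du_mm_im hq h hκ,
    du_mm_im hq h' hϰ, neg_zero, sub_zero] at e6
  exact (mul_eq_zero.1 e6).resolve_left (sub_ne_zero.2 hne)

theorem mul_zero_eq_dp (f g : ℝ → ℂ) : mul G f g 0 = convConst G * dp G f g := by
  simp only [mul, dp, zero_sub]

/-- Frequency zero has positive mass on the circle only. There `m̂(0)` is `(∫ q + ∫ q m) / κ`, which
is real. -/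
theorem mm_zero_im {q : Hs G s} (hq : IsReal q) (h : Good κ q) (hκ : 1 ≤ κ) :
    ∀ᵐ ξ ∂(freq G), ξ = 0 → ((mm κ q : ℝ → ℂ) ξ).im = 0 := by
  have hm := res_coe (κ := κ) (q + low q (mm κ q))
  rw [← mm_eq_res h] at hm
  filter_upwards [hm, coe_add_ae q (low q (mm κ q)), low_coe q (mm κ q), hq] with ξ h1 h2 h3 h4 h0
  subst h0
  rw [h1, h2, h3, mul_zero_eq_dp, dp_comm]
  rw [neg_zero] at h4
  refine mul_im_eq_zero (Complex.conj_eq_iff_im.1 (conj_resSym _ _)) ?_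
  have e := du_mm_im hq h hκ
  rw [du] at e
  rw [Complex.add_im, Complex.conj_eq_iff_im.1 h4.symm,
    mul_im_eq_zero (convConst_im G) e, add_zero]

/-- Both functions have nonnegative frequencies, so only frequency zero contributes. -/
theorem du_mm_mm_im {q : Hs G s} (hq : IsReal q) (h : Good κ q) (hκ : 1 ≤ κ) (h' : Good ϰ q)
    (hϰ : 1 ≤ ϰ) : (du (mm ϰ q) (emb1 G s (mm κ q))).im = 0 := by
  refine dp_im_eq_zero ?_
  filter_upwards [emb1_coe (mm κ q), mm_supp h, ae_neg (mm_supp h'), mm_zero_im hq h hκ,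
    ae_neg (mm_zero_im hq h' hϰ)] with ξ h1 h2 h3 h4 h5
  rw [h1]
  rcases lt_trichotomy ξ 0 with h0 | h0 | h0
  · rw [h2 h0, mul_zero, Complex.zero_im]
  · exact mul_im_eq_zero (h5 (by linarith)) (h4 h0)
  · rw [h3 (by linarith), zero_mul, Complex.zero_im]

/-- The auxiliary function `r̄(κ) + r̄(κ) m(ϰ) - κ m(ϰ)`. -/
def Bf (κ ϰ : ℝ) (q : Hs G s) : Hs G s :=
  rc κ q + low (rc κ q) (mm ϰ q) - (κ : ℂ) • emb1 G s (mm ϰ q)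

theorem low_rc_supp (κ : ℝ) {q : Hs G s} (h : Good ϰ q) :
    ∀ᵐ ξ ∂(freq G), ξ ≤ 0 → (rc κ q + low (rc κ q) (mm ϰ q) : Hs G s) ξ = 0 := by
  filter_upwards [coe_add_ae (rc κ q) (low (rc κ q) (mm ϰ q)), rc_supp κ q,
    low_coe (rc κ q) (mm ϰ q), mul_supp (S := fun ξ => ξ ≤ 0) (rc_supp κ q) (mm_supp h)
      (fun ξ hξ η => by
        by_contra! hc
        linarith [hc.1, hc.2])] with ξ h1 h2 h3 h4 hξ
  rw [h1, h2 hξ, h3, h4 hξ, add_zero]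

/-- The part `r̄ (1 + m)` of `Bf` has positive frequencies only and pairs to zero with `m(μ)`. -/
theorem du_mm_Bf_im {μ : ℝ} {q : Hs G s} (hq : IsReal q) (h : Good ϰ q) (hϰ : 1 ≤ ϰ)
    (h' : Good μ q) (hμ : 1 ≤ μ) : (du (mm μ q) (Bf κ ϰ q)).im = 0 := by
  rw [Bf, du_sub, du_eq_zero_of_supp (mm_supp h') (low_rc_supp κ h), du_smul, Complex.sub_im,
    Complex.im_ofReal_mul, du_mm_mm_im hq h hϰ h' hμ]
  simp

/-- The auxiliary function `m̄(κ) + m(ϰ) + m̄(κ) m(ϰ)`. -/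
def gf (κ ϰ : ℝ) (q : Hs G s) : Hs G (s + 1) := mc κ q + mm ϰ q + alg (mc κ q) (mm ϰ q)

/-- The last bracket has no positive frequencies, so there `Bf` is the real multiple `ξ + ϰ - κ` of
`gf`. -/
theorem Bf_eq {q : Hs G s} (hq : IsReal q) (h : Good κ q) (hκ : 1 ≤ κ) (h' : Good ϰ q)
    (hϰ : 1 ≤ ϰ) :
    Bf κ ϰ q = (-Complex.I) • dxL G s (gf κ ϰ q) + ((ϰ : ℂ) - κ) • emb1 G s (gf κ ϰ q) +
      (rr ϰ q + low (rr ϰ q) (mc κ q) - (ϰ : ℂ) • emb1 G s (mc κ q)) := by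
  have e1 := dx_mm h' hϰ
  have e2 := dx_mc hq h hκ
  have e : (-Complex.I) • dxL G s (gf κ ϰ q) =
      (-Complex.I) • dxL G s (mc κ q) + (-Complex.I) • dxL G s (mm ϰ q) +
      (low ((-Complex.I) • dxL G s (mc κ q)) (mm ϰ q) +
        low ((-Complex.I) • dxL G s (mm ϰ q)) (mc κ q)) := by
    rw [gf, map_add, map_add, dx_alg, smul_low, smul_low]; module
  rw [e, e1, e2, ← neg_one_smul ℂ (_ - _)]
  simp only [smul_low, sub_low, add_low, gf, Bf, map_add]
  rw [low_low q (mm ϰ q), ← emb1_alg, ← emb1_alg, alg_comm (mm ϰ q)]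
  module

/-- The integrand is real at almost every frequency: for `ξ > 0` it is `(ξ + ϰ - κ) |ĝ|²` by
`Bf_eq`, for `ξ < 0` it vanishes, and at `ξ = 0` both factors are real. -/
theorem du_gf_Bf_im {q : Hs G s} (hq : IsReal q) (h : Good κ q) (hκ : 1 ≤ κ) (h' : Good ϰ q)
    (hϰ : 1 ≤ ϰ) : (du (conjL G (s + 1) (gf κ ϰ q)) (Bf κ ϰ q)).im = 0 := by
  set g := gf κ ϰ q with hg
  set D := rr ϰ q + low (rr ϰ q) (mc κ q) with hD
  have hDs : ∀ᵐ ξ ∂(freq G), 0 ≤ ξ → (D : ℝ → ℂ) ξ = 0 := by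
    filter_upwards [coe_add_ae (rr ϰ q) (low (rr ϰ q) (mc κ q)), negP_supp (q + low q (mm ϰ q)),
      low_coe (rr ϰ q) (mc κ q), mul_supp (S := fun ξ => 0 ≤ ξ)
        (negP_supp (q + low q (mm ϰ q))) (mc_supp h) (fun ξ hξ η => by
          by_contra! hc
          linarith [hc.1, hc.2])] with ξ h1 h2 h3 h4 hξ
    rw [hD, h1, h3]
    exact (congrArg₂ (· + ·) (h2 hξ) (h4 hξ)).trans (add_zero _)
  have hg0 : ∀ᵐ ξ ∂(freq G), ξ = 0 → ((g : ℝ → ℂ) ξ).im = 0 := by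
    filter_upwards [coe_add_ae (mc κ q + mm ϰ q) (alg (mc κ q) (mm ϰ q)),
      coe_add_ae (mc κ q) (mm ϰ q), alg_coe (mc κ q) (mm ϰ q), conjL_coe (mm κ q),
      mm_zero_im hq h' hϰ, ae_neg (mm_zero_im hq h hκ)] with ξ h1 h2 h3 h4 h5 h6 h0
    subst h0
    have e : (mc κ q : ℝ → ℂ) 0 = starRingEnd ℂ ((mm κ q : ℝ → ℂ) (-0)) := h4
    have e2 : (dp G (mc κ q) (mm ϰ q)).im = 0 := by
      have := du_mc_mm_im hq h' hϰ h hκ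
      rwa [du, dp_congr ae_eq_rfl (emb1_coe _)] at this
    rw [hg, gf, h1, h2, h3, mul_zero_eq_dp, Complex.add_im, Complex.add_im,
      mul_im_eq_zero (convConst_im G) e2, h5 rfl, e, Complex.conj_im, h6 (neg_zero)]
    simp
  refine dp_im_eq_zero ?_
  have hB := Bf_eq hq h hκ h' hϰ
  rw [← hg, ← hD] at hB
  filter_upwards [ae_neg (conjL_coe g), hDs, hg0, low_rc_supp κ h',
    coe_sub_ae (rc κ q + low (rc κ q) (mm ϰ q)) ((κ : ℂ) • emb1 G s (mm ϰ q)),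
    coe_smul_ae (κ : ℂ) (emb1 G s (mm ϰ q)), emb1_coe (mm ϰ q), mm_supp h', mm_zero_im hq h' hϰ,
    coe_add_ae ((-Complex.I) • dxL G s g + ((ϰ : ℂ) - κ) • emb1 G s g)
      (D - (ϰ : ℂ) • emb1 G s (mc κ q)),
    coe_add_ae ((-Complex.I) • dxL G s g) (((ϰ : ℂ) - κ) • emb1 G s g),
    coe_smul_ae (-Complex.I) (dxL G s g), dxL_coe g, coe_smul_ae ((ϰ : ℂ) - κ) (emb1 G s g),
    emb1_coe g, coe_sub_ae D ((ϰ : ℂ) • emb1 G s (mc κ q)),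
    coe_smul_ae (ϰ : ℂ) (emb1 G s (mc κ q)), emb1_coe (mc κ q), mc_supp h]
    with ξ a1 a2 a3 a4 a5 a6 a7 a8 a9 b1 b2 b3 b4 b5 b6 b7 b8 b9 c1
  have eB : (Bf κ ϰ q : ℝ → ℂ) ξ = (rc κ q + low (rc κ q) (mm ϰ q) : Hs G s) ξ -
      κ * (mm ϰ q : ℝ → ℂ) ξ := by rw [Bf, a5, a6, a7]
  rw [a1, conjF, neg_neg]
  rcases lt_trichotomy ξ 0 with h0 | h0 | h0
  · rw [eB, a4 h0.le, a8 h0]; simp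
  · rw [eB, a4 h0.le]
    refine mul_im_eq_zero ?_ ?_
    · rw [Complex.conj_im, a3 h0, neg_zero]
    · rw [Complex.sub_im, Complex.im_ofReal_mul, a9 h0]; simp
  · have eB2 : (Bf κ ϰ q : ℝ → ℂ) ξ = ((ξ + ϰ - κ : ℝ) : ℂ) * (g : ℝ → ℂ) ξ := by
      rw [hB, b1, b2, b3, b4, b5, b6, b7, b8, b9, c1 h0, a2 h0.le, dx]
      push_cast
      linear_combination -(ξ : ℂ) * (g : ℝ → ℂ) ξ * Complex.I_sq
    rw [eB2, ← Complex.conj_eq_iff_im]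
    simp only [map_mul, Complex.conj_conj, Complex.conj_ofReal]
    ring

/-- Since `Z` is real, this reduces the vanishing of `∫ Z(ϰ) Z(κ)'` to the reality of `∫ Z(ϰ) B`,
where `B = r̄ (1 + m) - κ m`. -/
theorem dx_Zf {q : Hs G s} (hq : IsReal q) (h : Good κ q) (hκ : 1 ≤ κ) :
    (-Complex.I) • dxL G s (Zf κ q) = Bf κ κ q - conjL G s (Bf κ κ q) := by
  have e1 := dx_mm h hκ
  have e2 := dx_mc hq h hκ
  have e : (-Complex.I) • dxL G s (Zf κ q) =
      (-Complex.I) • dxL G s (mm κ q) + (-Complex.I) • dxL G s (mc κ q) +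
      (low ((-Complex.I) • dxL G s (mm κ q)) (mc κ q) +
        low ((-Complex.I) • dxL G s (mc κ q)) (mm κ q)) := by
    rw [Zf, map_add, map_add, dx_alg, smul_low, smul_low]; module
  have eB : conjL G s (Bf κ κ q) =
      rr κ q + low (rr κ q) (mc κ q) - (κ : ℂ) • emb1 G s (mc κ q) := by
    rw [Bf, map_sub, map_add, conj_low, conj_smul, Complex.conj_ofReal, rc, conjL_conjL, emb1,
      conj_emb, mc]
  rw [e, e1, e2, eB, ← neg_one_smul ℂ (_ - _)]
  simp only [smul_low, sub_low, add_low, Bf]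
  rw [low_low q (mm κ q), ← emb1_alg, ← emb1_alg, alg_comm (mm κ q)]
  module

/-- The densities `Z(ϰ)` and `Z(κ)` Poisson commute. -/
theorem du_Zf_dx_Zf {q : Hs G s} (hq : IsReal q) (h : Good κ q) (hκ : 1 ≤ κ) (h' : Good ϰ q)
    (hϰ : 1 ≤ ϰ) : du (Zf ϰ q) (dxL G s (Zf κ q)) = 0 := by
  have him : (du (Zf ϰ q) (Bf κ κ q)).im = 0 := by
    -- The product `r̄(κ) (1 + m(κ)) (1 + m(ϰ))` can be read in two ways; this exchanges the roles
    -- of `m(κ)` and `m(ϰ)` up to an explicit multiple of their difference.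
    have e1 : Bf κ κ q + low (Bf κ κ q) (mm ϰ q) = Bf κ ϰ q + low (Bf κ ϰ q) (mm κ q) +
        (κ : ℂ) • (emb1 G s (mm ϰ q) - emb1 G s (mm κ q)) := by
      simp only [Bf, sub_low, add_low, smul_low]
      rw [low_low (rc κ q) (mm κ q), ← emb1_alg, ← emb1_alg, alg_comm (mm κ q)]
      module
    have e2 : mc ϰ q + alg (mc ϰ q) (mm κ q) = conjL G (s + 1) (gf κ ϰ q) - mm κ q := by
      rw [gf, map_add, map_add, conj_alg, mc, mc, conjL_conjL, alg_comm]; abel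
    have e3 : du (Zf ϰ q) (Bf κ κ q) = du (mm ϰ q) (Bf κ κ q) +
        (du (conjL G (s + 1) (gf κ ϰ q)) (Bf κ ϰ q) - du (mm κ q) (Bf κ ϰ q) +
          κ * (du (mc ϰ q) (emb1 G s (mm ϰ q)) - du (mc ϰ q) (emb1 G s (mm κ q)))) := by
      rw [Zf, add_du, add_du, alg_comm, ← du_low, add_assoc, ← du_add, e1, du_add, du_smul, du_sub,
        du_add, du_low, ← add_du, e2, sub_du]
    rw [e3, Complex.add_im, Complex.add_im, Complex.sub_im, Complex.im_ofReal_mul, Complex.sub_im,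
      du_mm_Bf_im hq h hκ h' hϰ, du_gf_Bf_im hq h hκ h' hϰ, du_mm_Bf_im hq h' hϰ h hκ,
      du_mc_mm_im hq h' hϰ h' hϰ, du_mc_mm_im hq h hκ h' hϰ]
    simp
  have e := congrArg (du (Zf ϰ q)) (dx_Zf hq h hκ)
  have e4 : du (Zf ϰ q) (conjL G s (Bf κ κ q)) = du (Zf ϰ q) (Bf κ κ q) := by
    conv_lhs => rw [← Zf_real, du_conj]
    exact Complex.conj_eq_iff_im.2 him
  rw [du_smul, du_sub, e4, sub_self] at e
  exact (mul_eq_zero.1 e).resolve_left (by simp)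

end

section

variable {G : Geometry} {σ σ' κ ϰ s : ℝ}

theorem dp_tr (h : ℝ) (f : Hs G σ) (g : Hs G σ') : dp G (tr G σ h f) (tr G σ' h g) = dp G f g := by
  rw [dp_congr (tr_coe h f) (tr_coe h g), dp, dp]
  refine integral_congr_ae (Eventually.of_forall fun ξ => ?_)
  simp only
  have : Complex.exp (Complex.I * ((-ξ : ℝ) : ℂ) * h) * Complex.exp (Complex.I * (ξ : ℂ) * h) =
      1 := by
    rw [← Complex.exp_add]; push_cast; ring_nf; exact Complex.exp_zero
  linear_combination (f : ℝ → ℂ) (-ξ) * (g : ℝ → ℂ) ξ * this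

/-! ### The mean -/

theorem isReal_mean {f : ℝ → ℂ} (hf : ∀ᵐ ξ ∂(freq G), f (-ξ) = starRingEnd ℂ (f ξ)) :
    (((mean G f).re : ℝ) : ℂ) = mean G f := by
  cases G with
  | line => simp [mean]
  | circle =>
    have := ae_freq_circle.1 hf 0
    simp only [Int.cast_zero, mul_zero, neg_zero] at this
    exact Complex.conj_eq_iff_re.1 this.symm

theorem mean_congr {f g : ℝ → ℂ} (h : f =ᵐ[freq G] g) : mean G f = mean G g := by
  cases G with
  | line => rfl
  | circle =>
    have := ae_freq_circle.1 h 0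
    simpa [mean] using this

theorem mean_eq_zero {f : ℝ → ℂ} (h : ∀ᵐ ξ ∂(freq G), ξ = 0 → f ξ = 0) : mean G f = 0 := by
  cases G with
  | line => rfl
  | circle =>
    have := ae_freq_circle.1 h 0
    simpa [mean] using this

theorem sobSq_single_lt_top (G : Geometry) (σ : ℝ) :
    sobSq G σ (indicator {0} fun _ => (1 : ℂ)) < ∞ := by
  have e : ∀ ξ : ℝ, (ENNReal.ofReal ((|ξ| + 1) ^ σ) *
      ‖indicator {0} (fun _ => (1 : ℂ)) ξ‖ₑ) ^ 2 = indicator {0} (fun _ => (1 : ℝ≥0∞)) ξ := by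
    intro ξ
    by_cases h : ξ = 0
    · subst h; simp
    · simp [h]
  rw [sobSq, lintegral_congr e, lintegral_indicator_const (measurableSet_singleton 0), one_mul]
  cases G with
  | line => simp [freq]
  | circle =>
    have : ∀ i : ℤ, Measure.dirac (2 * Real.pi * (i : ℝ)) {(0 : ℝ)} =
        if i = 0 then 1 else 0 := by
      intro i
      rw [Measure.dirac_apply]
      split_ifs with h
      · simp [h]
      · simp [h, Real.pi_ne_zero]
    rw [freq, Measure.sum_apply _ (measurableSet_singleton 0)]
    simp [this]

/-- The frequency zero mode. -/
def zeroMode (G : Geometry) (σ : ℝ) : Hs G σ :=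
  ofFun (indicator {0} fun _ => 1) (measurable_const.indicator (measurableSet_singleton 0))
    (sobSq_single_lt_top G σ)

/-- On the line the zero mode is a null function, which agrees with the convention that `mean` is
zero there. The mean thus becomes a bounded functional in both settings. -/
theorem dp_zeroMode (f : ℝ → ℂ) : dp G (zeroMode G σ) f = mean G f := by
  rw [zeroMode, dp_congr (ofFun_coe _ _) ae_eq_rfl, dp]
  have e : ∀ ξ : ℝ, indicator {0} (fun _ => (1 : ℂ)) (-ξ) * f ξ =
      indicator {0} f ξ := by
    intro ξ
    by_cases h : ξ = 0 <;> simp [h]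
  simp only [e]
  rw [integral_indicator (measurableSet_singleton 0)]
  cases G with
  | line => simp [freq, mean]
  | circle =>
    have hr : (freq .circle).restrict {(0 : ℝ)} = Measure.dirac 0 := by
      ext A hA
      rw [Measure.restrict_apply hA, freq, Measure.sum_apply _ (hA.inter
        (measurableSet_singleton 0)), tsum_eq_single 0]
      · by_cases h0 : (0 : ℝ) ∈ A <;> simp [h0]
      · intro i hi
        rw [Measure.dirac_apply, indicator_of_notMem]
        simp [hi, Real.pi_ne_zero]
    rw [hr, integral_dirac, mean]

/-- The mean, as a functional on `H^σ`. -/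
def meanL (G : Geometry) (σ : ℝ) : Hs G σ →L[ℂ] ℂ :=
  dpL G (σ := -σ) (by simp) (zeroMode G (-σ))

theorem meanL_apply (f : Hs G σ) : meanL G σ f = mean G f := dp_zeroMode _

/-! ### The vector field -/

/-- `∂ₓ` as an operator `H^σ → H^{σ-1}`. -/
theorem isMult_dxD (σ : ℝ) : IsMult σ (σ - 1) 1 fun ξ => Complex.I * (ξ : ℂ) := by
  have := isMult_dx (σ - 1)
  rwa [sub_add_cancel] at this

def dxD (G : Geometry) (σ : ℝ) : Hs G σ →L[ℂ] Hs G (σ - 1) := mlt G (isMult_dxD σ)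

theorem dxD_coe (f : Hs G σ) : (dxD G σ f : ℝ → ℂ) =ᵐ[freq G] dx f := mlt_coe _ f

variable [hs : Fact (s ∈ Ioo (-(1 / 2) : ℝ) 0)]

theorem Adm.isGood {r : ℝ} (h : Adm G s κ r) {q : Hs G s} (hq : ‖q‖ ≤ r) : Good κ q ∧ 1 ≤ κ :=
  ⟨h.good hq, h.one_le⟩

/-- The vector field `-κ² (m + m̄ + |m|²)'`. -/
def Yf (κ : ℝ) (q : Hs G s) : Hs G s := (-(κ ^ 2)) • dxL G s (Zf κ q)

theorem conj_real_smul (c : ℝ) (f : Hs G σ) : conjL G σ (c • f) = c • conjL G σ f :=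
  map_smul _ _ _

theorem Yf_real (κ : ℝ) (q : Hs G s) : conjL G s (Yf κ q) = Yf κ q := by
  rw [Yf, conj_real_smul, conj_dxL, Zf_real]

/-- The derivative of `Zf`. -/
def DZf (κ : ℝ) (y : Hs G s) : Hs G s →L[ℝ] Hs G (s + 1) :=
  let D : Hs G s →L[ℝ] Hs G (s + 1) := (Dmm κ y).restrictScalars ℝ
  D + (conjL G (s + 1)).comp D +
    (((mulAlg G half_lt_add_one).flip (mc κ y)).restrictScalars ℝ).comp D +
    ((mulAlg G half_lt_add_one (mm κ y)).restrictScalars ℝ).comp ((conjL G (s + 1)).comp D)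

theorem DZf_apply (κ : ℝ) (y f : Hs G s) : DZf κ y f =
    Dmm κ y f + conjL G (s + 1) (Dmm κ y f) + alg (Dmm κ y f) (mc κ y) +
      alg (mm κ y) (conjL G (s + 1) (Dmm κ y f)) := rfl

/-- The derivative of `Yf`. -/
def DYf (κ : ℝ) (y : Hs G s) : Hs G s →L[ℝ] Hs G s :=
  (-(κ ^ 2)) • ((dxL G s).restrictScalars ℝ).comp (DZf κ y)

theorem DYf_apply (κ : ℝ) (y f : Hs G s) : DYf κ y f = (-(κ ^ 2)) • dxL G s (DZf κ y f) := rfl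

theorem alg_norm_le (a b : Hs G (s + 1)) :
    ‖alg a b‖ ≤ ‖mulAlg G (half_lt_add_one (s := s))‖ * ‖a‖ * ‖b‖ :=
  (mulAlg G half_lt_add_one).le_opNorm₂ a b

theorem conj_mm (x : Hs G s) : conjL G (s + 1) (mm κ x) = mc κ x := rfl

theorem mc_sub (x y : Hs G s) : mc κ x - mc κ y = conjL G (s + 1) (mm κ x - mm κ y) := by
  rw [mc, mc, map_sub]

theorem dxL_norm_le (a : Hs G (σ + 1)) : ‖dxL G σ a‖ ≤ ‖a‖ := by
  have := mlt_norm_le (G := G) (isMult_dx σ) a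
  rwa [one_mul] at this

theorem sub_alg (a b c : Hs G (s + 1)) : alg (a - b) c = alg a c - alg b c := by simp [alg]
theorem alg_sub (a b c : Hs G (s + 1)) : alg a (b - c) = alg a b - alg a c := by simp [alg]

theorem exists_Zf_bounds {r : ℝ} (h : Adm G s κ r) : ∃ K : ℝ, 0 ≤ K ∧
    (∀ x : Hs G s, ‖x‖ ≤ r → ‖Zf κ x‖ ≤ K) ∧
    (∀ x y : Hs G s, ‖x‖ ≤ r → ‖y‖ ≤ r → ‖Zf κ x - Zf κ y‖ ≤ K * ‖x - y‖) ∧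
    (∀ y f : Hs G s, ‖y‖ ≤ r → ‖DZf κ y f‖ ≤ K * ‖f‖) ∧
    (∀ x y : Hs G s, ‖x‖ ≤ r → ‖y‖ ≤ r →
      ‖Zf κ x - Zf κ y - DZf κ y (x - y)‖ ≤ K * ‖x - y‖ ^ 2) := by
  obtain ⟨K, hK, k1, k2, k3, k4⟩ := exists_mm_bounds h
  set M := ‖mulAlg G (half_lt_add_one (s := s))‖ with hM
  have hM0 : 0 ≤ M := norm_nonneg (mulAlg G (half_lt_add_one (s := s)))
  have hA : ∀ (a b : Hs G (s + 1)) {α β : ℝ}, ‖a‖ ≤ α → ‖b‖ ≤ β → ‖alg a b‖ ≤ M * α * β :=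
    fun a b α β ha hb => by
      have := (norm_nonneg a).trans ha
      exact (alg_norm_le a b).trans (by gcongr)
  have c1 : ∀ x : Hs G s, ‖x‖ ≤ r → ‖mc κ x‖ ≤ K := fun x hx => (conjL_norm_le _).trans (k1 x hx)
  have p1 : 0 ≤ M * K * K := by positivity
  have p3 : 0 ≤ 2 * K + 2 * (M * K * K) := by positivity
  refine ⟨2 * K + 3 * (M * K * K), by positivity, fun x hx => ?_, fun x y hx hy => ?_,
    fun y f hy => ?_, fun x y hx hy => ?_⟩
  · have h1 := norm_add₃_le (a := mm κ x) (b := mc κ x) (c := alg (mm κ x) (mc κ x))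
    have h2 := hA _ _ (k1 x hx) (c1 x hx)
    have h3 := k1 x hx
    have h4 := c1 x hx
    rw [Zf]; linarith
  · have e : Zf κ x - Zf κ y = (mm κ x - mm κ y) + (mc κ x - mc κ y) +
        (alg (mm κ x - mm κ y) (mc κ x) + alg (mm κ y) (mc κ x - mc κ y)) := by
      rw [sub_alg, alg_sub, Zf, Zf]; abel
    have h0 := k2 x y hx hy
    have h0' : ‖mc κ x - mc κ y‖ ≤ K * ‖x - y‖ := by
      rw [mc_sub]; exact (conjL_norm_le _).trans h0
    have h1 := hA _ _ h0 (c1 x hx)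
    have h2 := hA _ _ (k1 y hy) h0'
    have h3 := norm_add₃_le (a := mm κ x - mm κ y) (b := mc κ x - mc κ y)
      (c := alg (mm κ x - mm κ y) (mc κ x) + alg (mm κ y) (mc κ x - mc κ y))
    have h4 := norm_add_le (alg (mm κ x - mm κ y) (mc κ x)) (alg (mm κ y) (mc κ x - mc κ y))
    rw [e]
    have := mul_nonneg p1 (norm_nonneg (x - y))
    linarith
  · have h0 := k3 y f hy
    have h0' : ‖conjL G (s + 1) (Dmm κ y f)‖ ≤ K * ‖f‖ := (conjL_norm_le _).trans h0
    have h1 := hA _ _ h0 (c1 y hy)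
    have h2 := hA _ _ (k1 y hy) h0'
    rw [DZf_apply]
    have h3 := norm_add₃_le (a := Dmm κ y f) (b := conjL G (s + 1) (Dmm κ y f))
      (c := alg (Dmm κ y f) (mc κ y))
    refine (norm_add_le _ _).trans ?_
    have := mul_nonneg p1 (norm_nonneg f)
    linarith
  · set δ := mm κ x - mm κ y with hδ
    set d := Dmm κ y (x - y) with hd
    -- Exact second-order remainder: the linear terms see only `δ - d`, already quadratic, and
    -- `|m|²` contributes `δ δ̄`.
    have e : Zf κ x - Zf κ y - DZf κ y (x - y) = (δ - d) + conjL G (s + 1) (δ - d) +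
        (alg (δ - d) (mc κ y) + alg (mm κ y) (conjL G (s + 1) (δ - d)) +
          alg δ (conjL G (s + 1) δ)) := by
      rw [DZf_apply, ← hd, Zf, Zf]
      simp only [map_sub, sub_alg, alg_sub, hδ]
      simp only [conj_mm]
      abel
    have h0 := k4 x y hx hy
    rw [← hδ, ← hd] at h0
    have h0' : ‖conjL G (s + 1) (δ - d)‖ ≤ K * ‖x - y‖ ^ 2 := (conjL_norm_le _).trans h0
    have h1 := hA _ _ h0 (c1 y hy)
    have h2 := hA _ _ (k1 y hy) h0'
    have h5 := hA _ _ (k2 x y hx hy) ((conjL_norm_le δ).trans (k2 x y hx hy))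
    rw [← hδ] at h5
    rw [e]
    have h3 := norm_add₃_le (a := δ - d) (b := conjL G (s + 1) (δ - d))
      (c := alg (δ - d) (mc κ y) + alg (mm κ y) (conjL G (s + 1) (δ - d)) +
          alg δ (conjL G (s + 1) δ))
    have h4 := norm_add₃_le (a := alg (δ - d) (mc κ y))
      (b := alg (mm κ y) (conjL G (s + 1) (δ - d))) (c := alg δ (conjL G (s + 1) δ))
    linarith

theorem exists_Yf_bounds {r : ℝ} (h : Adm G s κ r) : ∃ K : ℝ≥0,
    (∀ x : Hs G s, ‖x‖ ≤ r → ‖Yf κ x‖ ≤ K) ∧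
    (∀ x y : Hs G s, ‖x‖ ≤ r → ‖y‖ ≤ r → ‖Yf κ x - Yf κ y‖ ≤ K * ‖x - y‖) ∧
    (∀ y : Hs G s, ‖y‖ ≤ r → ‖DYf κ y‖ ≤ K) ∧
    (∀ x y : Hs G s, ‖x‖ ≤ r → ‖y‖ ≤ r →
      ‖Yf κ x - Yf κ y - DYf κ y (x - y)‖ ≤ K * ‖x - y‖ ^ 2) := by
  obtain ⟨K, hK, k1, k2, k3, k4⟩ := exists_Zf_bounds h
  have hb : ∀ {a : Hs G (s + 1)} {c : ℝ}, ‖a‖ ≤ c → ‖(-(κ ^ 2)) • dxL G s a‖ ≤ κ ^ 2 * c :=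
    fun {a c} ha => by
      rw [norm_smul, norm_neg, Real.norm_of_nonneg (sq_nonneg κ)]
      exact mul_le_mul_of_nonneg_left ((dxL_norm_le a).trans ha) (sq_nonneg κ)
  refine ⟨⟨κ ^ 2 * K, mul_nonneg (sq_nonneg κ) hK⟩, fun x hx => hb (k1 x hx), fun x y hx hy => ?_,
    fun y hy => ?_, fun x y hx hy => ?_⟩
  · rw [Yf, Yf, ← smul_sub, ← map_sub]
    exact (hb (k2 x y hx hy)).trans_eq (mul_assoc _ _ _).symm
  · refine ContinuousLinearMap.opNorm_le_bound _ (mul_nonneg (sq_nonneg κ) hK) fun f => ?_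
    rw [DYf_apply]
    exact (hb (k3 y f hy)).trans_eq (mul_assoc _ _ _).symm
  · rw [Yf, Yf, DYf_apply, ← smul_sub, ← map_sub, ← smul_sub, ← map_sub]
    exact (hb (k4 x y hx hy)).trans_eq (mul_assoc _ _ _).symm

/-! ### Differentiability of `β` -/

theorem hasFDerivAt_of_taylor {E F : Type*} [NormedAddCommGroup E] [NormedSpace ℝ E]
    [NormedAddCommGroup F] [NormedSpace ℝ F] {f : E → F} {D : E →L[ℝ] F} {y : E} {K r : ℝ}
    (hy : ‖y‖ < r) (h : ∀ x, ‖x‖ ≤ r → ‖f x - f y - D (x - y)‖ ≤ K * ‖x - y‖ ^ 2) :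
    HasFDerivAt f D y := by
  rw [hasFDerivAt_iff_isLittleO]
  have h1 : (fun x => f x - f y - D (x - y)) =O[𝓝 y] fun x => ‖x - y‖ ^ 2 := by
    refine Asymptotics.IsBigO.of_bound K ?_
    filter_upwards [continuous_norm.continuousAt.eventually (Iio_mem_nhds hy)] with x hx
    simpa using h x (le_of_lt hx)
  exact h1.trans_isLittleO (Asymptotics.isLittleO_pow_sub_sub y (by norm_num))

theorem hasFDerivAt_mm {r : ℝ} (h : Adm G s κ r) {y : Hs G s} (hy : ‖y‖ < r) :
    HasFDerivAt (mm κ) ((Dmm κ y).restrictScalars ℝ) y := by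
  obtain ⟨K, hK, k1, k2, k3, k4⟩ := exists_mm_bounds h
  exact hasFDerivAt_of_taylor hy fun x hx => k4 x y hx hy.le

/-- The derivative of `β` along a differentiable curve of real functions. -/
theorem hasDerivAt_beta {r : ℝ} (h : Adm G s ϰ r) {p : ℝ → Hs G s} {v : Hs G s} {t : ℝ}
    (hp : HasDerivAt p v t) (hpr : ∀ t, IsReal (p t)) (ht : ‖p t‖ < r) :
    HasDerivAt (fun t => beta ϰ (p t)) (du (Zf ϰ (p t)) v) t := by
  have h1 : HasDerivAt (fun t => mm ϰ (p t)) (Dmm ϰ (p t) v) t :=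
    (hasFDerivAt_mm h ht).comp_hasDerivAt t hp
  let B : Hs G (s + 1) →L[ℝ] Hs G s →L[ℝ] ℂ :=
    (dpL G (by linarith [zero_le_dual (s := s)])).bilinearRestrictScalars ℝ
  have h2 := B.hasDerivAt_of_bilinear (fun _ => h1) (fun _ => hp)
  have e : (fun t => beta ϰ (p t)) =ᶠ[𝓝 t] fun t => du (mm ϰ (p t)) (p t) := by
    filter_upwards [hp.continuousAt.norm.eventually (Iio_mem_nhds ht)] with t' ht'
    rw [beta_eq (hpr t') (h.good (le_of_lt ht')) h.one_le, dp_comm]; rfl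
  refine (HasDerivAt.congr_of_eventuallyEq (f₁ := fun t => beta ϰ (p t)) h2 e).congr_deriv ?_
  change du (mm ϰ (p t)) v + du (Dmm ϰ (p t) v) (p t) = _
  rw [du_Dmm (hpr t) (h.good ht.le), Zf, ← add_du]
  congr 1
  abel

theorem du_Zf_Yf {q : Hs G s} (hq : IsReal q) (h : Good κ q ∧ 1 ≤ κ) (h' : Good ϰ q ∧ 1 ≤ ϰ) :
    du (Zf ϰ q) (Yf κ q) = 0 := by
  have e : Yf κ q = ((-(κ ^ 2) : ℝ) : ℂ) • dxL G s (Zf κ q) := by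
    rw [Yf]
    exact (RCLike.real_smul_eq_coe_smul (K := ℂ) _ _)
  rw [e, du_smul, du_Zf_dx_Zf hq h.1 h.2 h'.1 h'.2, mul_zero]

theorem Zf_tr (h : ℝ) {q : Hs G s} (hq : Good κ q) (hq2 : Good κ (tr G s h q)) :
    Zf κ (tr G s h q) = tr G (s + 1) h (Zf κ q) := by
  rw [Zf, Zf, mc, mm_tr h hq hq2, conjL_tr, alg, mulAlg_tr, map_add, map_add]; rfl

theorem Yf_tr (h : ℝ) {q : Hs G s} (hq : Good κ q) (hq2 : Good κ (tr G s h q)) :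
    Yf κ (tr G s h q) = tr G s h (Yf κ q) := by
  rw [Yf, Yf, Zf_tr h hq hq2, dxL, mlt_tr]
  exact ((tr G s h).restrictScalars ℝ).map_smul _ _ |>.symm

theorem beta_tr {h : ℝ} {q : Hs G s} (hr : IsReal q) (hq : Good κ q)
    (hq2 : Good κ (tr G s h q)) (hκ : 1 ≤ κ) : beta κ (tr G s h q) = beta κ q := by
  have hr2 : IsReal (tr G s h q) := by
    rw [isReal_iff, conjL_tr, isReal_iff.1 hr]
  rw [beta_eq hr2 hq2 hκ, beta_eq hr hq hκ, mm_tr h hq hq2, dp_tr]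

theorem mean_Yf (κ : ℝ) (q : Hs G s) : mean G (Yf κ q) = 0 := by
  refine mean_eq_zero ?_
  have : Yf κ q = ((-(κ ^ 2) : ℝ) : ℂ) • dxL G s (Zf κ q) :=
    RCLike.real_smul_eq_coe_smul (K := ℂ) _ _
  rw [this]
  filter_upwards [coe_smul_ae ((-(κ ^ 2) : ℝ) : ℂ) (dxL G s (Zf κ q)), dxL_coe (Zf κ q)]
    with ξ h1 h2 h0
  rw [h1, h2, dx, h0]; simp

end

section

variable {G : Geometry} {σ σ' κ κ₀ ϰ s R A : ℝ}

/-! ### Translations -/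

theorem norm_exp_sub_exp_le (ξ h k : ℝ) :
    ‖Complex.exp (Complex.I * (ξ : ℂ) * (h : ℂ)) - Complex.exp (Complex.I * (ξ : ℂ) * (k : ℂ))‖ ≤
      |h - k| * |ξ| := by
  have e : Complex.exp (Complex.I * (ξ : ℂ) * (h : ℂ)) -
      Complex.exp (Complex.I * (ξ : ℂ) * (k : ℂ)) =
      Complex.exp (Complex.I * (ξ : ℂ) * (k : ℂ)) *
        (Complex.exp (Complex.I * ((ξ * (h - k) : ℝ) : ℂ)) - 1) := by
    rw [mul_sub, mul_one, ← Complex.exp_add]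
    congr 2
    push_cast; ring
  rw [e, norm_mul, norm_exp_I_mul, one_mul]
  refine (Real.norm_exp_I_mul_ofReal_sub_one_le).trans ?_
  rw [Real.norm_eq_abs, abs_mul, mul_comm]

theorem isMult_tr_sub (σ h k : ℝ) : IsMult (σ + 1) σ |h - k| fun ξ =>
    Complex.exp (Complex.I * (ξ : ℂ) * (h : ℂ)) - Complex.exp (Complex.I * (ξ : ℂ) * (k : ℂ)) :=
  ⟨by fun_prop, abs_nonneg _, fun ξ => by
    rw [Real.rpow_add (bracket_pos ξ), Real.rpow_one, mul_left_comm]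
    refine mul_le_mul_of_nonneg_left ((norm_exp_sub_exp_le ξ h k).trans ?_)
      (bracket_rpow_pos ξ σ).le
    gcongr
    linarith⟩

theorem norm_tr_emb_sub_le (h k : ℝ) (hσ : σ ≤ σ + 1) (f : Hs G (σ + 1)) :
    ‖tr G σ h (emb G hσ f) - tr G σ k (emb G hσ f)‖ ≤ |h - k| * ‖f‖ := by
  have e : tr G σ h (emb G hσ f) - tr G σ k (emb G hσ f) = mlt G (isMult_tr_sub σ h k) f := by
    refine Hs_ext ?_
    filter_upwards [coe_sub_ae (tr G σ h (emb G hσ f)) (tr G σ k (emb G hσ f)),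
      tr_coe h (emb G hσ f), tr_coe k (emb G hσ f), emb_coe hσ f, mlt_coe (isMult_tr_sub σ h k) f]
      with ξ h1 h2 h3 h4 h5
    rw [h1, h2, h3, h4, h5]; ring
  rw [e]
  exact mlt_norm_le _ f

/-- Translations are isometries, so frequency cutoffs approximate uniformly in `h`, and a
band-limited function has Lipschitz translates. -/
theorem continuous_tr (f : Hs G σ) : Continuous fun h => tr G σ h f := by
  have hσ : σ ≤ σ + 1 := by linarith
  have hu : TendstoUniformly (fun (n : ℕ) (h : ℝ) => tr G σ h (cut G σ σ (Nat.cast_nonneg n) f))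
      (fun h => tr G σ h f) atTop := by
    rw [Metric.tendstoUniformly_iff]
    intro ε hε
    filter_upwards [(Metric.tendsto_nhds.1 (tendsto_cut_self f)) ε hε] with n hn h
    rw [dist_comm, dist_eq_norm, ← map_sub, tr_norm, ← dist_eq_norm]
    exact hn
  refine hu.continuous (Eventually.frequently (Eventually.of_forall fun n => ?_))
  have e : cut G σ σ (Nat.cast_nonneg n) f = emb G hσ (cut G σ (σ + 1) (Nat.cast_nonneg n) f) := by
    refine Hs_ext ?_
    filter_upwards [cut_coe (σ := σ) (σ' := σ) (Nat.cast_nonneg n) f,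
      cut_coe (σ := σ) (σ' := σ + 1) (Nat.cast_nonneg n) f,
      emb_coe hσ (cut G σ (σ + 1) (Nat.cast_nonneg n) f)] with ξ h1 h2 h3
    rw [h1, h3, h2]
  rw [e]
  refine (LipschitzWith.of_dist_le_mul (K := ‖cut G σ (σ + 1) (Nat.cast_nonneg n) f‖₊)
    fun h k => ?_).continuous
  rw [dist_eq_norm, Real.dist_eq, mul_comm]
  exact norm_tr_emb_sub_le h k hσ _

theorem continuous_tr_uncurry : Continuous fun p : ℝ × Hs G σ => tr G σ p.1 p.2 := by
  rw [continuous_iff_continuousAt]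
  rintro ⟨h, f⟩
  have h1 : Tendsto (fun p : ℝ × Hs G σ => ‖p.2 - f‖ + ‖tr G σ p.1 f - tr G σ h f‖)
      (𝓝 (h, f)) (𝓝 0) := by
    have : Continuous fun p : ℝ × Hs G σ => ‖p.2 - f‖ + ‖tr G σ p.1 f - tr G σ h f‖ :=
      (continuous_snd.sub continuous_const).norm.add
        ((((continuous_tr f).comp continuous_fst)).sub continuous_const).norm
    simpa using this.tendsto (h, f)
  rw [ContinuousAt, tendsto_iff_norm_sub_tendsto_zero]
  refine squeeze_zero (fun _ => norm_nonneg _) (fun p => ?_) h1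
  have e : tr G σ p.1 p.2 - tr G σ h f = tr G σ p.1 (p.2 - f) + (tr G σ p.1 f - tr G σ h f) := by
    rw [map_sub]; abel
  rw [e]
  exact (norm_add_le _ _).trans_eq (by rw [tr_norm])

theorem norm_exp_sub_sub_le (x : ℝ) :
    ‖Complex.exp (Complex.I * (x : ℂ)) - 1 - Complex.I * x‖ ≤ 2 * x ^ 2 := by
  rcases le_or_gt |x| 1 with h | h
  · have h1 : ‖Complex.I * (x : ℂ)‖ ≤ 1 := by simpa using h
    have := Complex.norm_exp_sub_one_sub_id_le h1
    refine this.trans ?_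
    simp only [norm_mul, Complex.norm_I, Complex.norm_real, one_mul, Real.norm_eq_abs, sq_abs]
    nlinarith [sq_nonneg x]
  · have h1 : ‖Complex.exp (Complex.I * (x : ℂ)) - 1‖ ≤ |x| :=
      Real.norm_exp_I_mul_ofReal_sub_one_le
    refine (norm_sub_le _ _).trans ?_
    simp only [norm_mul, Complex.norm_I, Complex.norm_real, one_mul, Real.norm_eq_abs]
    nlinarith [sq_abs x]

theorem isMult_tr_taylor (σ h : ℝ) : IsMult σ (σ - 1 - 1) (2 * h ^ 2) fun ξ =>
    Complex.exp (Complex.I * (ξ : ℂ) * (h : ℂ)) - 1 - Complex.I * ξ * h :=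
  ⟨by fun_prop, by positivity, fun ξ => by
    have e : (|ξ| + 1) ^ σ = (|ξ| + 1) ^ (σ - 1 - 1) * (|ξ| + 1) ^ 2 := by
      rw [← Real.rpow_natCast, ← Real.rpow_add (bracket_pos ξ)]
      congr 1; push_cast; ring
    rw [e, mul_left_comm]
    refine mul_le_mul_of_nonneg_left ?_ (bracket_rpow_pos ξ _).le
    have := norm_exp_sub_sub_le (ξ * h)
    push_cast at this
    rw [← mul_assoc] at this
    refine this.trans ?_
    rw [mul_pow, ← sq_abs ξ, mul_comm (|ξ| ^ 2), ← mul_assoc]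
    gcongr
    linarith⟩

theorem sub_one_le (σ : ℝ) : σ - 1 ≤ σ := by linarith

theorem isRegEmb_emb (h : σ' ≤ σ) : IsRegEmb ((emb G h).restrictScalars ℝ)
    fun n => (cut G σ' σ (Nat.cast_nonneg n)).restrictScalars ℝ :=
  ⟨fun n x => cut_emb_norm_le (Nat.cast_nonneg n) h x, fun x => by
    refine (tendsto_cut_self x).congr fun n => ?_
    exact (cut_emb h (Nat.cast_nonneg n) x).symm⟩

theorem tr_emb (h : σ' ≤ σ) (k : ℝ) (f : Hs G σ) :
    tr G σ' k (emb G h f) = emb G h (tr G σ k f) := (mlt_tr _ k f).symm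

/-- The quadratic Taylor bound costs two derivatives and gives the derivative in `H^{σ-2}`; as the
derivative is continuous into `H^{σ-1}`, it holds there. -/
theorem hasDerivAt_tr (f : Hs G σ) (k : ℝ) :
    HasDerivAt (fun k => emb G (sub_one_le σ) (tr G σ k f)) (dxD G σ (tr G σ k f)) k := by
  rw [← hasDerivWithinAt_univ]
  refine (isRegEmb_emb (sub_one_le (σ - 1))).hasDerivWithinAt
    (f' := fun k => dxD G σ (tr G σ k f)) convex_univ (fun t _ => ?_) (mem_univ k)
    (((dxD G σ).continuous.comp (continuous_tr f)).continuousWithinAt)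
  rw [hasDerivWithinAt_univ, hasDerivAt_iff_isLittleO]
  set ι := (emb G (sub_one_le (σ - 1))).restrictScalars ℝ with hι
  have hb : ∀ u : ℝ, ‖ι (emb G (sub_one_le σ) (tr G σ u f)) -
      ι (emb G (sub_one_le σ) (tr G σ t f)) - (u - t) • ι (dxD G σ (tr G σ t f))‖ ≤
      2 * (u - t) ^ 2 * ‖f‖ := by
    intro u
    have e : ι (emb G (sub_one_le σ) (tr G σ u f)) -
        ι (emb G (sub_one_le σ) (tr G σ t f)) - (u - t) • ι (dxD G σ (tr G σ t f)) =
        mlt G (isMult_tr_taylor σ (u - t)) (tr G σ t f) := by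
      rw [hι]
      simp only [ContinuousLinearMap.coe_restrictScalars']
      refine Hs_ext ?_
      set a := emb G (sub_one_le (σ - 1)) (emb G (sub_one_le σ) (tr G σ u f))
      set b := emb G (sub_one_le (σ - 1)) (emb G (sub_one_le σ) (tr G σ t f))
      set d := emb G (sub_one_le (σ - 1)) (dxD G σ (tr G σ t f))
      filter_upwards [coe_sub_ae (a - b) ((u - t) • d), coe_sub_ae a b,
        coe_real_smul_ae (u - t) d, emb_coe (sub_one_le (σ - 1)) (dxD G σ (tr G σ t f)),
        emb_coe (sub_one_le (σ - 1)) (emb G (sub_one_le σ) (tr G σ u f)),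
        emb_coe (sub_one_le (σ - 1)) (emb G (sub_one_le σ) (tr G σ t f)),
        emb_coe (sub_one_le σ) (tr G σ u f), emb_coe (sub_one_le σ) (tr G σ t f),
        dxD_coe (tr G σ t f), mlt_coe (isMult_tr_taylor σ (u - t)) (tr G σ t f),
        tr_coe u f, tr_coe t f] with ξ h1 h2 h3 h4 h5 h6 h7 h8 h9 h10 h11 h12
      rw [h1, h2, h3, h4, h5, h6, h7, h8, h9, h10, dx, h11, h12]
      have : Complex.exp (Complex.I * ξ * u) =
          Complex.exp (Complex.I * ξ * ((u - t : ℝ) : ℂ)) * Complex.exp (Complex.I * ξ * t) := by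
        rw [← Complex.exp_add]; congr 1; push_cast; ring
      rw [this]
      push_cast; ring
    rw [e]
    exact (mlt_norm_le _ _).trans_eq (by rw [tr_norm])
  have h2 : (fun u : ℝ => 2 * (u - t) ^ 2 * ‖f‖) =o[𝓝 t] fun u => u - t := by
    have := (Asymptotics.isLittleO_pow_sub_sub t (m := 2) (by norm_num)).const_mul_left (2 * ‖f‖)
    refine this.norm_left.congr_left fun u => ?_
    simp
    ring
  refine (Asymptotics.IsBigO.of_bound 1 (Eventually.of_forall fun u => ?_)).trans_isLittleO h2
  rw [one_mul]
  exact (hb u).trans (le_abs_self _)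

/-- Product rule with little regularity: translate the frozen value `p t`, and separately translate
the increment of `p`, where isometry makes the error harmless. -/
theorem hasDerivWithinAt_tr_comp {I : Set ℝ} {p : ℝ → Hs G σ} {p' : Hs G (σ - 1)} {t : ℝ}
    (hp : HasDerivWithinAt (fun t => emb G (sub_one_le σ) (p t)) p' I t) (c : ℝ) :
    HasDerivWithinAt (fun t => emb G (sub_one_le σ) (tr G σ (c * t) (p t)))
      (c • dxD G σ (tr G σ (c * t) (p t)) + tr G (σ - 1) (c * t) p') I t := by
  set ι := emb G (sub_one_le σ) with hι
  have hB : HasDerivWithinAt (fun u => ι (tr G σ (c * u) (p t)))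
      (c • dxD G σ (tr G σ (c * t) (p t))) I t := by
    have h1 : HasDerivAt (fun u : ℝ => c * u) c t := by
      simpa using (hasDerivAt_id t).const_mul c
    exact ((hasDerivAt_tr (p t) (c * t)).scomp t h1).hasDerivWithinAt
  have hA : HasDerivWithinAt (fun u => tr G (σ - 1) (c * u) (ι (p u) - ι (p t)))
      (tr G (σ - 1) (c * t) p') I t := by
    rw [hasDerivWithinAt_iff_isLittleO] at hp ⊢
    have hp2 : (fun u => tr G (σ - 1) (c * u) (ι (p u) - ι (p t) - (u - t) • p')) =o[𝓝[I] t]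
        fun u => u - t := by
      refine hp.norm_left.congr_left (fun u => ?_) |>.of_norm_left
      rw [tr_norm]
    have hc : (fun u => (u - t) • (tr G (σ - 1) (c * u) p' - tr G (σ - 1) (c * t) p')) =o[𝓝[I] t]
        fun u => u - t := by
      have h0 : (fun u => tr G (σ - 1) (c * u) p' - tr G (σ - 1) (c * t) p') =o[𝓝[I] t]
          fun _ => (1 : ℝ) := by
        rw [Asymptotics.isLittleO_one_iff]
        have : Continuous fun u => tr G (σ - 1) (c * u) p' - tr G (σ - 1) (c * t) p' :=
          ((continuous_tr p').comp (continuous_const.mul continuous_id)).sub continuous_const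
        have := this.tendsto t
        rw [sub_self] at this
        exact this.mono_left nhdsWithin_le_nhds
      have := (Asymptotics.isBigO_refl (fun u : ℝ => u - t) (𝓝[I] t)).smul_isLittleO h0
      simpa using this
    refine (hp2.add hc).congr_left fun u => ?_
    have : tr G (σ - 1) (c * u) ((u - t) • p') = (u - t) • tr G (σ - 1) (c * u) p' :=
      ((tr G (σ - 1) (c * u)).restrictScalars ℝ).map_smul _ _
    rw [map_sub (tr G (σ - 1) (c * u)) _ ((u - t) • p'), this, smul_sub, sub_self, map_zero]
    abel
  have e : ∀ u, ι (tr G σ (c * u) (p u)) =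
      ι (tr G σ (c * u) (p t)) + tr G (σ - 1) (c * u) (ι (p u) - ι (p t)) := fun u => by
    rw [map_sub, tr_emb, tr_emb]; abel
  exact (hB.add hA).congr (fun u _ => e u) (e t)

variable [hs : Fact (s ∈ Ioo (-(1 / 2) : ℝ) 0)]

/-! ### Invariance of the sets `Q_**` -/

/-- Concatenation of two paths. It makes `Q_**` invariant under every flow that conserves `β`. -/
theorem starStar_extend {Q : Set (Hs G s)} {q₀ : Hs G s} (h0 : q₀ ∈ starStar Q)
    {p : ℝ → Hs G s} {T : ℝ} (hT : 0 ≤ T) (hp : ContinuousOn p (Icc 0 T)) (hp0 : p 0 = q₀)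
    (hr : ∀ t ∈ Icc 0 T, IsReal (p t))
    (hb : ∀ t ∈ Icc 0 T, ∀ᶠ ϰ : ℝ in atTop, beta ϰ (p t) = beta ϰ (p 0)) :
    p T ∈ starStar Q := by
  obtain ⟨a, b, q, hab, hq, hqr, hqa, hqb, hqe⟩ := h0
  set u : ℝ → Hs G s := fun t => if t ≤ b then q t else p (t - b) with hu
  have hu1 : ∀ t ∈ Icc a b, u t = q t := fun t ht => by simp [hu, ht.2]
  have hu2 : ∀ t ∈ Icc b (b + T), u t = p (t - b) := fun t ht => by
    by_cases h : t ≤ b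
    · have : t = b := le_antisymm h ht.1
      subst this
      simp [hu, hqe, hp0]
    · simp [hu, h]
  have hsh : ∀ t ∈ Icc b (b + T), t - b ∈ Icc 0 T := fun t ht =>
    ⟨by linarith [ht.1], by linarith [ht.2]⟩
  have hU : Icc a (b + T) = Icc a b ∪ Icc b (b + T) :=
    (Icc_union_Icc_eq_Icc hab (by linarith)).symm
  have hbb : b ∈ Icc a b := ⟨hab, le_rfl⟩
  refine ⟨a, b + T, u, by linarith, ?_, fun t ht => ?_, ?_, fun t ht => ?_, ?_⟩
  · rw [hU]
    refine ContinuousOn.union_of_isClosed (hq.congr hu1) ?_ isClosed_Icc isClosed_Icc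
    exact (hp.comp (by fun_prop) hsh).congr hu2
  · rw [hU] at ht
    rcases ht with ht | ht
    · rw [hu1 t ht]; exact hqr t ht
    · rw [hu2 t ht]; exact hr _ (hsh t ht)
  · rw [hu1 a ⟨le_rfl, hab⟩]; exact hqa
  · rw [hu1 a ⟨le_rfl, hab⟩]
    rw [hU] at ht
    rcases ht with ht | ht
    · rw [hu1 t ht]; exact hqb t ht
    · rw [hu2 t ht]
      filter_upwards [hb _ (hsh t ht), hqb b hbb] with ϰ h1 h2
      rw [h1, ← h2, hqe, hp0]
  · rw [hu2 (b + T) ⟨by linarith, le_rfl⟩]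
    congr 1; ring

theorem starStar_real {Q : Set (Hs G s)} {q : Hs G s} (h : q ∈ starStar Q) : IsReal q := by
  obtain ⟨a, b, u, hab, -, hr, -, -, rfl⟩ := h
  exact hr b ⟨hab, le_rfl⟩

/-- A real curve along which `β` is stationary as long as the curve stays in a ball remains in
`Q_**`. -/
theorem mem_starStar_of_stationary {Q : Set (Hs G s)} (hQ : ∀ q ∈ starStar Q, ‖q‖ ≤ R)
    {u : ℝ → Hs G s} (huc : Continuous u) (hur : ∀ t, IsReal (u t)) (h0 : u 0 ∈ starStar Q)
    (hub : ∀ᶠ ϰ : ℝ in atTop, ∀ t, ‖u t‖ < R + 1 → HasDerivAt (fun t => beta ϰ (u t)) 0 t)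
    {T : ℝ} (hT : 0 ≤ T) : u T ∈ starStar Q := by
  have key : ∀ y, 0 ≤ y → (∀ t ∈ Icc 0 y, ‖u t‖ < R + 1) → u y ∈ starStar Q := by
    intro y hy hn
    refine starStar_extend h0 hy huc.continuousOn rfl (fun t _ => hur t) fun t ht => ?_
    filter_upwards [hub] with ϰ hϰ
    have hd : ∀ τ ∈ Icc 0 y, HasDerivAt (fun t => beta ϰ (u t)) 0 τ := fun τ hτ => hϰ τ (hn τ hτ)
    exact constant_of_has_deriv_right_zero (fun τ hτ => (hd τ hτ).continuousAt.continuousWithinAt)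
      (fun τ hτ => (hd τ (Ico_subset_Icc_self hτ)).hasDerivWithinAt) t ht
  -- Continuous induction on `[0, T]`: a bound `R` up to time `t` gives `R + 1` slightly later,
  -- hence conservation, hence membership in `Q_**`, hence again `R`.
  set S : Set ℝ := {t | ‖u t‖ ≤ R} with hS
  have hSc : IsClosed (S ∩ Icc 0 T) :=
    (isClosed_le huc.norm continuous_const).inter isClosed_Icc
  have hsub : Icc 0 T ⊆ S := by
    refine hSc.Icc_subset_of_forall_mem_nhdsGT_of_Icc_subset (hQ _ h0) fun t ht hts => ?_
    have htS : ‖u t‖ < R + 1 := by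
      have : ‖u t‖ ≤ R := hts ⟨ht.1, le_rfl⟩
      linarith
    have hev : ∀ᶠ y in 𝓝 t, ‖u y‖ < R + 1 := huc.norm.continuousAt.eventually (Iio_mem_nhds htS)
    obtain ⟨δ, hδ, hball⟩ := Metric.eventually_nhds_iff.1 hev
    filter_upwards [Ioo_mem_nhdsGT (show t < t + δ by linarith)] with y hy
    refine hQ _ (key y (ht.1.trans hy.1.le) fun τ hτ => ?_)
    rcases le_or_gt τ t with h | h
    · have : ‖u τ‖ ≤ R := hts ⟨hτ.1, h⟩
      linarith
    · exact hball (by rw [Real.dist_eq, abs_of_pos (by linarith)]; linarith [hτ.2, hy.2])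
  exact key T hT fun t ht => by
    have : ‖u t‖ ≤ R := hsub ht
    linarith

/-! ### The flow in the moving frame -/

/-- The flow of the (truncated) vector field `Yf`. -/
structure IsFlow (κ R : ℝ) (Ψ : ℝ → Hs G s → Hs G s) : Prop where
  zero : ∀ x, Ψ 0 x = x
  deriv : ∀ x t, HasDerivAt (fun t => Ψ t x) (Yf κ (retract (R + 1) (Ψ t x))) t
  lip : ∃ K : ℝ≥0, ∀ t x y, ‖Ψ t x - Ψ t y‖ ≤ ‖x - y‖ * Real.exp (K * |t|)

/-- Composing with the retraction onto the ball of radius `R + 1` makes the field globally bounded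
and Lipschitz. -/
theorem exists_isFlow (hR : 0 ≤ R) (h : Adm G s κ (R + 1)) :
    ∃ Ψ : ℝ → Hs G s → Hs G s, IsFlow κ R Ψ := by
  obtain ⟨K, k1, k2, -, -⟩ := exists_Yf_bounds h
  have hR1 : 0 < R + 1 := by linarith
  have hl : LipschitzWith (K * 2) fun x : Hs G s => Yf κ (retract (R + 1) x) := by
    refine LipschitzWith.of_dist_le_mul fun x y => ?_
    rw [dist_eq_norm, dist_eq_norm]
    refine (k2 _ _ (norm_retract_le hR1 x) (norm_retract_le hR1 y)).trans ?_
    push_cast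
    rw [mul_assoc]
    gcongr
    exact norm_retract_sub_le hR1 x y
  obtain ⟨Ψ, h1, h2, h3⟩ := exists_global_flow hl fun x => k1 _ (norm_retract_le hR1 x)
  exact ⟨Ψ, h1, h2, _, h3⟩

variable {Ψ : ℝ → Hs G s → Hs G s}

/-- `Yf` takes real values whatever its argument, so the imaginary part of an orbit is constant. -/
theorem IsFlow.real (h : IsFlow κ R Ψ) {q : Hs G s} (hq : IsReal q) (t : ℝ) :
    IsReal (Ψ t q) := by
  rw [isReal_iff]
  have hd : ∀ t, HasDerivAt (fun t => conjL G s (Ψ t q) - Ψ t q) 0 t := fun t => by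
    have := ((conjL G s).hasFDerivAt.comp_hasDerivAt t (h.deriv q t)).sub (h.deriv q t)
    rw [Yf_real, sub_self] at this
    exact this
  have := is_const_of_deriv_eq_zero (fun t => (hd t).differentiableAt) (fun t => (hd t).deriv) t 0
  rw [h.zero, isReal_iff.1 hq, sub_self] at this
  exact sub_eq_zero.1 this

theorem IsFlow.continuous (h : IsFlow κ R Ψ) (x : Hs G s) : Continuous fun t => Ψ t x :=
  continuous_iff_continuousAt.2 fun t => (h.deriv x t).continuousAt

theorem IsFlow.continuous_uncurry (h : IsFlow κ R Ψ) :
    Continuous fun p : ℝ × Hs G s => Ψ p.1 p.2 := by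
  obtain ⟨K, hK⟩ := h.lip
  rw [continuous_iff_continuousAt]
  rintro ⟨t, x⟩
  have h1 : Tendsto (fun p : ℝ × Hs G s => ‖p.2 - x‖ * Real.exp (K * |p.1|) + ‖Ψ p.1 x - Ψ t x‖)
      (𝓝 (t, x)) (𝓝 0) := by
    have : Continuous fun p : ℝ × Hs G s =>
        ‖p.2 - x‖ * Real.exp (K * |p.1|) + ‖Ψ p.1 x - Ψ t x‖ :=
      ((continuous_snd.sub continuous_const).norm.mul (by fun_prop)).add
        ((((h.continuous x).comp continuous_fst)).sub continuous_const).norm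
    simpa using this.tendsto (t, x)
  rw [ContinuousAt, tendsto_iff_norm_sub_tendsto_zero]
  refine squeeze_zero (fun _ => norm_nonneg _) (fun p => ?_) h1
  have e : Ψ p.1 p.2 - Ψ t x = (Ψ p.1 p.2 - Ψ p.1 x) + (Ψ p.1 x - Ψ t x) := by abel
  rw [e]
  exact (norm_add_le _ _).trans (add_le_add (hK _ _ _) le_rfl)

theorem IsFlow.hasDerivAt_beta (h : IsFlow κ R Ψ) (hR : 0 ≤ R) (hκ : Adm G s κ (R + 1))
    (hϰ : Adm G s ϰ (R + 1)) {q : Hs G s} (hq : IsReal q) {t : ℝ} (ht : ‖Ψ t q‖ < R + 1) :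
    HasDerivAt (fun t => beta ϰ (Ψ t q)) 0 t := by
  have hd := h.deriv q t
  rw [retract_of_norm_le (by linarith) ht.le] at hd
  have := BenjaminOno.hasDerivAt_beta hϰ hd (fun t => h.real hq t) ht
  rwa [du_Zf_Yf (h.real hq t) (hκ.isGood ht.le) (hϰ.isGood ht.le)] at this

theorem IsFlow.mem_starStar (h : IsFlow κ R Ψ) (hR : 0 ≤ R) (hκ : Adm G s κ (R + 1))
    {Q : Set (Hs G s)} (hQ : ∀ q ∈ starStar Q, ‖q‖ ≤ R) {q : Hs G s} (hq : q ∈ starStar Q)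
    (t : ℝ) : Ψ t q ∈ starStar Q := by
  have hr := starStar_real hq
  rcases le_total 0 t with ht | ht
  · refine mem_starStar_of_stationary hQ (h.continuous q) (h.real hr) (by rwa [h.zero]) ?_ ht
    filter_upwards [eventually_ge_atTop κ] with ϰ hϰ τ hτ
    exact h.hasDerivAt_beta hR hκ (hκ.mono hϰ) hr hτ
  · have := mem_starStar_of_stationary (T := -t) (u := fun t => Ψ (-t) q) hQ
      ((h.continuous q).comp continuous_neg) (fun t => h.real hr _)
      (by simpa [h.zero] using hq) (by
        filter_upwards [eventually_ge_atTop κ] with ϰ hϰ τ hτ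
        simpa using hasDerivAt_comp_neg (h.hasDerivAt_beta hR hκ (hκ.mono hϰ) hr hτ)) (by linarith)
    simpa using this

theorem IsFlow.mean_eq (h : IsFlow κ R Ψ) (q : Hs G s) (t : ℝ) :
    mean G (Ψ t q) = mean G q := by
  have hd : ∀ t, HasDerivAt (fun t => meanL G s (Ψ t q)) 0 t := fun t => by
    have := ((meanL G s).restrictScalars ℝ).hasFDerivAt.comp_hasDerivAt t (h.deriv q t)
    have e : ((meanL G s).restrictScalars ℝ) (Yf κ (retract (R + 1) (Ψ t q))) = 0 := by
      simp [meanL_apply, mean_Yf]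
    rw [e] at this
    exact this
  have := is_const_of_deriv_eq_zero (fun t => (hd t).differentiableAt) (fun t => (hd t).deriv) t 0
  simpa only [h.zero, meanL_apply] using this

end

section

variable {G : Geometry} {σ σ' κ κ₀ ϰ s R A : ℝ}

attribute [local irreducible] mlt bil

theorem ContinuousOn.trans_tr {I : Set ℝ} {a : ℝ → ℝ} {q : ℝ → Hs G σ} (ha : ContinuousOn a I)
    (hq : ContinuousOn q I) : ContinuousOn (fun t => tr G σ (a t) (q t)) I :=
  continuous_tr_uncurry.comp_continuousOn (ha.prodMk hq)

theorem mean_tr (h : ℝ) (f : Hs G σ) : mean G (tr G σ h f) = mean G f := by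
  have := tr_coe h f
  cases G with
  | line => rfl
  | circle =>
    have := ae_freq_circle.1 this 0
    simpa [mean] using this

theorem isReal_tr (h : ℝ) {q : Hs G σ} (hq : IsReal q) : IsReal (tr G σ h q) := by
  rw [isReal_iff, conjL_tr, isReal_iff.1 hq]

variable [hs : Fact (s ∈ Ioo (-(1 / 2) : ℝ) 0)]

/-! ### The `H_κ` flow -/

/-- The velocity of the moving frame. -/
def speed (κ : ℝ) (q : Hs G s) : ℝ := κ + (mean G q).re

theorem speed_congr {p q : Hs G s} (h : mean G p = mean G q) : speed κ p = speed κ q := by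
  rw [speed, speed, h]

/-- The `H_κ` flow, from the flow in the moving frame. -/
def hkFlow (κ : ℝ) (Ψ : ℝ → Hs G s → Hs G s) (t : ℝ) (q : Hs G s) : Hs G s :=
  tr G s (speed κ q * t) (Ψ t q)

/-- The `H_κ` field is `Yf` plus transport at speed `speed κ q`. -/
theorem hkField_eq {q : Hs G s} (hq : IsReal q) (hg : Good κ q ∧ 1 ≤ κ) :
    (emb G (sub_one_le s) (Yf κ q) + speed κ q • dxD G s q : Hs G (s - 1)) =ᵐ[freq G]
      hkField κ q := by
  have e : Yf κ q = ((-(κ ^ 2) : ℝ) : ℂ) • dxL G s (Zf κ q) :=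
    RCLike.real_smul_eq_coe_smul (K := ℂ) _ _
  filter_upwards [coe_add_ae (emb G (sub_one_le s) (Yf κ q)) (speed κ q • dxD G s q),
    emb_coe (sub_one_le s) (Yf κ q), coe_real_smul_ae (speed κ q) (dxD G s q), dxD_coe q,
    coe_smul_ae ((-(κ ^ 2) : ℝ) : ℂ) (dxL G s (Zf κ q)), dxL_coe (Zf κ q),
    coe_add_ae (mm κ q + mc κ q) (alg (mm κ q) (mc κ q)), coe_add_ae (mm κ q) (mc κ q),
    conjL_coe (mm κ q), alg_coe (mm κ q) (mc κ q),
    mul_congr (ae_eq_refl (mm κ q : ℝ → ℂ)) (conjL_coe (mm κ q))]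
    with ξ h1 h2 h3 h4 h5 h6 h7 h8 h9 h10 h11
  rw [h1, h2, h3, h4, e, h5, h6, hkField, hg.1.gauge_eq hg.2, ← isReal_mean hq, dx, dx, Zf, h7, h8,
    h10]
  simp only [dx]
  rw [← h11, ← h9, speed, ← mc]
  push_cast; ring

variable {Ψ : ℝ → Hs G s → Hs G s}

theorem norm_hkFlow (t : ℝ) (q : Hs G s) : ‖hkFlow κ Ψ t q‖ = ‖Ψ t q‖ := tr_norm _ _

theorem IsFlow.hkFlow_zero (h : IsFlow κ R Ψ) (q : Hs G s) : hkFlow κ Ψ 0 q = q := by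
  rw [hkFlow, h.zero, mul_zero, tr_zero]

theorem IsFlow.continuous_hkFlow (h : IsFlow κ R Ψ) :
    Continuous fun p : ℝ × Hs G s => hkFlow κ Ψ p.1 p.2 := by
  have h1 : Continuous fun q : Hs G s => speed κ q := by
    have : Continuous fun q : Hs G s => κ + (meanL G s q).re :=
      continuous_const.add (Complex.continuous_re.comp (meanL G s).continuous)
    simpa only [meanL_apply, speed] using this
  exact continuous_tr_uncurry.comp
    (((h1.comp continuous_snd).mul continuous_fst).prodMk h.continuous_uncurry)

/-- Undoing the moving frame: `Yf` commutes with translations, and the mean, hence the speed, is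
constant along the orbit. -/
theorem IsFlow.isHkSolution (h : IsFlow κ R Ψ) (hR : 0 ≤ R) (hκ : Adm G s κ (R + 1))
    {q : Hs G s} (hq : IsReal q) (hb : ∀ t, ‖Ψ t q‖ ≤ R) :
    IsHkSolution κ univ (fun t => hkFlow κ Ψ t q) := by
  have hb' : ∀ t, ‖hkFlow κ Ψ t q‖ ≤ R + 1 := fun t => by
    rw [norm_hkFlow]; linarith [hb t]
  have hr : ∀ t, IsReal (hkFlow κ Ψ t q) := fun t => isReal_tr _ (h.real hq t)
  refine ⟨?_, fun t _ => ⟨hr t, (hκ.good (hb' t)).hasGauge hκ.one_le⟩, ?_⟩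
  · exact (h.continuous_hkFlow.comp (continuous_id.prodMk continuous_const)).continuousOn
  · have hsp : ∀ t, speed κ (hkFlow κ Ψ t q) = speed κ q := fun t =>
      speed_congr (by rw [hkFlow, mean_tr, h.mean_eq])
    refine ⟨fun t => emb G (sub_one_le s) (hkFlow κ Ψ t q), fun t =>
      emb G (sub_one_le s) (Yf κ (hkFlow κ Ψ t q)) +
        speed κ (hkFlow κ Ψ t q) • dxD G s (hkFlow κ Ψ t q), fun t _ =>
      ⟨emb_coe _ _, hkField_eq (hr t) (hκ.isGood (hb' t)), ?_⟩⟩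
    have hd := ((emb G (sub_one_le s)).restrictScalars ℝ).hasFDerivAt.comp_hasDerivAt t
      (h.deriv q t)
    have h2 := hasDerivWithinAt_tr_comp (I := univ) (p := fun t => Ψ t q) (t := t)
      hd.hasDerivWithinAt (speed κ q)
    refine h2.congr_deriv ?_
    beta_reduce
    rw [hsp, hkFlow, Yf_tr _ (hκ.good (by linarith [hb t])) (hκ.good (hb' t)),
      retract_of_norm_le (by linarith) (by linarith [hb t])]
    simp only [ContinuousLinearMap.coe_restrictScalars']
    rw [tr_emb, add_comm]

theorem mean_hkField (q : Hs G s) : mean G (hkField κ q) = 0 := by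
  refine mean_eq_zero (Eventually.of_forall fun ξ hξ => ?_)
  simp [hkField, dx, hξ]

theorem IsHkSolution.exists_deriv {I : Set ℝ} {q : ℝ → Hs G s} (hsol : IsHkSolution κ I q) :
    ∃ V : ℝ → Hs G (s - 1), ∀ t ∈ I, V t =ᵐ[freq G] hkField κ (q t) ∧
      HasDerivWithinAt (fun t => emb G (sub_one_le s) (q t)) (V t) I t := by
  obtain ⟨hqc, hqr, U, V, hUV⟩ := hsol
  refine ⟨V, fun t ht => ⟨(hUV t ht).2.1, (hUV t ht).2.2.congr_of_mem (fun u hu => ?_) ht⟩⟩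
  exact Hs_ext ((emb_coe _ _).trans (hUV u hu).1.symm)

theorem IsHkSolution.mean_eq {I : Set ℝ} (hI : I.OrdConnected) (h0 : (0 : ℝ) ∈ I)
    {q : ℝ → Hs G s} (hsol : IsHkSolution κ I q) {t : ℝ} (ht : t ∈ I) :
    mean G (q t) = mean G (q 0) := by
  obtain ⟨V, hV⟩ := hsol.exists_deriv
  have hd : ∀ t ∈ I, HasDerivWithinAt (fun t => meanL G (s - 1) (emb G (sub_one_le s) (q t)))
      0 I t := fun t ht => by
    have := ((meanL G (s - 1)).restrictScalars ℝ).hasFDerivAt.comp_hasDerivWithinAt t (hV t ht).2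
    have e : ((meanL G (s - 1)).restrictScalars ℝ) (V t) = 0 := by
      simp only [ContinuousLinearMap.coe_restrictScalars', meanL_apply]
      rw [mean_congr (hV t ht).1, mean_hkField]
    rw [e] at this
    exact this
  have := hI.convex.norm_image_sub_le_of_norm_hasDerivWithin_le hd (C := 0)
    (fun _ _ => by simp) h0 ht
  rw [zero_mul, norm_le_zero_iff, sub_eq_zero] at this
  simp only [meanL_apply] at this
  rw [← mean_congr (emb_coe (sub_one_le s) (q t)), this, mean_congr (emb_coe _ _)]

/-- In the moving frame the transport terms cancel and only `Yf` remains. The derivative is still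
taken in `H^{s-1}`, which is what `IsRegEmb.ode_unique` is made for. -/
theorem IsHkSolution.hasDerivWithinAt_frame {I : Set ℝ} {q : ℝ → Hs G s}
    (hsol : IsHkSolution κ I q) (hI : I.OrdConnected) (h0 : (0 : ℝ) ∈ I) (hκ : Adm G s κ (R + 1))
    {t : ℝ} (ht : t ∈ I) (hn : ‖q t‖ ≤ R + 1) :
    HasDerivWithinAt
      (fun t => emb G (sub_one_le s) (tr G s (-speed κ (q 0) * t) (q t)))
      (emb G (sub_one_le s) (Yf κ (tr G s (-speed κ (q 0) * t) (q t)))) I t := by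
  obtain ⟨V, hUV⟩ := hsol.exists_deriv
  have h1 := hasDerivWithinAt_tr_comp (hUV t ht).2 (-speed κ (q 0))
  refine h1.congr_deriv ?_
  have hV : V t = emb G (sub_one_le s) (Yf κ (q t)) + speed κ (q 0) • dxD G s (q t) := by
    refine Hs_ext ((hUV t ht).1.trans ?_)
    rw [← speed_congr (hsol.mean_eq hI h0 ht)]
    exact (hkField_eq (hsol.2.1 t ht).1 (hκ.isGood hn)).symm
  set k := -speed κ (q 0) * t with hk
  have hg2 : Good κ (tr G s k (q t)) := hκ.good (by rw [tr_norm]; exact hn)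
  have e1 : tr G (s - 1) k (speed κ (q 0) • dxD G s (q t)) =
      speed κ (q 0) • tr G (s - 1) k (dxD G s (q t)) :=
    ((tr G (s - 1) k).restrictScalars ℝ).map_smul _ _
  have e2 : dxD G s (tr G s k (q t)) = tr G (s - 1) k (dxD G s (q t)) := mlt_tr _ _ _
  rw [Yf_tr _ (hκ.good hn) hg2, hV, map_add, e1, tr_emb, e2, neg_smul]
  abel

theorem IsFlow.hk_unique (h : IsFlow κ R Ψ) (hR : 0 ≤ R) (hκ : Adm G s κ (R + 1))
    {q₀ : Hs G s} (hb : ∀ t, ‖Ψ t q₀‖ ≤ R) {I : Set ℝ}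
    (hI : I.OrdConnected) (h0 : (0 : ℝ) ∈ I) {q : ℝ → Hs G s} (hsol : IsHkSolution κ I q)
    (hq0 : q 0 = q₀) : ∀ t ∈ I, q t = hkFlow κ Ψ t q₀ := by
  obtain ⟨K, -, k2, -, -⟩ := exists_Yf_bounds hκ
  subst hq0
  have hpc : ContinuousOn (fun t => tr G s (-speed κ (q 0) * t) (q t)) I := by
    exact ContinuousOn.trans_tr (continuous_const.mul continuous_id).continuousOn hsol.1
  have hu : ∀ t ∈ I, HasDerivWithinAt (fun t => Ψ t (q 0)) (Yf κ (Ψ t (q 0))) I t :=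
    fun t _ => by
      have := h.deriv (q 0) t
      rw [retract_of_norm_le (by linarith) (by linarith [hb t])] at this
      exact this.hasDerivWithinAt
  have hmain := (isRegEmb_emb (G := G) (sub_one_le s)).ode_unique hI h0 (Y := Yf κ) (R := R) K.2 k2
    hpc hu (fun t _ => hb t) (by rw [mul_zero, tr_zero, h.zero]) (fun t ht hn =>
      hsol.hasDerivWithinAt_frame hI h0 hκ ht (by rwa [tr_norm] at hn))
  intro t ht
  have := hmain t ht
  have e : speed κ (q 0) * t + -speed κ (q 0) * t = 0 := by ring
  rw [hkFlow, ← this, tr_tr, e, tr_zero]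

theorem IsFlow.hasDerivAt_beta_hkFlow (h : IsFlow κ R Ψ) (hR : 0 ≤ R) (hκ : Adm G s κ (R + 1))
    (hϰ : Adm G s ϰ (R + 1)) {q : Hs G s} (hq : IsReal q) (hb : ∀ t, ‖Ψ t q‖ ≤ R) (t : ℝ) :
    HasDerivAt (fun t => beta ϰ (hkFlow κ Ψ t q)) 0 t := by
  have hb' : ∀ t, ‖Ψ t q‖ < R + 1 := fun t => by linarith [hb t]
  refine (h.hasDerivAt_beta hR hκ hϰ hq (hb' t)).congr_of_eventuallyEq
    (Eventually.of_forall fun t => ?_)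
  exact beta_tr (h.real hq t) (hϰ.good (hb' t).le) (hϰ.good (by rw [tr_norm]; exact (hb' t).le))
    hϰ.one_le

end

section

variable {G : Geometry} {σ σ' σ₁ σ₂ σ₃ c κ s r A : ℝ} {φ f g : ℝ → ℂ}

/-! ### Sobolev norms of functions -/

/-- The `H^σ` norm of a function given by its Fourier transform, possibly infinite. -/
def eN (G : Geometry) (σ : ℝ) (f : ℝ → ℂ) : ℝ≥0∞ := eLpNorm f 2 (sobolevMeasure G σ)

theorem eN_sq (σ : ℝ) (f : ℝ → ℂ) : eN G σ f ^ 2 = sobSq G σ f := eLpNorm_sobolevMeasure_sq σ f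

theorem eN_le_of_sobSq_le {C : ℝ≥0∞} (h : sobSq G σ f ≤ C ^ 2) : eN G σ f ≤ C :=
  (ENNReal.pow_le_pow_left_iff two_ne_zero).1 ((eN_sq σ f).trans_le h)

theorem eN_congr (h : f =ᵐ[freq G] g) : eN G σ f = eN G σ g :=
  eLpNorm_congr_ae (by rw [EventuallyEq, ae_sobolevMeasure]; exact h)

theorem eN_coe (f : Hs G σ) : eN G σ f = ‖f‖ₑ := (Lp.enorm_def f).symm

theorem eN_lt_top_iff : eN G σ f < ∞ ↔ sobSq G σ f < ∞ := by
  rw [← eN_sq]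
  simp [lt_top_iff_ne_top]

theorem eN_add_le (hf : Measurable f) (hg : Measurable g) :
    eN G σ (fun ξ => f ξ + g ξ) ≤ eN G σ f + eN G σ g :=
  eLpNorm_add_le hf.aestronglyMeasurable hg.aestronglyMeasurable one_le_two

theorem eN_mult_le (h : IsMult σ σ' c φ) (f : ℝ → ℂ) :
    eN G σ' (fun ξ => φ ξ * f ξ) ≤ ENNReal.ofReal c * eN G σ f := by
  refine eN_le_of_sobSq_le ((sobSq_mult_le h f).trans_eq ?_)
  rw [mul_pow, eN_sq, ENNReal.ofReal_pow h.nonneg]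

theorem eN_mlt_le (h : IsMult σ₁ σ₂ A φ) (h' : IsMult σ σ' c φ) (f : Hs G σ₁) :
    eN G σ' (mlt G h f) ≤ ENNReal.ofReal c * eN G σ f := by
  rw [eN_congr (mlt_coe h f)]; exact eN_mult_le h' f

theorem eN_mono (h : σ' ≤ σ) (f : ℝ → ℂ) : eN G σ' f ≤ eN G σ f := by
  simpa using eN_mult_le (isMult_one h) f

theorem eN_conjF (hf : Measurable f) : eN G σ (conjF f) = eN G σ f := by
  apply le_antisymm <;> refine eN_le_of_sobSq_le ?_
  · rw [eN_sq, sobSq_conjF hf]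
  · rw [eN_sq, sobSq_conjF hf]

theorem eN_mul_le (hk : IsKer G σ₁ σ₂ σ₃ A fun _ _ => convConst G) (hf : Measurable f)
    (hg : Measurable g) :
    eN G σ₃ (mul G f g) ≤ ENNReal.ofReal (3 * A) * eN G σ₁ f * eN G σ₂ g := by
  refine eN_le_of_sobSq_le ?_
  rw [mul_eq_kconv]
  refine (sobSq_kconv_le hk hf hg).trans_eq ?_
  rw [ENNReal.ofReal_pow (by linarith [hk.nonneg]), ← eN_sq, ← eN_sq]
  ring

theorem IsKer.mono_right {k : ℝ → ℝ → ℂ} (hk : IsKer G σ₁ σ₂ σ₃ A k) (h : σ₂ ≤ σ) :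
    IsKer G σ₁ σ σ₃ A k := by
  obtain ⟨g, h1, h2, h3, h4⟩ := hk.bound
  refine ⟨hk.meas, hk.nonneg, g, h1, h2, h3, fun ξ η => (h4 ξ η).trans ?_⟩
  have := add_nonneg (add_nonneg (h2 ξ) (h2 η)) (h2 (ξ - η))
  gcongr
  exact one_le_bracket η

theorem IsKer.mono_left {k : ℝ → ℝ → ℂ} (hk : IsKer G σ₁ σ₂ σ₃ A k) (h : σ₁ ≤ σ) :
    IsKer G σ σ₂ σ₃ A k := by
  obtain ⟨g, h1, h2, h3, h4⟩ := hk.bound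
  refine ⟨hk.meas, hk.nonneg, g, h1, h2, h3, fun ξ η => (h4 ξ η).trans ?_⟩
  have := add_nonneg (add_nonneg (h2 ξ) (h2 η)) (h2 (ξ - η))
  gcongr
  exact one_le_bracket (ξ - η)

/-- The element of `H^σ` given by a function, or `0` if its norm is infinite. -/
def up (σ : ℝ) {σ₁ : ℝ} (f : Hs G σ₁) : Hs G σ :=
  open Classical in if h : sobSq G σ f < ∞ then ofFun f (measurable_coe f) h else 0

theorem up_coe {f : Hs G σ₁} (h : eN G σ f < ∞) : (up σ f : ℝ → ℂ) =ᵐ[freq G] f := by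
  rw [up, dif_pos (eN_lt_top_iff.1 h)]
  exact ofFun_coe _ _

theorem enorm_up {f : Hs G σ₁} (h : eN G σ f < ∞) : ‖up σ f‖ₑ = eN G σ f := by
  rw [← eN_coe, eN_congr (up_coe h)]

theorem norm_le_of_eN_le {f : Hs G σ} {C : ℝ≥0} (h : eN G σ f ≤ C) : ‖f‖ ≤ C := by
  rw [eN_coe] at h
  exact_mod_cast h

theorem eN_le_of_norm_le {f : Hs G σ} {C : ℝ≥0} (h : ‖f‖ ≤ C) : eN G σ f ≤ C := by
  rw [eN_coe]
  exact_mod_cast h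

theorem eN_sub_le (f g : Hs G σ₁) : eN G σ (f - g : Hs G σ₁) ≤ eN G σ f + eN G σ g := by
  have h : (f - g : Hs G σ₁) =ᵐ[freq G] fun ξ => f ξ + (-g : Hs G σ₁) ξ := by
    rw [sub_eq_add_neg]; exact coe_add_ae f (-g)
  rw [eN_congr h]
  refine (eN_add_le (measurable_coe f) (measurable_coe _)).trans (le_of_eq ?_)
  congr 1
  have : (-g : Hs G σ₁) =ᵐ[freq G] fun ξ => -g ξ := coe_neg_ae g
  rw [eN_congr this]
  exact eLpNorm_neg _ _ _

theorem eN_add_le' (f g : Hs G σ₁) : eN G σ (f + g : Hs G σ₁) ≤ eN G σ f + eN G σ g := by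
  rw [eN_congr (coe_add_ae f g)]
  exact eN_add_le (measurable_coe f) (measurable_coe g)

theorem eN_conjL (f : Hs G σ₁) : eN G σ (conjL G σ₁ f) = eN G σ f := by
  rw [eN_congr (conjL_coe f), eN_conjF (measurable_coe f)]

theorem eN_tr (h : ℝ) (f : Hs G σ₁) : eN G σ (tr G σ₁ h f) = eN G σ f := by
  have key : ∀ (h : ℝ) (f : Hs G σ₁), eN G σ (tr G σ₁ h f) ≤ eN G σ f := fun h f => by
    have := eN_mlt_le (G := G) (isMult_tr σ₁ h) (isMult_tr σ h) f
    rwa [ENNReal.ofReal_one, one_mul] at this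
  refine le_antisymm (key h f) ?_
  have := key (-h) (tr G σ₁ h f)
  rwa [tr_tr, neg_add_cancel, tr_zero] at this

theorem eN_real_smul (a : ℝ) (f : Hs G σ₁) :
    eN G σ (a • f : Hs G σ₁) = ‖a‖ₑ * eN G σ f := by
  rw [eN_congr (coe_real_smul_ae a f)]
  have : ‖a‖ₑ = ‖(a : ℂ)‖ₑ := by
    rw [← ofReal_norm, ← ofReal_norm, Complex.norm_real]
  rw [this]
  exact eLpNorm_const_smul (a : ℂ) (f : ℝ → ℂ) 2 (sobolevMeasure G σ)

variable [hs : Fact (s ∈ Ioo (-(1 / 2) : ℝ) 0)]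

/-! ### Higher regularity of the vector field -/

theorem exists_isKer_alg (G : Geometry) (s : ℝ) [hs : Fact (s ∈ Ioo (-(1 / 2) : ℝ) 0)] (k : ℕ) :
    ∃ A, IsKer G (s + k + 1) (s + k + 1) (s + k + 1) A fun _ _ => convConst G :=
  exists_isKer_mul_alg G (by have := hs.out.1; have : (0 : ℝ) ≤ k := k.cast_nonneg; linarith)

/-- From `k = 1` on, the lower space is itself an algebra. -/
theorem exists_isKer_low (G : Geometry) (s : ℝ) [hs : Fact (s ∈ Ioo (-(1 / 2) : ℝ) 0)] (k : ℕ) :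
    ∃ A, IsKer G (s + k) (s + k + 1) (s + k) A fun _ _ => convConst G := by
  cases k with
  | zero => simpa using exists_isKer_mul_low G hs.out
  | succ k =>
    obtain ⟨A, hA⟩ := exists_isKer_alg G s k
    refine ⟨A, ?_⟩
    push_cast
    rw [← add_assoc]
    exact hA.mono_right (by linarith)

/-- Bootstrap on `x = R (g + q x)`: each pass through the resolvent gains a derivative. Smallness is
needed only in `H^s`, so `κ` does not depend on `k`. -/
theorem exists_eN_gInv (h : Adm G s κ r) (k : ℕ) (M : ℝ≥0) : ∃ C : ℝ≥0, ∀ q g : Hs G s,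
    ‖q‖ ≤ r → eN G (s + k) q ≤ M →
      eN G (s + k + 1) (gInv κ q (res G s κ g)) ≤ C * eN G (s + k) g := by
  induction k with
  | zero =>
    have hκ0 : 0 < κ := by linarith [h.one_le]
    refine ⟨(2 * κ ^ (s + 1)).toNNReal, fun q g hq _ => ?_⟩
    simp only [CharP.cast_eq_zero, add_zero]
    have h1 := (h.gInv_le hq (res G s κ g)).trans
      (mul_le_mul_of_nonneg_left (res_norm_le g) (by positivity))
    rw [eN_coe, eN_coe, enorm_eq_nnnorm, enorm_eq_nnnorm, ← ENNReal.coe_mul, ENNReal.coe_le_coe,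
      ← NNReal.coe_le_coe, NNReal.coe_mul, Real.coe_toNNReal _ (by positivity)]
    exact h1
  | succ k ih =>
    obtain ⟨C, hC⟩ := ih
    obtain ⟨A, hA⟩ := exists_isKer_alg G s k
    refine ⟨1 + (3 * A).toNNReal * M * C, fun q g hq hM => ?_⟩
    have e : s + ((k + 1 : ℕ) : ℝ) = s + k + 1 := by push_cast; ring
    rw [e] at hM ⊢
    have hk : s + k ≤ s + k + 1 := by linarith
    have h0 := hC q g hq ((eN_mono hk _).trans hM)
    set x := gInv κ q (res G s κ g) with hx
    have hxe : x = res G s κ (g + low q x) := by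
      rw [map_add]; exact gInv_eq (h.good hq) _
    have h1 : eN G (s + k + 1 + 1) x ≤ eN G (s + k + 1) (g + low q x : Hs G s) := by
      conv_lhs => rw [hxe]
      have := eN_mlt_le (G := G) (isMult_resSym s κ) (isMult_resSym (s + k + 1) κ) (g + low q x)
      rwa [ENNReal.ofReal_one, one_mul] at this
    refine h1.trans ((eN_add_le' _ _).trans ?_)
    rw [eN_congr (low_coe q x)]
    have h2 := eN_mul_le hA (measurable_coe q) (measurable_coe x)
    have h3 : eN G (s + k + 1) (mul G q x) ≤
        ENNReal.ofReal (3 * A) * M * (C * eN G (s + k + 1) g) := by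
      refine h2.trans ?_
      gcongr
      exact h0.trans (by gcongr; exact eN_mono hk _)
    refine (add_le_add le_rfl h3).trans (le_of_eq ?_)
    push_cast
    rw [ENNReal.ofReal]; ring

/-- Products are Lipschitz on bounded sets. -/
theorem eN_alg_sub_le {σ : ℝ} (hA : IsKer G σ σ σ A fun _ _ => convConst G)
    (a b a' b' : Hs G (s + 1)) {B D : ℝ≥0∞} (ha : eN G σ a ≤ B)
    (hb' : eN G σ b' ≤ B) (had : eN G σ (a - a' : Hs G (s + 1)) ≤ D)
    (hbd : eN G σ (b - b' : Hs G (s + 1)) ≤ D) :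
    eN G σ (alg a b - alg a' b' : Hs G (s + 1)) ≤ 2 * (ENNReal.ofReal (3 * A) * B * D) := by
  have e : alg a b - alg a' b' = alg a (b - b') + alg (a - a') b' := by
    rw [alg_sub, sub_alg]; abel
  rw [e, two_mul]
  refine (eN_add_le' _ _).trans (add_le_add ?_ ?_)
  · rw [eN_congr (alg_coe _ _)]
    refine (eN_mul_le hA (measurable_coe _) (measurable_coe _)).trans ?_
    gcongr
  · rw [eN_congr (alg_coe _ _)]
    refine (eN_mul_le hA (measurable_coe _) (measurable_coe _)).trans ?_
    rw [mul_right_comm]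
    gcongr

theorem exists_eN_Yf (h : Adm G s κ r) (k : ℕ) (M : ℝ≥0) : ∃ C : ℝ≥0,
    (∀ x : Hs G s, ‖x‖ ≤ r → eN G (s + k) x ≤ M → eN G (s + k) (Yf κ x) ≤ C) ∧
    ∀ x y : Hs G s, ‖x‖ ≤ r → ‖y‖ ≤ r → eN G (s + k) x ≤ M → eN G (s + k) y ≤ M →
      eN G (s + k) (Yf κ x - Yf κ y : Hs G s) ≤ C * eN G (s + k) (x - y : Hs G s) := by
  obtain ⟨C, hC⟩ := exists_eN_gInv h k M
  obtain ⟨A, hA⟩ := exists_isKer_alg G s k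
  obtain ⟨A', hA'⟩ := exists_isKer_low G s k
  have hm : ∀ x : Hs G s, ‖x‖ ≤ r → eN G (s + k) x ≤ M → eN G (s + k + 1) (mm κ x) ≤ C * M :=
    fun x hx hM => (hC x x hx hM).trans (by gcongr)
  have hmc : ∀ x : Hs G s, ‖x‖ ≤ r → eN G (s + k) x ≤ M → eN G (s + k + 1) (mc κ x) ≤ C * M :=
    fun x hx hM => by rw [mc, eN_conjL]; exact hm x hx hM
  set C₁ : ℝ≥0 := C * (1 + (3 * A').toNNReal * (C * M)) with hC₁
  have hmd : ∀ x y : Hs G s, ‖x‖ ≤ r → ‖y‖ ≤ r → eN G (s + k) x ≤ M → eN G (s + k) y ≤ M →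
      eN G (s + k + 1) (mm κ x - mm κ y : Hs G (s + 1)) ≤ C₁ * eN G (s + k) (x - y : Hs G s) := by
    intro x y hx hy hMx hMy
    have e : mm κ x - mm κ y = gInv κ x (res G s κ ((x - y) + low (x - y) (mm κ y))) := by
      rw [mm_sub (h.good hx) (h.good hy), map_add (res G s κ)]; rfl
    rw [e]
    refine (hC x _ hx hMx).trans ?_
    have h1 : eN G (s + k) (low (x - y) (mm κ y)) ≤
        ENNReal.ofReal (3 * A') * eN G (s + k) (x - y : Hs G s) * (C * M) := by
      rw [eN_congr (low_coe _ _)]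
      refine (eN_mul_le hA' (measurable_coe _) (measurable_coe _)).trans ?_
      gcongr
      exact hm y hy hMy
    refine (mul_le_mul' le_rfl ((eN_add_le' _ _).trans (add_le_add le_rfl h1))).trans_eq ?_
    rw [hC₁]; push_cast
    rw [ENNReal.ofReal]; ring
  have hY : ∀ a : Hs G (s + 1), eN G (s + k) ((-(κ ^ 2)) • dxL G s a : Hs G s) ≤
      ‖-(κ ^ 2)‖ₑ * eN G (s + k + 1) a := fun a => by
    rw [eN_real_smul]
    gcongr
    have := eN_mlt_le (G := G) (isMult_dx s) (isMult_dx (s + k)) a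
    rwa [ENNReal.ofReal_one, one_mul] at this
  set P : ℝ≥0 := ‖-(κ ^ 2)‖₊ with hP
  refine ⟨P * (C * M + C * M + (3 * A).toNNReal * (C * M) * (C * M)) +
    P * (C₁ + C₁ + 2 * ((3 * A).toNNReal * (C * M) * C₁)), fun x hx hM => ?_,
    fun x y hx hy hMx hMy => ?_⟩
  · refine (hY _).trans ?_
    have h1 : eN G (s + k + 1) (Zf κ x) ≤
        C * M + C * M + ENNReal.ofReal (3 * A) * (C * M) * (C * M) := by
      refine (eN_add_le' _ _).trans (add_le_add ((eN_add_le' _ _).trans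
        (add_le_add (hm x hx hM) (hmc x hx hM))) ?_)
      rw [eN_congr (alg_coe _ _)]
      refine (eN_mul_le hA (measurable_coe _) (measurable_coe _)).trans ?_
      gcongr
      · exact hm x hx hM
      · exact hmc x hx hM
    refine (mul_le_mul' le_rfl h1).trans ?_
    push_cast
    exact le_add_right (le_of_eq rfl)
  · have e : Yf κ x - Yf κ y = (-(κ ^ 2)) • dxL G s (Zf κ x - Zf κ y) := by
      rw [Yf, Yf, ← smul_sub, ← map_sub]
    rw [e]
    refine (hY _).trans ?_
    set D := eN G (s + k) (x - y : Hs G s) with hD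
    have hd := hmd x y hx hy hMx hMy
    have hdc : eN G (s + k + 1) (mc κ x - mc κ y : Hs G (s + 1)) ≤ C₁ * D := by
      rw [mc_sub, eN_conjL]; exact hd
    have e2 : Zf κ x - Zf κ y = (mm κ x - mm κ y) + (mc κ x - mc κ y) +
        (alg (mm κ x) (mc κ x) - alg (mm κ y) (mc κ y)) := by
      rw [Zf, Zf]; abel
    have h1 : eN G (s + k + 1) (Zf κ x - Zf κ y : Hs G (s + 1)) ≤ C₁ * D + C₁ * D +
        2 * (ENNReal.ofReal (3 * A) * (C * M) * (C₁ * D)) := by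
      rw [e2]
      exact (eN_add_le' _ _).trans (add_le_add ((eN_add_le' _ _).trans (add_le_add hd hdc))
        (eN_alg_sub_le hA _ _ _ _ (hm x hx hMx) (hmc y hy hMy) hd hdc))
    refine (mul_le_mul' le_rfl h1).trans ?_
    push_cast
    rw [add_mul]
    refine le_add_left (le_of_eq ?_)
    rw [hP, ENNReal.ofReal, enorm_eq_nnnorm]
    ring

end

section

/-! ### Gronwall's inequality in both time directions, and continuity from local comparison -/

section Gronwall

variable {E F : Type*} [NormedAddCommGroup E] [NormedSpace ℝ E]
  [NormedAddCommGroup F] [NormedSpace ℝ F]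

theorem norm_le_mul_exp_of_hasDerivAt {d d' : ℝ → E} {K T : ℝ}
    (hd : ∀ t, HasDerivAt d (d' t) t) (hK : ∀ t ∈ Icc (-T) T, ‖d' t‖ ≤ K * ‖d t‖) {t : ℝ}
    (ht : t ∈ Icc (-T) T) : ‖d t‖ ≤ ‖d 0‖ * Real.exp (K * |t|) := by
  have key : ∀ {d d' : ℝ → E}, (∀ t, HasDerivAt d (d' t) t) →
      (∀ t ∈ Icc 0 T, ‖d' t‖ ≤ K * ‖d t‖) → ∀ t ∈ Icc 0 T, ‖d t‖ ≤ ‖d 0‖ * Real.exp (K * t) := by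
    intro d d' hd hK t ht
    have := norm_le_gronwallBound_of_norm_deriv_right_le (f := d) (f' := d') (a := 0) (b := T)
      (K := K) (ε := 0) (fun t _ => (hd t).continuousAt.continuousWithinAt)
      (fun t _ => (hd t).hasDerivWithinAt) le_rfl
      (fun t ht => by rw [add_zero]; exact hK t (Ico_subset_Icc_self ht)) t ht
    rwa [gronwallBound_ε0, sub_zero] at this
  rcases le_total 0 t with h | h
  · rw [abs_of_nonneg h]
    exact key hd (fun t ht => hK t ⟨by linarith [ht.1, ht.2], ht.2⟩) t ⟨h, ht.2⟩
  · rw [abs_of_nonpos h]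
    have := key (d := fun t => d (-t)) (fun t => hasDerivAt_comp_neg (hd (-t)))
      (fun t ht => by
        rw [norm_neg]
        exact hK (-t) ⟨by linarith [ht.2], by linarith [ht.1, ht.2]⟩) (-t)
      ⟨by linarith, by linarith [ht.1]⟩
    simpa using this

theorem continuous_of_local_bound {f : ℝ → E} {g : ℝ → F} (hg : Continuous g)
    (h : ∀ T : ℝ, ∃ C : ℝ≥0, ∀ x ∈ Icc (-T) T, ∀ y ∈ Icc (-T) T,
      ‖f x - f y‖ ≤ C * ‖g x - g y‖) : Continuous f := by
  rw [continuous_iff_continuousAt]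
  intro t
  obtain ⟨C, hC⟩ := h (|t| + 1)
  rw [ContinuousAt, tendsto_iff_norm_sub_tendsto_zero]
  have h1 : Tendsto (fun x => (C : ℝ) * ‖g x - g t‖) (𝓝 t) (𝓝 0) := by
    have hc : Continuous fun x => (C : ℝ) * ‖g x - g t‖ := by fun_prop
    simpa using hc.tendsto t
  refine squeeze_zero' (Eventually.of_forall fun _ => norm_nonneg _) ?_ h1
  have h2 : ∀ᶠ x in 𝓝 t, |x| < |t| + 1 :=
    continuous_abs.continuousAt.eventually (Iio_mem_nhds (by linarith))
  filter_upwards [h2] with x hx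
  exact hC x (abs_le.1 hx.le) t (abs_le.1 (by linarith))

end Gronwall

/-! ### Lifting differentiable curves to higher Sobolev norms -/

variable {G : Geometry} {σ σ' τ κ s R A : ℝ}

theorem up_sub {f g : Hs G σ} (hf : eN G τ f < ∞) (hg : eN G τ g < ∞) :
    up τ f - up τ g = up τ (f - g) := by
  refine Hs_ext ?_
  filter_upwards [coe_sub_ae (up τ f) (up τ g), up_coe hf, up_coe hg, coe_sub_ae f g,
    up_coe (f := f - g) ((eN_sub_le f g).trans_lt (ENNReal.add_lt_top.2 ⟨hf, hg⟩))]
    with ξ h1 h2 h3 h4 h5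
  rw [h1, h2, h3, h5, h4]

theorem emb_up (h : σ ≤ τ) {f : Hs G σ} (hf : eN G τ f < ∞) : emb G h (up τ f) = f := by
  refine Hs_ext ?_
  filter_upwards [emb_coe h (up τ f), up_coe hf] with ξ h1 h2
  rw [h1, h2]

theorem up_tr {f : Hs G σ} (hf : eN G τ f < ∞) (h : ℝ) :
    up τ (tr G σ h f) = tr G τ h (up τ f) := by
  refine Hs_ext ?_
  filter_upwards [up_coe (f := tr G σ h f) (by rwa [eN_tr]), tr_coe h f, tr_coe h (up τ f),
    up_coe hf] with ξ h1 h2 h3 h4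
  rw [h1, h2, h3, h4]

theorem norm_up_le {f : Hs G σ} {C : ℝ≥0} (h : eN G τ f ≤ C) : ‖up τ f‖ ≤ C :=
  norm_le_of_eN_le (by rwa [eN_congr (up_coe (h.trans_lt ENNReal.coe_lt_top))])

theorem norm_up_le_mul {f : Hs G σ} {g : Hs G σ'} {C : ℝ≥0} (hg : eN G τ g < ∞)
    (h : eN G τ f ≤ C * eN G τ g) : ‖up τ f‖ ≤ C * ‖up τ g‖ := by
  rw [← enorm_up hg, enorm_eq_nnnorm, ← ENNReal.coe_mul] at h
  exact norm_up_le h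

/-- Local boundedness in `H^τ`. -/
def LocBdd (τ : ℝ) (w : ℝ → Hs G σ) : Prop :=
  ∀ T : ℝ, ∃ C : ℝ≥0, ∀ t ∈ Icc (-T) T, eN G τ (w t) ≤ C

theorem LocBdd.lt_top {w : ℝ → Hs G σ} (h : LocBdd τ w) (t : ℝ) : eN G τ (w t) < ∞ := by
  obtain ⟨C, hC⟩ := h |t|
  exact (hC t (abs_le.1 le_rfl)).trans_lt ENNReal.coe_lt_top

theorem hasDerivWithinAt_emb_up (hσ : σ ≤ τ) {w v : ℝ → Hs G σ} (hw : LocBdd τ w)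
    (hv : LocBdd τ v) (hd : ∀ t, HasDerivAt w (v t) t) (I : Set ℝ) (t : ℝ) :
    HasDerivWithinAt (fun t => (emb G hσ).restrictScalars ℝ (up τ (w t)))
      ((emb G hσ).restrictScalars ℝ (up τ (v t))) I t := by
  have e : ∀ {w : ℝ → Hs G σ}, LocBdd τ w → ∀ t,
      (emb G hσ).restrictScalars ℝ (up τ (w t)) = w t := fun h t => emb_up hσ (h.lt_top t)
  rw [e hv]
  exact ((hd t).hasDerivWithinAt).congr (fun t _ => e hw t) (e hw t)

/-- A derivative locally bounded in `H^τ` makes the curve locally Lipschitz in `H^τ`, although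
differentiability is known only in `H^σ`. -/
theorem continuous_up (hσ : σ ≤ τ) {w v : ℝ → Hs G σ} (hw : LocBdd τ w) (hv : LocBdd τ v)
    (hd : ∀ t, HasDerivAt w (v t) t) : Continuous fun t => up τ (w t) := by
  refine continuous_of_local_bound continuous_id fun T => ?_
  obtain ⟨C, hC⟩ := hv T
  refine ⟨C, fun x hx y hy => ?_⟩
  have := (isRegEmb_emb hσ).norm_image_sub_le (I := Icc (-T) T) (f := fun t => up τ (w t))
    (f' := fun t => up τ (v t)) (c := 0) (convex_Icc _ _)
    (fun t _ => hasDerivWithinAt_emb_up hσ hw hv hd _ t)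
    (fun t ht => by rw [sub_zero]; exact norm_up_le (hC t ht)) hy hx
  simpa using this

theorem hasDerivAt_up (hσ : σ ≤ τ) {w v : ℝ → Hs G σ} (hw : LocBdd τ w) (hv : LocBdd τ v)
    (hd : ∀ t, HasDerivAt w (v t) t) (hc : Continuous fun t => up τ (v t)) (t : ℝ) :
    HasDerivAt (fun t => up τ (w t)) (up τ (v t)) t := by
  rw [← hasDerivWithinAt_univ]
  exact (isRegEmb_emb hσ).hasDerivWithinAt (f' := fun t => up τ (v t)) convex_univ
    (fun t _ => hasDerivWithinAt_emb_up hσ hw hv hd _ t) (mem_univ t) hc.continuousWithinAt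

/-- The difference quotients converge pointwise to `i ξ f` on the Fourier side; Fatou's lemma passes
their common bound to the limit. -/
theorem eN_abs_mul_le {f : Hs G σ} {B : ℝ≥0}
    (h : ∀ n : ℕ, ‖tr G σ (1 / (n + 1 : ℝ)) f - f‖ ≤ 1 / (n + 1 : ℝ) * B) :
    eN G σ (fun ξ => (ξ : ℂ) * f ξ) ≤ B := by
  set F : ℕ → ℝ → ℂ := fun n ξ => (n + 1 : ℂ) *
    ((Complex.exp (Complex.I * (ξ : ℂ) * ((1 / (n + 1 : ℝ) : ℝ) : ℂ)) - 1) * f ξ) with hF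
  have hFm : ∀ n, Measurable (F n) := fun n => by
    have := measurable_coe f
    fun_prop
  have hlim : ∀ ξ : ℝ, Tendsto (fun n => F n ξ) atTop (𝓝 (Complex.I * ξ * f ξ)) := by
    intro ξ
    have h1 : HasDerivAt (fun t : ℝ => Complex.exp (Complex.I * (ξ : ℂ) * (t : ℂ)))
        (Complex.I * ξ) 0 := by
      have h2 : HasDerivAt (fun t : ℂ => Complex.exp (Complex.I * (ξ : ℂ) * t))
          (Complex.I * ξ) ((0 : ℝ) : ℂ) := by
        have := ((hasDerivAt_id ((0 : ℝ) : ℂ)).const_mul (Complex.I * (ξ : ℂ))).cexp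
        simpa using this
      exact h2.comp_ofReal
    have h3 := h1.tendsto_slope_zero_right
    have h4 : Tendsto (fun n : ℕ => 1 / ((n : ℝ) + 1)) atTop (𝓝[>] 0) := by
      rw [tendsto_nhdsWithin_iff]
      exact ⟨tendsto_one_div_add_atTop_nhds_zero_nat, Eventually.of_forall fun n => by
        simp only [mem_Ioi]; positivity⟩
    have h5 := (h3.comp h4).mul_const (f ξ)
    refine h5.congr fun n => ?_
    simp only [Function.comp, hF, zero_add, one_div, inv_inv, Complex.ofReal_zero, mul_zero,
      Complex.exp_zero, Complex.real_smul]
    push_cast; ring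
  have hnorm : ∀ n, eN G σ (F n) ≤ B := by
    intro n
    have e : F n =ᵐ[freq G] (((n + 1 : ℂ) • (tr G σ (1 / (n + 1 : ℝ)) f - f) : Hs G σ) : ℝ → ℂ) := by
      filter_upwards [coe_smul_ae (n + 1 : ℂ) (tr G σ (1 / (n + 1 : ℝ)) f - f),
        coe_sub_ae (tr G σ (1 / (n + 1 : ℝ)) f) f, tr_coe (1 / (n + 1 : ℝ)) f] with ξ h1 h2 h3
      rw [h1, h2, h3, hF]; ring
    rw [eN_congr e]
    refine eN_le_of_norm_le ?_
    rw [norm_smul]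
    have hn : ‖(n + 1 : ℂ)‖ = (n : ℝ) + 1 := by
      have := Complex.norm_natCast (n + 1)
      push_cast at this; exact this
    rw [hn]
    calc ((n : ℝ) + 1) * ‖tr G σ (1 / (n + 1 : ℝ)) f - f‖ ≤ ((n : ℝ) + 1) * (1 / (n + 1 : ℝ) * B) := by
          gcongr; exact h n
      _ = B := by field_simp
  have e : eN G σ (fun ξ => (ξ : ℂ) * f ξ) = eN G σ (fun ξ => Complex.I * ξ * f ξ) := by
    refine eLpNorm_congr_norm_ae (Eventually.of_forall fun ξ => ?_)
    simp
  rw [e]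
  refine (Lp.eLpNorm_lim_le_liminf_eLpNorm (fun n => (hFm n).aestronglyMeasurable) _
    (Eventually.of_forall hlim)).trans ?_
  refine (liminf_le_liminf (Eventually.of_forall hnorm)).trans ?_
  simp

theorem eN_add_one_le {f : ℝ → ℂ} (hf : Measurable f) :
    eN G (σ + 1) f ≤ eN G σ f + eN G σ (fun ξ => (ξ : ℂ) * f ξ) := by
  have e : eN G (σ + 1) f = eN G σ (fun ξ => ((‖f ξ‖ + ‖(ξ : ℂ) * f ξ‖ : ℝ) : ℂ)) := by
    have h2 : eN G (σ + 1) f ^ 2 =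
        eN G σ (fun ξ => ((‖f ξ‖ + ‖(ξ : ℂ) * f ξ‖ : ℝ) : ℂ)) ^ 2 := by
      rw [eN_sq, eN_sq, sobSq, sobSq]
      refine lintegral_congr fun ξ => ?_
      congr 1
      rw [Real.rpow_add (bracket_pos ξ), Real.rpow_one, ENNReal.ofReal_mul (bracket_rpow_pos ξ σ).le,
        mul_assoc]
      congr 1
      rw [← ofReal_norm, ← ofReal_norm, ← ENNReal.ofReal_mul (bracket_pos ξ).le, Complex.norm_real,
        Real.norm_of_nonneg (by positivity), norm_mul, Complex.norm_real, Real.norm_eq_abs]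
      congr 1; ring
    exact (ENNReal.pow_right_strictMono two_ne_zero).injective h2
  rw [e]
  have h1 := eN_add_le (G := G) (σ := σ) (f := fun ξ => ((‖f ξ‖ : ℝ) : ℂ))
    (g := fun ξ => ((‖(ξ : ℂ) * f ξ‖ : ℝ) : ℂ)) (by fun_prop) (by fun_prop)
  push_cast at h1 ⊢
  refine h1.trans (le_of_eq ?_)
  congr 1 <;> refine eLpNorm_congr_norm_ae (Eventually.of_forall fun ξ => ?_) <;> simp

theorem eN_add_one_le_of_tr {f : Hs G σ} {B : ℝ≥0}
    (h : ∀ n : ℕ, ‖tr G σ (1 / (n + 1 : ℝ)) f - f‖ ≤ 1 / (n + 1 : ℝ) * B) :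
    eN G (σ + 1) f ≤ eN G σ f + B :=
  (eN_add_one_le (measurable_coe f)).trans (add_le_add le_rfl (eN_abs_mul_le h))

/-! ### Propagation of regularity along integral curves -/

variable [hs : Fact (s ∈ Ioo (-(1 / 2) : ℝ) 0)]

/-- An integral curve of `Yf` in a ball. -/
structure IsCurve (κ R : ℝ) (p : ℝ → Hs G s) : Prop where
  deriv : ∀ t, HasDerivAt p (Yf κ (p t)) t
  bound : ∀ t, ‖p t‖ ≤ R

theorem le_add_natCast (s : ℝ) (k : ℕ) : s ≤ s + k := le_add_of_nonneg_right k.cast_nonneg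

theorem locBdd_Yf (h : Adm G s κ R) {k : ℕ} {p : ℝ → Hs G s} (hp : ∀ t, ‖p t‖ ≤ R)
    (hb : LocBdd (s + k) p) : LocBdd (s + k) fun t => Yf κ (p t) := by
  intro T
  obtain ⟨M, hM⟩ := hb T
  obtain ⟨C, hC, -⟩ := exists_eN_Yf h k M
  exact ⟨C, fun t ht => hC _ (hp t) (hM t ht)⟩

theorem continuous_up_Yf (h : Adm G s κ R) {k : ℕ} {p : ℝ → Hs G s} (hp : ∀ t, ‖p t‖ ≤ R)
    (hb : LocBdd (s + k) p) (hc : Continuous fun t => up (s + k) (p t)) :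
    Continuous fun t => up (s + k) (Yf κ (p t)) := by
  have hY := locBdd_Yf h hp hb
  refine continuous_of_local_bound hc fun T => ?_
  obtain ⟨M, hM⟩ := hb T
  obtain ⟨C, -, hC⟩ := exists_eN_Yf h k M
  refine ⟨C, fun x hx y hy => ?_⟩
  rw [up_sub (hY.lt_top x) (hY.lt_top y), up_sub (hb.lt_top x) (hb.lt_top y)]
  exact norm_up_le_mul ((eN_sub_le _ _).trans_lt
    (ENNReal.add_lt_top.2 ⟨hb.lt_top x, hb.lt_top y⟩))
    (hC _ _ (hp x) (hp y) (hM x hx) (hM y hy))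

theorem IsCurve.hasDerivAt_up (h : Adm G s κ R) {k : ℕ} {p : ℝ → Hs G s} (hp : IsCurve κ R p)
    (hb : LocBdd (s + k) p) (t : ℝ) :
    HasDerivAt (fun t => up (s + k) (p t)) (up (s + k) (Yf κ (p t))) t := by
  have hY := locBdd_Yf h hp.bound hb
  have hs := le_add_natCast s k
  exact BenjaminOno.hasDerivAt_up hs hb hY hp.deriv
    (continuous_up_Yf h hp.bound hb (continuous_up hs hb hY hp.deriv)) t

/-- Propagation of regularity, with uniform bounds. -/
theorem exists_eN_curve_le (h : Adm G s κ R) (k : ℕ) : ∀ (T : ℝ) (M : ℝ≥0), ∃ M' : ℝ≥0,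
    ∀ p : ℝ → Hs G s, IsCurve κ R p → eN G (s + k) (p 0) ≤ M →
      ∀ t ∈ Icc (-T) T, eN G (s + k) (p t) ≤ M' := by
  induction k with
  | zero =>
    intro T M
    refine ⟨⟨R, h.nonneg⟩, fun p hp _ t _ => ?_⟩
    simp only [CharP.cast_eq_zero, add_zero]
    exact eN_le_of_norm_le (hp.bound t)
  | succ k ih =>
    intro T M
    obtain ⟨M₁, hM₁⟩ := ih T M
    obtain ⟨C, -, hC⟩ := exists_eN_Yf h k M₁
    refine ⟨M₁ + M * (Real.exp (C * |T|)).toNNReal, fun p hp h0 => ?_⟩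
    have e : s + ((k + 1 : ℕ) : ℝ) = s + k + 1 := by push_cast; ring
    rw [e] at h0 ⊢
    have hk : s + k ≤ s + k + 1 := by linarith
    have h0' : eN G (s + k) (p 0) ≤ M := (eN_mono hk _).trans h0
    have hb : LocBdd (s + k) p := fun T => (ih T M).imp fun M' hM' => hM' p hp h0'
    have hY := locBdd_Yf h hp.bound hb
    set P : ℝ → Hs G (s + k) := fun t => up (s + k) (p t) with hP
    have hd := hp.hasDerivAt_up h hb
    intro t ht
    -- An orbit and its translate by `u` solve the same equation, as `Yf` commutes with
    -- translations. Gronwall in `H^{s+k}` bounds their difference by `|u|` times a constant, and a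
    -- Lipschitz bound under translation is one more derivative.
    have hest : ∀ u : ℝ, ‖tr G (s + k) u (P t) - P t‖ ≤
        |u| * ((M * (Real.exp (C * |T|)).toNNReal : ℝ≥0) : ℝ) := by
      intro u
      have hd2 : ∀ t, HasDerivAt (fun t => tr G (s + k) u (P t) - P t)
          (tr G (s + k) u (up (s + k) (Yf κ (p t))) - up (s + k) (Yf κ (p t))) t := fun t =>
        (((tr G (s + k) u).restrictScalars ℝ).hasFDerivAt.comp_hasDerivAt t (hd t)).sub (hd t)
      have hg := norm_le_mul_exp_of_hasDerivAt (K := C) hd2 (T := T) (fun t ht => by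
        have b1 : ‖tr G s u (p t)‖ ≤ R := (tr_norm u (p t)).trans_le (hp.bound t)
        have fin : eN G (s + k) (tr G s u (p t)) < ∞ := by rw [eN_tr]; exact hb.lt_top t
        have fin2 : eN G (s + k) (tr G s u (Yf κ (p t))) < ∞ := by rw [eN_tr]; exact hY.lt_top t
        rw [hP, ← up_tr (hb.lt_top t), ← up_tr (hY.lt_top t), up_sub fin (hb.lt_top t),
          up_sub fin2 (hY.lt_top t), ← Yf_tr u (h.good (hp.bound t)) (h.good b1)]
        refine norm_up_le_mul ((eN_sub_le _ _).trans_lt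
          (ENNReal.add_lt_top.2 ⟨fin, hb.lt_top t⟩)) (hC _ _ b1 (hp.bound t) ?_ (hM₁ p hp h0' t ht))
        rw [eN_tr]; exact hM₁ p hp h0' t ht) ht
      have hT : |t| ≤ |T| := (abs_le.2 ht).trans (le_abs_self T)
      have h00 : ‖tr G (s + k) u (P 0) - P 0‖ ≤ |u| * M := by
        set f := up (s + k + 1) (p 0) with hf
        have fin := h0.trans_lt ENNReal.coe_lt_top
        have e2 : P 0 = emb G hk f := by
          refine Hs_ext ?_
          filter_upwards [emb_coe hk f, up_coe fin, up_coe (hb.lt_top 0)] with ξ h1 h2 h3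
          rw [h1, h2, h3]
        have h5 := norm_tr_emb_sub_le u 0 hk f
        rw [tr_zero, sub_zero, ← e2] at h5
        exact h5.trans (by gcongr; exact norm_up_le h0)
      refine hg.trans ?_
      push_cast
      rw [Real.coe_toNNReal _ (Real.exp_pos _).le, ← mul_assoc]
      gcongr
    have h6 := eN_add_one_le_of_tr (f := P t) (B := M * (Real.exp (C * |T|)).toNNReal) fun n => by
      have := hest (1 / (n + 1 : ℝ))
      rwa [abs_of_nonneg (by positivity)] at this
    rw [hP, eN_congr (up_coe (hb.lt_top t)), eN_congr (up_coe (hb.lt_top t))] at h6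
    refine h6.trans ?_
    rw [ENNReal.coe_add]
    gcongr
    exact hM₁ p hp h0' t ht

theorem IsCurve.locBdd (h : Adm G s κ R) {k : ℕ} {p : ℝ → Hs G s} (hp : IsCurve κ R p)
    (h0 : eN G (s + k) (p 0) < ∞) : LocBdd (s + k) p := fun T => by
  obtain ⟨M', hM'⟩ := exists_eN_curve_le h k T (eN G (s + k) (p 0)).toNNReal
  exact ⟨M', hM' p hp (ENNReal.coe_toNNReal h0.ne).ge⟩

theorem memHInfty_iff {q : Hs G s} : MemHInfty q ↔ ∀ k : ℕ, eN G (s + k) q < ∞ := by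
  constructor
  · intro h k
    obtain ⟨u, hu⟩ := h (s + k)
    rw [← eN_congr hu, eN_coe]
    exact enorm_lt_top
  · intro h τ
    obtain ⟨k, hk⟩ := exists_nat_ge (τ - s)
    have hk' : τ ≤ s + k := by linarith
    exact ⟨emb G hk' (up (s + k) q), (emb_coe hk' _).trans (up_coe (h k))⟩

end

section

variable {G : Geometry} {σ σ' τ κ s R A c : ℝ}

/-! ### The algebra of smooth functions -/

/-- `H^∞`, as a space of elements of `H^1`. -/
def smooth (G : Geometry) : Submodule ℂ (Hs G 1) where
  carrier := {f | ∀ τ, eN G τ f < ∞}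
  add_mem' ha hb τ := (eN_add_le' _ _).trans_lt (ENNReal.add_lt_top.2 ⟨ha τ, hb τ⟩)
  zero_mem' τ := by
    rw [eN_congr coe_zero_ae, eN]
    simp
  smul_mem' a f hf τ := by
    rw [eN_congr (coe_smul_ae a f)]
    have e := eLpNorm_const_smul a (f : ℝ → ℂ) 2 (sobolevMeasure G τ)
    exact e.trans_lt (ENNReal.mul_lt_top (by simp) (hf τ))

/-- The space `H^∞`. -/
def Sm (G : Geometry) : Type := smooth G

namespace Sm

instance : AddCommGroup (Sm G) := inferInstanceAs (AddCommGroup (smooth G))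
instance : Module ℂ (Sm G) := inferInstanceAs (Module ℂ (smooth G))

/-- The underlying element of `H^1`. -/
def val : Sm G →ₗ[ℂ] Hs G 1 := (smooth G).subtype

/-- The Fourier transform. -/
def fn (f : Sm G) : ℝ → ℂ := f.val

theorem meas (f : Sm G) : Measurable f.fn := measurable_coe f.val

theorem eN_lt_top (f : Sm G) (τ : ℝ) : eN G τ f.fn < ∞ := f.2 τ

theorem ext_ae {f g : Sm G} (h : f.fn =ᵐ[freq G] g.fn) : f = g := Subtype.ext (Hs_ext h)

theorem fn_add (f g : Sm G) : (f + g).fn =ᵐ[freq G] fun ξ => f.fn ξ + g.fn ξ :=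
  coe_add_ae f.val g.val

theorem fn_sub (f g : Sm G) : (f - g).fn =ᵐ[freq G] fun ξ => f.fn ξ - g.fn ξ :=
  coe_sub_ae f.val g.val

theorem fn_smul (a : ℂ) (f : Sm G) : (a • f).fn =ᵐ[freq G] fun ξ => a * f.fn ξ :=
  coe_smul_ae a f.val

/-- The smooth element with given Fourier transform. -/
def mk (f : ℝ → ℂ) (hf : Measurable f) (h : ∀ τ, eN G τ f < ∞) : Sm G :=
  ⟨ofFun f hf (eN_lt_top_iff.1 (h 1)), fun τ => by rw [eN_congr (ofFun_coe _ _)]; exact h τ⟩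

theorem mk_fn {f : ℝ → ℂ} (hf : Measurable f) (h : ∀ τ, eN G τ f < ∞) :
    (mk f hf h).fn =ᵐ[freq G] f :=
  ofFun_coe hf (eN_lt_top_iff.1 (h 1))

theorem half_lt_one : (1 / 2 : ℝ) < 1 := by norm_num

theorem eN_mul_lt_top (f g : Sm G) (τ : ℝ) : eN G τ (mul G f.fn g.fn) < ∞ := by
  obtain ⟨A, hA⟩ := exists_isKer_mul_alg G (lt_max_of_lt_right half_lt_one : 1 / 2 < max τ 1)
  refine ((eN_mono (le_max_left τ 1) _).trans (eN_mul_le hA f.meas g.meas)).trans_lt ?_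
  exact ENNReal.mul_lt_top (ENNReal.mul_lt_top ENNReal.ofReal_lt_top (f.eN_lt_top _)) (g.eN_lt_top _)

instance : Mul (Sm G) := ⟨fun f g => ⟨mulAlg G half_lt_one f.val g.val, fun τ => by
  rw [eN_congr (mulAlg_coe half_lt_one f.val g.val)]
  exact eN_mul_lt_top f g τ⟩⟩

theorem val_mul (f g : Sm G) : (f * g).val = mulAlg G half_lt_one f.val g.val := rfl

theorem fn_mul (f g : Sm G) : (f * g).fn =ᵐ[freq G] mul G f.fn g.fn :=
  mulAlg_coe half_lt_one f.val g.val

theorem val_injective : Function.Injective (val : Sm G →ₗ[ℂ] Hs G 1) := Subtype.val_injective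

theorem sobSq_lt_top (f : Sm G) (τ : ℝ) : sobSq G τ f.fn < ∞ := eN_lt_top_iff.1 (f.eN_lt_top τ)

protected theorem mul_comm' (f g : Sm G) : f * g = g * f :=
  ext_ae ((fn_mul f g).trans ((mul_comm_ae _ _).trans (fn_mul g f).symm))

theorem mul_right_comm' (f g h : Sm G) : f * g * h = f * h * g := by
  obtain ⟨A, hA⟩ := exists_isKer_mul_alg G half_lt_one
  refine ext_ae ((fn_mul _ _).trans ?_)
  refine (mul_congr (fn_mul f g) ae_eq_rfl).trans ?_
  refine (mul_right_comm_ae hA f.meas g.meas h.meas (f.sobSq_lt_top 1) (g.sobSq_lt_top 1)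
    (h.sobSq_lt_top 1)).trans ?_
  exact (mul_congr (fn_mul f h).symm ae_eq_rfl).trans (fn_mul _ _).symm

/-- There is no unit: on the line the constant `1` is not in `H^∞`. Polynomial identities are
therefore checked in the unitization. -/
instance : NonUnitalCommRing (Sm G) where
  left_distrib f g h := val_injective (by simp only [val_mul, map_add])
  right_distrib f g h := val_injective (by
    simp only [val_mul, map_add, add_apply])
  zero_mul f := val_injective (by simp only [val_mul, map_zero, zero_apply])
  mul_zero f := val_injective (by simp only [val_mul, map_zero])
  mul_assoc f g h := by
    rw [mul_right_comm', Sm.mul_comm' (f * h) g, Sm.mul_comm' f h, Sm.mul_comm' g (h * f),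
      mul_right_comm', Sm.mul_comm' (h * g) f, Sm.mul_comm' h g]
  mul_comm f g := Sm.mul_comm' f g

instance : IsScalarTower ℂ (Sm G) (Sm G) := ⟨fun a f g => val_injective (by
  simp only [val_mul, smul_eq_mul, map_smul, smul_apply])⟩

instance : SMulCommClass ℂ (Sm G) (Sm G) := ⟨fun a f g => val_injective (by
  simp only [val_mul, smul_eq_mul, map_smul])⟩

/-- Multipliers of polynomial growth. -/
structure IsPoly (φ : ℝ → ℂ) : Prop where
  meas : Measurable φ
  bound : ∃ n : ℕ, ∀ ξ, ‖φ ξ‖ ≤ (|ξ| + 1) ^ n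

theorem IsPoly.exists_isMult {φ : ℝ → ℂ} (h : IsPoly φ) : ∃ n : ℕ, ∀ τ, IsMult (τ + n) τ 1 φ := by
  obtain ⟨n, hn⟩ := h.bound
  refine ⟨n, fun τ => ⟨h.meas, zero_le_one, fun ξ => ?_⟩⟩
  rw [Real.rpow_add (bracket_pos ξ), one_mul, Real.rpow_natCast]
  exact mul_le_mul_of_nonneg_left (hn ξ) (bracket_rpow_pos ξ τ).le

theorem IsPoly.eN_lt_top {φ : ℝ → ℂ} (h : IsPoly φ) (f : Sm G) (τ : ℝ) :
    eN G τ (fun ξ => φ ξ * f.fn ξ) < ∞ := by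
  obtain ⟨n, hn⟩ := h.exists_isMult
  exact (eN_mult_le (hn τ) f.fn).trans_lt (ENNReal.mul_lt_top (by simp) (f.eN_lt_top _))

theorem IsPoly.meas_mul {φ : ℝ → ℂ} (h : IsPoly φ) (f : Sm G) :
    Measurable fun ξ => φ ξ * f.fn ξ := h.meas.mul f.meas

/-- The operator on `H^∞` given by a multiplier. -/
def mult {φ : ℝ → ℂ} (h : IsPoly φ) : Sm G →ₗ[ℂ] Sm G where
  toFun f := mk (fun ξ => φ ξ * f.fn ξ) (h.meas_mul f) (h.eN_lt_top f)
  map_add' f g := ext_ae (by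
    filter_upwards [mk_fn (h.meas_mul (f + g)) (h.eN_lt_top (f + g)), fn_add f g,
      mk_fn (h.meas_mul f) (h.eN_lt_top f), mk_fn (h.meas_mul g) (h.eN_lt_top g),
      fn_add (mk _ (h.meas_mul f) (h.eN_lt_top f)) (mk _ (h.meas_mul g) (h.eN_lt_top g))]
      with ξ h1 h2 h3 h4 h5
    rw [h1, h2, h5, h3, h4]; ring)
  map_smul' a f := ext_ae (by
    filter_upwards [mk_fn (h.meas_mul (a • f)) (h.eN_lt_top (a • f)), fn_smul a f,
      mk_fn (h.meas_mul f) (h.eN_lt_top f),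
      fn_smul a (mk _ (h.meas_mul f) (h.eN_lt_top f))] with ξ h1 h2 h3 h4
    rw [h1, h2, RingHom.id_apply, h4, h3]; ring)

theorem mult_fn {φ : ℝ → ℂ} (h : IsPoly φ) (f : Sm G) :
    (mult h f).fn =ᵐ[freq G] fun ξ => φ ξ * f.fn ξ := mk_fn (h.meas_mul f) (h.eN_lt_top f)

theorem isPoly_dx : IsPoly fun ξ => Complex.I * (ξ : ℂ) :=
  ⟨by fun_prop, 1, fun ξ => by simp⟩

/-- The derivative. -/
def D : Sm G →ₗ[ℂ] Sm G := mult isPoly_dx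

theorem D_fn (f : Sm G) : (D f).fn =ᵐ[freq G] dx f.fn := mult_fn _ f

theorem isPoly_neg : IsPoly (indicator (Iio 0) fun _ => (1 : ℂ)) :=
  ⟨measurable_const.indicator measurableSet_Iio, 0, fun ξ => by
    by_cases h : ξ ∈ Iio (0 : ℝ)
    · rw [indicator_of_mem h]; simp
    · rw [indicator_of_notMem h]; simp⟩

/-- The projection to negative frequencies. -/
def N : Sm G →ₗ[ℂ] Sm G := mult isPoly_neg

theorem N_fn (f : Sm G) :
    (N f).fn =ᵐ[freq G] fun ξ => indicator (Iio 0) (fun _ => (1 : ℂ)) ξ * f.fn ξ := mult_fn _ f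

theorem isPoly_hilbert : IsPoly fun ξ => -Complex.I * ((SignType.sign ξ : ℝ) : ℂ) :=
  ⟨by
    have : Measurable fun ξ : ℝ => (SignType.sign ξ : ℝ) := by
      have e : (fun ξ : ℝ => (SignType.sign ξ : ℝ)) =
          fun ξ => if 0 < ξ then 1 else if ξ < 0 then -1 else 0 := by
        ext ξ
        rw [sign_apply]
        split_ifs <;> simp
      rw [e]
      exact Measurable.ite measurableSet_Ioi measurable_const
        (Measurable.ite measurableSet_Iio measurable_const measurable_const)
    fun_prop, 0, fun ξ => by
    rcases lt_trichotomy ξ 0 with h | h | h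
    · simp [sign_neg h]
    · simp [h]
    · simp [sign_pos h]⟩

/-- The Hilbert transform. -/
def Hil : Sm G →ₗ[ℂ] Sm G := mult isPoly_hilbert

theorem Hil_fn (f : Sm G) : (Hil f).fn =ᵐ[freq G] hilbert f.fn := mult_fn _ f

theorem mult_comm {φ ψ : ℝ → ℂ} (h : IsPoly φ) (h' : IsPoly ψ) (f : Sm G) :
    mult h (mult h' f) = mult h' (mult h f) := ext_ae (by
  filter_upwards [mult_fn h (mult h' f), mult_fn h' f, mult_fn h' (mult h f), mult_fn h f]
    with ξ h1 h2 h3 h4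
  rw [h1, h2, h3, h4]; ring)

theorem D_N (f : Sm G) : D (N f) = N (D f) := mult_comm _ _ f

theorem D_Hil (f : Sm G) : D (Hil f) = Hil (D f) := mult_comm _ _ f

theorem D_mul (f g : Sm G) : D (f * g) = D f * g + f * D g := by
  obtain ⟨A, hA⟩ := exists_isKer_mul_alg G half_lt_one
  have hA2 : IsKer G (1 + 1) 1 1 A fun _ _ => convConst G := hA.mono_left (by norm_num)
  have hA3 : IsKer G 1 (2 - 1) 1 A fun _ _ => convConst G := by norm_num; exact hA
  refine ext_ae ?_
  filter_upwards [D_fn (f * g), fn_mul f g, dx_mul_ae (σ₁ := 1) (σ₂ := 2) (hA.mono_right one_le_two)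
    (by norm_num; exact hA.mono_left one_le_two) f.meas g.meas (f.sobSq_lt_top _) (g.sobSq_lt_top _),
    fn_add (D f * g) (f * D g), fn_mul (D f) g, fn_mul f (D g),
    mul_congr (D_fn f) (ae_eq_rfl (f := g.fn)), mul_congr (ae_eq_rfl (f := f.fn)) (D_fn g)]
    with ξ h1 h2 h3 h4 h5 h6 h7 h8
  rw [h1, dx, h2, h4, h5, h6, h7, h8, ← h3]
  rfl

/-- Complex conjugation. -/
def conj : Sm G →+ Sm G where
  toFun f := mk (conjF f.fn) (measurable_conjF f.meas) fun τ => by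
    rw [eN_conjF f.meas]; exact f.eN_lt_top τ
  map_zero' := by
    refine ext_ae ?_
    have h0 : (0 : Sm G).fn =ᵐ[freq G] fun _ => 0 := coe_zero_ae
    refine (mk_fn _ _).trans ((conjF_congr h0).trans ?_)
    filter_upwards [h0] with ξ h1
    rw [h1, conjF, map_zero]
  map_add' f g := ext_ae (by
    refine (mk_fn _ _).trans ((conjF_congr (fn_add f g)).trans ?_)
    refine EventuallyEq.trans ?_ (fn_add _ _).symm
    filter_upwards [mk_fn (measurable_conjF f.meas) fun τ => by
        rw [eN_conjF f.meas]; exact f.eN_lt_top τ, mk_fn (measurable_conjF g.meas) fun τ => by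
        rw [eN_conjF g.meas]; exact g.eN_lt_top τ] with ξ h1 h2
    rw [h1, h2, conjF, map_add]; rfl)

theorem conj_fn (f : Sm G) : (conj f).fn =ᵐ[freq G] conjF f.fn :=
  mk_fn (measurable_conjF f.meas) fun τ => by rw [eN_conjF f.meas]; exact f.eN_lt_top τ

theorem conj_smul (a : ℂ) (f : Sm G) : conj (a • f) = starRingEnd ℂ a • conj f := ext_ae (by
  filter_upwards [conj_fn (a • f), conjF_congr (fn_smul a f), fn_smul (starRingEnd ℂ a) (conj f),
    conj_fn f] with ξ h1 h2 h3 h4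
  rw [h1, h2, h3, h4, conjF, conjF, map_mul])

theorem conj_D (f : Sm G) : conj (D f) = D (conj f) := ext_ae (by
  filter_upwards [conj_fn (D f), conjF_congr (D_fn f), D_fn (conj f), conj_fn f]
    with ξ h1 h2 h3 h4
  rw [h1, h2, h3, dx, h4, conjF, conjF, dx]
  simp)

theorem conj_mul (f g : Sm G) : conj (f * g) = conj f * conj g := ext_ae (by
  refine (conj_fn _).trans ((conjF_congr (fn_mul f g)).trans ?_)
  rw [conjF_mul]
  exact (mul_congr (conj_fn f).symm (conj_fn g).symm).trans (fn_mul _ _).symm)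

/-! ### The bilinear pairing -/

/-- `∫ f g`. -/
def ip (f g : Sm G) : ℂ := dpL G (σ := 1) (σ' := 1) (by norm_num) f.val g.val

theorem ip_eq (f g : Sm G) : ip f g = dp G f.fn g.fn := rfl

theorem ip_comm (f g : Sm G) : ip f g = ip g f := dp_comm _ _

theorem ip_add (f g h : Sm G) : ip f (g + h) = ip f g + ip f h := by
  simp only [ip, map_add]

theorem ip_sub (f g h : Sm G) : ip f (g - h) = ip f g - ip f h := by
  simp only [ip, map_sub]

theorem ip_smul (f : Sm G) (a : ℂ) (g : Sm G) : ip f (a • g) = a * ip f g := by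
  simp only [ip, map_smul, smul_eq_mul]

theorem add_ip (f g h : Sm G) : ip (f + g) h = ip f h + ip g h := by
  rw [ip_comm, ip_add, ip_comm h f, ip_comm h g]

theorem sub_ip (f g h : Sm G) : ip (f - g) h = ip f h - ip g h := by
  rw [ip_comm, ip_sub, ip_comm h f, ip_comm h g]

theorem smul_ip (a : ℂ) (f g : Sm G) : ip (a • f) g = a * ip f g := by
  rw [ip_comm, ip_smul, ip_comm g f]

theorem ip_D (f g : Sm G) : ip f (D g) = -ip (D f) g := by
  rw [ip_eq, ip_eq, dp_congr ae_eq_rfl (D_fn g), dp_congr (D_fn f) ae_eq_rfl, dp, dp,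
    ← integral_neg]
  refine integral_congr_ae (Eventually.of_forall fun ξ => ?_)
  simp only [dx]
  push_cast; ring

theorem ip_mul (f g h : Sm G) : ip f (g * h) = ip g (f * h) := by
  obtain ⟨A, hA⟩ := exists_isKer_mul_alg G half_lt_one
  rw [ip_eq, ip_eq, dp_congr ae_eq_rfl (fn_mul g h), dp_congr ae_eq_rfl (fn_mul f h)]
  exact dp_tri_fun (σ := 1) hA (by norm_num) g.meas f.meas h.meas (g.sobSq_lt_top 1) (f.sobSq_lt_top 1)
    (h.sobSq_lt_top 1)

theorem ip_eq_zero {f g : Sm G} (h : ∀ᵐ ξ ∂(freq G), f.fn (-ξ) = 0 ∨ g.fn ξ = 0) :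
    ip f g = 0 := by
  rw [ip_eq, dp, integral_eq_zero_of_ae]
  filter_upwards [h] with ξ h1
  rcases h1 with h1 | h1 <;> simp [h1]

end Sm

end

section

/-! ### Polynomial identities -/

section Ring

variable {A : Type*} [CommRing A]

/-- For `Sm.gaugeDot_eq`. Primes are derivatives, `qp` and `qm` the nonnegative and negative
frequencies of `q`, `r` the remainder in the gauge equation, `n` the proposed time derivative of
`m`, and `X` the Benjamin–Ono field. -/
theorem gauge_bo_identity {i k q qp' qp'' qm' qm'' m m' m'' m''' r r' r'' n n' X : A}
    (hi : i * i = -1) (h1 : m' = i * (q + q * m - k * m - r))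
    (h2 : m'' = i * (qp' + qm' + ((qp' + qm') * m + q * m') - k * m' - r'))
    (h3 : m''' = i * (qp'' + qm'' + ((qp'' + qm'') * m + (qp' + qm') * m' +
      ((qp' + qm') * m' + q * m'')) - k * m'' - r''))
    (hn : n = i * m'' - 2 * k * m' + 2 * (qp' + qp' * m))
    (hn' : n' = i * m''' - 2 * k * m'' + 2 * (qp'' + (qp'' * m + qp' * m')))
    (hX : X = -i * qp'' + i * qm'' - 2 * (q * (qp' + qm'))) :
    -i * n' + k * n - (X + X * m + q * n) =
      2 * (qm' * r) - 2 * k * qm' + 2 * k * r' - i * r'' := by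
  subst hn hn' hX
  linear_combination h3 + 2 * i * k * h2 + 2 * i * qm' * h1 + (-m''' +
    2 * k * (qp' + qm' + ((qp' + qm') * m + q * m') - k * m' - r') +
    2 * qm' * (q + q * m - k * m - r)) * hi

/-- For `Sm.density_bo`. Here `c`, `t`, `p`, `b` stand for the conjugates of `m`, `r`, `n`, `a`, and
`a` is the derivative of the nonnegative-frequency part of `q`. -/
theorem density_bo_identity {i k q q' a b m m' m'' c c' c'' r r' t t' n p : A}
    (hi : i * i = -1) (hab : a + b = q')
    (h1 : m' = i * (q + q * m - k * m - r))
    (h2 : m'' = i * (q' + (q' * m + q * m') - k * m' - r'))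
    (g1 : c' = -i * (q + q * c - k * c - t))
    (g2 : c'' = -i * (q' + (q' * c + q * c') - k * c' - t'))
    (hn : n = i * m'' - 2 * k * m' + 2 * (a + a * m))
    (hp : p = -i * c'' - 2 * k * c' + 2 * (b + b * c)) :
    n + p + (n * c + m * p) = (t' + (t' * m + t * m') - k * m' +
      (r' + (r' * c + r * c') - k * c')) - 2 * (q * (m' + c' + (m' * c + m * c'))) := by
  subst hn hp
  linear_combination 2 * (1 + m) * (1 + c) * hab + i * (1 + c) * h2 - i * (1 + m) * g2 +
    ((1 + c) * (q' + (q' * m + q * m') - k * m' - r') +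
      (1 + m) * (q' + (q' * c + q * c') - k * c' - t')) * hi +
    (q + q * c - k * c - t) * h1 + (q + q * m - k * m - r) * g1

end Ring

variable {G : Geometry} {σ σ' τ κ s R A c : ℝ}

namespace Sm

/-! ### Frequency supports -/

/-- The functions with frequency support in `S`. -/
def supp (G : Geometry) (S : Set ℝ) : Submodule ℂ (Sm G) where
  carrier := {f | ∀ᵐ ξ ∂(freq G), ξ ∉ S → f.fn ξ = 0}
  add_mem' {f g} hf hg := by
    filter_upwards [hf, hg, fn_add f g] with ξ h1 h2 h3 hξ
    rw [h3, h1 hξ, h2 hξ, add_zero]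
  zero_mem' := by
    have h0 : (0 : Sm G).fn =ᵐ[freq G] fun _ => 0 := coe_zero_ae
    filter_upwards [h0] with ξ h _ using h
  smul_mem' a f hf := by
    filter_upwards [hf, fn_smul a f] with ξ h1 h2 hξ
    rw [h2, h1 hξ, mul_zero]

theorem mem_supp {S : Set ℝ} {f : Sm G} :
    f ∈ supp G S ↔ ∀ᵐ ξ ∂(freq G), ξ ∉ S → f.fn ξ = 0 := Iff.rfl

theorem D_mem {S : Set ℝ} {f : Sm G} (h : f ∈ supp G S) : D f ∈ supp G S := by
  filter_upwards [D_fn f, mem_supp.1 h] with ξ h1 h2 hξ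
  rw [h1, dx, h2 hξ, mul_zero]

theorem D_mem_Ioi {f : Sm G} (h : f ∈ supp G (Ici 0)) : D f ∈ supp G (Ioi 0) := by
  filter_upwards [D_fn f, mem_supp.1 h] with ξ h1 h2 hξ
  rw [h1, dx]
  rcases (not_lt.1 (show ¬0 < ξ from hξ)).lt_or_eq with h3 | h3
  · rw [h2 (not_le.2 h3), mul_zero]
  · rw [h3]; simp

theorem mul_mem {S T V : Set ℝ} {f g : Sm G} (hf : f ∈ supp G S) (hg : g ∈ supp G T)
    (h : ∀ x ∈ S, ∀ y ∈ T, x + y ∈ V) : f * g ∈ supp G V := by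
  filter_upwards [fn_mul f g, mul_supp (S := fun ξ => ξ ∉ V) hf hg fun ξ hξ η => by
    by_contra hcon
    push Not at hcon
    exact hξ (by simpa using h _ hcon.1 _ hcon.2)] with ξ h1 h2 hξ
  rw [h1, h2 hξ]

theorem N_mem (f : Sm G) : N f ∈ supp G (Iio 0) := by
  filter_upwards [N_fn f] with ξ h hξ
  rw [h, indicator_of_notMem hξ, zero_mul]

theorem sub_N_mem (f : Sm G) : f - N f ∈ supp G (Ici 0) := by
  filter_upwards [N_fn f, fn_sub f (N f)] with ξ h h2 hξ
  rw [h2, h, indicator_of_mem (by simpa using hξ), one_mul, sub_self]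

theorem supp_mono {S T : Set ℝ} (h : S ⊆ T) {f : Sm G} (hf : f ∈ supp G S) : f ∈ supp G T := by
  filter_upwards [mem_supp.1 hf] with ξ h1 hξ using h1 fun h2 => hξ (h h2)

theorem ip_eq_zero_of_mem {S T : Set ℝ} {f g : Sm G} (hf : f ∈ supp G S) (hg : g ∈ supp G T)
    (h : ∀ ξ ∈ T, -ξ ∉ S) : ip f g = 0 := by
  refine ip_eq_zero ?_
  filter_upwards [ae_neg (mem_supp.1 hf), mem_supp.1 hg] with ξ h1 h2
  by_cases hξ : ξ ∈ T
  · exact Or.inl (h1 (h ξ hξ))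
  · exact Or.inr (h2 hξ)

/-! ### The Benjamin–Ono vector field -/

/-- The Benjamin–Ono vector field `H q'' - 2 q q'`. -/
def bo (Q : Sm G) : Sm G := Hil (D (D Q)) - (2 : ℂ) • (Q * D Q)

/-- `N` leaves frequency zero in `f - N f`, where `H` does not act as `-i`; the derivative kills
that frequency. -/
theorem Hil_D (f : Sm G) : Hil (D f) = -Complex.I • D (f - N f) + Complex.I • D (N f) := by
  refine ext_ae ?_
  filter_upwards [Hil_fn (D f), D_fn f, fn_add (-Complex.I • D (f - N f)) (Complex.I • D (N f)),
    fn_smul (-Complex.I) (D (f - N f)), fn_smul Complex.I (D (N f)), D_fn (f - N f), D_fn (N f),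
    fn_sub f (N f), N_fn f] with ξ h1 h2 h3 h4 h5 h6 h7 h8 h9
  rw [h1, hilbert, h2, h3, h4, h5, h6, h7, dx, dx, dx, h8, h9]
  rcases lt_trichotomy ξ 0 with h | h | h
  · rw [indicator_of_mem (by simpa using h), sign_neg h]
    simp
  · simp [h]
  · rw [indicator_of_notMem (by simpa using h.le), sign_pos h]
    simp

/-- The time derivative of the gauge along the Benjamin–Ono flow. -/
def gaugeDot (κ : ℂ) (Q m : Sm G) : Sm G :=
  Complex.I • D (D m) - (2 * κ) • D m + (2 : ℂ) • (D (Q - N Q) + D (Q - N Q) * m)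

theorem bo_eq (Q : Sm G) : bo Q = -Complex.I • D (D (Q - N Q)) + Complex.I • D (D (N Q)) -
    (2 : ℂ) • (Q * (D (Q - N Q) + D (N Q))) := by
  rw [bo, Hil_D, ← D_N, ← map_sub, ← map_add, sub_add_cancel]

/-- The linearised gauge equation holds up to the right-hand side, each term of which is built from
the negative-frequency functions `N Q` and `r`; the projection `C₊` removes them all. -/
theorem gaugeDot_eq {κ : ℂ} {Q m r : Sm G} (h : D m = Complex.I • (Q + Q * m - κ • m - r)) :
    -Complex.I • D (gaugeDot κ Q m) + κ • gaugeDot κ Q m -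
        (bo Q + bo Q * m + Q * gaugeDot κ Q m) =
      (2 : ℂ) • (D (N Q) * r) - (2 * κ) • D (N Q) + (2 * κ) • D r - Complex.I • D (D r) := by
  have hQ : Q = (Q - N Q) + N Q := (sub_add_cancel _ _).symm
  have h2 := congrArg D h
  have h3 := congrArg D h2
  have hD : D Q = D (Q - N Q) + D (N Q) := by rw [← map_add, sub_add_cancel]
  have hDD : D (D Q) = D (D (Q - N Q)) + D (D (N Q)) := by rw [hD, map_add]
  have hn : D (gaugeDot κ Q m) = Complex.I • D (D (D m)) - (2 * κ) • D (D m) +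
      (2 : ℂ) • (D (D (Q - N Q)) + (D (D (Q - N Q)) * m + D (Q - N Q) * D m)) := by
    rw [gaugeDot, map_add, map_sub, map_smul, map_smul, map_smul, map_add, D_mul]
  simp only [map_smul, map_add, map_sub, D_mul] at h2 h3
  rw [hD] at h2 h3
  simp only [map_add D (D (Q - N Q)) (D (N Q))] at h3
  have hi : (algebraMap ℂ (Unitization ℂ (Sm G)) Complex.I) *
      (algebraMap ℂ (Unitization ℂ (Sm G)) Complex.I) = -1 := by
    rw [← map_mul, Complex.I_mul_I, map_neg, map_one]
  -- In the unitization scalars become ring elements, and the claim becomes an identity in a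
  -- commutative ring with a square root of `-1`.
  apply Unitization.inr_injective (R := ℂ)
  have toU := fun (a b : Sm G) (h : a = b) => congrArg (Unitization.inr (R := ℂ)) h
  replace h := toU _ _ h
  replace h2 := toU _ _ h2
  replace h3 := toU _ _ h3
  replace hn := toU _ _ hn
  have e5 := toU _ _ (bo_eq Q)
  have e6 : Unitization.inr (R := ℂ) (gaugeDot κ Q m) = Unitization.inr (R := ℂ)
    (Complex.I • D (D m) - (2 * κ) • D m + (2 : ℂ) • (D (Q - N Q) + D (Q - N Q) * m)) := rfl
  simp only [Unitization.inr_add, Unitization.inr_sub, Unitization.inr_mul, Unitization.inr_smul,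
    Algebra.smul_def, map_mul, map_neg, map_ofNat] at h h2 h3 hn e5 e6 ⊢
  exact gauge_bo_identity hi h h2 h3 e6 hn e5

theorem Hil_D_of_mem_Ici {f : Sm G} (h : f ∈ supp G (Ici 0)) : Hil (D f) = -Complex.I • D f := by
  refine ext_ae ?_
  filter_upwards [Hil_fn (D f), D_fn f, fn_smul (-Complex.I) (D f), mem_supp.1 h]
    with ξ h1 h2 h3 h4
  rw [h1, hilbert, h3, h2, dx]
  rcases lt_trichotomy ξ 0 with h | h | h
  · rw [h4 (by simpa using h)]; simp
  · simp [h]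
  · rw [sign_pos h]; simp

theorem Hil_D_of_mem_Iic {f : Sm G} (h : f ∈ supp G (Iic 0)) : Hil (D f) = Complex.I • D f := by
  refine ext_ae ?_
  filter_upwards [Hil_fn (D f), D_fn f, fn_smul Complex.I (D f), mem_supp.1 h]
    with ξ h1 h2 h3 h4
  rw [h1, hilbert, h3, h2, dx]
  rcases lt_trichotomy ξ 0 with h | h | h
  · rw [sign_neg h]; simp
  · simp [h]
  · rw [h4 (by simpa using h)]; simp

theorem conj_mem {S T : Set ℝ} {f : Sm G} (h : f ∈ supp G S) (hST : ∀ ξ ∈ S, -ξ ∈ T) :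
    conj f ∈ supp G T := by
  filter_upwards [conj_fn f, ae_neg (mem_supp.1 h)] with ξ h1 h2 hξ
  rw [h1, conjF, h2 fun h3 => hξ (by simpa using hST _ h3), map_zero]

/-- Frequency zero is counted twice in `Q - N Q` plus its conjugate, but disappears after
differentiation. -/
theorem D_add_conj_D {Q : Sm G} (hQ : conj Q = Q) :
    D (Q - N Q) + conj (D (Q - N Q)) = D Q := by
  refine ext_ae ?_
  have hQ' : Q.fn =ᵐ[freq G] conjF Q.fn := by
    have := conj_fn Q
    rwa [hQ] at this
  have hd : (D (Q - N Q)).fn =ᵐ[freq G]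
      fun ξ => Complex.I * ξ * ((1 - indicator (Iio 0) (fun _ => (1 : ℂ)) ξ) * Q.fn ξ) := by
    filter_upwards [D_fn (Q - N Q), fn_sub Q (N Q), N_fn Q] with ξ h1 h2 h3
    rw [h1, dx, h2, h3]; ring
  filter_upwards [fn_add (D (Q - N Q)) (conj (D (Q - N Q))), conj_fn (D (Q - N Q)), hd,
    conjF_congr hd, D_fn Q, hQ'] with ξ h1 h2 h3 h4 h5 h6
  rw [h1, h2, h3, h4, h5, dx, conjF, map_mul, map_mul]
  rw [conjF] at h6
  rw [map_mul, ← h6]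
  rcases lt_trichotomy ξ 0 with h | h | h
  · rw [indicator_of_mem (by simpa using h), indicator_of_notMem (by simp [h.le])]
    simp
  · simp [h]
  · rw [indicator_of_notMem (by simp [h.le]), indicator_of_mem (by simpa using h)]
    simp

theorem conj_gauge {κ : ℝ} {Q m r : Sm G} (hQ : conj Q = Q)
    (h : D m = Complex.I • (Q + Q * m - (κ : ℂ) • m - r)) :
    D (conj m) = -Complex.I • (Q + Q * conj m - (κ : ℂ) • conj m - conj r) := by
  rw [← conj_D, h, conj_smul, map_sub, map_sub, map_add, conj_mul, conj_smul, hQ, Complex.conj_I,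
    Complex.conj_ofReal]

theorem unit_I_mul_I : (algebraMap ℂ (Unitization ℂ (Sm G)) Complex.I) *
    (algebraMap ℂ (Unitization ℂ (Sm G)) Complex.I) = -1 := by
  rw [← map_mul, Complex.I_mul_I, map_neg, map_one]

theorem D_density {κ : ℝ} {Q m r : Sm G} (hQ : conj Q = Q)
    (h : D m = Complex.I • (Q + Q * m - (κ : ℂ) • m - r)) :
    D (m + conj m + m * conj m) = Complex.I • ((conj r + conj r * m - (κ : ℂ) • m) -
      (r + r * conj m - (κ : ℂ) • conj m)) := by
  have h' := conj_gauge hQ h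
  rw [map_add, map_add, D_mul]
  apply Unitization.inr_injective (R := ℂ)
  have e := congrArg (Unitization.inr (R := ℂ)) h
  have e' := congrArg (Unitization.inr (R := ℂ)) h'
  simp only [Unitization.inr_add, Unitization.inr_sub, Unitization.inr_mul, Unitization.inr_smul,
    Algebra.smul_def, map_neg] at e e' ⊢
  linear_combination (1 + (conj m : Unitization ℂ (Sm G))) * e +
    (1 + (m : Unitization ℂ (Sm G))) * e'

/-- `D_density` splits the derivative into a part with nonnegative and a part with nonpositive
frequencies, on whose derivatives `H` acts as `-i` and `i`. -/
theorem Hil_D_D_density {κ : ℝ} {Q m r : Sm G} (hQ : conj Q = Q)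
    (h : D m = Complex.I • (Q + Q * m - (κ : ℂ) • m - r)) (hm : m ∈ supp G (Ici 0))
    (hr : r ∈ supp G (Iio 0)) :
    Hil (D (D (m + conj m + m * conj m))) = D (conj r + conj r * m - (κ : ℂ) • m) +
      D (r + r * conj m - (κ : ℂ) • conj m) := by
  have hc : conj m ∈ supp G (Iic 0) := conj_mem hm fun ξ hξ => by simpa using hξ
  have ht : conj r ∈ supp G (Ici 0) := conj_mem hr fun ξ hξ => by
    have : ξ < 0 := hξ
    simpa using this.le
  have hr' : r ∈ supp G (Iic 0) := supp_mono Iio_subset_Iic_self hr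
  have hB : conj r + conj r * m - (κ : ℂ) • m ∈ supp G (Ici 0) :=
    Submodule.sub_mem _ (Submodule.add_mem _ ht (mul_mem ht hm fun x hx y hy =>
      add_nonneg (mem_Ici.1 hx) (mem_Ici.1 hy)))
      (Submodule.smul_mem _ _ hm)
  have hC : r + r * conj m - (κ : ℂ) • conj m ∈ supp G (Iic 0) :=
    Submodule.sub_mem _ (Submodule.add_mem _ hr' (mul_mem hr' hc fun x hx y hy =>
      add_nonpos (mem_Iic.1 hx) (mem_Iic.1 hy))) (Submodule.smul_mem _ _ hc)
  rw [D_density hQ h, map_smul, map_smul, map_sub, map_sub, Hil_D_of_mem_Ici hB,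
    Hil_D_of_mem_Iic hC, smul_sub, smul_smul, smul_smul]
  simp
  abel

/-- Along Benjamin–Ono the density `Z` satisfies `dZ/dt = H Z'' - 2 q Z'`. Differentiated in space,
this says that `Z'` solves the linearised Benjamin–Ono equation, which is the bracket identity. -/
theorem density_bo {κ : ℝ} {Q m r : Sm G} (hQ : conj Q = Q)
    (h : D m = Complex.I • (Q + Q * m - (κ : ℂ) • m - r)) (hm : m ∈ supp G (Ici 0))
    (hr : r ∈ supp G (Iio 0)) :
    gaugeDot κ Q m + conj (gaugeDot κ Q m) +
        (gaugeDot κ Q m * conj m + m * conj (gaugeDot κ Q m)) =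
      Hil (D (D (m + conj m + m * conj m))) - (2 : ℂ) • (Q * D (m + conj m + m * conj m)) := by
  rw [Hil_D_D_density hQ h hm hr]
  have h' := conj_gauge hQ h
  have h2 := congrArg D h
  have h2' := congrArg D h'
  have hab := D_add_conj_D hQ
  set b := conj (D (Q - N Q)) with hb
  have hp : conj (gaugeDot κ Q m) = -Complex.I • D (D (conj m)) - (2 * (κ : ℂ)) • D (conj m) +
      (2 : ℂ) • (b + b * conj m) := by
    rw [gaugeDot, map_add, map_sub, conj_smul, conj_smul, conj_smul, map_add, conj_mul, conj_D,
      conj_D, conj_D, ← conj_D (Q - N Q), ← hb, Complex.conj_I, map_mul, Complex.conj_ofReal,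
      Complex.conj_ofNat]
  have hn : gaugeDot κ Q m = Complex.I • D (D m) - (2 * (κ : ℂ)) • D m +
      (2 : ℂ) • (D (Q - N Q) + D (Q - N Q) * m) := rfl
  simp only [map_smul, map_add, map_sub _ (_ + _), map_sub _ (_ - _), D_mul] at h2 h2' ⊢
  apply Unitization.inr_injective (R := ℂ)
  have toU := fun (a b : Sm G) (h : a = b) => congrArg (Unitization.inr (R := ℂ)) h
  replace h := toU _ _ h
  replace h' := toU _ _ h'
  replace h2 := toU _ _ h2
  replace h2' := toU _ _ h2'
  replace hab := toU _ _ hab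
  replace hn := toU _ _ hn
  replace hp := toU _ _ hp
  simp only [Unitization.inr_add, Unitization.inr_sub, Unitization.inr_mul, Unitization.inr_smul,
    Algebra.smul_def, map_mul, map_neg, map_ofNat] at h h' h2 h2' hab hn hp ⊢
  exact density_bo_identity unit_I_mul_I hab h h2 h' h2' hn hp

/-- The pairing whose vanishing expresses the conservation of `β`. -/
theorem ip_bo {κ : ℂ} {Q m r : Sm G} (h : D m = Complex.I • (Q + Q * m - κ • m - r))
    (hm : m ∈ supp G (Ici 0)) (hr : r ∈ supp G (Iio 0)) :
    ip m (bo Q) + ip (gaugeDot κ Q m) Q = 0 := by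
  have hP := sub_N_mem Q
  have hW := N_mem Q
  have hQ : D Q = D (Q - N Q) + D (N Q) := by rw [← map_add, sub_add_cancel]
  have z0 : ∀ ξ ∈ Ioi (0 : ℝ), -ξ ∉ Ici (0 : ℝ) := fun ξ hξ => by simpa using hξ
  have z1 : ip m (D (Q - N Q)) = 0 := ip_eq_zero_of_mem hm (D_mem_Ioi hP) z0
  have z2 : ip m (D (D (Q - N Q))) = 0 :=
    ip_eq_zero_of_mem hm (D_mem_Ioi (D_mem hP)) z0
  -- Once `r` is expressed through the gauge equation, this relation accounts, with the factor `-2`,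
  -- for all terms that do not cancel by support or by parts.
  have z3 : ip (D (N Q)) r = 0 := ip_eq_zero_of_mem (D_mem hW) hr fun ξ hξ => by
    have : ξ < 0 := hξ
    simpa using this.le
  have hr' : r = Q + Q * m - κ • m + Complex.I • D m := by
    rw [h, smul_smul, Complex.I_mul_I, neg_one_smul]; abel
  have z4 : ip (D Q) Q = 0 := by
    have h1 := ip_D Q Q
    rw [ip_comm] at h1
    have h2 : (2 : ℂ) * ip (D Q) Q = 0 := by linear_combination h1
    simpa using h2
  have e1 : ip m (bo Q) = Complex.I * ip m (D (D (N Q))) - 2 * ip m (Q * D Q) := by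
    rw [bo, ip_sub, Hil_D, ← D_N, ← map_sub, ip_add, ip_smul, ip_smul, z2, mul_zero, zero_add,
      ip_smul]
  have e2 : ip (gaugeDot κ Q m) Q = Complex.I * ip m (D (D (N Q))) + 2 * κ * ip m (D (N Q)) +
      2 * (-ip (D (N Q)) Q + (ip m (Q * D Q) - ip (D (N Q)) (Q * m))) := by
    have D_ip : ∀ f g : Sm G, ip (D f) g = -ip f (D g) := fun f g => by rw [ip_D, neg_neg]
    have y1 : ip (D (D m)) Q = ip m (D (D (N Q))) := by
      rw [D_ip, D_ip, neg_neg, hQ, map_add, ip_add, z2, zero_add]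
    have y2 : ip (D m) Q = -ip m (D (N Q)) := by rw [D_ip, hQ, ip_add, z1, zero_add]
    have y3 : ip (D (Q - N Q)) Q = -ip (D (N Q)) Q := by
      rw [hQ, add_ip] at z4
      linear_combination z4
    have y4 : ip (D (Q - N Q) * m) Q = ip m (Q * D Q) - ip (D (N Q)) (Q * m) := by
      have e : D (Q - N Q) = D Q - D (N Q) := map_sub _ _ _
      rw [e, sub_mul, sub_ip, ip_comm, mul_comm, ip_mul, ip_comm _ Q, ip_mul Q]
    rw [gaugeDot, add_ip, sub_ip, smul_ip, smul_ip, smul_ip, add_ip, y1, y2, y3, y4]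
    ring
  rw [hr', ip_add, ip_sub, ip_add, ip_smul, ip_smul, ip_D, ip_comm _ m, ip_comm _ m] at z3
  rw [e1, e2]
  linear_combination (-2) * z3

end Sm

end

section

variable {G : Geometry} {σ σ' τ κ s R A c : ℝ}

/-! ### Smooth functions inside the Sobolev spaces -/

namespace Sm

/-- The element of `H^σ` given by a smooth function. -/
def toH (G : Geometry) (σ : ℝ) : Sm G →ₗ[ℂ] Hs G σ where
  toFun f := ofFun f.fn f.meas (f.sobSq_lt_top σ)
  map_add' f g := Hs_ext (by
    refine (ofFun_coe _ _).trans ((fn_add f g).trans (EventuallyEq.trans ?_ (coe_add_ae _ _).symm))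
    filter_upwards [ofFun_coe f.meas (f.sobSq_lt_top σ), ofFun_coe g.meas (g.sobSq_lt_top σ)]
      with ξ h1 h2
    rw [h1, h2])
  map_smul' a f := Hs_ext (by
    refine (ofFun_coe _ _).trans ((fn_smul a f).trans (EventuallyEq.trans ?_ (coe_smul_ae a _).symm))
    filter_upwards [ofFun_coe f.meas (f.sobSq_lt_top σ)] with ξ h1
    rw [h1])

theorem toH_coe (σ : ℝ) (f : Sm G) : (toH G σ f : ℝ → ℂ) =ᵐ[freq G] f.fn :=
  ofFun_coe f.meas (f.sobSq_lt_top σ)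

theorem eq_toH {f : Hs G σ} {g : Sm G} (h : (f : ℝ → ℂ) =ᵐ[freq G] g.fn) : f = toH G σ g :=
  Hs_ext (h.trans (toH_coe σ g).symm)

theorem toH_injective (σ : ℝ) : Function.Injective (toH G σ) := fun f g h => ext_ae (by
  have := toH_coe σ f
  rw [h] at this
  exact this.symm.trans (toH_coe σ g))

theorem eN_toH (σ τ : ℝ) (f : Sm G) : eN G τ (toH G σ f) = eN G τ f.fn := eN_congr (toH_coe σ f)

theorem exists_eq_toH {f : Hs G σ} (h : ∀ τ, eN G τ f < ∞) : ∃ g : Sm G, f = toH G σ g :=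
  ⟨mk f (measurable_coe f) h, eq_toH (mk_fn _ _).symm⟩

theorem up_toH (σ τ : ℝ) (f : Sm G) : up τ (toH G σ f) = toH G τ f :=
  eq_toH ((up_coe (by rw [eN_toH]; exact f.eN_lt_top τ)).trans (toH_coe σ f))

theorem dxL_toH (f : Sm G) : dxL G σ (toH G (σ + 1) f) = toH G σ (D f) := eq_toH (by
  filter_upwards [dxL_coe (toH G (σ + 1) f), toH_coe (σ + 1) f, D_fn f] with ξ h1 h2 h3
  rw [h1, h3, dx, h2, dx])

theorem conj_toH (f : Sm G) : conjL G σ (toH G σ f) = toH G σ (conj f) :=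
  eq_toH ((conjL_coe _).trans ((conjF_congr (toH_coe σ f)).trans (conj_fn f).symm))

theorem isReal_toH {f : Sm G} : IsReal (toH G σ f) ↔ conj f = f := by
  rw [isReal_iff, conj_toH, (toH_injective σ).eq_iff]

theorem real_smul_toH (a : ℝ) (f : Sm G) : a • toH G σ f = toH G σ ((a : ℂ) • f) := by
  rw [map_smul]
  exact RCLike.real_smul_eq_coe_smul (K := ℂ) _ _

variable [hs : Fact (s ∈ Ioo (-(1 / 2) : ℝ) 0)]

theorem low_toH (f g : Sm G) : low (toH G s f) (toH G (s + 1) g) = toH G s (f * g) :=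
  eq_toH ((low_coe _ _).trans ((mul_congr (toH_coe s f) (toH_coe (s + 1) g)).trans
    (fn_mul f g).symm))

theorem alg_toH (f g : Sm G) : alg (toH G (s + 1) f) (toH G (s + 1) g) = toH G (s + 1) (f * g) :=
  eq_toH ((alg_coe _ _).trans ((mul_congr (toH_coe (s + 1) f) (toH_coe (s + 1) g)).trans
    (fn_mul f g).symm))

theorem emb1_toH (f : Sm G) : emb1 G s (toH G (s + 1) f) = toH G s f :=
  eq_toH ((emb1_coe _).trans (toH_coe (s + 1) f))

theorem negP_toH (f : Sm G) : negP G s (toH G s f) = toH G s (N f) := eq_toH (by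
  filter_upwards [negP_coe (toH G s f), toH_coe s f, N_fn f] with ξ h1 h2 h3
  rw [h1, h3, h2])

theorem du_toH (f g : Sm G) : du (toH G (s + 1) f) (toH G s g) = ip f g :=
  dp_congr (toH_coe _ f) (toH_coe _ g)

/-- The equation need only hold modulo negative frequencies, because the resolvent contains `C₊`. -/
theorem eq_res_of_supp (hκ : 1 ≤ κ) {n f w : Sm G} (hn : n ∈ supp G (Ici 0))
    (hw : w ∈ supp G (Iio 0)) (h : -Complex.I • D n + (κ : ℂ) • n - f = w) :
    toH G (s + 1) n = res G s κ (toH G s f) := by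
  refine Hs_ext ?_
  have h' := congrArg fn h
  filter_upwards [toH_coe (s + 1) n, res_coe (κ := κ) (toH G s f), toH_coe s f, mem_supp.1 hn,
    mem_supp.1 hw, fn_sub (-Complex.I • D n + (κ : ℂ) • n) f,
    fn_add (-Complex.I • D n) ((κ : ℂ) • n), fn_smul (-Complex.I) (D n), fn_smul (κ : ℂ) n, D_fn n]
    with ξ h1 h2 h3 h4 h5 h6 h7 h8 h9 h10
  rw [h1, h2, h3]
  rcases lt_or_ge ξ 0 with hξ | hξ
  · rw [h4 (by simpa using hξ), resSym_of_neg hξ, zero_mul]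
  · have e := congrFun h' ξ
    rw [h6, h7, h8, h9, h10, h5 (by simpa using hξ), dx] at e
    linear_combination (-n.fn ξ) * resSym_of_nonneg hκ hξ + resSym κ ξ * e +
      resSym κ ξ * ξ * n.fn ξ * Complex.I_mul_I

/-- The bounds of `exists_eN_gInv` for all `k` make `m` smooth when `q` is, with `κ` fixed. -/
theorem exists_gauge {r : ℝ} (h : Adm G s κ r) {Q : Sm G} (hQ : ‖toH G s Q‖ ≤ r) :
    ∃ m r : Sm G, mm κ (toH G s Q) = toH G (s + 1) m ∧
      D m = Complex.I • (Q + Q * m - (κ : ℂ) • m - r) ∧ m ∈ supp G (Ici 0) ∧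
      r ∈ supp G (Iio 0) := by
  set q := toH G s Q with hq
  have hg := h.good hQ
  have hfin : ∀ τ, eN G τ (mm κ q) < ∞ := by
    intro τ
    obtain ⟨k, hk⟩ := exists_nat_ge (τ - s)
    have hqk : eN G (s + k) q < ∞ := by rw [hq, eN_toH]; exact Q.eN_lt_top _
    obtain ⟨C, hC⟩ := exists_eN_gInv h k (eN G (s + k) q).toNNReal
    refine (eN_mono (by linarith : τ ≤ s + k + 1) _).trans_lt
      ((hC q q hQ (ENNReal.coe_toNNReal hqk.ne).ge).trans_lt (ENNReal.mul_lt_top (by simp) hqk))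
  obtain ⟨m, hm⟩ := exists_eq_toH hfin
  refine ⟨m, N (Q + Q * m), hm, ?_, ?_, N_mem _⟩
  · apply toH_injective s
    have e := dx_mm hg h.one_le
    rw [rr, hm, hq, low_toH, emb1_toH, dxL_toH, ← map_add, negP_toH] at e
    rw [sub_right_comm, map_smul, map_sub, map_sub, map_smul, ← e, smul_smul]
    simp
  · filter_upwards [mm_supp hg, toH_coe (s + 1) m] with ξ h1 h2 hξ
    rw [← h2, ← hm]
    exact h1 (by simpa using hξ)

/-- `gaugeDot` has nonnegative frequencies and solves the linearised equation modulo negative ones,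
so by invertibility it is the derivative of `m` in the direction of the Benjamin–Ono field. -/
theorem Dmm_bo {r : ℝ} (h : Adm G s κ r) {Q m w : Sm G} (hQ : ‖toH G s Q‖ ≤ r)
    (hm : mm κ (toH G s Q) = toH G (s + 1) m)
    (he : D m = Complex.I • (Q + Q * m - (κ : ℂ) • m - w)) (hms : m ∈ supp G (Ici 0))
    (hws : w ∈ supp G (Iio 0)) :
    Dmm κ (toH G s Q) (toH G s (bo Q)) = toH G (s + 1) (gaugeDot κ Q m) := by
  have hn : gaugeDot κ Q m ∈ supp G (Ici 0) := by
    have hP := D_mem (sub_N_mem Q)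
    exact Submodule.add_mem _ (Submodule.sub_mem _ (Submodule.smul_mem _ _ (D_mem (D_mem hms)))
      (Submodule.smul_mem _ _ (D_mem hms))) (Submodule.smul_mem _ _ (Submodule.add_mem _ hP
        (mul_mem hP hms fun x hx y hy => add_nonneg (mem_Ici.1 hx) (mem_Ici.1 hy))))
  have hW := D_mem (N_mem Q)
  have hneg : (2 : ℂ) • (D (N Q) * w) - (2 * (κ : ℂ)) • D (N Q) + (2 * (κ : ℂ)) • D w -
      Complex.I • D (D w) ∈ supp G (Iio 0) :=
    Submodule.sub_mem _ (Submodule.add_mem _ (Submodule.sub_mem _ (Submodule.smul_mem _ _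
      (mul_mem hW hws fun x hx y hy => add_neg (mem_Iio.1 hx) (mem_Iio.1 hy)))
      (Submodule.smul_mem _ _ hW)) (Submodule.smul_mem _ _ (D_mem hws)))
      (Submodule.smul_mem _ _ (D_mem (D_mem hws)))
  have hres := eq_res_of_supp (s := s) h.one_le hn hneg (gaugeDot_eq he)
  rw [Dmm_apply]
  symm
  refine eq_gInv (h.good hQ) ?_
  refine hres.trans ?_
  rw [hm, map_add (toH G s), map_add (toH G s), map_add (res G s κ), map_add (res G s κ),
    ← low_toH, ← low_toH]
  rfl

theorem du_Zf_bo {r : ℝ} (h : Adm G s κ r) {Q : Sm G} (hr : conj Q = Q)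
    (hQ : ‖toH G s Q‖ ≤ r) : du (Zf κ (toH G s Q)) (toH G s (bo Q)) = 0 := by
  obtain ⟨m, w, hm, he, hms, hws⟩ := exists_gauge h hQ
  have e := du_Dmm (isReal_toH.2 hr) (h.good hQ) (toH G s (bo Q))
  rw [Zf, add_assoc, add_du, ← e, Dmm_bo h hQ hm he hms hws, hm, du_toH, du_toH]
  exact ip_bo he hms hws

/-- The vector fields `Yf` and `bo` commute. -/
theorem exists_DYf_bo {r : ℝ} (h : Adm G s κ r) {Q : Sm G} (hr : conj Q = Q)
    (hQ : ‖toH G s Q‖ ≤ r) : ∃ y : Sm G, Yf κ (toH G s Q) = toH G s y ∧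
      DYf κ (toH G s Q) (toH G s (bo Q)) = toH G s (Hil (D (D y)) - (2 : ℂ) • D (Q * y)) := by
  obtain ⟨m, w, hm, he, hms, hws⟩ := exists_gauge h hQ
  set a : ℂ := ((-(κ ^ 2) : ℝ) : ℂ) with ha
  refine ⟨a • D (m + conj m + m * conj m), ?_, ?_⟩
  · rw [Yf, Zf, mc, hm, conj_toH, alg_toH, ← map_add, ← map_add, dxL_toH, real_smul_toH]
  · rw [DYf_apply, DZf_apply, mc, Dmm_bo h hQ hm he hms hws, hm, conj_toH, conj_toH, alg_toH,
      alg_toH, ← map_add, ← map_add, ← map_add, dxL_toH, real_smul_toH, add_assoc (_ + _),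
      density_bo hr he hms hws, map_sub, D_Hil]
    simp only [map_smul, mul_smul_comm, smul_sub]
    rw [smul_comm (2 : ℂ) a]

end Sm

end

section

variable {G : Geometry} {σ σ' τ κ s R A c : ℝ}

/-! ### The Benjamin–Ono field in Sobolev spaces -/

theorem isMult_hilbert_dx_dx (σ : ℝ) : IsMult (σ + 2) σ 1 fun ξ =>
    -Complex.I * ((SignType.sign ξ : ℝ) : ℂ) * (Complex.I * (ξ : ℂ) * (Complex.I * (ξ : ℂ))) := by
  refine ⟨Sm.isPoly_hilbert.meas.mul (by fun_prop), zero_le_one, fun ξ => ?_⟩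
  have e : (|ξ| + 1) ^ (σ + 2) = (|ξ| + 1) ^ σ * (|ξ| + 1) ^ 2 := by
    rw [Real.rpow_add (bracket_pos ξ), ← Real.rpow_natCast]; norm_num
  rw [one_mul, e]
  refine mul_le_mul_of_nonneg_left ?_ (bracket_rpow_pos ξ σ).le
  have h1 : ‖((SignType.sign ξ : ℝ) : ℂ)‖ ≤ 1 := by
    rcases lt_trichotomy ξ 0 with h | h | h
    · simp [sign_neg h]
    · simp [h]
    · simp [sign_pos h]
  have h2 := abs_nonneg ξ
  simp only [norm_mul, norm_neg, Complex.norm_I, one_mul]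
  rw [Complex.norm_real ξ, Real.norm_eq_abs]
  nlinarith [norm_nonneg ((SignType.sign ξ : ℝ) : ℂ), mul_nonneg h2 h2]

/-- The linear part `f ↦ H f''`. -/
def hilDD (G : Geometry) (σ : ℝ) : Hs G (σ + 2) →L[ℂ] Hs G σ := mlt G (isMult_hilbert_dx_dx σ)

/-- The bilinear part `(f, g) ↦ (f g)'`. -/
def dxMul (G : Geometry) (h : 1 / 2 < σ + 1) : Hs G (σ + 2) →L[ℂ] Hs G (σ + 2) →L[ℂ] Hs G σ :=
  ((ContinuousLinearMap.compL ℂ (Hs G (σ + 1)) (Hs G (σ + 1)) (Hs G σ) (dxL G σ)).comp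
    (mulAlg G h)).bilinearComp (emb G (by linarith)) (emb G (by linarith))

/-- The Benjamin–Ono vector field from `H^{σ+2}` to `H^σ`. -/
def boH (h : 1 / 2 < σ + 1) (f : Hs G (σ + 2)) : Hs G σ := hilDD G σ f - dxMul G h f f

namespace Sm

theorem emb_toH (h : σ' ≤ σ) (f : Sm G) : emb G h (toH G σ f) = toH G σ' f :=
  eq_toH ((emb_coe h _).trans (toH_coe σ f))

theorem hilDD_toH (f : Sm G) : hilDD G σ (toH G (σ + 2) f) = toH G σ (Hil (D (D f))) := eq_toH (by
  filter_upwards [mlt_coe (isMult_hilbert_dx_dx σ) (toH G (σ + 2) f), toH_coe (σ + 2) f,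
    Hil_fn (D (D f)), D_fn (D f), D_fn f] with ξ h1 h2 h3 h4 h5
  rw [hilDD, h1, h2, h3, hilbert, h4, dx, h5, dx]; ring)

theorem dxMul_toH (h : 1 / 2 < σ + 1) (f g : Sm G) :
    dxMul G h (toH G (σ + 2) f) (toH G (σ + 2) g) = toH G σ (D (f * g)) := by
  have e : mulAlg G h (toH G (σ + 1) f) (toH G (σ + 1) g) = toH G (σ + 1) (f * g) :=
    eq_toH ((mulAlg_coe h _ _).trans ((mul_congr (toH_coe _ f) (toH_coe _ g)).trans
      (fn_mul f g).symm))
  have h2 : σ + 1 ≤ σ + 2 := by linarith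
  change dxL G σ (mulAlg G h (emb G h2 (toH G (σ + 2) f)) (emb G h2 (toH G (σ + 2) g))) = _
  rw [emb_toH, emb_toH, e, dxL_toH]

theorem bo_eq_sub (Q : Sm G) : bo Q = Hil (D (D Q)) - D (Q * Q) := by
  rw [bo, D_mul, mul_comm (D Q) Q, two_smul]

theorem boH_toH (h : 1 / 2 < σ + 1) (Q : Sm G) : boH h (toH G (σ + 2) Q) = toH G σ (bo Q) := by
  rw [boH, hilDD_toH, dxMul_toH, ← map_sub, bo_eq_sub]

theorem bo_fn (Q : Sm G) : (bo Q).fn =ᵐ[freq G] boField G Q.fn := by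
  have e := mul_congr (ae_eq_rfl (f := Q.fn)) (D_fn Q)
  filter_upwards [fn_sub (Hil (D (D Q))) ((2 : ℂ) • (Q * D Q)), fn_smul (2 : ℂ) (Q * D Q),
    fn_mul Q (D Q), e, Hil_fn (D (D Q)), D_fn (D Q), D_fn Q] with ξ h1 h2 h3 h4 h5 h6 h7
  rw [bo, h1, h2, h3, h4, h5, hilbert, h6, dx, h7]
  rfl

theorem boField_congr {f g : ℝ → ℂ} (h : f =ᵐ[freq G] g) : boField G f =ᵐ[freq G] boField G g := by
  have e : dx f =ᵐ[freq G] dx g := by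
    filter_upwards [h] with ξ h
    rw [dx, dx, h]
  filter_upwards [h, mul_congr h e] with ξ h1 h2
  have e2 : dx (dx f) ξ = dx (dx g) ξ := by simp only [dx, h1]
  rw [boField, boField, h2, hilbert, hilbert, e2]

/-- `U` is differentiable with derivative `V` in every Sobolev space. -/
def HasDeriv (U V : ℝ → Sm G) : Prop :=
  ∀ (σ t : ℝ), HasDerivAt (fun t => toH G σ (U t)) (toH G σ (V t)) t

theorem hasDerivAt_toH_mono (h : σ' ≤ σ) {U V : ℝ → Sm G} {t : ℝ}
    (hd : HasDerivAt (fun t => toH G σ (U t)) (toH G σ (V t)) t) :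
    HasDerivAt (fun t => toH G σ' (U t)) (toH G σ' (V t)) t := by
  have := ((emb G h).restrictScalars ℝ).hasFDerivAt.comp_hasDerivAt t hd
  simp only [ContinuousLinearMap.coe_restrictScalars', Function.comp_def, emb_toH] at this
  exact this

/-- The derivative of the Benjamin–Ono field in direction `V` has the form found in `exists_DYf_bo`;
that match is the commutation. -/
theorem hasDerivAt_boH (h : 1 / 2 < σ + 1) {U V : ℝ → Sm G} {t : ℝ}
    (hd : HasDerivAt (fun t => toH G (σ + 2) (U t)) (toH G (σ + 2) (V t)) t) :
    HasDerivAt (fun t => toH G σ (bo (U t)))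
      (toH G σ (Hil (D (D (V t))) - (2 : ℂ) • D (U t * V t))) t := by
  have h1 := ((hilDD G σ).restrictScalars ℝ).hasFDerivAt.comp_hasDerivAt t hd
  have h2 := ((dxMul G h).bilinearRestrictScalars ℝ).hasDerivAt_of_bilinear (fun _ => hd)
    (fun _ => hd)
  have h3 := h1.sub h2
  refine (h3.congr_deriv ?_).congr_of_eventuallyEq (Eventually.of_forall fun t => ?_)
  · change hilDD G σ _ - (dxMul G h _ _ + dxMul G h _ _) = _
    rw [hilDD_toH, dxMul_toH, dxMul_toH, mul_comm (V t), ← map_add, ← map_sub, ← two_smul ℂ (D _)]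
  · exact (boH_toH h (U t)).symm

variable [hs : Fact (s ∈ Ioo (-(1 / 2) : ℝ) 0)]

theorem exists_toH_of_memHInfty {q : Hs G s} (h : MemHInfty q) : ∃ Q : Sm G, q = toH G s Q :=
  exists_eq_toH fun τ => by
    obtain ⟨u, hu⟩ := h τ
    rw [← eN_congr hu, eN_coe]
    exact enorm_lt_top

theorem isBOSolution_iff {u : ℝ → Hs G s} : IsBOSolution u ↔ ∃ U : ℝ → Sm G,
    (∀ t, u t = toH G s (U t)) ∧ (∀ t, conj (U t) = U t) ∧ HasDeriv U fun t => bo (U t) := by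
  constructor
  · rintro ⟨hr, h⟩
    have hex : ∀ t, ∃ Q : Sm G, u t = toH G s Q := fun t => exists_toH_of_memHInfty fun σ => by
      obtain ⟨U, V, hUV⟩ := h σ
      exact ⟨U t, (hUV t (mem_univ t)).1⟩
    choose U hU using hex
    refine ⟨U, hU, fun t => isReal_toH.1 (by rw [← hU]; exact hr t), fun σ t => ?_⟩
    obtain ⟨U', V', hUV⟩ := h σ
    have hu : ∀ t, (u t : ℝ → ℂ) =ᵐ[freq G] (U t).fn := fun t => by rw [hU]; exact toH_coe s (U t)
    have e1 : ∀ t, U' t = toH G σ (U t) := fun t =>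
      eq_toH ((hUV t (mem_univ t)).1.trans (hu t))
    have e2 : V' t = toH G σ (bo (U t)) := eq_toH ((hUV t (mem_univ t)).2.1.trans
      ((boField_congr (hu t)).trans (bo_fn (U t)).symm))
    have := (hUV t (mem_univ t)).2.2
    rw [hasDerivWithinAt_univ, e2] at this
    rwa [funext e1] at this
  · rintro ⟨U, hU, hr, hd⟩
    have hu : ∀ t, (u t : ℝ → ℂ) =ᵐ[freq G] (U t).fn := fun t => by rw [hU]; exact toH_coe s (U t)
    refine ⟨fun t => by rw [hU]; exact isReal_toH.2 (hr t), fun σ =>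
      ⟨fun t => toH G σ (U t), fun t => toH G σ (bo (U t)), fun t _ => ⟨?_, ?_, ?_⟩⟩⟩
    · exact (toH_coe σ _).trans (hu t).symm
    · exact (toH_coe σ _).trans ((bo_fn (U t)).trans (boField_congr (hu t)).symm)
    · exact (hd σ t).hasDerivWithinAt

/-! ### Translations of smooth functions -/

theorem isPoly_tr (h : ℝ) : IsPoly fun ξ => Complex.exp (Complex.I * (ξ : ℂ) * (h : ℂ)) :=
  ⟨by fun_prop, 0, fun ξ => by rw [norm_exp_I_mul, pow_zero]⟩

/-- Translation. -/
def Tr (h : ℝ) : Sm G →ₗ[ℂ] Sm G := mult (isPoly_tr h)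

theorem Tr_fn (h : ℝ) (f : Sm G) : (Tr h f).fn =ᵐ[freq G]
    fun ξ => Complex.exp (Complex.I * (ξ : ℂ) * (h : ℂ)) * f.fn ξ := mult_fn _ f

theorem tr_toH (σ h : ℝ) (f : Sm G) : tr G σ h (toH G σ f) = toH G σ (Tr h f) := eq_toH (by
  filter_upwards [tr_coe h (toH G σ f), toH_coe σ f, Tr_fn h f] with ξ h1 h2 h3
  rw [h1, h2, h3])

theorem Tr_mul (h : ℝ) (f g : Sm G) : Tr h (f * g) = Tr h f * Tr h g := ext_ae (by
  filter_upwards [Tr_fn h (f * g), fn_mul f g, fn_mul (Tr h f) (Tr h g),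
    mul_congr (Tr_fn h f) (Tr_fn h g)] with ξ h1 h2 h3 h4
  rw [h1, h2, h3, h4, mul_tr])

theorem Tr_bo (h : ℝ) (Q : Sm G) : bo (Tr h Q) = Tr h (bo Q) := by
  have e1 : D (Tr h Q) = Tr h (D Q) := mult_comm _ _ _
  have e2 : D (Tr h (D Q)) = Tr h (D (D Q)) := mult_comm _ _ _
  have e3 : Hil (Tr h (D (D Q))) = Tr h (Hil (D (D Q))) := mult_comm _ _ _
  rw [bo, bo, e1, e2, e3, ← Tr_mul, ← map_smul, ← map_sub]

theorem conj_Tr (h : ℝ) (f : Sm G) : conj (Tr h f) = Tr h (conj f) := by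
  apply toH_injective 0
  rw [← conj_toH, ← tr_toH, conjL_tr, conj_toH, tr_toH]

theorem mean_toH_bo (σ : ℝ) (Q : Sm G) : mean G (toH G σ (bo Q)) = 0 := by
  refine mean_eq_zero ?_
  have e : bo Q = D (Hil (D Q) - Q * Q) := by rw [bo_eq_sub, map_sub, D_Hil]
  filter_upwards [toH_coe σ (bo Q), D_fn (Hil (D Q) - Q * Q)] with ξ h1 h2 h0
  rw [h1, e, h2, dx, h0]
  simp

theorem HasDeriv.mean_eq {U : ℝ → Sm G} (h : HasDeriv U fun t => bo (U t)) (σ t : ℝ) :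
    mean G (toH G σ (U t)) = mean G (toH G σ (U 0)) := by
  have hd : ∀ t, HasDerivAt (fun t => meanL G σ (toH G σ (U t))) 0 t := fun t => by
    have := ((meanL G σ).restrictScalars ℝ).hasFDerivAt.comp_hasDerivAt t (h σ t)
    have e : ((meanL G σ).restrictScalars ℝ) (toH G σ (bo (U t))) = 0 := by
      simp [meanL_apply, mean_toH_bo]
    rw [e] at this
    exact this
  have := is_const_of_deriv_eq_zero (fun t => (hd t).differentiableAt) (fun t => (hd t).deriv) t 0
  simpa only [meanL_apply] using this

/-! ### Uniqueness for the Benjamin–Ono equation -/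

theorem norm_toH_sq {d : Sm G} (hd : conj d = d) : ip d d = ((‖toH G 0 d‖ ^ 2 : ℝ) : ℂ) := by
  have h1 : ip d d = ∫ ξ, ((‖d.fn ξ‖ ^ 2 : ℝ) : ℂ) ∂(freq G) := by
    rw [ip_eq, dp]
    have hd' : conjF d.fn =ᵐ[freq G] d.fn := by
      have := conj_fn d
      rw [hd] at this
      exact this.symm
    refine integral_congr_ae ?_
    filter_upwards [hd'] with ξ h
    rw [conjF] at h
    have h' : d.fn (-ξ) = starRingEnd ℂ (d.fn ξ) := by rw [← h, Complex.conj_conj]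
    rw [h', ← Complex.normSq_eq_conj_mul_self, Complex.normSq_eq_norm_sq]
  have h2 : ‖toH G 0 d‖ ^ 2 = ∫ ξ, ‖d.fn ξ‖ ^ 2 ∂(freq G) := by
    rw [integral_eq_lintegral_of_nonneg_ae (Eventually.of_forall fun ξ => by positivity)
      (by have := d.meas; fun_prop)]
    have e := enorm_sq_Hs (toH G 0 d)
    rw [sobSq_congr (toH_coe 0 d), sobSq] at e
    rw [← toReal_enorm, ← ENNReal.toReal_pow, e]
    congr 1
    refine lintegral_congr fun ξ => ?_
    rw [Real.rpow_zero, ENNReal.ofReal_one, one_mul, ENNReal.ofReal_pow (norm_nonneg _),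
      ofReal_norm]
  rw [h1, h2]
  exact integral_ofReal

theorem ip_Hil (f g : Sm G) : ip f (Hil g) = -ip (Hil f) g := by
  rw [ip_eq, ip_eq, dp_congr ae_eq_rfl (Hil_fn g), dp_congr (Hil_fn f) ae_eq_rfl, dp, dp,
    ← integral_neg]
  refine integral_congr_ae (Eventually.of_forall fun ξ => ?_)
  simp only [hilbert, Left.sign_neg, SignType.coe_neg]
  push_cast; ring

/-- Energy identity: `H ∂²` is antisymmetric, and integration by parts moves the derivative off the
difference onto `V + W`. -/
theorem ip_bo_sub_bo (V W : Sm G) : ip (V - W) (bo V - bo W) =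
    -(1 / 2) * ip (V - W) (D (V + W) * (V - W)) := by
  set d := V - W with hd
  have e : bo V - bo W = Hil (D (D d)) - D ((V + W) * d) := by
    have : (V + W) * d = V * V - W * W := by rw [hd, add_mul, mul_sub, mul_sub, mul_comm W V]; abel
    rw [this, bo_eq_sub, bo_eq_sub, hd]
    simp only [map_sub]; abel
  have h1 : ip d (Hil (D (D d))) = 0 := by
    have h2 : ip d (Hil (D (D d))) = -ip d (Hil (D (D d))) := by
      conv_lhs => rw [ip_Hil, ip_D, ip_D, D_Hil, D_Hil, neg_neg, ip_comm]
    have h3 : (2 : ℂ) * ip d (Hil (D (D d))) = 0 := by linear_combination h2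
    simpa using h3
  have h4 : (2 : ℂ) * ip (D d) ((V + W) * d) = -ip d (D (V + W) * d) := by
    rw [ip_mul d, ← neg_neg (ip (D (V + W)) (d * d)), ← ip_D, D_mul, mul_comm d, ← two_smul ℂ,
      ip_smul, ip_mul (D d)]
    ring
  rw [e, ip_sub, h1, ip_D]
  linear_combination (1 / 2 : ℂ) * h4

theorem exists_isKer_mul_one (G : Geometry) : ∃ A, IsKer G 1 0 0 A fun _ _ => convConst G := by
  obtain ⟨c, hc, h⟩ := exists_lintegral_rpow_le G (p := 2) (by norm_num)
  have h1 := h 1 le_rfl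
  refine ⟨‖convConst G‖ * Real.sqrt c, measurable_const, by positivity,
    fun ξ => ‖convConst G‖ * (|ξ| + 1) ^ (-1 : ℝ), by fun_prop, fun ξ => by positivity, ?_, ?_⟩
  · rw [mul_pow, Real.sq_sqrt hc.le, ENNReal.ofReal_mul (by positivity)]
    calc _ = ∫⁻ ξ, ENNReal.ofReal (‖convConst G‖ ^ 2) *
          ENNReal.ofReal ((|ξ| + 1) ^ (-2 : ℝ)) ∂(freq G) := by
          refine lintegral_congr fun ξ => ?_
          rw [← ENNReal.ofReal_pow (by positivity), ← ENNReal.ofReal_mul (by positivity), mul_pow,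
            ← Real.rpow_natCast (_ ^ (-1 : ℝ)), ← Real.rpow_mul (bracket_pos ξ).le]
          norm_num
      _ = ENNReal.ofReal (‖convConst G‖ ^ 2) * ∫⁻ ξ, ENNReal.ofReal ((|ξ| + 1) ^ (-2 : ℝ))
          ∂(freq G) := lintegral_const_mul _ (by fun_prop)
      _ ≤ _ := by
          gcongr
          simpa using h1
  · intro ξ η
    simp only [Real.rpow_zero, one_mul, mul_one, Real.rpow_one]
    have hz := bracket_pos (ξ - η)
    have e : (|ξ - η| + 1) ^ (-1 : ℝ) * (|ξ - η| + 1) = 1 := by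
      rw [Real.rpow_neg_one, inv_mul_cancel₀ hz.ne']
    calc ‖convConst G‖ = ‖convConst G‖ * ((|ξ - η| + 1) ^ (-1 : ℝ) * (|ξ - η| + 1)) := by
          rw [e, mul_one]
      _ = (0 + 0 + ‖convConst G‖ * (|ξ - η| + 1) ^ (-1 : ℝ)) * (|ξ - η| + 1) := by ring
      _ ≤ _ := by gcongr <;> positivity

/-- Gronwall for the squared `L²` norm of the difference, with `(V + W)'` locally bounded in `H^1`.
-/
theorem HasDeriv.unique {V W : ℝ → Sm G} (hV : HasDeriv V fun t => bo (V t))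
    (hW : HasDeriv W fun t => bo (W t)) (hVr : ∀ t, conj (V t) = V t)
    (hWr : ∀ t, conj (W t) = W t) (h0 : V 0 = W 0) (t : ℝ) : V t = W t := by
  obtain ⟨A, hA⟩ := exists_isKer_mul_one G
  set d : ℝ → Sm G := fun t => V t - W t with hd
  have hdr : ∀ t, conj (d t) = d t := fun t => by rw [hd, map_sub, hVr, hWr]
  have hdd : ∀ t, HasDerivAt (fun t => toH G 1 (d t)) (toH G 1 (bo (V t) - bo (W t))) t := fun t => by
    simp only [hd, map_sub]
    exact (hV 1 t).sub (hW 1 t)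
  have hip : ∀ f g : Sm G, dpL G (σ := 1) (σ' := 1) (by norm_num) (toH G 1 f) (toH G 1 g) =
      ip f g := fun f g => dp_congr (toH_coe 1 f) (toH_coe 1 g)
  set F : ℝ → ℝ := fun t => ‖toH G 0 (d t)‖ ^ 2 with hF
  have hFd : ∀ t, HasDerivAt F (-(ip (d t) (D (V t + W t) * d t)).re) t := by
    intro t
    have h1 := ((dpL G (σ := 1) (σ' := 1) (by norm_num)).bilinearRestrictScalars
      ℝ).hasDerivAt_of_bilinear (fun _ => hdd t) (fun _ => hdd t)
    have h2 := (Complex.reCLM.hasFDerivAt.comp_hasDerivAt t h1)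
    refine (h2.congr_deriv ?_).congr_of_eventuallyEq (Eventually.of_forall fun t => ?_)
    · change (dpL G (σ := 1) (σ' := 1) (by norm_num) _ _ + dpL G (σ := 1) (σ' := 1) (by norm_num) _ _).re = _
      rw [hip, hip, ip_comm _ (d t), hd, ip_bo_sub_bo, ← Complex.neg_re]
      congr 1; ring
    · change F t = (dpL G (σ := 1) (σ' := 1) (by norm_num) _ _).re
      rw [hip, norm_toH_sq (hdr t), Complex.ofReal_re]
  obtain ⟨K, hK⟩ : ∃ K : ℝ, ∀ x ∈ Icc (-|t|) |t|, ‖toH G 1 (D (V x + W x))‖ ≤ K := by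
    have hc : Continuous fun x => toH G 1 (D (V x + W x)) := by
      have e : (fun x => toH G 1 (D (V x + W x))) =
          fun x => dxL G 1 (toH G (1 + 1) (V x) + toH G (1 + 1) (W x)) := by
        ext1 x; rw [← map_add, dxL_toH]
      rw [e]
      exact (dxL G 1).continuous.comp
        ((continuous_iff_continuousAt.2 fun x => (hV _ x).continuousAt).add
          (continuous_iff_continuousAt.2 fun x => (hW _ x).continuousAt))
    exact isCompact_Icc.exists_bound_of_continuousOn hc.continuousOn
  have hbd : ∀ x ∈ Icc (-|t|) |t|, ‖-(ip (d x) (D (V x + W x) * d x)).re‖ ≤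
      (3 * A * K) * ‖F x‖ := by
    intro x hx
    set S := D (V x + W x) with hS
    have h1 : ‖toH G 0 (S * d x)‖ ≤ 3 * A * ‖toH G 1 S‖ * ‖toH G 0 (d x)‖ := by
      have e : toH G 0 (S * d x) = bil hA (toH G 1 S) (toH G 0 (d x)) := by
        symm
        refine eq_toH ((bil_coe hA _ _).trans ?_)
        rw [← mul_eq_kconv]
        exact (mul_congr (toH_coe _ S) (toH_coe _ (d x))).trans (fn_mul S (d x)).symm
      rw [e]
      exact bil_norm_le hA _ _
    have h2 : ‖ip (d x) (S * d x)‖ ≤ ‖toH G 0 (d x)‖ * ‖toH G 0 (S * d x)‖ := by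
      have := dp_norm_le (σ := 0) (σ' := 0) (by norm_num) (toH G 0 (d x)) (toH G 0 (S * d x))
      rwa [dp_congr (toH_coe 0 (d x)) (toH_coe 0 (S * d x))] at this
    have hA0 := hA.nonneg
    have hFn : ‖F x‖ = ‖toH G 0 (d x)‖ ^ 2 := Real.norm_of_nonneg (sq_nonneg _)
    rw [norm_neg, hFn, Real.norm_eq_abs]
    calc _ ≤ ‖ip (d x) (S * d x)‖ := Complex.abs_re_le_norm _
      _ ≤ ‖toH G 0 (d x)‖ * (3 * A * ‖toH G 1 S‖ * ‖toH G 0 (d x)‖) := h2.trans (by gcongr)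
      _ ≤ ‖toH G 0 (d x)‖ * (3 * A * K * ‖toH G 0 (d x)‖) := by gcongr; exact hK x hx
      _ = _ := by ring
  have hfin := norm_le_mul_exp_of_hasDerivAt hFd hbd (abs_le.1 le_rfl : t ∈ Icc (-|t|) |t|)
  have hF0 : F 0 = 0 := by simp [hF, hd, h0]
  rw [hF0, norm_zero, zero_mul, norm_le_zero_iff] at hfin
  have : toH G 0 (d t) = 0 := by simpa [hF] using hfin
  exact sub_eq_zero.1 (toH_injective 0 (this.trans (map_zero _).symm))

end Sm

end

section

variable {G : Geometry} {σ κ s R : ℝ} {Ψ : ℝ → Hs G s → Hs G s} {U W : ℝ → Sm G} {Q : Set (Hs G s)}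
variable [hs : Fact (s ∈ Ioo (-(1 / 2) : ℝ) 0)]

/-! ### Commutation with the Benjamin–Ono flow -/

theorem IsFlow.isCurve (h : IsFlow κ R Ψ) (hR : 0 ≤ R) {q : Hs G s} (hb : ∀ t, ‖Ψ t q‖ ≤ R) :
    IsCurve κ (R + 1) fun t => Ψ t q where
  deriv t := by
    have := h.deriv q t
    rwa [retract_of_norm_le (by linarith) (by linarith [hb t])] at this
  bound t := by linarith [hb t]

theorem IsFlow.memHInfty_hkFlow (h : IsFlow κ R Ψ) (hR : 0 ≤ R) (hκ : Adm G s κ (R + 1))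
    {q : Hs G s} (hb : ∀ t, ‖Ψ t q‖ ≤ R) (hq : MemHInfty q) (t : ℝ) :
    MemHInfty (hkFlow κ Ψ t q) := by
  rw [memHInfty_iff] at hq ⊢
  intro k
  rw [hkFlow, eN_tr]
  exact ((h.isCurve hR hb).locBdd hκ (by simpa only [h.zero] using hq k)).lt_top t

namespace Sm

theorem HasDeriv.continuous {V : ℝ → Sm G} (h : HasDeriv U V) (σ : ℝ) :
    Continuous fun t => toH G σ (U t) :=
  continuous_iff_continuousAt.2 fun t => (h σ t).continuousAt

theorem HasDeriv.mem_starStar (hU : HasDeriv U fun t => bo (U t)) (hr : ∀ t, conj (U t) = U t)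
    (hκ : Adm G s κ (R + 1)) (hQ : ∀ q ∈ starStar Q, ‖q‖ ≤ R) (h0 : toH G s (U 0) ∈ starStar Q)
    (t : ℝ) : toH G s (U t) ∈ starStar Q := by
  have hub : ∀ ϰ, κ ≤ ϰ → ∀ t, ‖toH G s (U t)‖ < R + 1 →
      HasDerivAt (fun t => beta ϰ (toH G s (U t))) 0 t := fun ϰ hϰ t ht => by
    have := hasDerivAt_beta (hκ.mono hϰ) (hU s t) (fun t => isReal_toH.2 (hr t)) ht
    rwa [du_Zf_bo (hκ.mono hϰ) (hr t) ht.le] at this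
  rcases le_total 0 t with ht | ht
  · refine mem_starStar_of_stationary hQ (hU.continuous s) (fun t => isReal_toH.2 (hr t)) h0 ?_ ht
    filter_upwards [eventually_ge_atTop κ] with ϰ hϰ using hub ϰ hϰ
  · have := mem_starStar_of_stationary (T := -t) (u := fun t => toH G s (U (-t))) hQ
      ((hU.continuous s).comp continuous_neg) (fun t => isReal_toH.2 (hr _))
      (by simpa using h0) (by
        filter_upwards [eventually_ge_atTop κ] with ϰ hϰ τ hτ
        simpa using hasDerivAt_comp_neg (hub ϰ hϰ (-τ) hτ)) (by linarith)
    simpa using this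

theorem norm_boH_le (h : 1 / 2 < σ + 1) {f : Hs G (σ + 2)} {C : ℝ} (hf : ‖f‖ ≤ C) :
    ‖boH h f‖ ≤ ‖hilDD G σ‖ * C + ‖dxMul G h‖ * C * C := by
  refine (norm_sub_le _ _).trans (add_le_add ?_ ?_)
  · exact (hilDD G σ).le_opNorm_of_le hf
  · exact (dxMul G h).le_of_opNorm₂_le_of_le le_rfl hf hf

theorem continuous_boH (h : 1 / 2 < σ + 1) : Continuous fun f : Hs G (σ + 2) => boH h f :=
  (hilDD G σ).continuous.sub
    ((dxMul G h).continuous.clm_apply continuous_id)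

theorem half_lt_add_natCast_add_one (k : ℕ) : 1 / 2 < s + k + 1 := by
  have := half_lt_add_one (s := s)
  have := k.cast_nonneg (α := ℝ)
  linarith

theorem add_natCast_add_two (s : ℝ) (k : ℕ) : s + ((k + 2 : ℕ) : ℝ) = s + k + 2 := by
  push_cast; ring

theorem locBdd_toH_iff : LocBdd σ (fun t => toH G s (W t)) ↔
    ∀ T : ℝ, ∃ C : ℝ≥0, ∀ t ∈ Icc (-T) T, ‖toH G σ (W t)‖ ≤ C := by
  have e : ∀ t (C : ℝ≥0), eN G σ (toH G s (W t)) ≤ C ↔ ‖toH G σ (W t)‖ ≤ C := fun t C => by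
    rw [eN_toH, ← eN_toH σ]
    exact ⟨norm_le_of_eN_le, eN_le_of_norm_le⟩
  simp only [LocBdd, e]

theorem locBdd_bo {k : ℕ} (hb : LocBdd (s + (k + 2 : ℕ)) fun t => toH G s (W t)) :
    LocBdd (s + k) fun t => toH G s (bo (W t)) := by
  rw [add_natCast_add_two, locBdd_toH_iff] at hb
  rw [locBdd_toH_iff]
  intro T
  obtain ⟨C, hC⟩ := hb T
  have h := half_lt_add_natCast_add_one (s := s) k
  refine ⟨(‖hilDD G (s + k)‖ * C + ‖dxMul G h‖ * C * C).toNNReal, fun t ht => ?_⟩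
  rw [← boH_toH h]
  exact (norm_boH_le h (hC t ht)).trans (Real.le_coe_toNNReal _)

/-- A solution in `H^s` that is locally bounded in all higher norms is one in every norm. -/
theorem hasDeriv_bo_of_locBdd (hd : ∀ t, HasDerivAt (fun t => toH G s (W t)) (toH G s (bo (W t))) t)
    (hb : ∀ k : ℕ, LocBdd (s + k) fun t => toH G s (W t)) : HasDeriv W fun t => bo (W t) := by
  have hv : ∀ k : ℕ, LocBdd (s + k) fun t => toH G s (bo (W t)) := fun k => locBdd_bo (hb (k + 2))
  have hc : ∀ k : ℕ, Continuous fun t => toH G (s + k + 2) (W t) := fun k => by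
    have := continuous_up (le_add_natCast s (k + 2)) (hb (k + 2)) (hv (k + 2)) hd
    simp only [up_toH] at this
    rwa [add_natCast_add_two] at this
  intro σ t
  obtain ⟨k, hk⟩ := exists_nat_ge (σ - s)
  have hcv : Continuous fun t => up (s + k) (toH G s (bo (W t))) := by
    simp only [up_toH, ← boH_toH (half_lt_add_natCast_add_one k)]
    exact (continuous_boH (half_lt_add_natCast_add_one k)).comp (hc k)
  have := hasDerivAt_up (le_add_natCast s k) (hb k) (hv k) hd hcv t
  simp only [up_toH] at this
  exact hasDerivAt_toH_mono (U := W) (V := fun t => bo (W t)) (sub_le_iff_le_add'.1 hk) this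

/-- The flow of `Yf` is differentiated with respect to its initial value along `t ↦ U t`. Uniform
bounds in all higher norms then lift the equation from `H^s` to every `H^σ`. -/
theorem HasDeriv.comp_flow (hΨ : IsFlow κ R Ψ) (hR : 0 ≤ R) (hκ : Adm G s κ (R + 1))
    (hU : HasDeriv U fun t => bo (U t)) (hr : ∀ t, conj (U t) = U t)
    (hb : ∀ τ t, ‖Ψ τ (toH G s (U t))‖ ≤ R) (τ : ℝ) :
    ∃ W : ℝ → Sm G, (∀ t, Ψ τ (toH G s (U t)) = toH G s (W t)) ∧ (∀ t, conj (W t) = W t) ∧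
      HasDeriv W fun t => bo (W t) := by
  have hcur : ∀ t, IsCurve κ (R + 1) fun τ => Ψ τ (toH G s (U t)) := fun t =>
    hΨ.isCurve hR fun τ => hb τ t
  have hloc : ∀ (k : ℕ) t, LocBdd (s + k) fun τ => Ψ τ (toH G s (U t)) := fun k t =>
    (hcur t).locBdd hκ (by rw [hΨ.zero, eN_toH]; exact eN_lt_top _ _)
  have hex : ∀ τ t, ∃ P : Sm G, Ψ τ (toH G s (U t)) = toH G s P := fun τ t =>
    exists_toH_of_memHInfty (memHInfty_iff.2 fun k => (hloc k t).lt_top τ)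
  choose P hP using hex
  have hPr : ∀ τ t, conj (P τ t) = P τ t := fun τ t => isReal_toH.1 (by
    rw [← hP]; exact hΨ.real (isReal_toH.2 (hr t)) τ)
  have hPb : ∀ τ t, ‖toH G s (P τ t)‖ ≤ R + 1 := fun τ t => by
    rw [← hP]; linarith [hb τ t]
  refine ⟨P τ, hP τ, hPr τ, hasDeriv_bo_of_locBdd (s := s) (fun t₀ => ?_) fun k T => ?_⟩
  · obtain ⟨K, -, -, k3, k4⟩ := exists_Yf_bounds hκ
    obtain ⟨L, hL⟩ := hΨ.lip
    have hY := fun τ => exists_DYf_bo hκ (hPr τ t₀) (hPb τ t₀)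
    choose y hy1 hy2 using hY
    -- The Benjamin–Ono field costs two derivatives, so the orbit is differentiated in `H^{s+2}`.
    have hP2 : ∀ τ, HasDerivAt (fun τ => toH G (s + 2) (P τ t₀)) (toH G (s + 2) (y τ)) τ := by
      intro τ
      have := (hcur t₀).hasDerivAt_up hκ (hloc 2 t₀) τ
      simp only [hP, hy1, up_toH, Nat.cast_ofNat] at this
      exact this
    have h0 : ∀ t, P 0 t = U t := fun t => toH_injective s (by rw [← hP, hΨ.zero])
    -- The candidate derivative `z` is the Benjamin–Ono field along the orbit. It solves the
    -- linearised equation by `exists_DYf_bo`, and at `τ = 0` it is the velocity of `U` at `t₀`.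
    have key := hasDerivAt_flow (p := fun h τ => toH G s (P τ (t₀ + h)))
      (v := fun h τ => Yf κ (toH G s (P τ (t₀ + h))))
      (z := fun τ => toH G s (bo (P τ t₀))) (D := fun τ => DYf κ (toH G s (P τ t₀)))
      (K := K) (L := Real.exp (L * |τ|)) (T := τ) K.coe_nonneg
      (fun h τ => by simpa only [hP] using (hcur (t₀ + h)).deriv τ)
      (fun h τ' hτ' => ?_) (fun τ => k3 _ (hPb τ t₀))
      (fun h τ => ?_) (fun τ => ?_) ?_
    · have h1 : HasDerivAt (fun t : ℝ => t - t₀) 1 t₀ := (hasDerivAt_id t₀).sub_const t₀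
      have := HasDerivAt.scomp t₀ (by simpa using key) h1
      simpa [Function.comp_def] using this
    · have := hL τ' (toH G s (U (t₀ + h))) (toH G s (U t₀))
      simp only [add_zero, h0]
      rw [← hP, ← hP, mul_comm]
      exact this.trans (mul_le_mul_of_nonneg_left (Real.exp_le_exp.2
        (mul_le_mul_of_nonneg_left (abs_le.2 hτ') L.coe_nonneg)) (norm_nonneg _))
    · simp only [add_zero]
      exact k4 _ _ (hPb _ _) (hPb _ _)
    · simp only [hy2]
      exact hasDerivAt_boH (half_lt_add_one (s := s)) (hP2 τ)
    · simp only [h0]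
      have h1 : HasDerivAt (fun h : ℝ => t₀ + h) 1 0 := (hasDerivAt_id (0 : ℝ)).const_add t₀
      have := HasDerivAt.scomp (0 : ℝ) (by simpa using hU s t₀) h1
      simpa [Function.comp_def] using this
  · obtain ⟨M, hM⟩ := isCompact_Icc.exists_bound_of_continuousOn (s := Icc (-T) T)
      (hU.continuous (s + k)).continuousOn
    obtain ⟨M', hM'⟩ := exists_eN_curve_le hκ k |τ| M.toNNReal
    refine ⟨M', fun t ht => ?_⟩
    change eN G (s + k) (toH G s (P τ t)) ≤ M'
    rw [← hP]
    refine hM' _ (hcur t) ?_ τ (abs_le.1 le_rfl)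
    rw [hΨ.zero, eN_toH, ← eN_toH (s + k)]
    exact eN_le_of_norm_le ((hM t ht).trans (Real.le_coe_toNNReal M))

theorem HasDeriv.tr (hW : HasDeriv W fun t => bo (W t)) (h : ℝ) :
    HasDeriv (fun t => Tr h (W t)) fun t => bo (Tr h (W t)) := fun σ t => by
  simp only [← tr_toH, Tr_bo]
  exact ((BenjaminOno.tr G σ h).restrictScalars ℝ).hasFDerivAt.comp_hasDerivAt t (hW σ t)

end Sm

open Sm in
theorem IsFlow.bo_commute (hΨ : IsFlow κ R Ψ) (hR : 0 ≤ R) (hκ : Adm G s κ (R + 1))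
    (hQ : ∀ q ∈ starStar Q, ‖q‖ ≤ R) {u : ℝ → Hs G s} (hu : IsBOSolution u)
    (h0 : u 0 ∈ starStar Q) :
    (∀ t, u t ∈ starStar Q) ∧ ∀ τ : ℝ, IsBOSolution (fun t => hkFlow κ Ψ τ (u t)) ∧
      ∀ v : ℝ → Hs G s, IsBOSolution v → v 0 = hkFlow κ Ψ τ (u 0) →
        ∀ t, v t = hkFlow κ Ψ τ (u t) := by
  obtain ⟨U, hU, hr, hd⟩ := isBOSolution_iff.1 hu
  obtain rfl : u = fun t => toH G s (U t) := funext hU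
  have hmem := fun t => hd.mem_starStar hr hκ hQ h0 t
  refine ⟨hmem, fun τ => ?_⟩
  obtain ⟨W, hW, hWr, hWd⟩ := hd.comp_flow hΨ hR hκ hr
    (fun τ t => hQ _ (hΨ.mem_starStar hR hκ hQ (hmem t) τ)) τ
  set c := speed κ (toH G s (U 0)) * τ
  have e : ∀ t, hkFlow κ Ψ τ (toH G s (U t)) = toH G s (Tr c (W t)) := fun t => by
    rw [hkFlow, hW, tr_toH, speed_congr (hd.mean_eq s t)]
  have hTr : ∀ t, conj (Tr c (W t)) = Tr c (W t) := fun t => by rw [conj_Tr, hWr]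
  -- A translation by one and the same `c` for all `t`, since Benjamin–Ono conserves the mean; it
  -- commutes with the Benjamin–Ono field.
  refine ⟨isBOSolution_iff.2 ⟨fun t => Tr c (W t), e, hTr, hWd.tr c⟩, fun v hv hv0 t => ?_⟩
  obtain ⟨V, hV, hVr, hVd⟩ := isBOSolution_iff.1 hv
  have h00 : V 0 = Tr c (W 0) := toH_injective s (by rw [← hV, hv0, e])
  rw [hV, e, hVd.unique (hWd.tr c) hVr hTr h00 t]

end

end BenjaminOno

end

/-! ### Assembly of the theorem -/

theorem theorem5p2 (G : Geometry) (s : ℝ) (hs : s ∈ Set.Ioo (-(1 / 2) : ℝ) 0) :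
    ∃ C : ℝ, 1 ≤ C ∧
      -- `m(κ; q)` exists and is unique as soon as `κ ≥ C (1 + ‖q‖)^(1/(2ε))`
      (∀ (q : Hs G s) (κ : ℝ), IsReal q → C * (1 + ‖q‖) ^ (1 / (1 / 2 - |s|)) ≤ κ →
        HasGauge κ q) ∧
      ∀ A : ℝ, 0 < A →
        -- there are admissible thresholds
        (∃ κ₀ : ℝ, Admissible G s C A κ₀) ∧
        ∀ κ₀ : ℝ, Admissible G s C A κ₀ → ∀ κ : ℝ, κ₀ ≤ κ →
          ∃ Φ : ℝ → Hs G s → Hs G s,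
            -- existence of global solutions
            (∀ q₀ ∈ starStar (closedBallReal G s A),
              IsHkSolution κ Set.univ (fun t => Φ t q₀) ∧ Φ 0 q₀ = q₀) ∧
            -- uniqueness, on every time interval
            (∀ q₀ ∈ starStar (closedBallReal G s A), ∀ I : Set ℝ, I.OrdConnected → (0 : ℝ) ∈ I →
              ∀ q : ℝ → Hs G s, IsHkSolution κ I q → q 0 = q₀ → ∀ t ∈ I, q t = Φ t q₀) ∧
            -- continuity of the data-to-solution map, locally uniformly in time
            ContinuousOn (fun p : ℝ × Hs G s => Φ p.1 p.2)
              (Set.univ ×ˢ starStar (closedBallReal G s A)) ∧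
            -- conservation of `β(ϰ)`
            (∀ q₀ ∈ starStar (closedBallReal G s A), ∀ ϰ : ℝ, κ₀ ≤ ϰ → ∀ t : ℝ,
              HasGauge ϰ (Φ t q₀) ∧ HasDerivAt (fun τ => beta ϰ (Φ τ q₀)) 0 t) ∧
            -- preservation of `H^∞`
            (∀ q₀ ∈ starStar (closedBallReal G s A), MemHInfty q₀ → ∀ t : ℝ,
              MemHInfty (Φ t q₀)) ∧
            -- commutation with the Benjamin–Ono flow on `H^∞`
            (∀ u : ℝ → Hs G s, IsBOSolution u → u 0 ∈ starStar (closedBallReal G s A) →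
              (∀ t : ℝ, u t ∈ starStar (closedBallReal G s A)) ∧
              ∀ τ : ℝ, IsBOSolution (fun t => Φ τ (u t)) ∧
                ∀ v : ℝ → Hs G s, IsBOSolution v → v 0 = Φ τ (u 0) →
                  ∀ t : ℝ, v t = Φ τ (u t)) := by
  have : Fact (s ∈ Set.Ioo (-(1 / 2) : ℝ) 0) := ⟨hs⟩
  refine ⟨thr G s, one_le_thr, fun q κ _ hκ => ?_, fun A hA => ⟨exists_admissible hA,
    fun κ₀ hκ₀ κ hκ => ?_⟩⟩
  · have h := adm_of_thr_le (norm_nonneg q) hκ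
    exact (h.good (by linarith)).hasGauge h.one_le
  -- The radius belongs to `κ₀`, and admissibility is monotone, so one ball serves both `κ` and
  -- every `ϰ ≥ κ₀`.
  · obtain ⟨R, hR, hQ, hadm₀⟩ := Admissible.exists_radius hA hκ₀
    have hadm := hadm₀.mono hκ
    obtain ⟨Ψ, hΨ⟩ := exists_isFlow hR hadm
    have hb : ∀ q ∈ starStar (closedBallReal G s A), ∀ t, ‖Ψ t q‖ ≤ R := fun q hq t =>
      hQ _ (hΨ.mem_starStar hR hadm hQ hq t)
    refine ⟨hkFlow κ Ψ, fun q hq => ⟨hΨ.isHkSolution hR hadm (starStar_real hq) (hb q hq),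
      hΨ.hkFlow_zero q⟩, fun q hq I hI h0 p hp hp0 => hΨ.hk_unique hR hadm (hb q hq) hI h0 hp hp0,
      hΨ.continuous_hkFlow.continuousOn, fun q hq ϰ hϰ t => ⟨?_, ?_⟩,
      fun q hq hi t => hΨ.memHInfty_hkFlow hR hadm (hb q hq) hi t,
      fun u hu h0 => hΨ.bo_commute hR hadm hQ hu h0⟩
    · have h := hadm₀.mono hϰ
      exact (h.good (by rw [norm_hkFlow]; linarith [hb q hq t])).hasGauge h.one_le
    · exact hΨ.hasDerivAt_beta_hkFlow hR hadm (hadm₀.mono hϰ) (starStar_real hq) (hb q hq) t
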